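/- Let $M$ be a smooth $n$-dimensional manifold (Hausdorff, second countable, without boundary). An \emph{integral affine structure} on $M$ is a maximal atlas $\mathcal A$ of smooth charts $\phi:U\to\mathbb R^n$ all of whose transition functions are locally restrictions of integral affine transformations $u\mapsto b+A u$, with $b\in\mathbb R^n$ and $A\in GL(n,\mathbb Z)$. A \emph{lattice} $\Lambda\subset T^*M$ is a family of discrete subgroups of full rank $\Lambda_x\subset T^*_xM$ which is a smooth sub-bundle, that is, which is locally generated over $\mathbb Z$ by $n$ smooth $1$-forms; it is \emph{Lagrangian} if the pullback to $\Lambda$ of the canonical symplectic form $\omega_{\mathrm{can}}$ of $T^*M$ is zero. A \emph{proper symplectic integration} of $(M,0)$ is a symplectic groupoid $(G\rightrightarrows M,\Omega)$ (a Lie groupoid with a multiplicative symplectic form on its manifold of arrows) which is Hausdorff, has connected source fibres, has proper anchor map $(s,t):G\to M\times M$, and whose target map $t:(G,\Omega)\to M$ is a Poisson map for the zero Poisson structure on $M$. Two of them are identified if there is an isomorphism of symplectic groupoids between them that covers the identity of $M$. Then there are bijections $$\{\text{proper symplectic integrations of }(M,0)\}/\!\cong\ \xrightarrow{\ \Phi\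 }\ \{\text{integral affine structures on }M\}\ \xrightarrow{\ \Psi\ }\ \{\text{Lagrangian lattices }\Lambda\subset T^*M\}$$ such that: (i) for every integral affine structure $\mathcal A$, with $\Lambda=\Psi(\mathcal A)$, a smooth chart $(U,x^1,\dots,x^n)$ of $M$ belongs to $\mathcal A$ if and only if $\Lambda_x=\mathbb Z\langle d_xx^1,\dots,d_xx^n\rangle$ for all $x\in U$; (ii) for every proper symplectic integration $(G,\Omega)$ of $(M,0)$ and every Lagrangian lattice $\Lambda$, one has $\Psi(\Phi([G]))=\Lambda$ if and only if $(G,\Omega)\cong (T^*M,\omega_{\mathrm{can}})/\Lambda$ as symplectic groupoids over $M$. The latter means that there is a surjective local diffeomorphism $p:T^*M\to G$ such that, for $\xi,\eta\in T^*_xM$: $s(p(\xi))=t(p(\xi))=x$; $p(\xi+\eta)=p(\xi)\,p(\eta)$; $p(\xi)=p(\eta)$ if and only if $\xi-\eta\in\Lambda_x$; and $p^*\Omega=\omega_{\mathrm{can}}$. -/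

import Mathlib

open scoped Manifold ContDiff Topology
open Bundle

universe u

namespace PoissonGeom

noncomputable section

/-! ### Differential forms on manifolds without boundary -/

/-- A (not necessarily smooth) differential `k`-form on a manifold `N`. -/
abbrev DiffForm {E H : Type*} [NormedAddCommGroup E] [NormedSpace ℝ E] [TopologicalSpace H]
    (I : ModelWithCorners ℝ E H) (N : Type*) [TopologicalSpace N] [ChartedSpace H N] (k : ℕ) :=
  ∀ x : N, TangentSpace I x [⋀^Fin k]→L[ℝ] ℝ

namespace DiffForm

variable {E H : Type*} [NormedAddCommGroup E] [NormedSpace ℝ E] [TopologicalSpace H]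
  {I : ModelWithCorners ℝ E H} {N : Type*} [TopologicalSpace N] [ChartedSpace H N] {k : ℕ}

/-- The expression of a form in the preferred chart around `x`, that is, its pullback under the
inverse of that chart (meaningful on the target of the chart, which is open for a manifold
without boundary). -/
def inChart (α : DiffForm I N k) (x : N) (y : E) : E [⋀^Fin k]→L[ℝ] ℝ :=
  (α ((extChartAt I x).symm y)).compContinuousLinearMap
    (mfderiv 𝓘(ℝ, E) I (extChartAt I x).symm y : E →L[ℝ] TangentSpace I ((extChartAt I x).symm y))

/-- A form is smooth if its expressions in charts are smooth. -/
def IsSmooth (α : DiffForm I N k) : Prop :=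
  ∀ x : N, ContDiffOn ℝ ∞ (α.inChart x) (extChartAt I x).target

/-- The exterior derivative: at `x` it is computed in the preferred chart around `x`. -/
def d (α : DiffForm I N k) : DiffForm I N (k + 1) := fun x =>
  ContinuousAlternatingMap.compContinuousLinearMap (M := E)
    (extDeriv (α.inChart x) (extChartAt I x x))
    (mfderiv I 𝓘(ℝ, E) (extChartAt I x) x : TangentSpace I x →L[ℝ] E)

/-- A symplectic form: a smooth closed nondegenerate `2`-form. -/
structure IsSymplectic (Ω : DiffForm I N 2) : Prop where
  smooth : Ω.IsSmooth
  closed : ∀ x, Ω.d x = 0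
  nondegenerate : ∀ (x : N) (v : TangentSpace I x),
    (∀ w : TangentSpace I x, Ω x ![v, w] = 0) → v = 0

end DiffForm

/-! ### The cotangent bundle and its canonical symplectic form -/

section Cotangent

variable (n : ℕ) (M : Type u) [TopologicalSpace M] [ChartedSpace (EuclideanSpace ℝ (Fin n)) M]

/-- The cotangent spaces of an `n`-dimensional manifold. -/
abbrev CotangentSpace (x : M) : Type := TangentSpace (𝓡 n) x →L[ℝ] Trivial M ℝ x

variable [IsManifold (𝓡 n) ∞ M]

/-- The total space `T*M` of the cotangent bundle. -/
abbrev CotangentBundle : Type u :=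
  TotalSpace (EuclideanSpace ℝ (Fin n) →L[ℝ] ℝ) (CotangentSpace n M)

/-- The model with corners of the manifold `T*M`. -/
abbrev cotangentModel := (𝓡 n).prod 𝓘(ℝ, EuclideanSpace ℝ (Fin n) →L[ℝ] ℝ)

/-- The tautological `1`-form `θ` on `T*M`: `θ_ξ(v) = ξ(dπ(v))`, where `π : T*M → M`. -/
def tautologicalForm : DiffForm (cotangentModel n) (CotangentBundle n M) 1 := fun ξ =>
  ContinuousAlternatingMap.ofSubsingleton ℝ _ ℝ (0 : Fin 1)
    ((ξ.2 : TangentSpace (𝓡 n) ξ.1 →L[ℝ] ℝ).comp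
      (mfderiv (cotangentModel n) (𝓡 n) (fun η : CotangentBundle n M => η.1) ξ))

/-- The canonical symplectic form `ω_can = -dθ` (`= ∑ dxⁱ ∧ dpᵢ`) on `T*M`. -/
def canonicalForm : DiffForm (cotangentModel n) (CotangentBundle n M) 2 := fun ξ =>
  -(tautologicalForm n M).d ξ

end Cotangent

/-! ### Poisson structures -/

section Poisson

variable (n : ℕ) (M : Type u) [TopologicalSpace M] [ChartedSpace (EuclideanSpace ℝ (Fin n)) M]

/-- A Poisson structure: a Lie bracket on the smooth functions that is a derivation in each
argument. -/
structure PoissonStructure where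
  bracket : C^∞⟮𝓡 n, M; ℝ⟯ →ₗ[ℝ] C^∞⟮𝓡 n, M; ℝ⟯ →ₗ[ℝ] C^∞⟮𝓡 n, M; ℝ⟯
  skew : ∀ f g, bracket f g = -bracket g f
  jacobi : ∀ f g h,
    bracket f (bracket g h) + bracket g (bracket h f) + bracket h (bracket f g) = 0
  leibniz : ∀ f g h, bracket f (g * h) = bracket f g * h + g * bracket f h

/-- The zero Poisson structure. -/
def PoissonStructure.zero : PoissonStructure n M where
  bracket := 0
  skew := by simp
  jacobi := by simp
  leibniz := by simp

end Poisson

/-! ### Lie groupoids and symplectic integrations -/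

section Groupoid

variable (n : ℕ) (M : Type u) [TopologicalSpace M] [ChartedSpace (EuclideanSpace ℝ (Fin n)) M]

/-- A Lie groupoid over `M`. The product `mul g h` is meaningful when `src g = tgt h`; its values
on other pairs are irrelevant. -/
structure LieGroupoid where
  /-- the manifold of arrows -/
  Arrow : Type u
  /-- its dimension -/
  dim : ℕ
  [topArrow : TopologicalSpace Arrow]
  [chartedArrow : ChartedSpace (EuclideanSpace ℝ (Fin dim)) Arrow]
  [manifoldArrow : IsManifold (𝓡 dim) ∞ Arrow]
  src : Arrow → M
  tgt : Arrow → M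
  unit : M → Arrow
  mul : Arrow → Arrow → Arrow
  inv : Arrow → Arrow
  src_unit : ∀ x, src (unit x) = x
  tgt_unit : ∀ x, tgt (unit x) = x
  src_mul : ∀ g h, src g = tgt h → src (mul g h) = src h
  tgt_mul : ∀ g h, src g = tgt h → tgt (mul g h) = tgt g
  mul_assoc : ∀ g h k, src g = tgt h → src h = tgt k → mul (mul g h) k = mul g (mul h k)
  unit_mul : ∀ g, mul (unit (tgt g)) g = g
  mul_unit : ∀ g, mul g (unit (src g)) = g
  src_inv : ∀ g, src (inv g) = tgt g
  tgt_inv : ∀ g, tgt (inv g) = src g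
  inv_mul : ∀ g, mul (inv g) g = unit (src g)
  mul_inv : ∀ g, mul g (inv g) = unit (tgt g)
  src_submersion : Manifold.IsSubmersion (𝓡 dim) (𝓡 n) ∞ src
  tgt_submersion : Manifold.IsSubmersion (𝓡 dim) (𝓡 n) ∞ tgt
  unit_smooth : ContMDiff (𝓡 n) (𝓡 dim) ∞ unit
  inv_smooth : ContMDiff (𝓡 dim) (𝓡 dim) ∞ inv
  mul_smooth : ContMDiffOn ((𝓡 dim).prod (𝓡 dim)) (𝓡 dim) ∞
    (fun p : Arrow × Arrow => mul p.1 p.2) {p | src p.1 = tgt p.2}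

attribute [instance] LieGroupoid.topArrow LieGroupoid.chartedArrow LieGroupoid.manifoldArrow

variable {n M}

/-- A `2`-form `Ω` on the arrows is multiplicative: `m^*Ω = pr₁^*Ω + pr₂^*Ω` on the manifold of
composable pairs. The tangent space of that manifold at `(g, h)` consists of the pairs `(v, w)` with
`ds(v) = dt(w)`, and every derivative of `m` within the set of composable pairs restricts on it to
the differential of `m`. -/
def LieGroupoid.IsMultiplicative (G : LieGroupoid n M) (Ω : DiffForm (𝓡 G.dim) G.Arrow 2) : Prop :=
  ∀ (g h : G.Arrow), G.src g = G.tgt h →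
    ∀ D : TangentSpace (𝓡 G.dim) g × TangentSpace (𝓡 G.dim) h →L[ℝ]
        TangentSpace (𝓡 G.dim) (G.mul g h),
      HasMFDerivWithinAt ((𝓡 G.dim).prod (𝓡 G.dim)) (𝓡 G.dim)
        (fun p : G.Arrow × G.Arrow => G.mul p.1 p.2) {p | G.src p.1 = G.tgt p.2} (g, h) D →
      ∀ (v₁ v₂ : TangentSpace (𝓡 G.dim) g) (w₁ w₂ : TangentSpace (𝓡 G.dim) h),
        (mfderiv (𝓡 G.dim) (𝓡 n) G.src g v₁ : EuclideanSpace ℝ (Fin n)) =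
          mfderiv (𝓡 G.dim) (𝓡 n) G.tgt h w₁ →
        (mfderiv (𝓡 G.dim) (𝓡 n) G.src g v₂ : EuclideanSpace ℝ (Fin n)) =
          mfderiv (𝓡 G.dim) (𝓡 n) G.tgt h w₂ →
        Ω (G.mul g h) ![D (v₁, w₁), D (v₂, w₂)] = Ω g ![v₁, v₂] + Ω h ![w₁, w₂]

/-- A (Hausdorff, source-connected) symplectic integration of a Poisson manifold `(M, P)`: a
symplectic groupoid over `M` whose target map is a Poisson map. The Hamiltonian vector `X` of a
function `F` at a point `g` of the symplectic manifold of arrows is determined by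
`Ω(X, ·) = -dF`, and the bracket of two functions is `Ω` evaluated on their Hamiltonian vectors. -/
structure SymplecticIntegration (P : PoissonStructure n M) extends LieGroupoid n M where
  form : DiffForm (𝓡 dim) Arrow 2
  hausdorff : T2Space Arrow
  src_connected : ∀ x : M, IsConnected (src ⁻¹' {x})
  symplectic : form.IsSymplectic
  multiplicative : toLieGroupoid.IsMultiplicative form
  tgt_poisson : ∀ (f₁ f₂ : C^∞⟮𝓡 n, M; ℝ⟯) (g : Arrow) (X₁ X₂ : TangentSpace (𝓡 dim) g),
    (∀ Z : TangentSpace (𝓡 dim) g,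
      form g ![X₁, Z] = -(mfderiv (𝓡 dim) 𝓘(ℝ, ℝ) (fun a => f₁ (tgt a)) g Z : ℝ)) →
    (∀ Z : TangentSpace (𝓡 dim) g,
      form g ![X₂, Z] = -(mfderiv (𝓡 dim) 𝓘(ℝ, ℝ) (fun a => f₂ (tgt a)) g Z : ℝ)) →
    form g ![X₁, X₂] = P.bracket f₁ f₂ (tgt g)

/-- A symplectic integration is proper if the groupoid anchor `(s, t)` is a proper map. -/
structure ProperSymplecticIntegration (P : PoissonStructure n M) extends
    SymplecticIntegration P where
  proper : IsProperMap (fun g : Arrow => (src g, tgt g))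

/-- Isomorphism of symplectic groupoids over the identity of `M`. -/
def SymplecticIntegration.IsIsomorphic {P : PoissonStructure n M}
    (G G' : SymplecticIntegration P) : Prop :=
  ∃ F : Diffeomorph (𝓡 G.dim) (𝓡 G'.dim) G.Arrow G'.Arrow ∞,
    (∀ g, G'.src (F g) = G.src g) ∧
    (∀ g, G'.tgt (F g) = G.tgt g) ∧
    (∀ g h, G.src g = G.tgt h → F (G.mul g h) = G'.mul (F g) (F h)) ∧
    ∀ (g : G.Arrow) (v w : TangentSpace (𝓡 G.dim) g),
      G'.form (F g) ![mfderiv (𝓡 G.dim) (𝓡 G'.dim) F g v, mfderiv (𝓡 G.dim) (𝓡 G'.dim) F g w] =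
        G.form g ![v, w]

theorem SymplecticIntegration.IsIsomorphic.refl {P : PoissonStructure n M}
    (G : SymplecticIntegration P) : G.IsIsomorphic G := by
  refine ⟨Diffeomorph.refl _ _ _, fun _ => rfl, fun _ => rfl, fun _ _ _ => rfl, fun g v w => ?_⟩
  have h : mfderiv (𝓡 G.dim) (𝓡 G.dim) (Diffeomorph.refl (𝓡 G.dim) G.Arrow ∞) g =
      ContinuousLinearMap.id ℝ _ := by
    rw [Diffeomorph.coe_refl]; exact mfderiv_id
  rw [h]; rfl

theorem SymplecticIntegration.IsIsomorphic.symm {P : PoissonStructure n M}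
    {G G' : SymplecticIntegration P} (h : G.IsIsomorphic G') : G'.IsIsomorphic G := by
  obtain ⟨F, hs, ht, hm, hΩ⟩ := h
  have es : ∀ g, G.src (F.symm g) = G'.src g := fun g => by
    rw [← hs, F.apply_symm_apply]
  have et : ∀ g, G.tgt (F.symm g) = G'.tgt g := fun g => by
    rw [← ht, F.apply_symm_apply]
  refine ⟨F.symm, es, et, fun g h hgh => ?_, fun g v w => ?_⟩
  · apply F.injective
    change F (F.symm _) = F (G.mul _ _)
    rw [F.apply_symm_apply, hm _ _ (by rw [es, et, hgh]), F.apply_symm_apply, F.apply_symm_apply]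
  · have hd' : MDifferentiableAt (𝓡 G'.dim) (𝓡 G.dim) F.symm g :=
      F.symm.mdifferentiable (by simp) _
    have hd'' : MDifferentiableAt (𝓡 G.dim) (𝓡 G'.dim) F (F.symm g) :=
      F.mdifferentiable (by simp) _
    have hc : ∀ u : EuclideanSpace ℝ (Fin G'.dim),
        (mfderiv (𝓡 G.dim) (𝓡 G'.dim) F (F.symm g)
          (mfderiv (𝓡 G'.dim) (𝓡 G.dim) F.symm g u) : EuclideanSpace ℝ (Fin G'.dim)) = u := by
      intro u
      have e := mfderiv_comp g hd'' hd'
      have : (F ∘ F.symm : G'.Arrow → G'.Arrow) = id := funext fun b => F.apply_symm_apply b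
      rw [this, mfderiv_id] at e
      exact (DFunLike.congr_fun e u).symm
    have transport : ∀ (b b' : G'.Arrow), b = b' →
        ∀ v w v' w' : EuclideanSpace ℝ (Fin G'.dim), v = v' → w = w' →
          G'.form b ![v, w] = G'.form b' ![v', w'] := by
      rintro b _ rfl v w _ _ rfl rfl; rfl
    rw [← hΩ]
    exact transport _ _ (F.apply_symm_apply g) _ _ _ _ (hc v) (hc w)

theorem SymplecticIntegration.IsIsomorphic.trans {P : PoissonStructure n M}
    {G G' G'' : SymplecticIntegration P} (h : G.IsIsomorphic G') (h' : G'.IsIsomorphic G'') :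
    G.IsIsomorphic G'' := by
  obtain ⟨F, hs, ht, hm, hΩ⟩ := h
  obtain ⟨F', hs', ht', hm', hΩ'⟩ := h'
  refine ⟨F.trans F', fun g => (hs' _).trans (hs g), fun g => (ht' _).trans (ht g),
    fun g h hgh => ?_, fun g v w => ?_⟩
  · change F' (F _) = G''.mul (F' (F g)) (F' (F h))
    rw [hm _ _ hgh, hm' _ _ (by rw [hs, ht, hgh])]
  · have e : mfderiv (𝓡 G.dim) (𝓡 G''.dim) (F.trans F') g =
        (mfderiv (𝓡 G'.dim) (𝓡 G''.dim) F' (F g)).comp (mfderiv (𝓡 G.dim) (𝓡 G'.dim) F g) :=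
      mfderiv_comp g (F'.mdifferentiable (by simp) _) (F.mdifferentiable (by simp) _)
    rw [e, ← hΩ, ← hΩ']
    rfl

/-- Isomorphism of symplectic groupoids over the identity of `M`, as an equivalence relation on
proper symplectic integrations. -/
instance ProperSymplecticIntegration.isomorphismSetoid (P : PoissonStructure n M) :
    Setoid (ProperSymplecticIntegration P) where
  r G G' := G.toSymplecticIntegration.IsIsomorphic G'.toSymplecticIntegration
  iseqv :=
    { refl := fun _ => .refl _
      symm := fun h => h.symm
      trans := fun h h' => h.trans h' }

end Groupoid

/-! ### Integral affine structures -/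

section IntegralAffine

variable (n : ℕ) (M : Type u) [TopologicalSpace M] [ChartedSpace (EuclideanSpace ℝ (Fin n)) M]

variable {n} in
/-- A partially defined map `ℝⁿ → ℝⁿ` is locally the restriction of integral affine
transformations `v ↦ b + A v`, `b ∈ ℝⁿ`, `A ∈ GL(n, ℤ)`. -/
def IsIntegralAffine
    (f : OpenPartialHomeomorph (EuclideanSpace ℝ (Fin n)) (EuclideanSpace ℝ (Fin n))) : Prop :=
  ∀ u ∈ f.source, ∃ (A : GL (Fin n) ℤ) (b : EuclideanSpace ℝ (Fin n)),
    ∀ᶠ v in 𝓝 u, ∀ i, f v i = b i + ∑ j, ((A : Matrix (Fin n) (Fin n) ℤ) i j : ℝ) * v j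

/-- An integral affine structure on the smooth manifold `M`: a maximal atlas of smooth charts
whose transition functions are integral affine. -/
structure IntegralAffineStructure where
  charts : Set (OpenPartialHomeomorph M (EuclideanSpace ℝ (Fin n)))
  smooth : ∀ φ ∈ charts, φ ∈ IsManifold.maximalAtlas (𝓡 n) ∞ M
  cover : ∀ x : M, ∃ φ ∈ charts, x ∈ φ.source
  compatible : ∀ φ ∈ charts, ∀ ψ ∈ charts, IsIntegralAffine (φ.symm.trans ψ)
  maximal : ∀ φ ∈ IsManifold.maximalAtlas (𝓡 n) ∞ M,
    (∀ ψ ∈ charts, IsIntegralAffine (φ.symm.trans ψ) ∧ IsIntegralAffine (ψ.symm.trans φ)) →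
      φ ∈ charts

/-! ### Lagrangian lattices -/

/-- A smooth section over a set `U` of the cotangent bundle (a smooth `1`-form on `U`). -/
def IsSmoothSectionOn [IsManifold (𝓡 n) ∞ M] (α : ∀ x : M, CotangentSpace n M x) (U : Set M) :
    Prop :=
  ContMDiffOn (𝓡 n) (cotangentModel n) ∞ (fun x => (⟨x, α x⟩ : CotangentBundle n M)) U

variable [IsManifold (𝓡 n) ∞ M]

/-- A smooth lattice `Λ ⊂ T*M`: a family of lattices (discrete subgroups of full rank) in the
fibres that is a smooth sub-bundle, that is, locally generated over `ℤ` by `n` smooth sections. -/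
structure CotangentLattice where
  fiber : ∀ x : M, AddSubgroup (CotangentSpace n M x)
  discrete : ∀ x, DiscreteTopology (fiber x)
  full_rank : ∀ x, Submodule.span ℝ (fiber x : Set (CotangentSpace n M x)) = ⊤
  smooth : ∀ x : M, ∃ (U : Set M) (α : Fin n → ∀ y : M, CotangentSpace n M y),
    IsOpen U ∧ x ∈ U ∧ (∀ i, IsSmoothSectionOn n M (α i) U) ∧
      ∀ y ∈ U, fiber y = AddSubgroup.closure (Set.range fun i => α i y)

/-- A smooth lattice `Λ ⊂ T*M` is Lagrangian if the pullback of `ω_can` to the submanifold `Λ`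
vanishes. As `Λ` is étale over `M`, it is parametrized locally by the smooth local sections of
`T*M` with values in `Λ`, and the condition is that `ω_can` pulls back to zero under these. -/
structure LagrangianLattice extends CotangentLattice n M where
  lagrangian : ∀ (U : Set M) (α : ∀ y : M, CotangentSpace n M y), IsOpen U →
    IsSmoothSectionOn n M α U → (∀ y ∈ U, α y ∈ fiber y) →
      ∀ y ∈ U, ∀ v w : TangentSpace (𝓡 n) y,
        let dα := mfderiv (𝓡 n) (cotangentModel n) (fun x => (⟨x, α x⟩ : CotangentBundle n M)) y
        canonicalForm n M ⟨y, α y⟩ ![dα v, dα w] = 0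

variable {n M}

/-- The differential at `x` of the `i`-th coordinate function of `φ : M ⊇ U → ℝⁿ`. -/
def coordDifferential (φ : OpenPartialHomeomorph M (EuclideanSpace ℝ (Fin n))) (i : Fin n)
    (x : M) : CotangentSpace n M x :=
  mfderiv (𝓡 n) 𝓘(ℝ, ℝ) (fun y => φ y i) x

/-- `G = T*M/Λ` as a symplectic groupoid: `p : T*M → G` exhibits the manifold of arrows of `G` as
the quotient of `T*M` by fibrewise translations by `Λ`, with source and target both induced by the
bundle projection, the product induced by fibrewise addition, and the symplectic form induced by
`ω_can`. -/
structure IsCotangentQuotientMap {P : PoissonStructure n M} (G : SymplecticIntegration P)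
    (Λ : CotangentLattice n M) (p : CotangentBundle n M → G.Arrow) : Prop where
  localDiffeo : IsLocalDiffeomorph (cotangentModel n) (𝓡 G.dim) ∞ p
  surjective : Function.Surjective p
  src_eq : ∀ ξ, G.src (p ξ) = ξ.1
  tgt_eq : ∀ ξ, G.tgt (p ξ) = ξ.1
  map_add : ∀ (x : M) (ξ η : CotangentSpace n M x), p ⟨x, ξ + η⟩ = G.mul (p ⟨x, ξ⟩) (p ⟨x, η⟩)
  eq_iff : ∀ (x : M) (ξ η : CotangentSpace n M x), p ⟨x, ξ⟩ = p ⟨x, η⟩ ↔ ξ - η ∈ Λ.fiber x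
  pullback_form : ∀ (ξ : CotangentBundle n M) (v w : TangentSpace (cotangentModel n) ξ),
    G.form (p ξ) ![mfderiv (cotangentModel n) (𝓡 G.dim) p ξ v,
      mfderiv (cotangentModel n) (𝓡 G.dim) p ξ w] = canonicalForm n M ξ ![v, w]

/-- `G` is isomorphic, as a symplectic groupoid over `M`, to `T*M/Λ`. -/
def IsCotangentQuotient {P : PoissonStructure n M} (G : SymplecticIntegration P)
    (Λ : CotangentLattice n M) : Prop :=
  ∃ p : CotangentBundle n M → G.Arrow, IsCotangentQuotientMap G Λ p

end IntegralAffine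

end

end PoissonGeom

set_option linter.unusedSectionVars false

/-! ### Calculus: integrals with parameters, the Poincaré lemma, exterior derivatives in low degree
-/

namespace PoissonGeom

section Calculus

open MeasureTheory Set Filter

/-! Affine structures and lattices. The coordinate differentials of a chart span a lattice in each
cotangent space over its domain. A transition map preserves these lattices exactly when its Jacobian
lies in `GL(n, ℤ)`; integers being discrete, the Jacobian is then locally constant and the
transition is affine (`chartLattice_le_of_isIntegralAffine`, `isIntegralAffine_of_chartLattice_eq`).
Sections of the lattice of an integral affine atlas have locally constant coefficients, hence are
closed, which is the Lagrangian condition. Conversely, local generators of a Lagrangian lattice are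
closed `1`-forms whose primitives are coordinates (`exists_isLatticeChart`), and maximality of the
atlas makes the two constructions inverse (`affineEquivLattice`, which is `Ψ`).

From lattices to groupoids. In a lattice chart, translation by an element of `Λ` is `(q, p) ↦ (q, p
+ m)` with `m` constant. So `ω_can` descends to `T*M/Λ`, a bundle of tori with fibrewise addition,
and compactness of the tori gives properness (`LagQuot.integration`).

From groupoids to lattices. Multiplicativity puts `ker ds` inside `(ker dt)^⊥`, and the Poisson
condition for the zero structure puts `(ker dt)^⊥` inside `ker dt`. Counting ranks, all three agree,
so `dim G = 2n`, the fibres are Lagrangian, and `s = t` by connectedness of the source fibres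
(`dim_and_ker`, `tgt_eq_src`). A covector `a` at `x` determines a vector field `X` along the fibre
over `x` by `Ω(X, ·) = -a ∘ ds`; `exp a` is the endpoint at time one of its integral curve from the
unit. No differential equation is solved. Closedness of `Ω` makes the pairing with vertical vectors
a closed `1`-form along the fibres; its primitive is a logarithm (`exists_log`), which the inverse
function theorem inverts near the units, and squaring extends the result to all covectors
(`double`). Uniqueness comes from multiplicativity: the quotient of two exponential curves with the
same covector has velocity zero.

Multiplicativity makes `exp` fibrewise a homomorphism; closedness of `Ω` and isotropy of the units
give `exp^*Ω = ω_can` (`pair_exp`). Hence `exp` is a local diffeomorphism, and it is onto because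
the fibres are connected. Its kernel is discrete, has full rank because proper integrations have
compact fibres (`kernel_span`), is smooth (`kernel_smooth`), and is Lagrangian because `exp` maps
its sections to units.

Finally, every quotient map `T*M → G` as in (ii) satisfies the characterization of `exp`
(`IsCotangentQuotientMap.eq_exp`), so its lattice is the kernel of `exp`. Thus `G` and its lattice
determine each other up to isomorphism (`latticeEquiv`), and `Φ` is this bijection followed by the
inverse of `Ψ`. -/

theorem contDiffOn_intervalIntegral_nat {X : Type u} [NormedAddCommGroup X]
    [NormedSpace ℝ X] {O : Set X} {W : Set (X × ℝ)} (hO : IsOpen O) (hW : IsOpen W)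
    (hOW : ∀ y ∈ O, ∀ τ ∈ Icc (0 : ℝ) 1, (y, τ) ∈ W) (k : ℕ) :
    ∀ {F : Type u} [NormedAddCommGroup F] [NormedSpace ℝ F] {f : X × ℝ → F},
      ContDiffOn ℝ k f W → ContDiffOn ℝ k (fun y => ∫ τ in (0 : ℝ)..1, f (y, τ)) O := by
  have hcont : ∀ {F : Type u} [NormedAddCommGroup F] [NormedSpace ℝ F] {f : X × ℝ → F},
      ContinuousOn f W → ∀ y ∈ O, ContinuousOn (fun τ => f (y, τ)) (Icc 0 1) :=
    fun hf y hy => hf.comp (by fun_prop) fun τ hτ => hOW y hy τ hτ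
  -- Compactness of `[0, 1]` gives a bound that is uniform for parameters near `y`; it is the
  -- dominating constant in both uses of dominated convergence below.
  have hbound : ∀ {F : Type u} [NormedAddCommGroup F] [NormedSpace ℝ F] {f : X × ℝ → F},
      ContinuousOn f W → ∀ y ∈ O, ∃ C, ∃ s ∈ 𝓝 y, s ⊆ O ∧ ∀ y' ∈ s, ∀ τ ∈ Icc (0 : ℝ) 1,
        ‖f (y', τ)‖ ≤ C := by
    intro F _ _ f hf y hy
    obtain ⟨C, hC⟩ := (isCompact_Icc.image_of_continuousOn (hcont hf y hy)).isBounded.exists_norm_le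
    have key : ∀ τ ∈ Icc (0 : ℝ) 1, ∀ᶠ p : X × ℝ in 𝓝 (y, τ), ‖f p‖ ≤ C + 1 := by
      intro τ hτ
      have h1 : ContinuousAt (fun p => ‖f p‖) (y, τ) :=
        (hf.continuousAt (hW.mem_nhds (hOW y hy τ hτ))).norm
      have h2 : ‖f (y, τ)‖ < C + 1 := by
        linarith [hC _ (mem_image_of_mem _ hτ)]
      filter_upwards [h1.eventually_lt_const h2] with p hp using hp.le
    have h3 : ∀ᶠ y' in 𝓝 y, ∀ τ ∈ Icc (0 : ℝ) 1, ‖f (y', τ)‖ ≤ C + 1 :=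
      isCompact_Icc.eventually_forall_of_forall_eventually fun τ hτ => key τ hτ
    exact ⟨C + 1, _, inter_mem h3 (hO.mem_nhds hy), inter_subset_right, fun y' hy' => hy'.1⟩
  -- The target `F` varies in the induction, since the derivative takes values in `X →L[ℝ] F`; a
  -- single universe for all spaces is what allows this.
  induction k with
  | zero =>
    intro F _ _ f hf
    have hf' : ContinuousOn f W := hf.continuousOn
    simp only [CharP.cast_eq_zero, contDiffOn_zero]
    intro y hy
    apply ContinuousAt.continuousWithinAt
    obtain ⟨C, s, hs, hsO, hC⟩ := hbound hf' y hy
    refine intervalIntegral.continuousAt_of_dominated_interval (bound := fun _ => C) ?_ ?_ ?_ ?_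
    · filter_upwards [hs] with y' hy'
      exact ((hcont hf' y' (hsO hy')).mono (by
        rw [uIoc_of_le zero_le_one]; exact Ioc_subset_Icc_self)).aestronglyMeasurable
          measurableSet_uIoc
    · filter_upwards [hs] with y' hy'
      refine ae_of_all _ fun τ hτ => hC y' hy' τ ?_
      rw [uIoc_of_le zero_le_one] at hτ; exact Ioc_subset_Icc_self hτ
    · simp
    · refine ae_of_all _ fun τ hτ => ?_
      rw [uIoc_of_le zero_le_one] at hτ
      exact (hf'.continuousAt (hW.mem_nhds (hOW y hy τ (Ioc_subset_Icc_self hτ)))).comp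
        (f := fun y => (y, τ)) (by fun_prop)
  | succ k ih =>
    intro F _ _ f hf
    have hf0 : ContinuousOn f W := hf.continuousOn
    have hfd : ContDiffOn ℝ k (fun p => (fderiv ℝ f p).comp (ContinuousLinearMap.inl ℝ X ℝ)) W :=
      ((contDiffOn_succ_iff_fderiv_of_isOpen hW).1 hf).2.2.clm_comp contDiffOn_const
    have hder : ∀ y ∈ O, HasFDerivAt (fun y => ∫ τ in (0 : ℝ)..1, f (y, τ))
        (∫ τ in (0 : ℝ)..1, (fderiv ℝ f (y, τ)).comp (ContinuousLinearMap.inl ℝ X ℝ)) y := by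
      intro y hy
      obtain ⟨C, s, hs, hsO, hC⟩ := hbound hfd.continuousOn y hy
      have hsub : uIoc (0 : ℝ) 1 ⊆ Icc 0 1 := by
        rw [uIoc_of_le zero_le_one]; exact Ioc_subset_Icc_self
      refine intervalIntegral.hasFDerivAt_integral_of_dominated_of_fderiv_le
        (F := fun y τ => f (y, τ))
        (F' := fun y τ => (fderiv ℝ f (y, τ)).comp (ContinuousLinearMap.inl ℝ X ℝ))
        (bound := fun _ => C) hs ?_ ?_ ?_ ?_ ?_ ?_
      · filter_upwards [hs] with y' hy'
        exact ((hcont hf0 y' (hsO hy')).mono hsub).aestronglyMeasurable measurableSet_uIoc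
      · exact ContinuousOn.intervalIntegrable_of_Icc zero_le_one (hcont hf0 y hy)
      · exact ((hcont hfd.continuousOn y hy).mono hsub).aestronglyMeasurable measurableSet_uIoc
      · exact ae_of_all _ fun τ hτ y' hy' => hC y' hy' τ (hsub hτ)
      · simp
      · refine ae_of_all _ fun τ hτ y' hy' => ?_
        have h1 : HasFDerivAt f (fderiv ℝ f (y', τ)) (y', τ) :=
          ((hf.contDiffAt (hW.mem_nhds (hOW y' (hsO hy') τ (hsub hτ)))).differentiableAt
            (by simp)).hasFDerivAt
        exact h1.comp y' (hasFDerivAt_prodMk_left y' τ)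
    push_cast
    rw [contDiffOn_succ_iff_fderiv_of_isOpen hO]
    refine ⟨fun y hy => (hder y hy).differentiableAt.differentiableWithinAt, by simp, ?_⟩
    exact (ih hfd).congr fun y hy => (hder y hy).fderiv

theorem contDiffOn_intervalIntegral {X F : Type u} [NormedAddCommGroup X]
    [NormedSpace ℝ X] [NormedAddCommGroup F] [NormedSpace ℝ F] {f : X × ℝ → F}
    {O : Set X} {W : Set (X × ℝ)} (hO : IsOpen O) (hW : IsOpen W)
    (hOW : ∀ y ∈ O, ∀ τ ∈ Icc (0 : ℝ) 1, (y, τ) ∈ W) (hf : ContDiffOn ℝ ∞ f W) :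
    ContDiffOn ℝ ∞ (fun y => ∫ τ in (0 : ℝ)..1, f (y, τ)) O :=
  contDiffOn_infty.2 fun k => contDiffOn_intervalIntegral_nat hO hW hOW k
    (contDiffOn_infty.1 hf k)

/-- The Poincaré lemma for `1`-forms on a ball, with smooth dependence on a parameter. -/
theorem exists_primitive_with_parameter {Y Z F : Type u} [NormedAddCommGroup Y] [NormedSpace ℝ Y]
    [NormedAddCommGroup Z] [NormedSpace ℝ Z] [NormedAddCommGroup F] [NormedSpace ℝ F]
    [CompleteSpace F] {A : Y × Z → Z →L[ℝ] F} {U : Set Y} (hU : IsOpen U) {r : ℝ} (hr : 0 < r)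
    (hA : ContDiffOn ℝ ∞ A (U ×ˢ Metric.ball 0 r))
    (hsymm : ∀ p ∈ U ×ˢ Metric.ball 0 r, ∀ ζ η : Z,
      fderiv ℝ A p (0, ζ) η = fderiv ℝ A p (0, η) ζ) :
    ∃ L : Y × Z → F, ContDiffOn ℝ ∞ L (U ×ˢ Metric.ball 0 r) ∧ (∀ y, L (y, 0) = 0) ∧
      ∀ p ∈ U ×ˢ Metric.ball 0 r, ∀ ζ, fderiv ℝ L p (0, ζ) = A p ζ := by
  have hopen : IsOpen (U ×ˢ Metric.ball (0 : Z) r) := hU.prod Metric.isOpen_ball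
  -- The primitive is the radial integral of `A (y, τ z) z` over `τ`. Joint smoothness comes from
  -- differentiating under the integral; the derivative in `z` comes from the Poincaré lemma on a
  -- ball with `y` frozen.
  let f : (Y × Z) × ℝ → F := fun q => A (q.1.1, q.2 • q.1.2) q.1.2
  let W : Set ((Y × Z) × ℝ) := (fun q => (q.1.1, q.2 • q.1.2)) ⁻¹' (U ×ˢ Metric.ball (0 : Z) r)
  have hW : IsOpen W := hopen.preimage (by fun_prop)
  have hf : ContDiffOn ℝ ∞ f W :=
    (hA.comp (f := fun q : (Y × Z) × ℝ => (q.1.1, q.2 • q.1.2)) (by fun_prop)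
      (fun q hq => hq)).clm_apply (by fun_prop)
  have hL : ContDiffOn ℝ ∞ (fun p => ∫ τ in (0 : ℝ)..1, f (p, τ)) (U ×ˢ Metric.ball 0 r) := by
    refine contDiffOn_intervalIntegral hopen hW (fun p hp τ hτ => ⟨hp.1, ?_⟩) hf
    have h2 := hp.2
    simp only [mem_ball_zero_iff] at h2 ⊢
    rw [norm_smul, Real.norm_of_nonneg hτ.1]
    nlinarith [hτ.2, norm_nonneg p.2]
  refine ⟨_, hL, fun y => by simp [f], fun p hp ζ => ?_⟩
  have hdL := ((hL.contDiffAt (hopen.mem_nhds hp)).differentiableAt (by simp)).hasFDerivAt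
  have h1 := HasFDerivAt.comp (f := fun z => (p.1, z)) p.2 hdL (hasFDerivAt_prodMk_right p.1 p.2)
  have hAd : ∀ z ∈ Metric.ball (0 : Z) r, HasFDerivAt (fun z => A (p.1, z))
      ((fderiv ℝ A (p.1, z)).comp (.inr ℝ Y Z)) z := fun z hz =>
    HasFDerivAt.comp (g := A) (f := fun z => (p.1, z)) z
      ((hA.contDiffAt (hopen.mem_nhds (x := (p.1, z)) ⟨hp.1, hz⟩)).differentiableAt
        (by simp)).hasFDerivAt (hasFDerivAt_prodMk_right p.1 z)
  have h2 := (convex_ball (0 : Z) r).hasFDerivWithinAt_curveIntegral_segment_of_hasFDerivWithinAt_symmetric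
    (fun z hz => (hAd z hz).hasFDerivWithinAt)
    (fun z hz ζ _ η _ => hsymm (p.1, z) ⟨hp.1, hz⟩ ζ η) (Metric.mem_ball_self hr) hp.2
  have h3 := h2.hasFDerivAt (Metric.isOpen_ball.mem_nhds hp.2)
  have e : (fun z => ∫ᶜ x in Path.segment (0 : Z) z, A (p.1, x)) =
      (fun q => ∫ τ in (0 : ℝ)..1, f (q, τ)) ∘ fun z => (p.1, z) := by
    ext z
    rw [curveIntegral_segment]
    simp [f, AffineMap.lineMap_apply]
  rw [e] at h3
  have := DFunLike.congr_fun (h1.unique h3) ζ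
  simpa using this

theorem extDeriv_two_apply {V : Type*} [NormedAddCommGroup V] [NormedSpace ℝ V]
    {β : V → V [⋀^Fin 2]→L[ℝ] ℝ} {x : V} (hβ : DifferentiableAt ℝ β x) (a b c : V) :
    extDeriv β x ![a, b, c] = fderiv ℝ (fun y => β y ![b, c]) x a -
      fderiv ℝ (fun y => β y ![a, c]) x b + fderiv ℝ (fun y => β y ![a, b]) x c := by
  rw [extDeriv_apply hβ, Fin.sum_univ_three]
  have e0 : Fin.removeNth (0 : Fin 3) ![a, b, c] = ![b, c] := by
    ext i; fin_cases i <;> rfl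
  have e1 : Fin.removeNth (1 : Fin 3) ![a, b, c] = ![a, c] := by
    ext i; fin_cases i <;> rfl
  have e2 : Fin.removeNth (2 : Fin 3) ![a, b, c] = ![a, b] := by
    ext i; fin_cases i <;> rfl
  rw [e0, e1, e2]
  simp [sub_eq_add_neg]

theorem extDeriv_one_apply {V : Type*} [NormedAddCommGroup V] [NormedSpace ℝ V]
    {β : V → V [⋀^Fin 1]→L[ℝ] ℝ} {x : V} (hβ : DifferentiableAt ℝ β x) (a b : V) :
    extDeriv β x ![a, b] = fderiv ℝ (fun y => β y ![b]) x a -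
      fderiv ℝ (fun y => β y ![a]) x b := by
  rw [extDeriv_apply hβ, Fin.sum_univ_two]
  have e0 : Fin.removeNth (0 : Fin 2) ![a, b] = ![b] := by
    ext i; fin_cases i; rfl
  have e1 : Fin.removeNth (1 : Fin 2) ![a, b] = ![a] := by
    ext i; fin_cases i; rfl
  rw [e0, e1]
  simp [sub_eq_add_neg]

end Calculus

end PoissonGeom

/-! ### Pullback of differential forms and its compatibility with the exterior derivative -/

namespace PoissonGeom

noncomputable section

section ContDiffComp

variable {V W : Type*} [NormedAddCommGroup V] [NormedSpace ℝ V] [NormedAddCommGroup W]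
  [NormedSpace ℝ W]

/-- The projection of multilinear maps onto alternating ones. -/
def alternatingProjection (V : Type*) [NormedAddCommGroup V] [NormedSpace ℝ V] (k : ℕ) :
    ContinuousMultilinearMap ℝ (fun _ : Fin k => V) ℝ →L[ℝ] V [⋀^Fin k]→L[ℝ] ℝ :=
  LinearMap.mkContinuous
    { toFun := fun f => ((k.factorial : ℝ)⁻¹) • ContinuousMultilinearMap.alternatization f
      map_add' := fun f g => by rw [map_add, smul_add]
      map_smul' := fun c f => by
        ext v
        simp [ContinuousMultilinearMap.alternatization_apply_apply, Finset.mul_sum,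
          mul_smul_comm, mul_left_comm] } 1 (by
    intro f
    refine ContinuousAlternatingMap.opNorm_le_bound _ (by positivity) fun v => ?_
    simp only [LinearMap.coe_mk, AddHom.coe_mk, ContinuousAlternatingMap.smul_apply,
      ContinuousMultilinearMap.alternatization_apply_apply, norm_smul]
    have h : ‖∑ σ : Equiv.Perm (Fin k), Equiv.Perm.sign σ • f (v ∘ σ)‖ ≤
        ∑ _σ : Equiv.Perm (Fin k), ‖f‖ * ∏ i, ‖v i‖ := by
      refine norm_sum_le_of_le _ fun σ _ => ?_
      have h1 : ‖Equiv.Perm.sign σ • f (v ∘ σ)‖ = ‖f (v ∘ σ)‖ := by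
        rcases Int.units_eq_one_or (Equiv.Perm.sign σ) with h | h <;> simp [h]
      rw [h1]
      refine (f.le_opNorm _).trans_eq ?_
      congr 1
      exact Equiv.prod_comp σ fun i => ‖v i‖
    rw [Finset.sum_const, Finset.card_univ, Fintype.card_perm, Fintype.card_fin,
      nsmul_eq_mul] at h
    have hk : (0 : ℝ) < k.factorial := by exact_mod_cast k.factorial_pos
    rw [norm_inv, Real.norm_of_nonneg hk.le, one_mul]
    calc (k.factorial : ℝ)⁻¹ * _ ≤ (k.factorial : ℝ)⁻¹ * (k.factorial * (‖f‖ * ∏ i, ‖v i‖)) := by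
          gcongr
      _ = _ := by field_simp)

theorem alternatingProjection_coe {k : ℕ} (f : V [⋀^Fin k]→L[ℝ] ℝ) :
    alternatingProjection V k f.toContinuousMultilinearMap = f := by
  ext v
  have hk : (k.factorial : ℝ) ≠ 0 := by exact_mod_cast k.factorial_ne_zero
  have h : ∀ σ : Equiv.Perm (Fin k), Equiv.Perm.sign σ • f (v ∘ σ) = f v := fun σ => by
    
    have := f.toAlternatingMap.map_perm v σ
    change f (v ∘ σ) = Equiv.Perm.sign σ • f v at this
    rw [this, smul_smul, Int.units_mul_self, one_smul]
  change ((k.factorial : ℝ)⁻¹) •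
    (ContinuousMultilinearMap.alternatization f.toContinuousMultilinearMap) v = _
  rw [ContinuousMultilinearMap.alternatization_apply_apply]
  change ((k.factorial : ℝ)⁻¹) • (∑ σ : Equiv.Perm (Fin k), Equiv.Perm.sign σ • f (v ∘ σ)) = _
  rw [Finset.sum_congr rfl fun σ _ => h σ]
  simp [Fintype.card_perm, hk]

/-- For multilinear maps the pullback is a polynomial in the linear map and linear in the form.
`alternatingProjection` carries this back to alternating maps, on which it is the identity. -/
theorem _root_.ContDiffAt.compContinuousAlternating {X : Type*} [NormedAddCommGroup X]
    [NormedSpace ℝ X] {k : ℕ} {m : WithTop ℕ∞} {a : X → W [⋀^Fin k]→L[ℝ] ℝ} {g : X → V →L[ℝ] W}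
    {x : X} (ha : ContDiffAt ℝ m a x) (hg : ContDiffAt ℝ m g x) :
    ContDiffAt ℝ m (fun y => (a y).compContinuousLinearMap (g y)) x := by
  have h1 : ContDiffAt ℝ m (fun y => (a y).toContinuousMultilinearMap) x :=
    (ContinuousAlternatingMap.toContinuousMultilinearMapLI (𝕜 := ℝ) (E := W) (F := ℝ)
      (ι := Fin k)).contDiff.contDiffAt.comp x ha
  have h2 : ContDiffAt ℝ m (fun y =>
      ContinuousMultilinearMap.compContinuousLinearMapContinuousMultilinear ℝ
        (fun _ : Fin k => V) (fun _ => W) ℝ (fun _ => g y)) x :=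
    (ContinuousMultilinearMap.contDiff _).contDiffAt.comp x
      (contDiffAt_pi.2 fun _ => hg)
  have h3 := (alternatingProjection V k).contDiff.contDiffAt.comp x (h2.clm_apply h1)
  refine h3.congr_of_eventuallyEq (Filter.Eventually.of_forall fun y => ?_)
  exact (alternatingProjection_coe _).symm

end ContDiffComp

theorem two_le_infty : (2 : WithTop ℕ∞) ≤ ∞ := WithTop.coe_le_coe.2 le_top

namespace DiffForm

open Set Filter

variable {E H : Type*} [NormedAddCommGroup E] [NormedSpace ℝ E] [TopologicalSpace H]
  {I : ModelWithCorners ℝ E H} {N : Type*} [TopologicalSpace N] [ChartedSpace H N] {k : ℕ}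
  {V : Type*} [NormedAddCommGroup V] [NormedSpace ℝ V]

/-- The pullback of a form under a parametrization by an open subset of a normed space. -/
def pull (α : DiffForm I N k) (f : V → N) (y : V) : V [⋀^Fin k]→L[ℝ] ℝ :=
  (α (f y)).compContinuousLinearMap
    (mfderiv 𝓘(ℝ, V) I f y : V →L[ℝ] TangentSpace I (f y))

theorem apply_congr (α : DiffForm I N k) {a b : N} (h : a = b) {v w : Fin k → E} (hvw : v = w) :
    α a v = α b w := by
  subst h; subst hvw; rfl

theorem inChart_eq_pull (α : DiffForm I N k) (x : N) :
    α.inChart x = α.pull (extChartAt I x).symm := rfl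

variable [IsManifold I ∞ N] [I.Boundaryless]

theorem _root_.PoissonGeom.mdifferentiableAt_extChartAt_symm {x : N} {y : E}
    (hy : y ∈ (extChartAt I x).target) :
    MDifferentiableAt 𝓘(ℝ, E) I (extChartAt I x).symm y :=
  ((contMDiffOn_extChartAt_symm (n := ∞) x).contMDiffAt
    ((isOpen_extChartAt_target x).mem_nhds hy)).mdifferentiableAt (by simp)

/-- Near `y` the map `f` is the inverse chart composed with the coordinate expression of `f`, so a
pullback to a vector space reduces to one between vector spaces. -/
theorem pull_eq_inChart (α : DiffForm I N k) {f : V → N} {x : N} {y : V}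
    (hf : MDifferentiableAt 𝓘(ℝ, V) I f y) (hx : f y ∈ (extChartAt I x).source) :
    α.pull f y = (α.inChart x (extChartAt I x (f y))).compContinuousLinearMap
      (fderiv ℝ (extChartAt I x ∘ f) y) := by
  have hsrc : f y ∈ (chartAt H x).source := by simpa using hx
  have hext : MDifferentiableAt I 𝓘(ℝ, E) (extChartAt I x) (f y) :=
    (contMDiffAt_extChartAt' (n := ∞) hsrc).mdifferentiableAt (by simp)
  have hcomp : MDifferentiableAt 𝓘(ℝ, V) 𝓘(ℝ, E) (extChartAt I x ∘ f) y := hext.comp y hf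
  have hsymm := mdifferentiableAt_extChartAt_symm ((extChartAt I x).map_source hx)
  have heq : f =ᶠ[𝓝 y] (extChartAt I x).symm ∘ (extChartAt I x ∘ f) := by
    filter_upwards [hf.continuousAt ((isOpen_extChartAt_source x).mem_nhds hx)] with z hz
    exact ((extChartAt I x).left_inv hz).symm
  have hd := heq.mfderiv_eq (I := 𝓘(ℝ, V)) (I' := I)
  have hd2 := mfderiv_comp (I := 𝓘(ℝ, V)) (I' := 𝓘(ℝ, E)) (I'' := I) y hsymm hcomp
  have hd3 : ∀ v : V, (mfderiv 𝓘(ℝ, V) I f y v : E) =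
      mfderiv 𝓘(ℝ, E) I (extChartAt I x).symm (extChartAt I x (f y))
        (fderiv ℝ (extChartAt I x ∘ f) y v) := by
    intro v
    have h1 := DFunLike.congr_fun (hd.trans hd2) v
    rw [mfderiv_eq_fderiv] at h1
    exact h1
  ext v
  exact apply_congr α ((extChartAt I x).left_inv hx).symm (funext fun i => hd3 (v i))

theorem pull_contDiffOn {α : DiffForm I N k} (hα : α.IsSmooth) {f : V → N} {U : Set V}
    (hU : IsOpen U) (hf : ContMDiffOn 𝓘(ℝ, V) I ∞ f U) : ContDiffOn ℝ ∞ (α.pull f) U := by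
  intro y hy
  apply ContDiffAt.contDiffWithinAt
  have hfy := hf.contMDiffAt (hU.mem_nhds hy)
  set x := f y
  have hx : f y ∈ (extChartAt I x).source := mem_extChartAt_source x
  have hcomp : ContDiffAt ℝ ∞ (extChartAt I x ∘ f) y :=
    ((contMDiffAt_extChartAt (n := ∞)).comp y hfy).contDiffAt
  have h1 : ContDiffAt ℝ ∞ (fun z => (α.inChart x ((extChartAt I x ∘ f) z)).compContinuousLinearMap
      (fderiv ℝ (extChartAt I x ∘ f) z)) y := by
    have h2 : ContDiffAt ℝ ∞ (fun z => α.inChart x ((extChartAt I x ∘ f) z)) y :=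
      ContDiffAt.comp (g := α.inChart x) y ((hα x).contDiffAt
        ((isOpen_extChartAt_target x).mem_nhds ((extChartAt I x).map_source hx))) hcomp
    exact h2.compContinuousAlternating (hcomp.fderiv_right (by simp))
  refine h1.congr_of_eventuallyEq ?_
  filter_upwards [hU.mem_nhds hy,
    hfy.continuousAt ((isOpen_extChartAt_source x).mem_nhds hx)] with z hzU hz
  exact pull_eq_inChart α ((hf.contMDiffAt (hU.mem_nhds hzU)).mdifferentiableAt (by simp)) hz

/-- The chart used for the reduction is the preferred one at `f y`, exactly the one in which `d` is
computed there, so naturality of the exterior derivative on vector spaces is enough. Only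
differentiability of the chart expressions is asked for; for the tautological form it is read off
from an explicit formula. -/
theorem extDeriv_pull {α : DiffForm I N k} {f : V → N} {y : V}
    (hα : ∀ x, DifferentiableOn ℝ (α.inChart x) (extChartAt I x).target)
    {U : Set V} (hU : IsOpen U) (hy : y ∈ U) (hf : ContMDiffOn 𝓘(ℝ, V) I ∞ f U) :
    extDeriv (α.pull f) y = α.d.pull f y := by
  have hfy := hf.contMDiffAt (hU.mem_nhds hy)
  set x := f y with hxdef
  have hx : f y ∈ (extChartAt I x).source := mem_extChartAt_source x
  have hcomp : ContDiffAt ℝ ∞ (extChartAt I x ∘ f) y :=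
    ((contMDiffAt_extChartAt (n := ∞)).comp y hfy).contDiffAt
  have h1 : α.pull f =ᶠ[𝓝 y] fun z => (α.inChart x ((extChartAt I x ∘ f) z)).compContinuousLinearMap
      (fderiv ℝ (extChartAt I x ∘ f) z) := by
    filter_upwards [hU.mem_nhds hy,
      hfy.continuousAt ((isOpen_extChartAt_source x).mem_nhds hx)] with z hzU hz
    exact pull_eq_inChart α ((hf.contMDiffAt (hU.mem_nhds hzU)).mdifferentiableAt (by simp)) hz
  rw [h1.extDeriv_eq, extDeriv_pullback (r := ∞) (f := extChartAt I x ∘ f)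
    ((hα x).differentiableAt ((isOpen_extChartAt_target x).mem_nhds
        ((extChartAt I x).map_source hx))) hcomp (by simpa using two_le_infty)]
  have hext : MDifferentiableAt I 𝓘(ℝ, E) (extChartAt I x) (f y) :=
    (contMDiffAt_extChartAt (n := ∞)).mdifferentiableAt (by simp)
  have hd := mfderiv_comp (I := 𝓘(ℝ, V)) (I' := I) (I'' := 𝓘(ℝ, E)) y hext
    (hfy.mdifferentiableAt (by simp))
  rw [mfderiv_eq_fderiv] at hd
  rw [hd]
  rfl

omit [IsManifold I ∞ N] [I.Boundaryless] in
theorem IsSmooth.differentiableOn {α : DiffForm I N k} (hα : α.IsSmooth) (x : N) :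
    DifferentiableOn ℝ (α.inChart x) (extChartAt I x).target :=
  (hα x).differentiableOn (by simp)

end DiffForm

end

end PoissonGeom

/-! ### Cotangent coordinates `(q, p)` over a chart and the canonical form in them -/

namespace PoissonGeom

noncomputable section

section CotangentCharts

open Set Filter

variable {n : ℕ} {M : Type u} [TopologicalSpace M] [ChartedSpace (EuclideanSpace ℝ (Fin n)) M]

/-- The model vector space `ℝⁿ`. -/
abbrev Vec (n : ℕ) := EuclideanSpace ℝ (Fin n)

/-- The dual of the model vector space. -/
abbrev Covec (n : ℕ) := EuclideanSpace ℝ (Fin n) →L[ℝ] ℝ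

/-- The tautological form on `V × V*` in the coordinates `(q, p)`. -/
def modelTautological (V : Type*) [NormedAddCommGroup V] [NormedSpace ℝ V]
    (z : V × (V →L[ℝ] ℝ)) : (V × (V →L[ℝ] ℝ)) [⋀^Fin 1]→L[ℝ] ℝ :=
  ContinuousAlternatingMap.ofSubsingleton ℝ _ ℝ (0 : Fin 1)
    (z.2.comp (ContinuousLinearMap.fst ℝ V (V →L[ℝ] ℝ)))

theorem contDiff_pairingForm {V W : Type*} [NormedAddCommGroup V] [NormedSpace ℝ V]
    [NormedAddCommGroup W] [NormedSpace ℝ W] (B : W →L[ℝ] V →L[ℝ] ℝ) :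
    ContDiff ℝ ∞ (fun z : V × W => (ContinuousAlternatingMap.ofSubsingleton ℝ (V × W) ℝ (0 : Fin 1)
      ((B z.2).comp (ContinuousLinearMap.fst ℝ V W)) : (V × W) [⋀^Fin 1]→L[ℝ] ℝ)) := by
  have h1 : ContDiff ℝ ∞ (fun z : V × W => (B z.2).comp (ContinuousLinearMap.fst ℝ V W)) :=
    (B.contDiff.comp contDiff_snd).clm_comp contDiff_const
  exact (ContinuousAlternatingMap.ofSubsingletonLIE (𝕜 := ℝ) (E := V × W) (F := ℝ)
    (0 : Fin 1)).toContinuousLinearEquiv.contDiff.comp h1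

theorem contDiff_modelTautological {V : Type*} [NormedAddCommGroup V] [NormedSpace ℝ V] :
    ContDiff ℝ ∞ (modelTautological V) :=
  contDiff_pairingForm (ContinuousLinearMap.id ℝ (V →L[ℝ] ℝ))

theorem extDeriv_modelTautological {V : Type*} [NormedAddCommGroup V] [NormedSpace ℝ V]
    (z v w : V × (V →L[ℝ] ℝ)) :
    extDeriv (modelTautological V) z ![v, w] = v.2 w.1 - w.2 v.1 := by
  rw [extDeriv_one_apply (contDiff_modelTautological.differentiable (by simp) z)]
  have h4 : ∀ a b : V × (V →L[ℝ] ℝ), fderiv ℝ (fun y => modelTautological V y ![b]) z a =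
      a.2 b.1 := by
    intro a b
    have h5 : HasFDerivAt (fun y : V × (V →L[ℝ] ℝ) => y.2 b.1)
      ((ContinuousLinearMap.apply ℝ ℝ b.1).comp
        (ContinuousLinearMap.snd ℝ V (V →L[ℝ] ℝ))) z :=
      ((ContinuousLinearMap.apply ℝ ℝ b.1).comp
        (ContinuousLinearMap.snd ℝ V (V →L[ℝ] ℝ))).hasFDerivAt
    have h6 : (fun y => modelTautological V y ![b]) = fun y : V × (V →L[ℝ] ℝ) => y.2 b.1 := rfl
    rw [h6, h5.fderiv]
    rfl
  rw [h4, h4]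

section Chart

variable [IsManifold (𝓡 n) ∞ M] {φ : OpenPartialHomeomorph M (Vec n)}

theorem chart_contMDiffAt (hφ : φ ∈ IsManifold.maximalAtlas (𝓡 n) ∞ M) {x : M}
    (hx : x ∈ φ.source) : ContMDiffAt (𝓡 n) (𝓡 n) ∞ φ x :=
  contMDiffAt_of_mem_maximalAtlas hφ hx

theorem chart_symm_contMDiffAt (hφ : φ ∈ IsManifold.maximalAtlas (𝓡 n) ∞ M) {q : Vec n}
    (hq : q ∈ φ.target) : ContMDiffAt (𝓡 n) (𝓡 n) ∞ φ.symm q :=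
  contMDiffAt_symm_of_mem_maximalAtlas hφ hq

theorem chart_mdifferentiableAt (hφ : φ ∈ IsManifold.maximalAtlas (𝓡 n) ∞ M) {x : M}
    (hx : x ∈ φ.source) : MDifferentiableAt (𝓡 n) (𝓡 n) φ x :=
  (chart_contMDiffAt hφ hx).mdifferentiableAt (by simp)

theorem chart_symm_mdifferentiableAt (hφ : φ ∈ IsManifold.maximalAtlas (𝓡 n) ∞ M) {q : Vec n}
    (hq : q ∈ φ.target) : MDifferentiableAt (𝓡 n) (𝓡 n) φ.symm q :=
  (chart_symm_contMDiffAt hφ hq).mdifferentiableAt (by simp)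

theorem mfderiv_chart_symm_mfderiv (hφ : φ ∈ IsManifold.maximalAtlas (𝓡 n) ∞ M) {q : Vec n}
    (hq : q ∈ φ.target) (v : Vec n) :
    (mfderiv (𝓡 n) (𝓡 n) φ (φ.symm q) (mfderiv (𝓡 n) (𝓡 n) φ.symm q v) : Vec n) = v := by
  have h1 := mfderiv_comp q (chart_mdifferentiableAt hφ (φ.map_target hq))
    (chart_symm_mdifferentiableAt hφ hq)
  have h2 : (φ ∘ φ.symm : Vec n → Vec n) =ᶠ[𝓝 q] id := by
    filter_upwards [φ.open_target.mem_nhds hq] with y hy using φ.right_inv hy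
  rw [h2.mfderiv_eq, mfderiv_id] at h1
  exact (DFunLike.congr_fun h1 v).symm

theorem mfderiv_chart_mfderiv_symm (hφ : φ ∈ IsManifold.maximalAtlas (𝓡 n) ∞ M) {x : M}
    (hx : x ∈ φ.source) (v : Vec n) :
    (mfderiv (𝓡 n) (𝓡 n) φ.symm (φ x) (mfderiv (𝓡 n) (𝓡 n) φ x v) : Vec n) = v := by
  have h1 := mfderiv_comp x (chart_symm_mdifferentiableAt hφ (φ.map_source hx))
    (chart_mdifferentiableAt hφ hx)
  have h2 : (φ.symm ∘ φ : M → M) =ᶠ[𝓝 x] id := by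
    filter_upwards [φ.open_source.mem_nhds hx] with y hy using φ.left_inv hy
  rw [h2.mfderiv_eq, mfderiv_id] at h1
  exact (DFunLike.congr_fun h1 v).symm

theorem mfderiv_congr_base (f : M → Vec n) {x y : M} (h : x = y) (v : Vec n) :
    (mfderiv (𝓡 n) (𝓡 n) f x v : Vec n) = mfderiv (𝓡 n) (𝓡 n) f y v := by
  subst h; rfl

/-- The parametrization of the part of `T*M` over the domain of a chart `φ` by `(q, p)`. -/
def cotParam (φ : OpenPartialHomeomorph M (Vec n)) (z : Vec n × Covec n) : CotangentBundle n M :=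
  ⟨φ.symm z.1, (z.2 : Vec n →L[ℝ] ℝ).comp
    (mfderiv (𝓡 n) (𝓡 n) φ (φ.symm z.1) : TangentSpace (𝓡 n) (φ.symm z.1) →L[ℝ] Vec n)⟩

/-- The coordinates `(q, p)` on the part of `T*M` over the domain of a chart `φ`. -/
def cotCoord (φ : OpenPartialHomeomorph M (Vec n)) (ξ : CotangentBundle n M) : Vec n × Covec n :=
  (φ ξ.1, (ξ.2 : TangentSpace (𝓡 n) ξ.1 →L[ℝ] ℝ).comp
    (mfderiv (𝓡 n) (𝓡 n) φ.symm (φ ξ.1) : Vec n →L[ℝ] TangentSpace (𝓡 n) (φ.symm (φ ξ.1))))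

theorem cotangent_ext {x y : M} (h : x = y) {a : CotangentSpace n M x} {b : CotangentSpace n M y}
    (hab : ∀ v : Vec n, (a : Vec n →L[ℝ] ℝ) v = (b : Vec n →L[ℝ] ℝ) v) :
    (⟨x, a⟩ : CotangentBundle n M) = ⟨y, b⟩ := by
  subst h
  congr 1
  exact ContinuousLinearMap.ext hab

theorem cotParam_cotCoord (hφ : φ ∈ IsManifold.maximalAtlas (𝓡 n) ∞ M) {ξ : CotangentBundle n M}
    (hξ : ξ.1 ∈ φ.source) : cotParam φ (cotCoord φ ξ) = ξ := by
  refine cotangent_ext (φ.left_inv hξ) fun v => ?_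
  have e : (mfderiv (𝓡 n) (𝓡 n) φ (φ.symm (φ ξ.1)) v : Vec n) =
      mfderiv (𝓡 n) (𝓡 n) φ ξ.1 v := by rw [φ.left_inv hξ]
  have h := mfderiv_chart_mfderiv_symm hφ hξ v
  change (ξ.2 : Vec n →L[ℝ] ℝ) (mfderiv (𝓡 n) (𝓡 n) φ.symm (φ ξ.1)
    (mfderiv (𝓡 n) (𝓡 n) φ (φ.symm (φ ξ.1)) v)) = _
  exact congrArg (ξ.2 : Vec n →L[ℝ] ℝ) ((congrArg _ e).trans h)

theorem cotCoord_cotParam (hφ : φ ∈ IsManifold.maximalAtlas (𝓡 n) ∞ M) {z : Vec n × Covec n}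
    (hz : z.1 ∈ φ.target) : cotCoord φ (cotParam φ z) = z := by
  refine Prod.ext (φ.right_inv hz) ?_
  ext v
  change z.2 (mfderiv (𝓡 n) (𝓡 n) φ (φ.symm z.1)
    (mfderiv (𝓡 n) (𝓡 n) φ.symm (φ (φ.symm z.1)) v)) = _
  have e : (mfderiv (𝓡 n) (𝓡 n) φ.symm (φ (φ.symm z.1)) v : Vec n) =
      mfderiv (𝓡 n) (𝓡 n) φ.symm z.1 v := by rw [φ.right_inv hz]
  exact congrArg z.2 ((congrArg _ e).trans (mfderiv_chart_symm_mfderiv hφ hz v))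

/-- Identifies the hom-bundle trivialization of `T*M` with the `p`-coordinates: the tangent
trivialization is inverted by the derivative of the inverse chart, and the trivial line bundle
contributes the identity. -/
theorem inCoordinates_cotangent {x₀ x : M} (hx : x ∈ (chartAt (Vec n) x₀).source)
    (a : CotangentSpace n M x) :
    ContinuousLinearMap.inCoordinates (σ := RingHom.id ℝ) (Vec n) (TangentSpace (𝓡 n) : M → Type _)
      ℝ (Trivial M ℝ) x₀ x x₀ x a =
    (cotCoord (chartAt (Vec n) x₀) ⟨x, a⟩).2 := by
  rw [ContinuousLinearMap.inCoordinates, TangentBundle.symmL_trivializationAt hx]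
  have h : Trivialization.continuousLinearMapAt ℝ (trivializationAt ℝ (Trivial M ℝ) x₀) x =
    ContinuousLinearMap.id ℝ ℝ := Bundle.Trivial.continuousLinearMapAt_trivialization ℝ M ℝ x
  rw [h]
  simp only [ModelWithCorners.range_eq_univ, mfderivWithin_univ]
  rfl

theorem cotangent_extChartAt_apply (ξ η : CotangentBundle n M)
    (hη : η.1 ∈ (chartAt (Vec n) ξ.1).source) :
    extChartAt (cotangentModel n) ξ η = cotCoord (chartAt (Vec n) ξ.1) η := by
  have h := hom_chart (𝕜 := ℝ) (F₁ := Vec n) (E₁ := (TangentSpace (𝓡 n) : M → Type _))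
    (F₂ := ℝ) (E₂ := Trivial M ℝ) (HB := Vec n) ξ η
  have h2 : extChartAt (cotangentModel n) ξ η =
      chartAt (ModelProd (Vec n) (Vec n →L[ℝ] ℝ)) ξ η := rfl
  rw [h2, h]
  exact Prod.ext rfl (inCoordinates_cotangent hη η.2)

theorem cotangent_extChartAt_source (ξ η : CotangentBundle n M) :
    η ∈ (extChartAt (cotangentModel n) ξ).source ↔ η.1 ∈ (chartAt (Vec n) ξ.1).source := by
  rw [FiberBundle.extChartAt]
  simp [hom_trivializationAt_apply]

theorem cotangent_extChartAt_symm_apply (ξ : CotangentBundle n M) {z : Vec n × Covec n}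
    (hz : z ∈ (extChartAt (cotangentModel n) ξ).target) :
    (extChartAt (cotangentModel n) ξ).symm z = cotParam (chartAt (Vec n) ξ.1) z := by
  have h1 := (extChartAt (cotangentModel n) ξ).map_target hz
  have h2 := (cotangent_extChartAt_source ξ _).1 h1
  have h3 := cotangent_extChartAt_apply ξ _ h2
  rw [(extChartAt (cotangentModel n) ξ).right_inv hz] at h3
  conv_rhs => rw [h3]
  exact (cotParam_cotCoord (IsManifold.chart_mem_maximalAtlas _) h2).symm

theorem cotangent_extChartAt_target_fst (ξ : CotangentBundle n M) {z : Vec n × Covec n}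
    (hz : z ∈ (extChartAt (cotangentModel n) ξ).target) :
    z.1 ∈ (chartAt (Vec n) ξ.1).target := by
  have h1 := (extChartAt (cotangentModel n) ξ).map_target hz
  have h2 := (cotangent_extChartAt_source ξ _).1 h1
  have h3 := cotangent_extChartAt_apply ξ _ h2
  rw [(extChartAt (cotangentModel n) ξ).right_inv hz] at h3
  rw [h3]
  exact (chartAt (Vec n) ξ.1).map_source h2

/-- In coordinates the transition is `(q, p) ↦ (ψ φ⁻¹ q, p ∘ D(φ ψ⁻¹))`, whose ingredients are
smooth. This lets any chart of the maximal atlas of `M` serve for `T*M`, not only the preferred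
ones. -/
theorem cotTransition_contDiffAt {ψ : OpenPartialHomeomorph M (Vec n)}
    (hφ : φ ∈ IsManifold.maximalAtlas (𝓡 n) ∞ M) (hψ : ψ ∈ IsManifold.maximalAtlas (𝓡 n) ∞ M)
    {z : Vec n × Covec n} (hz : z.1 ∈ φ.target) (hz' : φ.symm z.1 ∈ ψ.source) :
    ContDiffAt ℝ ∞ (fun z => cotCoord ψ (cotParam φ z)) z := by
  have h1 : ContDiffAt ℝ ∞ (ψ ∘ φ.symm) z.1 :=
    ((chart_contMDiffAt hψ hz').comp z.1 (chart_symm_contMDiffAt hφ hz)).contDiffAt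
  have h2 : ContDiffAt ℝ ∞ (φ ∘ ψ.symm) (ψ (φ.symm z.1)) := by
    refine (ContMDiffAt.comp (I' := 𝓡 n) (ψ (φ.symm z.1)) ?_
      (chart_symm_contMDiffAt hψ (ψ.map_source hz'))).contDiffAt
    rw [ψ.left_inv hz']
    exact chart_contMDiffAt hφ (φ.map_target hz)
  have h3 : ContDiffAt ℝ ∞ (fun z : Vec n × Covec n =>
      (ψ (φ.symm z.1), z.2.comp (fderiv ℝ (φ ∘ ψ.symm) (ψ (φ.symm z.1))))) z := by
    have h4 : ContDiffAt ℝ ∞ (fun z : Vec n × Covec n => (ψ ∘ φ.symm) z.1) z :=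
      h1.comp z contDiffAt_fst
    refine h4.prodMk (contDiffAt_snd.clm_comp ?_)
    exact ContDiffAt.comp (g := fderiv ℝ (φ ∘ ψ.symm)) z (h2.fderiv_right (m := ∞) (by simp)) h4
  refine h3.congr_of_eventuallyEq ?_
  have hopen : ∀ᶠ w : Vec n × Covec n in 𝓝 z, w.1 ∈ φ.target ∧ φ.symm w.1 ∈ ψ.source := by
    have ht : ∀ᶠ q in 𝓝 z.1, q ∈ φ.target ∧ φ.symm q ∈ ψ.source :=
      Filter.Eventually.and (φ.open_target.mem_nhds hz)
        ((φ.symm.continuousAt hz).eventually (ψ.open_source.mem_nhds hz'))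
    exact continuousAt_fst.eventually ht
  filter_upwards [hopen] with w hw
  refine Prod.ext rfl ?_
  ext v
  have h5 := mfderiv_comp (I := 𝓡 n) (I' := 𝓡 n) (I'' := 𝓡 n) (ψ (φ.symm w.1))
    (g := φ) (f := ψ.symm)
    (by rw [ψ.left_inv hw.2]; exact chart_mdifferentiableAt hφ (φ.map_target hw.1))
    (chart_symm_mdifferentiableAt hψ (ψ.map_source hw.2))
  rw [mfderiv_eq_fderiv] at h5
  have h6 := DFunLike.congr_fun h5 v
  change w.2 (mfderiv (𝓡 n) (𝓡 n) φ (φ.symm w.1)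
    (mfderiv (𝓡 n) (𝓡 n) ψ.symm (ψ (φ.symm w.1)) v)) = w.2 (fderiv ℝ (φ ∘ ψ.symm) _ v)
  exact congrArg w.2 ((mfderiv_congr_base φ (ψ.left_inv hw.2).symm _).trans h6.symm)

theorem contMDiffAt_cotCoord (hφ : φ ∈ IsManifold.maximalAtlas (𝓡 n) ∞ M)
    {ξ : CotangentBundle n M} (hξ : ξ.1 ∈ φ.source) :
    ContMDiffAt (cotangentModel n) 𝓘(ℝ, Vec n × Covec n) ∞ (cotCoord φ) ξ := by
  have h1 : ContMDiffAt (cotangentModel n) 𝓘(ℝ, Vec n × Covec n) ∞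
      (extChartAt (cotangentModel n) ξ) ξ := contMDiffAt_extChartAt
  have hχ := IsManifold.chart_mem_maximalAtlas (I := 𝓡 n) (n := ∞) ξ.1
  have hs : ξ.1 ∈ (chartAt (Vec n) ξ.1).source := mem_chart_source _ _
  have e1 := cotangent_extChartAt_apply ξ ξ hs
  have h2 : ContDiffAt ℝ ∞ (fun z => cotCoord φ (cotParam (chartAt (Vec n) ξ.1) z))
      (extChartAt (cotangentModel n) ξ ξ) := by
    rw [e1]
    refine cotTransition_contDiffAt hχ hφ ((chartAt (Vec n) ξ.1).map_source hs) ?_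
    change (chartAt (Vec n) ξ.1).symm ((chartAt (Vec n) ξ.1) ξ.1) ∈ _
    rwa [(chartAt (Vec n) ξ.1).left_inv hs]
  refine (h2.contMDiffAt.comp ξ h1).congr_of_eventuallyEq ?_
  filter_upwards [extChartAt_source_mem_nhds (I := cotangentModel n) ξ] with η hη
  have hη' := (cotangent_extChartAt_source ξ η).1 hη
  change _ = cotCoord φ (cotParam _ (extChartAt (cotangentModel n) ξ η))
  rw [cotangent_extChartAt_apply ξ η hη', cotParam_cotCoord hχ hη']

theorem contMDiffAt_cotParam (hφ : φ ∈ IsManifold.maximalAtlas (𝓡 n) ∞ M)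
    {z : Vec n × Covec n} (hz : z.1 ∈ φ.target) :
    ContMDiffAt 𝓘(ℝ, Vec n × Covec n) (cotangentModel n) ∞ (cotParam φ) z := by
  have h1 : ContMDiffAt 𝓘(ℝ, Vec n × Covec n) (𝓡 n) ∞ (fun z => φ.symm z.1) z :=
    (chart_symm_contMDiffAt hφ hz).comp z contDiffAt_fst.contMDiffAt
  refine (contMDiffAt_hom_bundle (cotParam φ)).2 ⟨h1, ?_⟩
  have hχ := IsManifold.chart_mem_maximalAtlas (I := 𝓡 n) (n := ∞) (φ.symm z.1)
  have h2 := (cotTransition_contDiffAt hφ hχ hz (mem_chart_source _ _)).snd.contMDiffAt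
  refine h2.congr_of_eventuallyEq ?_
  filter_upwards [h1.continuousAt ((chartAt (Vec n) (φ.symm z.1)).open_source.mem_nhds
    (mem_chart_source _ _))] with w hw
  exact inCoordinates_cotangent hw _

theorem mdifferentiableAt_cotParam (hφ : φ ∈ IsManifold.maximalAtlas (𝓡 n) ∞ M)
    {z : Vec n × Covec n} (hz : z.1 ∈ φ.target) :
    MDifferentiableAt 𝓘(ℝ, Vec n × Covec n) (cotangentModel n) (cotParam φ) z :=
  (contMDiffAt_cotParam hφ hz).mdifferentiableAt (by simp)

theorem mdifferentiableAt_cotCoord (hφ : φ ∈ IsManifold.maximalAtlas (𝓡 n) ∞ M)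
    {ξ : CotangentBundle n M} (hξ : ξ.1 ∈ φ.source) :
    MDifferentiableAt (cotangentModel n) 𝓘(ℝ, Vec n × Covec n) (cotCoord φ) ξ :=
  (contMDiffAt_cotCoord hφ hξ).mdifferentiableAt (by simp)

theorem isOpen_cotTarget (φ : OpenPartialHomeomorph M (Vec n)) :
    IsOpen {z : Vec n × Covec n | z.1 ∈ φ.target} := φ.open_target.preimage continuous_fst

theorem contMDiff_cotProj : ContMDiff (cotangentModel n) (𝓡 n) ∞
    (fun η : CotangentBundle n M => η.1) :=
  Bundle.contMDiff_proj (CotangentSpace n M)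

theorem mfderiv_proj_cotParam (hφ : φ ∈ IsManifold.maximalAtlas (𝓡 n) ∞ M)
    {z : Vec n × Covec n} (hz : z.1 ∈ φ.target) (v : Vec n × Covec n) :
    (mfderiv (cotangentModel n) (𝓡 n) (fun η : CotangentBundle n M => η.1) (cotParam φ z)
      (mfderiv 𝓘(ℝ, Vec n × Covec n) (cotangentModel n) (cotParam φ) z v) : Vec n) =
    mfderiv (𝓡 n) (𝓡 n) φ.symm z.1 v.1 := by
  have h1 := mfderiv_comp (I := 𝓘(ℝ, Vec n × Covec n)) (I' := cotangentModel n) (I'' := 𝓡 n) z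
    (contMDiff_cotProj.mdifferentiable (by simp) (cotParam φ z)) (mdifferentiableAt_cotParam hφ hz)
  have h2 := mfderiv_comp (I := 𝓘(ℝ, Vec n × Covec n)) (I' := 𝓡 n) (I'' := 𝓡 n) z
    (f := Prod.fst) (chart_symm_mdifferentiableAt hφ hz) differentiableAt_fst.mdifferentiableAt
  have h3 : (φ.symm ∘ Prod.fst : Vec n × Covec n → M) =
    (fun η : CotangentBundle n M => η.1) ∘ cotParam φ := rfl
  rw [h3] at h2
  have h4 := DFunLike.congr_fun (h1.symm.trans h2) v
  refine h4.trans ?_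
  rw [mfderiv_eq_fderiv, fderiv_fst]
  rfl

theorem tautologicalForm_pull_cotParam (hφ : φ ∈ IsManifold.maximalAtlas (𝓡 n) ∞ M)
    {z : Vec n × Covec n} (hz : z.1 ∈ φ.target) :
    (tautologicalForm n M).pull (cotParam φ) z = modelTautological (Vec n) z := by
  ext v
  have h := mfderiv_proj_cotParam hφ hz (v 0)
  have h2 := mfderiv_chart_symm_mfderiv hφ hz (v 0).1
  change z.2 (mfderiv (𝓡 n) (𝓡 n) φ (φ.symm z.1) (mfderiv (cotangentModel n) (𝓡 n)
    (fun η : CotangentBundle n M => η.1) (cotParam φ z)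
      (mfderiv 𝓘(ℝ, Vec n × Covec n) (cotangentModel n) (cotParam φ) z (v 0)))) = z.2 (v 0).1
  exact congrArg z.2 ((congrArg _ h).trans h2)

/-- The preferred charts of `T*M` are `(q, p)`-coordinates on their targets, so `θ` has the explicit
expression `p dq` there; this supplies the differentiability needed to apply `extDeriv_pull` to `θ`.
-/
theorem tautologicalForm_inChart (ξ : CotangentBundle n M) :
    EqOn ((tautologicalForm n M).inChart ξ) (modelTautological (Vec n))
      (extChartAt (cotangentModel n) ξ).target := by
  intro z hz
  rw [← tautologicalForm_pull_cotParam (IsManifold.chart_mem_maximalAtlas ξ.1)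
    (cotangent_extChartAt_target_fst ξ hz)]
  have h1 : ((extChartAt (cotangentModel n) ξ).symm : Vec n × Covec n → CotangentBundle n M) =ᶠ[𝓝 z]
      cotParam (chartAt (Vec n) ξ.1) := by
    filter_upwards [(isOpen_extChartAt_target (I := cotangentModel n) ξ).mem_nhds hz] with w hw
    exact cotangent_extChartAt_symm_apply ξ hw
  ext v
  change (tautologicalForm n M ((extChartAt (cotangentModel n) ξ).symm z)) (fun i =>
      mfderiv 𝓘(ℝ, Vec n × Covec n) (cotangentModel n) (extChartAt (cotangentModel n) ξ).symm z
        (v i)) = (tautologicalForm n M (cotParam (chartAt (Vec n) ξ.1) z)) (fun i =>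
      mfderiv 𝓘(ℝ, Vec n × Covec n) (cotangentModel n) (cotParam (chartAt (Vec n) ξ.1)) z (v i))
  refine DiffForm.apply_congr (tautologicalForm n M) h1.self_of_nhds (funext fun i => ?_)
  rw [Filter.EventuallyEq.mfderiv_eq (I := 𝓘(ℝ, Vec n × Covec n)) (I' := cotangentModel n) h1]
  rfl

/-- The canonical symplectic form in the coordinates `(q, p)`. -/
theorem canonicalForm_cotParam (hφ : φ ∈ IsManifold.maximalAtlas (𝓡 n) ∞ M)
    {z : Vec n × Covec n} (hz : z.1 ∈ φ.target) (v w : Vec n × Covec n) :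
    canonicalForm n M (cotParam φ z)
      ![mfderiv 𝓘(ℝ, Vec n × Covec n) (cotangentModel n) (cotParam φ) z v,
        mfderiv 𝓘(ℝ, Vec n × Covec n) (cotangentModel n) (cotParam φ) z w] =
      w.2 v.1 - v.2 w.1 := by
  have h1 := DiffForm.extDeriv_pull (α := tautologicalForm n M) (f := cotParam φ) (y := z)
    (fun ξ => (contDiff_modelTautological.differentiable (by simp)).differentiableOn.congr
      (tautologicalForm_inChart ξ)) (isOpen_cotTarget φ) hz
    (fun w hw => (contMDiffAt_cotParam hφ hw).contMDiffWithinAt)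
  have h2 : (tautologicalForm n M).pull (cotParam φ) =ᶠ[𝓝 z] modelTautological (Vec n) := by
    filter_upwards [(isOpen_cotTarget φ).mem_nhds hz] with w hw
    exact tautologicalForm_pull_cotParam hφ hw
  have h3 := DFunLike.congr_fun h1 ![v, w]
  rw [h2.extDeriv_eq, extDeriv_modelTautological] at h3
  have h5 : (tautologicalForm n M).d.pull (cotParam φ) z ![v, w] =
      (tautologicalForm n M).d (cotParam φ z)
        ![mfderiv 𝓘(ℝ, Vec n × Covec n) (cotangentModel n) (cotParam φ) z v,
        mfderiv 𝓘(ℝ, Vec n × Covec n) (cotangentModel n) (cotParam φ) z w] :=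
    DiffForm.apply_congr (tautologicalForm n M).d rfl (funext fun i => by fin_cases i <;> rfl)
  rw [h5] at h3
  change -((tautologicalForm n M).d (cotParam φ z) _) = _
  rw [← h3]
  ring

end Chart

end CotangentCharts

end

end PoissonGeom

/-! ### Differentials as maps of model spaces, and `2`-forms as bilinear forms -/

namespace PoissonGeom

noncomputable section

section TangentMaps

open Set Filter

variable {E H E' H' E'' H'' : Type*} [NormedAddCommGroup E] [NormedSpace ℝ E] [TopologicalSpace H]
  [NormedAddCommGroup E'] [NormedSpace ℝ E'] [TopologicalSpace H']
  [NormedAddCommGroup E''] [NormedSpace ℝ E''] [TopologicalSpace H'']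
  (I : ModelWithCorners ℝ E H) (I' : ModelWithCorners ℝ E' H') (I'' : ModelWithCorners ℝ E'' H'')
  {N N' N'' : Type*} [TopologicalSpace N] [ChartedSpace H N] [TopologicalSpace N']
  [ChartedSpace H' N'] [TopologicalSpace N''] [ChartedSpace H'' N'']

/-- The differential of a map of manifolds, as a map between the model vector spaces. -/
def tderiv (f : N → N') (x : N) : E →L[ℝ] E' := mfderiv I I' f x

variable {I I' I''}

theorem tderiv_comp {g : N' → N''} {f : N → N'} {x : N} (hg : MDifferentiableAt I' I'' g (f x))
    (hf : MDifferentiableAt I I' f x) :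
    tderiv I I'' (g ∘ f) x = (tderiv I' I'' g (f x)).comp (tderiv I I' f x) :=
  mfderiv_comp x hg hf

theorem tderiv_comp_apply {g : N' → N''} {f : N → N'} {x : N}
    (hg : MDifferentiableAt I' I'' g (f x)) (hf : MDifferentiableAt I I' f x) (v : E) :
    tderiv I I'' (fun y => g (f y)) x v = tderiv I' I'' g (f x) (tderiv I I' f x v) :=
  DFunLike.congr_fun (tderiv_comp hg hf) v

/-- For the frequent case where the image point is known only up to a proved equality, such as `mul
(inv g) g = unit (src g)`. -/
theorem tderiv_comp_apply_of_eq {g : N' → N''} {f : N → N'} {x : N} {y : N'}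
    (hg : MDifferentiableAt I' I'' g y)
    (hf : MDifferentiableAt I I' f x) (hy : f x = y) (v : E) :
    tderiv I I'' (fun y => g (f y)) x v = tderiv I' I'' g y (tderiv I I' f x v) := by
  subst hy; exact tderiv_comp_apply hg hf v

theorem tderiv_congr {f g : N → N'} {x : N} (h : f =ᶠ[𝓝 x] g) : tderiv I I' f x = tderiv I I' g x :=
  h.mfderiv_eq

theorem tderiv_const (c : N') (x : N) : tderiv I I' (fun _ : N => c) x = 0 :=
  mfderiv_const

theorem tderiv_id (x : N) : tderiv I I (fun y : N => y) x = ContinuousLinearMap.id ℝ E :=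
  mfderiv_id

theorem tderiv_eq_fderiv {f : E → E'} {x : E} :
    tderiv 𝓘(ℝ, E) 𝓘(ℝ, E') f x = fderiv ℝ f x := mfderiv_eq_fderiv

theorem hasFDerivAt_of_tderiv {f : E → E'} {x : E}
    (h : MDifferentiableAt 𝓘(ℝ, E) 𝓘(ℝ, E') f x) :
    HasFDerivAt f (tderiv 𝓘(ℝ, E) 𝓘(ℝ, E') f x) x := by
  rw [tderiv_eq_fderiv]
  exact h.differentiableAt.hasFDerivAt

/-- If `g ∘ f` is the identity near `x`, the differentials compose to the identity. -/
theorem tderiv_leftInverse {g : N' → N} {f : N → N'} {x : N} {y : N'}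
    (hg : MDifferentiableAt I' I g y) (hf : MDifferentiableAt I I' f x) (hy : f x = y)
    (h : ∀ᶠ z in 𝓝 x, g (f z) = z) (v : E) : tderiv I' I g y (tderiv I I' f x v) = v := by
  rw [← tderiv_comp_apply_of_eq hg hf hy, tderiv_congr (g := fun z => z) h, tderiv_id]
  rfl

namespace DiffForm

/-- The bilinear form of an alternating form of degree two. -/
def altBilin (β : E [⋀^Fin 2]→L[ℝ] ℝ) : LinearMap.BilinForm ℝ E :=
  LinearMap.mk₂ ℝ (fun v w : E => β ![v, w])
    (fun v v' w => AlternatingMap.map_vecCons_add β.toAlternatingMap _ _ _)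
    (fun c v w => AlternatingMap.map_vecCons_smul β.toAlternatingMap _ _ _)
    (fun v w w' => by
      have h := β.toAlternatingMap.map_update_add ![v, 0] 1 w w'
      have e : ∀ u : E, Function.update ![v, 0] 1 u = ![v, u] := fun u => by
        ext i; fin_cases i <;> rfl
      rw [e, e, e] at h
      exact h)
    (fun c v w => by
      have h := β.toAlternatingMap.map_update_smul ![v, 0] 1 c w
      have e : ∀ u : E, Function.update ![v, 0] 1 u = ![v, u] := fun u => by
        ext i; fin_cases i <;> rfl
      rw [e, e] at h
      exact h)

/-- The value of a `2`-form as a bilinear form on the model vector space. -/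
def pair (Ω : DiffForm I N 2) (x : N) : LinearMap.BilinForm ℝ E := altBilin (Ω x)

theorem pair_self (Ω : DiffForm I N 2) (x : N) (v : E) : Ω.pair x v v = 0 :=
  (Ω x : E [⋀^Fin 2]→L[ℝ] ℝ).toAlternatingMap.map_eq_zero_of_eq ![v, v] (i := 0) (j := 1) rfl
    (by decide)

theorem pair_swap (Ω : DiffForm I N 2) (x : N) (v w : E) : Ω.pair x v w = -Ω.pair x w v := by
  have h := Ω.pair_self x (v + w)
  simp only [map_add, LinearMap.add_apply, pair_self] at h
  linarith

theorem pair_isAlt (Ω : DiffForm I N 2) (x : N) : (Ω.pair x).IsAlt := Ω.pair_self x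

theorem ext_pair {V : Type*} [NormedAddCommGroup V] [NormedSpace ℝ V]
    {α β : V [⋀^Fin 2]→L[ℝ] ℝ} (h : ∀ v w, α ![v, w] = β ![v, w]) : α = β := by
  ext v
  have e : v = ![v 0, v 1] := by ext i; fin_cases i <;> rfl
  rw [e, h]

theorem pull_pair {V : Type*} [NormedAddCommGroup V] [NormedSpace ℝ V] (Ω : DiffForm I N 2)
    (f : V → N) (y v w : V) :
    Ω.pull f y ![v, w] = Ω.pair (f y) (tderiv 𝓘(ℝ, V) I f y v) (tderiv 𝓘(ℝ, V) I f y w) :=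
  apply_congr Ω rfl (funext fun i => by fin_cases i <;> rfl)

end DiffForm

end TangentMaps

section ChartDerivatives

variable {n : ℕ} {M : Type u} [TopologicalSpace M] [ChartedSpace (EuclideanSpace ℝ (Fin n)) M]
  [IsManifold (𝓡 n) ∞ M] {φ : OpenPartialHomeomorph M (Vec n)}

/-- A cotangent vector as a covector on the model vector space. -/
def covec {x : M} (a : CotangentSpace n M x) : Covec n := a

theorem covec_add {x : M} (a b : CotangentSpace n M x) : covec (a + b) = covec a + covec b := rfl

theorem covec_injective {x : M} : Function.Injective (covec : CotangentSpace n M x → Covec n) :=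
  fun _ _ h => h

theorem tderiv_chart_tderiv_symm (hφ : φ ∈ IsManifold.maximalAtlas (𝓡 n) ∞ M) {q : Vec n}
    (hq : q ∈ φ.target) (v : Vec n) :
    tderiv (𝓡 n) (𝓡 n) φ (φ.symm q) (tderiv (𝓡 n) (𝓡 n) φ.symm q v) = v :=
  mfderiv_chart_symm_mfderiv hφ hq v

theorem tderiv_symm_tderiv_chart (hφ : φ ∈ IsManifold.maximalAtlas (𝓡 n) ∞ M) {x : M}
    (hx : x ∈ φ.source) (v : Vec n) :
    tderiv (𝓡 n) (𝓡 n) φ.symm (φ x) (tderiv (𝓡 n) (𝓡 n) φ x v) = v :=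
  mfderiv_chart_mfderiv_symm hφ hx v

theorem canonicalForm_pair_cotParam (hφ : φ ∈ IsManifold.maximalAtlas (𝓡 n) ∞ M)
    {z : Vec n × Covec n} (hz : z.1 ∈ φ.target) (v w : Vec n × Covec n) :
    (canonicalForm n M).pair (cotParam φ z)
      (tderiv 𝓘(ℝ, Vec n × Covec n) (cotangentModel n) (cotParam φ) z v)
      (tderiv 𝓘(ℝ, Vec n × Covec n) (cotangentModel n) (cotParam φ) z w) =
      w.2 v.1 - v.2 w.1 := canonicalForm_cotParam hφ hz v w

theorem tderiv_cotParam_cotCoord (hφ : φ ∈ IsManifold.maximalAtlas (𝓡 n) ∞ M)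
    {ξ : CotangentBundle n M} (hξ : ξ.1 ∈ φ.source) (v : Vec n × Covec n) :
    tderiv 𝓘(ℝ, Vec n × Covec n) (cotangentModel n) (cotParam φ) (cotCoord φ ξ)
      (tderiv (cotangentModel n) 𝓘(ℝ, Vec n × Covec n) (cotCoord φ) ξ v) = v :=
  tderiv_leftInverse (mdifferentiableAt_cotParam hφ (φ.map_source hξ))
    (mdifferentiableAt_cotCoord hφ hξ) rfl (by
      filter_upwards [(φ.open_source.preimage contMDiff_cotProj.continuous).mem_nhds hξ] with η hη
      exact cotParam_cotCoord hφ hη) v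

theorem canonicalForm_pair (hφ : φ ∈ IsManifold.maximalAtlas (𝓡 n) ∞ M)
    {ξ : CotangentBundle n M} (hξ : ξ.1 ∈ φ.source) (v w : Vec n × Covec n) :
    (canonicalForm n M).pair ξ v w =
      (tderiv (cotangentModel n) 𝓘(ℝ, Vec n × Covec n) (cotCoord φ) ξ w).2
        (tderiv (cotangentModel n) 𝓘(ℝ, Vec n × Covec n) (cotCoord φ) ξ v).1 -
      (tderiv (cotangentModel n) 𝓘(ℝ, Vec n × Covec n) (cotCoord φ) ξ v).2
        (tderiv (cotangentModel n) 𝓘(ℝ, Vec n × Covec n) (cotCoord φ) ξ w).1 := by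
  rw [← canonicalForm_pair_cotParam (z := cotCoord φ ξ) hφ (φ.map_source hξ)
    (tderiv (cotangentModel n) 𝓘(ℝ, Vec n × Covec n) (cotCoord φ) ξ v)
    (tderiv (cotangentModel n) 𝓘(ℝ, Vec n × Covec n) (cotCoord φ) ξ w), tderiv_cotParam_cotCoord hφ hξ, tderiv_cotParam_cotCoord hφ hξ, cotParam_cotCoord hφ hξ]

theorem tderiv_proj_cotParam (hφ : φ ∈ IsManifold.maximalAtlas (𝓡 n) ∞ M)
    {z : Vec n × Covec n} (hz : z.1 ∈ φ.target) (v : Vec n × Covec n) :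
    tderiv (cotangentModel n) (𝓡 n) (fun η : CotangentBundle n M => η.1) (cotParam φ z)
      (tderiv 𝓘(ℝ, Vec n × Covec n) (cotangentModel n) (cotParam φ) z v) =
    tderiv (𝓡 n) (𝓡 n) φ.symm z.1 v.1 := mfderiv_proj_cotParam hφ hz v

end ChartDerivatives

end

end PoissonGeom

/-! ### The inverse function theorem and the lattice of a chart -/

namespace PoissonGeom

noncomputable section

section InverseFunction

variable {V W : Type*} [NormedAddCommGroup V] [NormedSpace ℝ V] [CompleteSpace V]
  [NormedAddCommGroup W] [NormedSpace ℝ W]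

/-- The inverse function theorem, with smoothness of the inverse on its whole domain. -/
theorem exists_smooth_local_inverse {f : V → W} {U : Set V} (hU : IsOpen U) {x : V} (hx : x ∈ U)
    (hf : ContDiffOn ℝ ∞ f U) (e : V ≃L[ℝ] W) (he : HasFDerivAt f (e : V →L[ℝ] W) x) :
    ∃ g : OpenPartialHomeomorph V W, x ∈ g.source ∧ g.source ⊆ U ∧ (∀ y, g y = f y) ∧
      ContDiffOn ℝ ∞ g.symm g.target := by
  have hfx : ContDiffAt ℝ ∞ f x := hf.contDiffAt (hU.mem_nhds hx)
  let g₀ := hfx.toOpenPartialHomeomorph f he (by simp)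
  have hg₀ : ∀ y, g₀ y = f y := fun y => rfl
  have hcont : ContinuousOn (fderiv ℝ f) U :=
    hf.continuousOn_fderiv_of_isOpen hU (by simp)
  -- Restricting to the open locus where the derivative is invertible makes the local inverse smooth
  -- at every point of its domain, not only at the image of `x`.
  let S : Set V := U ∩ fderiv ℝ f ⁻¹' (Set.range ((↑) : (V ≃L[ℝ] W) → V →L[ℝ] W))
  have hS : IsOpen S := hcont.isOpen_inter_preimage hU (ContinuousLinearEquiv.isOpen)
  have hxS : x ∈ S := ⟨hx, e, he.fderiv.symm⟩
  refine ⟨g₀.restrOpen S hS, ⟨hfx.mem_toOpenPartialHomeomorph_source he (by simp), hxS⟩,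
    fun y hy => hy.2.1, hg₀, ?_⟩
  intro z hz
  apply ContDiffAt.contDiffWithinAt
  have hz' := (g₀.restrOpen S hS).map_target hz
  obtain ⟨e', he'⟩ := hz'.2.2
  have hd : HasFDerivAt f (e' : V →L[ℝ] W) ((g₀.restrOpen S hS).symm z) := by
    rw [he']
    exact ((hf.contDiffAt (hU.mem_nhds hz'.2.1)).differentiableAt (by simp)).hasFDerivAt
  exact (g₀.restrOpen S hS).contDiffAt_symm hz hd (hf.contDiffAt (hU.mem_nhds hz'.2.1))

end InverseFunction

section ChartLattice

open Set Filter

variable {n : ℕ} {M : Type u} [TopologicalSpace M] [ChartedSpace (EuclideanSpace ℝ (Fin n)) M]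
  [IsManifold (𝓡 n) ∞ M] {φ ψ : OpenPartialHomeomorph M (Vec n)}

/-- The standard basis vectors. -/
abbrev stdVec {n : ℕ} (i : Fin n) : Vec n := EuclideanSpace.single i (1 : ℝ)

theorem sum_stdVec (v : Vec n) : v = ∑ i, v i • stdVec i := by
  ext j
  simp [Pi.single_apply]

theorem coordDifferential_apply (hφ : φ ∈ IsManifold.maximalAtlas (𝓡 n) ∞ M) {x : M}
    (hx : x ∈ φ.source) (i : Fin n) (v : Vec n) :
    covec (coordDifferential φ i x) v = tderiv (𝓡 n) (𝓡 n) φ x v i := by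
  have h1 : MDifferentiableAt (𝓡 n) 𝓘(ℝ, ℝ) (EuclideanSpace.proj i : Vec n →L[ℝ] ℝ) (φ x) :=
    (EuclideanSpace.proj i : Vec n →L[ℝ] ℝ).differentiableAt.mdifferentiableAt
  have h2 := mfderiv_comp x h1 (chart_mdifferentiableAt hφ hx)
  rw [mfderiv_eq_fderiv, ContinuousLinearMap.fderiv] at h2
  exact DFunLike.congr_fun h2 v

/-- The lattice spanned by the coordinate differentials of a chart. -/
def chartLattice (φ : OpenPartialHomeomorph M (Vec n)) (x : M) :
    AddSubgroup (CotangentSpace n M x) :=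
  AddSubgroup.closure (Set.range fun i => coordDifferential φ i x)

theorem coordDifferential_mem (φ : OpenPartialHomeomorph M (Vec n)) (x : M) (i : Fin n) :
    coordDifferential φ i x ∈ chartLattice φ x := AddSubgroup.subset_closure ⟨i, rfl⟩

/-- The coordinate vectors of a chart. -/
def coordVec (φ : OpenPartialHomeomorph M (Vec n)) (x : M) (i : Fin n) : Vec n :=
  tderiv (𝓡 n) (𝓡 n) φ.symm (φ x) (stdVec i)

theorem coordDifferential_coordVec (hφ : φ ∈ IsManifold.maximalAtlas (𝓡 n) ∞ M) {x : M}
    (hx : x ∈ φ.source) (i j : Fin n) :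
    covec (coordDifferential φ i x) (coordVec φ x j) = if i = j then 1 else 0 := by
  have h := tderiv_chart_tderiv_symm hφ (φ.map_source hx) (stdVec j)
  rw [φ.left_inv hx] at h
  rw [coordDifferential_apply hφ hx, coordVec, h]
  simp [stdVec]

theorem vec_eq_sum_coordVec (hφ : φ ∈ IsManifold.maximalAtlas (𝓡 n) ∞ M) {x : M}
    (hx : x ∈ φ.source) (v : Vec n) :
    v = ∑ i, covec (coordDifferential φ i x) v • coordVec φ x i := by
  conv_lhs => rw [← tderiv_symm_tderiv_chart hφ hx v, sum_stdVec (tderiv (𝓡 n) (𝓡 n) φ x v),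
    map_sum]
  refine Finset.sum_congr rfl fun i _ => ?_
  rw [map_smul, coordDifferential_apply hφ hx, coordVec]

theorem covec_eq_sum (hφ : φ ∈ IsManifold.maximalAtlas (𝓡 n) ∞ M) {x : M}
    (hx : x ∈ φ.source) (a : Covec n) :
    a = ∑ i, a (coordVec φ x i) • covec (coordDifferential φ i x) := by
  ext v
  conv_lhs => rw [vec_eq_sum_coordVec hφ hx v]
  simp [mul_comm]

/-- The coordinate vectors are the basis dual to the coordinate differentials, so the numbers on the
right are the coefficients of `a` in that basis. -/
theorem mem_chartLattice (hφ : φ ∈ IsManifold.maximalAtlas (𝓡 n) ∞ M) {x : M}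
    (hx : x ∈ φ.source) (a : CotangentSpace n M x) :
    a ∈ chartLattice φ x ↔ ∀ i, ∃ m : ℤ, covec a (coordVec φ x i) = m := by
  constructor
  · intro ha
    induction ha using AddSubgroup.closure_induction with
    | mem b hb =>
      obtain ⟨j, rfl⟩ := hb
      intro i
      refine ⟨if j = i then 1 else 0, ?_⟩
      refine (coordDifferential_coordVec hφ hx j i).trans ?_
      split_ifs <;> simp
    | zero => exact fun i => ⟨0, by simp; rfl⟩
    | add b c _ _ hb hc =>
      intro i
      obtain ⟨m, hm⟩ := hb i
      obtain ⟨k, hk⟩ := hc i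
      refine ⟨m + k, ?_⟩
      push_cast
      rw [← hm, ← hk]
      rfl
    | neg b _ hb =>
      intro i
      obtain ⟨m, hm⟩ := hb i
      refine ⟨-m, ?_⟩
      push_cast
      rw [← hm]
      rfl
  · intro h
    choose m hm using h
    have h1 : covec a = ∑ i, m i • covec (coordDifferential φ i x) := by
      conv_lhs => rw [covec_eq_sum hφ hx (covec a)]
      refine Finset.sum_congr rfl fun i _ => ?_
      rw [hm i]
      exact Int.cast_smul_eq_zsmul ℝ (m i) (covec (coordDifferential φ i x))
    have h2 : (∑ i, m i • coordDifferential φ i x) ∈ chartLattice φ x :=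
      AddSubgroup.sum_mem _ fun i _ => AddSubgroup.zsmul_mem _ (coordDifferential_mem φ x i) _
    rw [show a = ∑ i, m i • coordDifferential φ i x from h1]
    exact h2

theorem cotParam_mem_chartLattice (hφ : φ ∈ IsManifold.maximalAtlas (𝓡 n) ∞ M)
    {z : Vec n × Covec n} (hz : z.1 ∈ φ.target) :
    (cotParam φ z).2 ∈ chartLattice φ (φ.symm z.1) ↔ ∀ i, ∃ m : ℤ, z.2 (stdVec i) = m := by
  refine (mem_chartLattice hφ (φ.map_target hz) _).trans (forall_congr' fun i => ?_)
  have e : covec (x := φ.symm z.1) (cotParam φ z).2 =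
    z.2.comp (tderiv (𝓡 n) (𝓡 n) φ (φ.symm z.1)) := rfl
  rw [coordVec, φ.right_inv hz, e, ContinuousLinearMap.comp_apply,
    tderiv_chart_tderiv_symm hφ hz]

theorem chartLattice_discrete (hφ : φ ∈ IsManifold.maximalAtlas (𝓡 n) ∞ M) {x : M}
    (hx : x ∈ φ.source) : DiscreteTopology (chartLattice φ x) := by
  apply discreteTopology_of_isOpen_singleton_zero
  -- The open unit box in coefficient space: its only point with integral coefficients is zero.
  let S : Set (Covec n) := {a | ∀ i, |a (coordVec φ x i)| < 1}
  have hS : IsOpen S := by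
    have : S = ⋂ i, {a : Covec n | |a (coordVec φ x i)| < 1} := by ext; simp [S]
    rw [this]
    refine isOpen_iInter_of_finite fun i => ?_
    have hc : Continuous fun a : Covec n => |a (coordVec φ x i)| := by fun_prop
    exact isOpen_lt hc continuous_const
  have hS' : IsOpen (S : Set (CotangentSpace n M x)) := hS
  have h : ({0} : Set (chartLattice φ x)) = Subtype.val ⁻¹' (S : Set (CotangentSpace n M x)) := by
    ext a
    constructor
    · rintro rfl i
      change |(0 : ℝ)| < 1
      simp
    · intro ha
      have h0 : ∀ i, covec a.1 (coordVec φ x i) = 0 := by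
        intro i
        obtain ⟨m, hm⟩ := (mem_chartLattice hφ hx a.1).1 a.2 i
        have h1 : |covec a.1 (coordVec φ x i)| < 1 := ha i
        rw [hm] at h1 ⊢
        have : |m| < 1 := by exact_mod_cast h1
        rw [Int.abs_lt_one_iff] at this
        simp [this]
      apply Subtype.ext
      have h1 := covec_eq_sum hφ hx (covec a.1)
      simp only [h0, zero_smul, Finset.sum_const_zero] at h1
      exact h1
  rw [h]
  exact hS'.preimage continuous_subtype_val

theorem chartLattice_span (hφ : φ ∈ IsManifold.maximalAtlas (𝓡 n) ∞ M) {x : M}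
    (hx : x ∈ φ.source) :
    Submodule.span ℝ (chartLattice φ x : Set (CotangentSpace n M x)) = ⊤ := by
  rw [eq_top_iff]
  intro a _
  have h : a = ∑ i, covec a (coordVec φ x i) • coordDifferential φ i x :=
    covec_eq_sum hφ hx (covec a)
  rw [h]
  exact Submodule.sum_mem _ fun i _ => Submodule.smul_mem _ _
    (Submodule.subset_span (coordDifferential_mem φ x i))

end ChartLattice

end

end PoissonGeom

/-! ### Integral affine transitions and equality of chart lattices -/

namespace PoissonGeom

noncomputable section

open Set Filter

/-- Distinct integers are at distance at least one. This discreteness makes Jacobians of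
lattice-preserving transitions, and coefficients of lattice sections, locally constant. -/
theorem eventually_eq_of_integer_valued {X : Type*} [TopologicalSpace X] {f : X → ℝ} {x : X}
    (hf : ContinuousAt f x) (h : ∀ᶠ y in 𝓝 x, ∃ m : ℤ, f y = m) : ∀ᶠ y in 𝓝 x, f y = f x := by
  obtain ⟨m, hm⟩ := h.self_of_nhds
  filter_upwards [h, hf (Metric.ball_mem_nhds (f x) one_pos)] with y hy hy'
  obtain ⟨k, hk⟩ := hy
  have hb : |f y - f x| < 1 := hy'
  rw [hk, hm] at hb ⊢
  have : |k - m| < 1 := by exact_mod_cast hb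
  rw [Int.abs_lt_one_iff] at this
  have : k = m := by omega
  rw [this]

section Transition

variable {n : ℕ} {M : Type u} [TopologicalSpace M] [ChartedSpace (EuclideanSpace ℝ (Fin n)) M]
  [IsManifold (𝓡 n) ∞ M] {φ ψ : OpenPartialHomeomorph M (Vec n)}

theorem covec_ext {a b : Covec n} (h : ∀ i, a (stdVec i) = b (stdVec i)) : a = b := by
  ext v
  rw [sum_stdVec v, map_sum, map_sum]
  exact Finset.sum_congr rfl fun i _ => by rw [map_smul, map_smul, h]

theorem vecMap_ext {a b : Vec n →L[ℝ] Vec n} (h : ∀ i j, a (stdVec i) j = b (stdVec i) j) :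
    a = b := by
  ext v j
  rw [sum_stdVec v, map_sum, map_sum]
  simp only [map_smul, PiLp.smul_apply, WithLp.ofLp_sum, Finset.sum_apply, h]

theorem contDiffAt_transition (hφ : φ ∈ IsManifold.maximalAtlas (𝓡 n) ∞ M)
    (hψ : ψ ∈ IsManifold.maximalAtlas (𝓡 n) ∞ M) {u : Vec n} (hu : u ∈ φ.target)
    (hu' : φ.symm u ∈ ψ.source) : ContDiffAt ℝ ∞ (ψ ∘ φ.symm) u :=
  ((chart_contMDiffAt hψ hu').comp u (chart_symm_contMDiffAt hφ hu)).contDiffAt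

theorem fderiv_transition (hφ : φ ∈ IsManifold.maximalAtlas (𝓡 n) ∞ M)
    (hψ : ψ ∈ IsManifold.maximalAtlas (𝓡 n) ∞ M) {u : Vec n} (hu : u ∈ φ.target)
    (hu' : φ.symm u ∈ ψ.source) (i j : Fin n) :
    fderiv ℝ (ψ ∘ φ.symm) u (stdVec j) i =
      covec (coordDifferential ψ i (φ.symm u)) (coordVec φ (φ.symm u) j) := by
  rw [coordDifferential_apply hψ hu', coordVec, φ.right_inv hu, ← tderiv_eq_fderiv,
    tderiv_comp (chart_mdifferentiableAt hψ hu') (chart_symm_mdifferentiableAt hφ hu)]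
  rfl

/-- The linear part `A` of the transition expresses the differentials of `ψ` through those of `φ`
with integer coefficients, and `A⁻¹` does the converse. -/
theorem chartLattice_le_of_isIntegralAffine (hφ : φ ∈ IsManifold.maximalAtlas (𝓡 n) ∞ M)
    (hψ : ψ ∈ IsManifold.maximalAtlas (𝓡 n) ∞ M) (h : IsIntegralAffine (φ.symm.trans ψ)) {x : M}
    (hx : x ∈ φ.source) (hx' : x ∈ ψ.source) : chartLattice φ x = chartLattice ψ x := by
  have hu : φ x ∈ φ.target := φ.map_source hx
  have hu' : φ.symm (φ x) ∈ ψ.source := by rwa [φ.left_inv hx]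
  obtain ⟨A, b, hA⟩ := h (φ x) (by simp [hu, hu'])
  have hc : ∀ i j, covec (coordDifferential ψ i x) (coordVec φ x j) =
      ((A : Matrix (Fin n) (Fin n) ℤ) i j : ℝ) := by
    intro i j
    have h1 := fderiv_transition hφ hψ hu hu' i j
    rw [φ.left_inv hx] at h1
    rw [← h1]
    have h2 : HasFDerivAt (fun v => (ψ ∘ φ.symm) v i)
        ((EuclideanSpace.proj i : Vec n →L[ℝ] ℝ).comp (fderiv ℝ (ψ ∘ φ.symm) (φ x))) (φ x) :=
      (EuclideanSpace.proj i : Vec n →L[ℝ] ℝ).hasFDerivAt.comp (φ x)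
        ((contDiffAt_transition hφ hψ hu hu').differentiableAt (by simp)).hasFDerivAt
    have h3 : HasFDerivAt (fun v : Vec n => b i + ∑ k, ((A : Matrix (Fin n) (Fin n) ℤ) i k : ℝ) * v k)
        (∑ k, ((A : Matrix (Fin n) (Fin n) ℤ) i k : ℝ) • (EuclideanSpace.proj k : Vec n →L[ℝ] ℝ))
        (φ x) := by
      refine HasFDerivAt.const_add _ ?_
      have := (∑ k, ((A : Matrix (Fin n) (Fin n) ℤ) i k : ℝ) •
        (EuclideanSpace.proj k : Vec n →L[ℝ] ℝ)).hasFDerivAt (x := φ x)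
      convert! this using 1
      ext v
      simp
    have h4 : (fun v => (ψ ∘ φ.symm) v i) =ᶠ[𝓝 (φ x)]
        fun v : Vec n => b i + ∑ k, ((A : Matrix (Fin n) (Fin n) ℤ) i k : ℝ) * v k := by
      filter_upwards [hA] with v hv using hv i
    have h5 := DFunLike.congr_fun (h2.unique (h3.congr_of_eventuallyEq h4)) (stdVec j)
    refine Eq.trans ?_ (h5.trans ?_)
    · simp
    · simp
  have hψφ : ∀ i, coordDifferential ψ i x =
      ∑ j, (A : Matrix (Fin n) (Fin n) ℤ) i j • coordDifferential φ j x := by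
    intro i
    have h1 : covec (coordDifferential ψ i x) =
        ∑ j, (A : Matrix (Fin n) (Fin n) ℤ) i j • covec (coordDifferential φ j x) := by
      conv_lhs => rw [covec_eq_sum hφ hx (covec (coordDifferential ψ i x))]
      refine Finset.sum_congr rfl fun j _ => ?_
      rw [hc]
      exact Int.cast_smul_eq_zsmul ℝ _ (covec (coordDifferential φ j x))
    exact h1
  apply le_antisymm
  · rw [chartLattice, AddSubgroup.closure_le]
    rintro _ ⟨k, rfl⟩
    have hinv : coordDifferential φ k x = ∑ i,
        ((A⁻¹ : GL (Fin n) ℤ) : Matrix (Fin n) (Fin n) ℤ) k i • coordDifferential ψ i x := by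
      have hm : ((A⁻¹ : GL (Fin n) ℤ) : Matrix (Fin n) (Fin n) ℤ) *
        (A : Matrix (Fin n) (Fin n) ℤ) = 1 := by
        rw [← Units.val_mul, inv_mul_cancel, Units.val_one]
      simp_rw [hψφ, Finset.smul_sum, smul_smul]
      rw [Finset.sum_comm]
      simp_rw [← Finset.sum_smul, ← Matrix.mul_apply, hm, Matrix.one_apply]
      simp
    change coordDifferential φ k x ∈ chartLattice ψ x
    rw [hinv]
    exact AddSubgroup.sum_mem _ fun i _ => AddSubgroup.zsmul_mem _ (coordDifferential_mem ψ x i) _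
  · rw [chartLattice, AddSubgroup.closure_le]
    rintro _ ⟨i, rfl⟩
    change coordDifferential ψ i x ∈ chartLattice φ x
    rw [hψφ]
    exact AddSubgroup.sum_mem _ fun i _ => AddSubgroup.zsmul_mem _ (coordDifferential_mem φ x i) _

/-- Lattice equality makes the Jacobian integral at every point of the overlap; being continuous it
is locally constant, so the transition is affine on a ball. It is invertible over `ℤ` because the
reverse change of basis is integral as well. -/
theorem isIntegralAffine_of_chartLattice_eq (hφ : φ ∈ IsManifold.maximalAtlas (𝓡 n) ∞ M)
    (hψ : ψ ∈ IsManifold.maximalAtlas (𝓡 n) ∞ M)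
    (h : ∀ x ∈ φ.source, x ∈ ψ.source → chartLattice φ x = chartLattice ψ x) :
    IsIntegralAffine (φ.symm.trans ψ) := by
  intro u hu
  have hO : IsOpen (φ.symm.trans ψ).source := (φ.symm.trans ψ).open_source
  have hmem : ∀ v ∈ (φ.symm.trans ψ).source, v ∈ φ.target ∧ φ.symm v ∈ ψ.source := by
    intro v hv
    simpa using hv
  have hint : ∀ v ∈ (φ.symm.trans ψ).source, ∀ i j, ∃ m : ℤ,
      fderiv ℝ (ψ ∘ φ.symm) v (stdVec j) i = m := by
    intro v hv i j
    obtain ⟨h1, h2⟩ := hmem v hv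
    rw [fderiv_transition hφ hψ h1 h2]
    have h3 : coordDifferential ψ i (φ.symm v) ∈ chartLattice φ (φ.symm v) := by
      rw [h _ (φ.map_target h1) h2]
      exact coordDifferential_mem _ _ _
    exact (mem_chartLattice hφ (φ.map_target h1) _).1 h3 j
  have hcont : ContinuousAt (fderiv ℝ (ψ ∘ φ.symm)) u :=
    ((contDiffAt_transition hφ hψ (hmem u hu).1 (hmem u hu).2).fderiv_right (m := ∞)
      (by simp)).continuousAt
  have hconst : ∀ᶠ v in 𝓝 u, fderiv ℝ (ψ ∘ φ.symm) v = fderiv ℝ (ψ ∘ φ.symm) u := by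
    have h1 : ∀ i j, ∀ᶠ v in 𝓝 u, fderiv ℝ (ψ ∘ φ.symm) v (stdVec j) i =
        fderiv ℝ (ψ ∘ φ.symm) u (stdVec j) i := by
      intro i j
      refine eventually_eq_of_integer_valued
        (f := fun v => fderiv ℝ (ψ ∘ φ.symm) v (stdVec j) i) ?_ ?_
      · exact (EuclideanSpace.proj i : Vec n →L[ℝ] ℝ).continuous.continuousAt.comp
          (hcont.clm_apply continuousAt_const)
      · filter_upwards [hO.mem_nhds hu] with v hv using hint v hv i j
    filter_upwards [eventually_all.2 fun i => eventually_all.2 (h1 i)] with v hv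
    exact vecMap_ext fun j i => hv i j
  choose A hA using fun i j => hint u hu i j
  have hx := φ.map_target (hmem u hu).1
  have hx' := (hmem u hu).2
  have hcA : ∀ i, covec (coordDifferential ψ i (φ.symm u)) =
      ∑ j, (A i j : ℝ) • covec (coordDifferential φ j (φ.symm u)) := by
    intro i
    conv_lhs => rw [covec_eq_sum hφ hx (covec (coordDifferential ψ i (φ.symm u)))]
    refine Finset.sum_congr rfl fun j _ => ?_
    rw [← fderiv_transition hφ hψ (hmem u hu).1 hx', hA]
  have hB' : ∀ j, coordDifferential φ j (φ.symm u) ∈ chartLattice ψ (φ.symm u) := by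
    intro j
    rw [← h _ hx hx']
    exact coordDifferential_mem _ _ _
  choose B hB using fun j => (mem_chartLattice hψ hx' _).1 (hB' j)
  have hcB : ∀ i, covec (coordDifferential φ i (φ.symm u)) =
      ∑ j, (B i j : ℝ) • covec (coordDifferential ψ j (φ.symm u)) := by
    intro i
    conv_lhs => rw [covec_eq_sum hψ hx' (covec (coordDifferential φ i (φ.symm u)))]
    refine Finset.sum_congr rfl fun j _ => ?_
    rw [hB]
  have hAB : (Matrix.of A) * (Matrix.of B) = 1 := by
    ext i l
    have h1 := coordDifferential_coordVec hψ hx' i l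
    rw [hcA] at h1
    simp only [sum_apply, smul_apply, hB,
      smul_eq_mul] at h1
    rw [Matrix.mul_apply, Matrix.one_apply]
    have h2 : ((∑ j, A i j * B j l : ℤ) : ℝ) = ((if i = l then 1 else 0 : ℤ) : ℝ) := by
      push_cast
      exact h1
    exact_mod_cast h2
  -- The translation part is the value at `u` minus the linear part at `u`; below, the map minus its
  -- linear part has zero derivative on a ball and so stays equal to it.
  refine ⟨⟨Matrix.of A, Matrix.of B, hAB, mul_eq_one_comm.1 hAB⟩,
    ψ (φ.symm u) - fderiv ℝ (ψ ∘ φ.symm) u u, ?_⟩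
  obtain ⟨r, hr, hball⟩ := Metric.mem_nhds_iff.1 (inter_mem hconst (hO.mem_nhds hu))
  filter_upwards [Metric.ball_mem_nhds u hr] with v hv i
  have hd : ∀ w ∈ Metric.ball u r, HasFDerivWithinAt
      (fun w => (ψ ∘ φ.symm) w - fderiv ℝ (ψ ∘ φ.symm) u w) (0 : Vec n →L[ℝ] Vec n)
      (Metric.ball u r) w := by
    intro w hw
    obtain ⟨h1, h2⟩ := hball hw
    have h3 := ((contDiffAt_transition hφ hψ (hmem w h2).1 (hmem w h2).2).differentiableAt
      (by simp)).hasFDerivAt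
    have h1' : fderiv ℝ (ψ ∘ φ.symm) w = fderiv ℝ (ψ ∘ φ.symm) u := h1
    rw [h1'] at h3
    have h4 := h3.sub ((fderiv ℝ (ψ ∘ φ.symm) u).hasFDerivAt (x := w))
    rw [sub_self] at h4
    exact h4.hasFDerivWithinAt
  have hc : (ψ ∘ φ.symm) v - fderiv ℝ (ψ ∘ φ.symm) u v =
      (ψ ∘ φ.symm) u - fderiv ℝ (ψ ∘ φ.symm) u u :=
    (convex_ball u r).is_const_of_fderivWithin_eq_zero (𝕜 := ℝ)
      (fun w hw => (hd w hw).differentiableWithinAt) (fun w hw =>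
        (hd w hw).fderivWithin (Metric.isOpen_ball.uniqueDiffWithinAt hw)) hv
      (Metric.mem_ball_self hr)
  have hv' : (ψ ∘ φ.symm) v = (ψ ∘ φ.symm) u - fderiv ℝ (ψ ∘ φ.symm) u u +
    fderiv ℝ (ψ ∘ φ.symm) u v := by rw [← hc]; abel
  have h5 : (fderiv ℝ (ψ ∘ φ.symm) u v) i = ∑ j, (A i j : ℝ) * v j := by
    conv_lhs => rw [sum_stdVec v, map_sum]
    simp only [map_smul, WithLp.ofLp_sum, Finset.sum_apply, PiLp.smul_apply, smul_eq_mul, hA]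
    exact Finset.sum_congr rfl fun j _ => mul_comm _ _
  change (ψ ∘ φ.symm) v i = _
  rw [hv', PiLp.add_apply, h5]
  rfl

end Transition

end

end PoissonGeom

/-! ### Sections of `T*M`; the bijection between integral affine structures and Lagrangian lattices
-/

namespace PoissonGeom

noncomputable section

open Set Filter

section Sections

variable {n : ℕ} {M : Type u} [TopologicalSpace M] [ChartedSpace (EuclideanSpace ℝ (Fin n)) M]
  [IsManifold (𝓡 n) ∞ M] {φ : OpenPartialHomeomorph M (Vec n)}

/-- The `1`-form `α` in the coordinates of the chart `φ`. -/
def secCoord (φ : OpenPartialHomeomorph M (Vec n)) (α : ∀ x : M, CotangentSpace n M x)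
    (q : Vec n) : Covec n := (cotCoord φ ⟨φ.symm q, α (φ.symm q)⟩).2

theorem secCoord_stdVec (α : ∀ x : M, CotangentSpace n M x) (q : Vec n) (i : Fin n) :
    secCoord φ α q (stdVec i) = covec (α (φ.symm q)) (coordVec φ (φ.symm q) i) := rfl

theorem secCoord_apply (α : ∀ x : M, CotangentSpace n M x) {y : M} (hy : y ∈ φ.source) :
    secCoord φ α (φ y) = (covec (α y)).comp (tderiv (𝓡 n) (𝓡 n) φ.symm (φ y)) := by
  have h : cotCoord φ ⟨φ.symm (φ y), α (φ.symm (φ y))⟩ = cotCoord φ ⟨y, α y⟩ := by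
    rw [φ.left_inv hy]
  exact congrArg Prod.snd h

theorem secCoord_tderiv (hφ : φ ∈ IsManifold.maximalAtlas (𝓡 n) ∞ M)
    (α : ∀ x : M, CotangentSpace n M x) {y : M} (hy : y ∈ φ.source) (v : Vec n) :
    secCoord φ α (φ y) (tderiv (𝓡 n) (𝓡 n) φ y v) = covec (α y) v := by
  rw [secCoord_apply α hy, ContinuousLinearMap.comp_apply, tderiv_symm_tderiv_chart hφ hy]

theorem secCoord_contDiffAt (hφ : φ ∈ IsManifold.maximalAtlas (𝓡 n) ∞ M)
    {α : ∀ x : M, CotangentSpace n M x} {U : Set M} (hU : IsOpen U)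
    (hα : IsSmoothSectionOn n M α U) {q : Vec n} (hq : q ∈ φ.target) (hq' : φ.symm q ∈ U) :
    ContDiffAt ℝ ∞ (secCoord φ α) q := by
  have h1 : ContMDiffAt (𝓡 n) (cotangentModel n) ∞
      (fun x => (⟨x, α x⟩ : CotangentBundle n M)) (φ.symm q) := hα.contMDiffAt (hU.mem_nhds hq')
  have h2 : ContMDiffAt (𝓡 n) 𝓘(ℝ, Vec n × Covec n) ∞
      (fun x => cotCoord φ (⟨x, α x⟩ : CotangentBundle n M)) (φ.symm q) :=
    (contMDiffAt_cotCoord hφ (ξ := ⟨φ.symm q, α (φ.symm q)⟩) (φ.map_target hq)).comp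
      (φ.symm q) h1
  exact (h2.comp q (chart_symm_contMDiffAt hφ hq)).contDiffAt.snd

/-- A section is `q ↦ (q, α(q))` in coordinates, so `ω_can` pulls back to `-dα`: it vanishes exactly
where the derivative of the coefficients is symmetric, which is the hypothesis of the Poincaré
lemma. -/
theorem canonicalForm_section (hφ : φ ∈ IsManifold.maximalAtlas (𝓡 n) ∞ M)
    {α : ∀ x : M, CotangentSpace n M x} {U : Set M} (hU : IsOpen U)
    (hα : IsSmoothSectionOn n M α U) {y : M} (hy : y ∈ U) (hy' : y ∈ φ.source) (v w : Vec n) :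
    (canonicalForm n M).pair ⟨y, α y⟩
      (tderiv (𝓡 n) (cotangentModel n) (fun x => (⟨x, α x⟩ : CotangentBundle n M)) y v)
      (tderiv (𝓡 n) (cotangentModel n) (fun x => (⟨x, α x⟩ : CotangentBundle n M)) y w) =
    fderiv ℝ (secCoord φ α) (φ y) (tderiv (𝓡 n) (𝓡 n) φ y w) (tderiv (𝓡 n) (𝓡 n) φ y v) -
    fderiv ℝ (secCoord φ α) (φ y) (tderiv (𝓡 n) (𝓡 n) φ y v) (tderiv (𝓡 n) (𝓡 n) φ y w) := by
  have hs : MDifferentiableAt (𝓡 n) (cotangentModel n)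
      (fun x => (⟨x, α x⟩ : CotangentBundle n M)) y :=
    (hα.contMDiffAt (hU.mem_nhds hy)).mdifferentiableAt (by simp)
  have hd : DifferentiableAt ℝ (secCoord φ α) (φ y) :=
    (secCoord_contDiffAt hφ hU hα (φ.map_source hy')
      (by rwa [φ.left_inv hy'])).differentiableAt (by simp)
  have hd2 := (hasFDerivAt_id (𝕜 := ℝ) (φ y)).prodMk hd.hasFDerivAt
  have key : ∀ u : Vec n, tderiv (cotangentModel n) 𝓘(ℝ, Vec n × Covec n) (cotCoord φ) ⟨y, α y⟩
      (tderiv (𝓡 n) (cotangentModel n) (fun x => (⟨x, α x⟩ : CotangentBundle n M)) y u) =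
      (tderiv (𝓡 n) (𝓡 n) φ y u, fderiv ℝ (secCoord φ α) (φ y) (tderiv (𝓡 n) (𝓡 n) φ y u)) := by
    intro u
    rw [← tderiv_comp_apply_of_eq (mdifferentiableAt_cotCoord hφ hy') hs rfl]
    have e : (fun x => cotCoord φ (⟨x, α x⟩ : CotangentBundle n M)) =ᶠ[𝓝 y]
        fun x => (fun q => (id q, secCoord φ α q)) (φ x) := by
      filter_upwards [φ.open_source.mem_nhds hy'] with x hx
      refine Prod.ext rfl ?_
      exact (secCoord_apply α hx).symm
    rw [tderiv_congr e, tderiv_comp_apply hd2.differentiableAt.mdifferentiableAt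
      (chart_mdifferentiableAt hφ hy'), tderiv_eq_fderiv, hd2.fderiv]
    rfl
  rw [canonicalForm_pair hφ hy', key, key]

/-- The `1`-form with constant coefficients `p` in the chart `φ`. -/
def constSection (φ : OpenPartialHomeomorph M (Vec n)) (p : Covec n) (y : M) :
    CotangentSpace n M y := p.comp (tderiv (𝓡 n) (𝓡 n) φ y)

theorem constSection_smooth (hφ : φ ∈ IsManifold.maximalAtlas (𝓡 n) ∞ M) (p : Covec n) :
    IsSmoothSectionOn n M (constSection φ p) φ.source := by
  intro y hy
  have h1 : ContMDiffAt (𝓡 n) 𝓘(ℝ, Vec n × Covec n) ∞ (fun x => (φ x, p)) y :=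
    (chart_contMDiffAt hφ hy).prodMk_space contMDiffAt_const
  have h2 : ContMDiffAt (𝓡 n) (cotangentModel n) ∞ (fun x => cotParam φ (φ x, p)) y :=
    (contMDiffAt_cotParam hφ (z := (φ y, p)) (φ.map_source hy)).comp y h1
  refine (h2.congr_of_eventuallyEq ?_).contMDiffWithinAt
  filter_upwards [φ.open_source.mem_nhds hy] with x hx
  refine cotangent_ext (φ.left_inv hx).symm fun v => ?_
  change p (tderiv (𝓡 n) (𝓡 n) φ x v) = p (tderiv (𝓡 n) (𝓡 n) φ (φ.symm (φ x)) v)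
  rw [φ.left_inv hx]

theorem coordDifferential_eq_constSection (hφ : φ ∈ IsManifold.maximalAtlas (𝓡 n) ∞ M) {y : M}
    (hy : y ∈ φ.source) (i : Fin n) :
    coordDifferential φ i y = constSection φ (EuclideanSpace.proj i : Vec n →L[ℝ] ℝ) y := by
  apply covec_injective
  ext v
  exact coordDifferential_apply hφ hy i v

theorem coordDifferential_smooth (hφ : φ ∈ IsManifold.maximalAtlas (𝓡 n) ∞ M) (i : Fin n) :
    IsSmoothSectionOn n M (coordDifferential φ i) φ.source := by
  refine (constSection_smooth hφ (EuclideanSpace.proj i : Vec n →L[ℝ] ℝ)).congr fun y hy => ?_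
  rw [coordDifferential_eq_constSection hφ hy]

/-- The coefficients of `α` in the chart are continuous and integral, hence locally constant, so
their derivative is zero. -/
theorem canonicalForm_section_of_mem_chartLattice (hφ : φ ∈ IsManifold.maximalAtlas (𝓡 n) ∞ M)
    {α : ∀ x : M, CotangentSpace n M x} {U : Set M} (hU : IsOpen U)
    (hα : IsSmoothSectionOn n M α U) {y : M} (hy : y ∈ U) (hy' : y ∈ φ.source)
    (h : ∀ x ∈ U, x ∈ φ.source → α x ∈ chartLattice φ x) (v w : Vec n) :
    (canonicalForm n M).pair ⟨y, α y⟩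
      (tderiv (𝓡 n) (cotangentModel n) (fun x => (⟨x, α x⟩ : CotangentBundle n M)) y v)
      (tderiv (𝓡 n) (cotangentModel n) (fun x => (⟨x, α x⟩ : CotangentBundle n M)) y w) = 0 := by
  have hq : φ y ∈ φ.target ∩ φ.symm ⁻¹' U :=
    ⟨φ.map_source hy', by rwa [mem_preimage, φ.left_inv hy']⟩
  have hO : φ.target ∩ φ.symm ⁻¹' U ∈ 𝓝 (φ y) :=
    (φ.symm.isOpen_inter_preimage hU).mem_nhds hq
  have hc : secCoord φ α =ᶠ[𝓝 (φ y)] fun _ => secCoord φ α (φ y) := by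
    have h1 : ∀ i, ∀ᶠ q in 𝓝 (φ y), secCoord φ α q (stdVec i) =
        secCoord φ α (φ y) (stdVec i) := by
      intro i
      refine eventually_eq_of_integer_valued (f := fun q => secCoord φ α q (stdVec i)) ?_ ?_
      · exact (secCoord_contDiffAt hφ hU hα hq.1 hq.2).continuousAt.clm_apply continuousAt_const
      · filter_upwards [hO] with q hq
        rw [secCoord_stdVec]
        exact (mem_chartLattice hφ (φ.map_target hq.1) _).1 (h _ hq.2 (φ.map_target hq.1)) i
    filter_upwards [eventually_all.2 h1] with q hq using covec_ext hq
  rw [canonicalForm_section hφ hU hα hy hy', hc.fderiv_eq]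
  simp

end Sections

section Affine

variable {n : ℕ} {M : Type u} [TopologicalSpace M] [ChartedSpace (EuclideanSpace ℝ (Fin n)) M]
  [IsManifold (𝓡 n) ∞ M] {φ : OpenPartialHomeomorph M (Vec n)}

/-- The lattice of an integral affine structure, generated by the coordinate differentials. -/
def IntegralAffineStructure.fiber (𝒜 : IntegralAffineStructure n M) (x : M) :
    AddSubgroup (CotangentSpace n M x) := chartLattice (𝒜.cover x).choose x

/-- Frees the fibre from the chart chosen in its definition. -/
theorem IntegralAffineStructure.fiber_eq (𝒜 : IntegralAffineStructure n M) (hφ : φ ∈ 𝒜.charts)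
    {x : M} (hx : x ∈ φ.source) : 𝒜.fiber x = chartLattice φ x :=
  have h := (𝒜.cover x).choose_spec
  chartLattice_le_of_isIntegralAffine (𝒜.smooth _ h.1) (𝒜.smooth _ hφ)
    (𝒜.compatible _ h.1 _ hφ) h.2 hx

/-- The Lagrangian lattice of an integral affine structure. -/
def IntegralAffineStructure.lattice (𝒜 : IntegralAffineStructure n M) : LagrangianLattice n M where
  fiber := 𝒜.fiber
  discrete x := chartLattice_discrete (𝒜.smooth _ (𝒜.cover x).choose_spec.1)
    (𝒜.cover x).choose_spec.2
  full_rank x := chartLattice_span (𝒜.smooth _ (𝒜.cover x).choose_spec.1)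
    (𝒜.cover x).choose_spec.2
  smooth x := by
    obtain ⟨φ, hφ, hx⟩ := 𝒜.cover x
    exact ⟨φ.source, fun i => coordDifferential φ i, φ.open_source, hx,
      fun i => coordDifferential_smooth (𝒜.smooth _ hφ) i, fun y hy => 𝒜.fiber_eq hφ hy⟩
  lagrangian U α hU hα hmem y hy v w := by
    obtain ⟨φ, hφ, hx⟩ := 𝒜.cover y
    exact canonicalForm_section_of_mem_chartLattice (𝒜.smooth _ hφ) hU hα hy hx
      (fun x hx hx' => by rw [← 𝒜.fiber_eq hφ hx']; exact hmem x hx) v w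

/-- A smooth chart is adapted to a lattice if its coordinate differentials generate it. -/
def IsLatticeChart (Λ : CotangentLattice n M) (φ : OpenPartialHomeomorph M (Vec n)) : Prop :=
  φ ∈ IsManifold.maximalAtlas (𝓡 n) ∞ M ∧ ∀ x ∈ φ.source, Λ.fiber x = chartLattice φ x

/-- The Lagrangian condition says that the local generators are closed, so on a ball they have
primitives `f i`. Their differentials are linearly independent at `x` by full rank, and the inverse
function theorem makes the `f i` coordinates whose differentials are the given generators. -/
theorem exists_isLatticeChart (Λ : LagrangianLattice n M) (x : M) :
    ∃ φ, IsLatticeChart Λ.toCotangentLattice φ ∧ x ∈ φ.source := by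
  obtain ⟨U, α, hU, hxU, hα, hgen⟩ := Λ.smooth x
  have hχ := IsManifold.chart_mem_maximalAtlas (I := 𝓡 n) (n := ∞) x
  have hxs : x ∈ (chartAt (Vec n) x).source := mem_chart_source _ _
  set χ := chartAt (Vec n) x with hχdef
  have hV : IsOpen (χ.target ∩ χ.symm ⁻¹' U) := χ.symm.isOpen_inter_preimage hU
  have hxV : χ x ∈ χ.target ∩ χ.symm ⁻¹' U :=
    ⟨χ.map_source hxs, by rwa [mem_preimage, χ.left_inv hxs]⟩
  obtain ⟨r, hr, hball⟩ := Metric.isOpen_iff.1 hV _ hxV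
  have hsm : ∀ i, ∀ q ∈ χ.target ∩ χ.symm ⁻¹' U, ContDiffAt ℝ ∞ (secCoord χ (α i)) q :=
    fun i q hq => secCoord_contDiffAt hχ hU (hα i) hq.1 hq.2
  have hsymm : ∀ i, ∀ q ∈ χ.target ∩ χ.symm ⁻¹' U, ∀ v w,
      fderiv ℝ (secCoord χ (α i)) q v w = fderiv ℝ (secCoord χ (α i)) q w v := by
    intro i q hq v w
    have h1 := Λ.lagrangian U (α i) hU (hα i)
      (fun y hy => by rw [hgen y hy]; exact AddSubgroup.subset_closure ⟨i, rfl⟩) (χ.symm q) hq.2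
      (tderiv (𝓡 n) (𝓡 n) χ.symm q w) (tderiv (𝓡 n) (𝓡 n) χ.symm q v)
    have h2 := (canonicalForm_section hχ hU (hα i) hq.2 (χ.map_target hq.1)
      (tderiv (𝓡 n) (𝓡 n) χ.symm q w) (tderiv (𝓡 n) (𝓡 n) χ.symm q v)).symm.trans h1
    rw [tderiv_chart_tderiv_symm hχ hq.1, tderiv_chart_tderiv_symm hχ hq.1, χ.right_inv hq.1] at h2
    linarith
  have hprim : ∀ i, ∃ f : Vec n → ℝ, ∀ q ∈ Metric.ball (χ x) r,
      HasFDerivAt f (secCoord χ (α i) q) q := fun i =>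
    (convex_ball (χ x) r).exists_forall_hasFDerivAt_of_fderiv_symmetric Metric.isOpen_ball
      (fun q hq => ((hsm i q (hball hq)).differentiableAt (by simp)).differentiableWithinAt)
      (fun q hq v w => hsymm i q (hball hq) v w)
  choose f hf using hprim
  have hfsm : ∀ i, ContDiffOn ℝ ∞ (f i) (Metric.ball (χ x) r) := by
    intro i
    rw [contDiffOn_infty_iff_fderiv_of_isOpen Metric.isOpen_ball]
    refine ⟨fun q hq => (hf i q hq).differentiableAt.differentiableWithinAt, fun q hq => ?_⟩
    refine ((hsm i q (hball hq)).contDiffWithinAt (s := Metric.ball (χ x) r)).congr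
      (fun y hy => (hf i y hy).fderiv) (hf i q hq).fderiv
  let F : Vec n → Vec n := fun q => WithLp.toLp 2 fun i => f i q
  have hFsm : ContDiffOn ℝ ∞ F (Metric.ball (χ x) r) :=
    contDiffOn_euclidean.2 fun i => hfsm i
  have hFd : ∀ q ∈ Metric.ball (χ x) r, ∀ v i, fderiv ℝ F q v i = secCoord χ (α i) q v := by
    intro q hq v i
    have h1 : HasFDerivAt F (fderiv ℝ F q) q :=
      ((hFsm.contDiffAt (Metric.isOpen_ball.mem_nhds hq)).differentiableAt (by simp)).hasFDerivAt
    have h2 := ((EuclideanSpace.proj i : Vec n →L[ℝ] ℝ).hasFDerivAt.comp q h1).unique (hf i q hq)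
    exact DFunLike.congr_fun h2 v
  have hx0 : χ x ∈ Metric.ball (χ x) r := Metric.mem_ball_self hr
  have hinj : Function.Injective (fderiv ℝ F (χ x)) := by
    rw [injective_iff_map_eq_zero]
    intro v hv
    have h1 : ∀ i, covec (α i x) (tderiv (𝓡 n) (𝓡 n) χ.symm (χ x) v) = 0 := by
      intro i
      have h2 := hFd _ hx0 v i
      rw [hv, secCoord_apply _ hxs] at h2
      exact h2.symm
    -- A vector killed by the generators is killed by the lattice, then by its real span, which is
    -- the whole cotangent space.
    have h2 : ∀ a : CotangentSpace n M x, a ∈ Submodule.span ℝ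
        (Λ.fiber x : Set (CotangentSpace n M x)) →
        covec a (tderiv (𝓡 n) (𝓡 n) χ.symm (χ x) v) = 0 := by
      intro a ha
      induction ha using Submodule.span_induction with
      | mem b hb =>
        rw [SetLike.mem_coe, hgen x hxU] at hb
        induction hb using AddSubgroup.closure_induction with
        | mem c hc => obtain ⟨i, rfl⟩ := hc; exact h1 i
        | zero => rfl
        | add c d _ _ hc hd =>
          rw [covec_add]
          change covec c _ + covec d _ = 0
          rw [hc, hd, add_zero]
        | neg c _ hc =>
          change -(covec c _) = 0
          rw [hc, neg_zero]
      | zero => rfl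
      | add c d _ _ hc hd =>
        rw [covec_add]
        change covec c _ + covec d _ = 0
        rw [hc, hd, add_zero]
      | smul t c _ hc =>
        change t * (covec c _) = 0
        rw [hc, mul_zero]
    have h3 : ∀ a : Covec n, a (tderiv (𝓡 n) (𝓡 n) χ.symm (χ x) v) = 0 := fun a =>
      h2 a (by rw [Λ.full_rank x]; trivial)
    have h4 : tderiv (𝓡 n) (𝓡 n) χ.symm (χ x) v = 0 := by
      ext i
      exact h3 (EuclideanSpace.proj i : Vec n →L[ℝ] ℝ)
    have h5 := tderiv_chart_tderiv_symm hχ (χ.map_source hxs) v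
    rw [h4, map_zero] at h5
    exact h5.symm
  let e : Vec n ≃L[ℝ] Vec n :=
    (LinearEquiv.ofInjectiveEndo (fderiv ℝ F (χ x)).toLinearMap hinj).toContinuousLinearEquiv
  have he : HasFDerivAt F (e : Vec n →L[ℝ] Vec n) (χ x) := by
    have h1 : (e : Vec n →L[ℝ] Vec n) = fderiv ℝ F (χ x) := by ext v; rfl
    rw [h1]
    exact ((hFsm.contDiffAt (Metric.isOpen_ball.mem_nhds hx0)).differentiableAt
      (by simp)).hasFDerivAt
  obtain ⟨g, hg1, hg2, hg3, hg4⟩ := exists_smooth_local_inverse Metric.isOpen_ball hx0 hFsm e he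
  have hgsm : ContDiffOn ℝ ∞ g g.source :=
    (hFsm.mono hg2).congr fun y _ => hg3 y
  have hsrc : ∀ y ∈ (χ.trans g).source, y ∈ χ.source ∧ χ y ∈ g.source := fun y hy => by
    simpa using hy
  have htgt : ∀ q ∈ (χ.trans g).target, q ∈ g.target ∧ g.symm q ∈ χ.target := fun y hy => by
    simpa using hy
  have hψ : χ.trans g ∈ IsManifold.maximalAtlas (𝓡 n) ∞ M := by
    apply OpenPartialHomeomorph.mem_maximalAtlas_of_contMDiffOn
    · intro y hy
      refine ContMDiffAt.contMDiffWithinAt ?_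
      obtain ⟨h1, h2⟩ := hsrc y hy
      exact (hgsm.contDiffAt (g.open_source.mem_nhds h2)).contMDiffAt.comp y
        (chart_contMDiffAt hχ h1)
    · intro q hq
      refine ContMDiffAt.contMDiffWithinAt ?_
      obtain ⟨h1, h2⟩ := htgt q hq
      exact (chart_symm_contMDiffAt hχ h2).comp q
        (hg4.contDiffAt (g.open_target.mem_nhds h1)).contMDiffAt
  refine ⟨χ.trans g, ⟨hψ, fun y hy => ?_⟩, by simp [hxs, hg1]⟩
  obtain ⟨h1, h2⟩ := hsrc y hy
  have h3 := hball (hg2 h2)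
  have hyU : y ∈ U := by
    have := h3.2
    rwa [mem_preimage, χ.left_inv h1] at this
  rw [hgen y hyU, chartLattice]
  congr 2
  ext1 i
  apply covec_injective
  ext v
  rw [coordDifferential_apply hψ hy]
  have e1 : (χ.trans g : M → Vec n) = fun z => F (χ z) := funext fun z => hg3 _
  have e2 : DifferentiableAt ℝ F (χ y) :=
    (hFsm.contDiffAt (Metric.isOpen_ball.mem_nhds (hg2 h2))).differentiableAt (by simp)
  rw [e1, tderiv_comp_apply e2.mdifferentiableAt (chart_mdifferentiableAt hχ h1),
    tderiv_eq_fderiv, hFd _ (hg2 h2), secCoord_tderiv hχ _ h1]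

/-- The integral affine structure of a Lagrangian lattice. -/
def LagrangianLattice.affine (Λ : LagrangianLattice n M) : IntegralAffineStructure n M where
  charts := {φ | IsLatticeChart Λ.toCotangentLattice φ}
  smooth _ h := h.1
  cover x := exists_isLatticeChart Λ x
  compatible φ hφ ψ hψ := isIntegralAffine_of_chartLattice_eq hφ.1 hψ.1 fun x hx hx' => by
    rw [← hφ.2 x hx, hψ.2 x hx']
  maximal φ hφ h := ⟨hφ, fun x hx => by
    obtain ⟨ψ, hψ, hx'⟩ := exists_isLatticeChart Λ x
    rw [hψ.2 x hx']
    exact chartLattice_le_of_isIntegralAffine hψ.1 hφ (h ψ hψ).2 hx' hx⟩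

/-- The nontrivial direction is maximality: a chart adapted to the lattice has integral affine
transitions with every chart of `𝒜`. -/
theorem IntegralAffineStructure.mem_charts_iff (𝒜 : IntegralAffineStructure n M)
    (hφ : φ ∈ IsManifold.maximalAtlas (𝓡 n) ∞ M) :
    φ ∈ 𝒜.charts ↔ ∀ x ∈ φ.source, 𝒜.lattice.fiber x = chartLattice φ x := by
  refine ⟨fun h x hx => 𝒜.fiber_eq h hx, fun h => 𝒜.maximal φ hφ fun ψ hψ => ?_⟩
  have h' : ∀ x ∈ φ.source, x ∈ ψ.source → chartLattice φ x = chartLattice ψ x :=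
    fun x hx hx' => (h x hx).symm.trans (𝒜.fiber_eq hψ hx')
  exact ⟨isIntegralAffine_of_chartLattice_eq hφ (𝒜.smooth _ hψ) h',
    isIntegralAffine_of_chartLattice_eq (𝒜.smooth _ hψ) hφ fun x hx hx' => (h' x hx' hx).symm⟩

theorem IntegralAffineStructure.ext_charts {𝒜 ℬ : IntegralAffineStructure n M}
    (h : 𝒜.charts = ℬ.charts) : 𝒜 = ℬ := by
  cases 𝒜; cases ℬ; congr

theorem LagrangianLattice.ext_fiber {Λ Λ' : LagrangianLattice n M}
    (h : ∀ x, Λ.fiber x = Λ'.fiber x) : Λ = Λ' := by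
  obtain ⟨⟨f, _, _, _⟩, _⟩ := Λ
  obtain ⟨⟨f', _, _, _⟩, _⟩ := Λ'
  obtain rfl : f = f' := funext h
  rfl

variable (n M) in
/-- Integral affine structures are the same as Lagrangian lattices. -/
def affineEquivLattice : IntegralAffineStructure n M ≃ LagrangianLattice n M where
  toFun := IntegralAffineStructure.lattice
  invFun := LagrangianLattice.affine
  left_inv 𝒜 := IntegralAffineStructure.ext_charts <| Set.ext fun φ =>
    ⟨fun h => (𝒜.mem_charts_iff h.1).2 h.2, fun h =>
      ⟨𝒜.smooth φ h, (𝒜.mem_charts_iff (𝒜.smooth φ h)).1 h⟩⟩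
  right_inv Λ := LagrangianLattice.ext_fiber fun x => by
    obtain ⟨φ, hφ, hx⟩ := exists_isLatticeChart Λ x
    exact (Λ.affine.fiber_eq hφ hx).trans (hφ.2 x hx).symm

end Affine

end

end PoissonGeom

/-! ### The topological quotient `T*M/Λ` and its local parametrizations -/

namespace PoissonGeom

noncomputable section

open Set Filter

section Quotient

variable {n : ℕ} {M : Type u} [TopologicalSpace M] [ChartedSpace (EuclideanSpace ℝ (Fin n)) M]
  [IsManifold (𝓡 n) ∞ M] {φ : OpenPartialHomeomorph M (Vec n)}

/-- Two cotangent vectors are related if they differ by an element of the lattice. -/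
def CotangentLattice.Rel (Λ : CotangentLattice n M) (ξ η : CotangentBundle n M) : Prop :=
  ∃ (x : M) (a b : CotangentSpace n M x), ξ = ⟨x, a⟩ ∧ η = ⟨x, b⟩ ∧ a - b ∈ Λ.fiber x

theorem CotangentLattice.rel_mk (Λ : CotangentLattice n M) {x : M} {a b : CotangentSpace n M x} :
    Λ.Rel ⟨x, a⟩ ⟨x, b⟩ ↔ a - b ∈ Λ.fiber x := by
  constructor
  · rintro ⟨y, a', b', h1, h2, h3⟩
    cases h1
    cases h2
    exact h3
  · intro h
    exact ⟨x, a, b, rfl, rfl, h⟩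

/-- The equivalence relation of fibrewise translation by a lattice. -/
def CotangentLattice.setoid (Λ : CotangentLattice n M) : Setoid (CotangentBundle n M) where
  r := Λ.Rel
  iseqv :=
    { refl := fun ξ => ⟨ξ.1, ξ.2, ξ.2, rfl, rfl, by rw [sub_self]; exact zero_mem _⟩
      symm := by
        rintro _ _ ⟨x, a, b, rfl, rfl, h⟩
        exact ⟨x, b, a, rfl, rfl, by rw [← neg_sub]; exact neg_mem h⟩
      trans := by
        rintro _ _ _ ⟨x, a, b, rfl, rfl, h⟩ ⟨y, b', c, h1, rfl, h'⟩
        cases h1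
        exact ⟨x, a, c, rfl, rfl, by rw [← sub_add_sub_cancel a b c]; exact add_mem h h'⟩ }

/-- The quotient of the cotangent bundle by a lattice. -/
def CotQuot (Λ : CotangentLattice n M) : Type u := Quotient Λ.setoid

instance (Λ : CotangentLattice n M) : TopologicalSpace (CotQuot Λ) :=
  inferInstanceAs (TopologicalSpace (Quotient Λ.setoid))

namespace CotQuot

variable {Λ : CotangentLattice n M}

/-- The quotient map. -/
def mk (Λ : CotangentLattice n M) (ξ : CotangentBundle n M) : CotQuot Λ := Quotient.mk Λ.setoid ξ

theorem mk_surjective : Function.Surjective (mk Λ) := Quotient.mk_surjective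

theorem mk_eq {ξ η : CotangentBundle n M} : mk Λ ξ = mk Λ η ↔ Λ.Rel ξ η :=
  Quotient.eq (r := Λ.setoid)

theorem continuous_mk : Continuous (mk Λ) := continuous_quotient_mk'

/-- The base point of a class of cotangent vectors. -/
def proj (b : CotQuot Λ) : M :=
  Quotient.lift (s := Λ.setoid) (fun ξ : CotangentBundle n M => ξ.1)
    (by rintro _ _ ⟨x, a, b, rfl, rfl, -⟩; rfl) b

theorem continuous_proj : Continuous (proj : CotQuot Λ → M) :=
  Continuous.quotient_lift (s := Λ.setoid) contMDiff_cotProj.continuous _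

/-- A covector with integral coordinates. -/
def IsIntegral (p : Covec n) : Prop := ∀ i, ∃ m : ℤ, p (stdVec i) = m

theorem rel_cotParam (hφ : IsLatticeChart Λ φ) {z w : Vec n × Covec n} (hz : z.1 ∈ φ.target)
    (hw : w.1 ∈ φ.target) :
    Λ.Rel (cotParam φ z) (cotParam φ w) ↔ z.1 = w.1 ∧ IsIntegral (z.2 - w.2) := by
  have key : ∀ (u : Vec n) (p p' : Covec n), u ∈ φ.target →
      (Λ.Rel (cotParam φ (u, p)) (cotParam φ (u, p')) ↔ IsIntegral (p - p')) := by
    intro u p p' hu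
    have h1 := cotParam_mem_chartLattice hφ.1 (z := (u, p - p')) hu
    rw [← hφ.2 _ (φ.map_target hu)] at h1
    exact Λ.rel_mk.trans h1
  obtain ⟨u, p⟩ := z
  obtain ⟨u', p'⟩ := w
  constructor
  · intro h
    have h1 : φ.symm u = φ.symm u' := by
      obtain ⟨x, a, b, ha, hb, -⟩ := h
      exact (congrArg TotalSpace.proj ha).trans (congrArg TotalSpace.proj hb).symm
    obtain rfl : u = u' := φ.symm.injOn hz hw h1
    exact ⟨rfl, (key u p p' hz).1 h⟩
  · rintro ⟨h1, h2⟩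
    obtain rfl : u = u' := h1
    exact (key u p p' hz).2 h2

theorem rel_iff_cotCoord (hφ : IsLatticeChart Λ φ) {ξ η : CotangentBundle n M}
    (hξ : ξ.1 ∈ φ.source) (hη : η.1 ∈ φ.source) :
    Λ.Rel ξ η ↔ (cotCoord φ ξ).1 = (cotCoord φ η).1 ∧
      IsIntegral ((cotCoord φ ξ).2 - (cotCoord φ η).2) := by
  rw [← rel_cotParam hφ (φ.map_source hξ) (φ.map_source hη), cotParam_cotCoord hφ.1 hξ,
    cotParam_cotCoord hφ.1 hη]

theorem IsIntegral.neg {p : Covec n} (h : IsIntegral p) : IsIntegral (-p) := fun i => by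
  obtain ⟨m, hm⟩ := h i
  refine ⟨-m, ?_⟩
  push_cast
  rw [← hm]
  rfl

/-- Over a lattice chart, a lattice element extends to the translation by a constant covector in the
`p`-coordinates. This translation is continuous and preserves classes, so the saturation of an open
set is open. -/
theorem isOpenMap_mk (hΛ : ∀ x, ∃ φ, IsLatticeChart Λ φ ∧ x ∈ φ.source) : IsOpenMap (mk Λ) := by
  intro U hU
  change IsOpen (mk Λ ⁻¹' (mk Λ '' U))
  rw [isOpen_iff_mem_nhds]
  rintro ξ ⟨η, hη, hηξ⟩
  have hrel := mk_eq.1 hηξ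
  have hbase : η.1 = ξ.1 := congrArg proj hηξ
  obtain ⟨φ, hφ, hx⟩ := hΛ ξ.1
  have hy : η.1 ∈ φ.source := hbase ▸ hx
  obtain ⟨h1, h2⟩ := (rel_iff_cotCoord hφ hy hx).1 hrel
  -- The integral translation carrying `ξ` to the equivalent point `η` of `U`; applied to points
  -- near `ξ` it still lands in `U`.
  set m := (cotCoord φ η).2 - (cotCoord φ ξ).2
  have hT : cotParam φ (cotCoord φ ξ + (0, m)) = η := by
    have : cotCoord φ ξ + (0, m) = cotCoord φ η :=
      Prod.ext (by simp [h1]) (by simp [m])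
    rw [this, cotParam_cotCoord hφ.1 hy]
  have hs : ∀ ζ : CotangentBundle n M, ζ.1 ∈ φ.source → (cotCoord φ ζ + (0, m)).1 ∈ φ.target := by
    intro ζ hζ
    rw [Prod.fst_add, add_zero]
    exact φ.map_source hζ
  have hc : ContinuousAt (fun ζ => cotParam φ (cotCoord φ ζ + (0, m))) ξ :=
    ContinuousAt.comp (g := cotParam φ) (f := fun ζ => cotCoord φ ζ + (0, m))
      (contMDiffAt_cotParam hφ.1 (hs ξ hx)).continuousAt
      ((contMDiffAt_cotCoord hφ.1 hx).continuousAt.add continuousAt_const)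
  have hU' : U ∈ 𝓝 (cotParam φ (cotCoord φ ξ + (0, m))) := by
    rw [hT]; exact hU.mem_nhds hη
  filter_upwards [hc hU', (φ.open_source.preimage contMDiff_cotProj.continuous).mem_nhds hx]
    with ζ hζ hζ'
  refine ⟨cotParam φ (cotCoord φ ζ + (0, m)), hζ, mk_eq.2 ?_⟩
  have h3 : Λ.Rel (cotParam φ (cotCoord φ ζ + (0, m))) (cotParam φ (cotCoord φ ζ)) := by
    rw [rel_cotParam hφ (hs ζ hζ') (φ.map_source hζ')]
    exact ⟨by simp, by simpa using h2⟩
  rwa [cotParam_cotCoord hφ.1 (ξ := ζ) hζ'] at h3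

/-- The domain of a parametrization of the quotient. -/
def box (φ : OpenPartialHomeomorph M (Vec n)) (c : Covec n) : Set (Vec n × Covec n) :=
  {z | z.1 ∈ φ.target ∧ ∀ i, |z.2 (stdVec i) - c (stdVec i)| < 1 / 2}

theorem isOpen_box (φ : OpenPartialHomeomorph M (Vec n)) (c : Covec n) : IsOpen (box φ c) := by
  have h : box φ c = {z | z.1 ∈ φ.target} ∩
      ⋂ i, {z : Vec n × Covec n | |z.2 (stdVec i) - c (stdVec i)| < 1 / 2} := by
    ext; simp [box]
  rw [h]
  refine (isOpen_cotTarget φ).inter (isOpen_iInter_of_finite fun i => ?_)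
  have hc : Continuous fun z : Vec n × Covec n => |z.2 (stdVec i) - c (stdVec i)| := by fun_prop
  exact isOpen_lt hc continuous_const

/-- The half-width `1/2` makes the coefficients of two covectors of the box differ by less than one,
and an integer of absolute value less than one is zero. -/
theorem injOn_box (hφ : IsLatticeChart Λ φ) (c : Covec n) :
    InjOn (fun z => mk Λ (cotParam φ z)) (box φ c) := by
  intro z hz w hw h
  obtain ⟨h1, h2⟩ := (rel_cotParam hφ hz.1 hw.1).1 (mk_eq.1 h)
  refine Prod.ext h1 (covec_ext fun i => ?_)
  obtain ⟨m, hm⟩ := h2 i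
  have h3 : z.2 (stdVec i) - w.2 (stdVec i) = m := hm
  have h4 : |(m : ℝ)| < 1 := by
    have e1 := abs_lt.1 (hz.2 i)
    have e2 := abs_lt.1 (hw.2 i)
    rw [← h3, abs_lt]
    constructor <;> linarith
  have h5 : |m| < 1 := by exact_mod_cast h4
  rw [Int.abs_lt_one_iff] at h5
  rw [h5, Int.cast_zero] at h3
  linarith

theorem continuousOn_mk_cotParam (hφ : φ ∈ IsManifold.maximalAtlas (𝓡 n) ∞ M) :
    ContinuousOn (fun z => mk Λ (cotParam φ z)) {z | z.1 ∈ φ.target} := fun _ hz =>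
  (continuous_mk.continuousAt.comp
    (contMDiffAt_cotParam hφ hz).continuousAt).continuousWithinAt

/-- The parametrization of an open part of the quotient by a box. -/
def boxParam (hΛ : ∀ x, ∃ φ, IsLatticeChart Λ φ ∧ x ∈ φ.source) (hφ : IsLatticeChart Λ φ)
    (c : Covec n) : OpenPartialHomeomorph (Vec n × Covec n) (CotQuot Λ) :=
  OpenPartialHomeomorph.ofContinuousOpenRestrict ((injOn_box hφ c).toPartialEquiv _ _)
    ((continuousOn_mk_cotParam hφ.1).mono fun _ hz => hz.1)
    (by
      intro O hO
      obtain ⟨O', hO', rfl⟩ := isOpen_induced_iff.1 hO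
      -- The image is that of an open subset of `T*M` under the open map `mk`.
      have e : (box φ c).domRestrict (fun z => mk Λ (cotParam φ z)) '' (Subtype.val ⁻¹' O') =
          mk Λ '' ({ξ | ξ.1 ∈ φ.source} ∩ cotCoord φ ⁻¹' (box φ c ∩ O')) := by
        ext b
        constructor
        · rintro ⟨⟨z, hz⟩, hzO, rfl⟩
          refine ⟨cotParam φ z, ⟨φ.map_target hz.1, ?_⟩, rfl⟩
          rw [mem_preimage, cotCoord_cotParam hφ.1 hz.1]
          exact ⟨hz, hzO⟩
        · rintro ⟨ξ, ⟨h1, h2⟩, rfl⟩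
          refine ⟨⟨cotCoord φ ξ, h2.1⟩, h2.2, ?_⟩
          change mk Λ (cotParam φ (cotCoord φ ξ)) = _
          rw [cotParam_cotCoord hφ.1 h1]
      change IsOpen ((box φ c).domRestrict (fun z => mk Λ (cotParam φ z)) '' (Subtype.val ⁻¹' O'))
      rw [e]
      apply isOpenMap_mk hΛ
      refine ContinuousOn.isOpen_inter_preimage (fun ξ hξ =>
        (contMDiffAt_cotCoord hφ.1 hξ).continuousAt.continuousWithinAt)
        (φ.open_source.preimage contMDiff_cotProj.continuous) ((isOpen_box φ c).inter hO'))
    (isOpen_box φ c)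

variable (hΛ : ∀ x, ∃ φ, IsLatticeChart Λ φ ∧ x ∈ φ.source)

theorem boxParam_apply (hφ : IsLatticeChart Λ φ) (c : Covec n) (z : Vec n × Covec n) :
    boxParam hΛ hφ c z = mk Λ (cotParam φ z) := rfl

theorem mem_box_self {ξ : CotangentBundle n M} (hξ : ξ.1 ∈ φ.source) :
    cotCoord φ ξ ∈ box φ (cotCoord φ ξ).2 := ⟨φ.map_source hξ, fun i => by simp⟩

theorem mk_mem_boxParam_target (hφ : IsLatticeChart Λ φ) {ξ : CotangentBundle n M}
    (hξ : ξ.1 ∈ φ.source) : mk Λ ξ ∈ (boxParam hΛ hφ (cotCoord φ ξ).2).target := by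
  have h := (boxParam hΛ hφ (cotCoord φ ξ).2).map_source (mem_box_self hξ)
  rwa [boxParam_apply, cotParam_cotCoord hφ.1 hξ] at h

/-- On `T*M`, the chart of the quotient differs from the cotangent coordinates by a shift that is
constant near `ξ`. Smoothness of charts and the value of their derivatives follow from this. -/
theorem boxParam_symm_mk (hφ : IsLatticeChart Λ φ) (c : Covec n) {ξ : CotangentBundle n M}
    (hξ : mk Λ ξ ∈ (boxParam hΛ hφ c).target) : ξ.1 ∈ φ.source ∧ ∃ m : Covec n,
      ∀ᶠ η in 𝓝 ξ, (boxParam hΛ hφ c).symm (mk Λ η) = cotCoord φ η + (0, m) := by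
  set B := boxParam hΛ hφ c
  set w := B.symm (mk Λ ξ) with hw
  have hwb : w ∈ box φ c := B.map_target hξ
  have hBw : mk Λ (cotParam φ w) = mk Λ ξ := B.right_inv hξ
  have hbase : φ.symm w.1 = ξ.1 := congrArg proj hBw
  have hx : ξ.1 ∈ φ.source := hbase ▸ φ.map_target hwb.1
  refine ⟨hx, w.2 - (cotCoord φ ξ).2, ?_⟩
  have h1 := mk_eq.1 hBw
  rw [rel_iff_cotCoord hφ (φ.map_target hwb.1) hx, cotCoord_cotParam hφ.1 hwb.1] at h1
  set m := w.2 - (cotCoord φ ξ).2 with hm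
  have hwξ : cotCoord φ ξ + (0, m) = w := Prod.ext (by simp [h1.1]) (by simp [hm])
  have hc : ContinuousAt (fun η => cotCoord φ η + (0, m)) ξ :=
    (contMDiffAt_cotCoord hφ.1 hx).continuousAt.add continuousAt_const
  have hbox : box φ c ∈ 𝓝 (cotCoord φ ξ + (0, m)) := by
    rw [hwξ]; exact (isOpen_box φ c).mem_nhds hwb
  filter_upwards [hc hbox, (φ.open_source.preimage contMDiff_cotProj.continuous).mem_nhds hx]
    with η hη hη'
  have h2 : mk Λ η = B (cotCoord φ η + (0, m)) := by
    rw [boxParam_apply, mk_eq, rel_iff_cotCoord hφ hη' (φ.map_target hη.1),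
      cotCoord_cotParam hφ.1 hη.1]
    refine ⟨by simp, ?_⟩
    have := h1.2.neg
    simpa [hm] using this
  rw [h2, B.left_inv hη]

theorem contMDiffAt_boxParam_symm_mk (hφ : IsLatticeChart Λ φ) (c : Covec n)
    {ξ : CotangentBundle n M} (hξ : mk Λ ξ ∈ (boxParam hΛ hφ c).target) :
    ContMDiffAt (cotangentModel n) 𝓘(ℝ, Vec n × Covec n) ∞
      (fun η => (boxParam hΛ hφ c).symm (mk Λ η)) ξ := by
  obtain ⟨hx, m, hm⟩ := boxParam_symm_mk hΛ hφ c hξ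
  exact ((contMDiffAt_cotCoord hφ.1 hx).add contMDiffAt_const).congr_of_eventuallyEq hm

theorem tderiv_boxParam_symm_mk (hφ : IsLatticeChart Λ φ) (c : Covec n)
    {ξ : CotangentBundle n M} (hξ : mk Λ ξ ∈ (boxParam hΛ hφ c).target) (v : Vec n × Covec n) :
    tderiv (cotangentModel n) 𝓘(ℝ, Vec n × Covec n)
      (fun η => (boxParam hΛ hφ c).symm (mk Λ η)) ξ v =
    tderiv (cotangentModel n) 𝓘(ℝ, Vec n × Covec n) (cotCoord φ) ξ v := by
  obtain ⟨hx, m, hm⟩ := boxParam_symm_mk hΛ hφ c hξ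
  have h2 : HasFDerivAt (fun z : Vec n × Covec n => z + (0, m))
      (ContinuousLinearMap.id ℝ (Vec n × Covec n)) (cotCoord φ ξ) :=
    (hasFDerivAt_id _).add_const _
  rw [tderiv_congr hm, tderiv_comp_apply (g := fun z : Vec n × Covec n => z + (0, m))
    h2.differentiableAt.mdifferentiableAt (mdifferentiableAt_cotCoord hφ.1 hx), tderiv_eq_fderiv,
    h2.fderiv]
  rfl

end CotQuot

end Quotient

end

end PoissonGeom

/-! ### The smooth structure and the symplectic form of `T*M/Λ` -/

namespace PoissonGeom

noncomputable section

open Set Filter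

section QuotientManifold

variable {n : ℕ} {M : Type u} [TopologicalSpace M] [ChartedSpace (EuclideanSpace ℝ (Fin n)) M]
  [IsManifold (𝓡 n) ∞ M] {φ : OpenPartialHomeomorph M (Vec n)}

/-- The dimension of the cotangent bundle. -/
def cotDim (n : ℕ) : ℕ := Module.finrank ℝ (Vec n × Covec n)

/-- A linear identification of the model of the cotangent bundle with a Euclidean space. -/
def cotEquiv (n : ℕ) : (Vec n × Covec n) ≃L[ℝ] Vec (cotDim n) := toEuclidean

/-- The quotient of the cotangent bundle by a Lagrangian lattice. -/
abbrev LagQuot (Λ : LagrangianLattice n M) : Type u := CotQuot Λ.toCotangentLattice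

namespace LagQuot

variable {Λ : LagrangianLattice n M}

/-- The quotient map. -/
abbrev mk (Λ : LagrangianLattice n M) (ξ : CotangentBundle n M) : LagQuot Λ :=
  CotQuot.mk Λ.toCotangentLattice ξ

/-- The parametrizations of the quotient. -/
abbrev param (hφ : IsLatticeChart Λ.toCotangentLattice φ) (c : Covec n) :
    OpenPartialHomeomorph (Vec n × Covec n) (LagQuot Λ) :=
  CotQuot.boxParam (exists_isLatticeChart Λ) hφ c

/-- The charts of the quotient. -/
def chart (hφ : IsLatticeChart Λ.toCotangentLattice φ) (c : Covec n) :
    OpenPartialHomeomorph (LagQuot Λ) (Vec (cotDim n)) :=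
  (param hφ c).symm.transHomeomorph (cotEquiv n).toHomeomorph

theorem chart_apply (hφ : IsLatticeChart Λ.toCotangentLattice φ) (c : Covec n) (b : LagQuot Λ) :
    chart hφ c b = cotEquiv n ((param hφ c).symm b) := rfl

theorem chart_symm_apply (hφ : IsLatticeChart Λ.toCotangentLattice φ) (c : Covec n)
    (y : Vec (cotDim n)) :
    (chart hφ c).symm y = mk Λ (cotParam φ ((cotEquiv n).symm y)) := rfl

theorem mem_chart_target (hφ : IsLatticeChart Λ.toCotangentLattice φ) (c : Covec n)
    {y : Vec (cotDim n)} (hy : y ∈ (chart hφ c).target) :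
    (cotEquiv n).symm y ∈ CotQuot.box φ c := hy

theorem exists_chart (b : LagQuot Λ) : ∃ C : OpenPartialHomeomorph (LagQuot Λ) (Vec (cotDim n)),
    (∃ (φ : OpenPartialHomeomorph M (Vec n)) (hφ : IsLatticeChart Λ.toCotangentLattice φ)
      (c : Covec n), C = chart hφ c) ∧ b ∈ C.source := by
  obtain ⟨ξ, rfl⟩ := CotQuot.mk_surjective b
  obtain ⟨φ, hφ, hx⟩ := exists_isLatticeChart Λ ξ.1
  exact ⟨_, ⟨φ, hφ, _, rfl⟩, CotQuot.mk_mem_boxParam_target (exists_isLatticeChart Λ) hφ hx⟩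

instance (Λ : LagrangianLattice n M) :
    ChartedSpace (EuclideanSpace ℝ (Fin (cotDim n))) (LagQuot Λ) where
  atlas := {C | ∃ (φ : OpenPartialHomeomorph M (Vec n))
    (hφ : IsLatticeChart Λ.toCotangentLattice φ) (c : Covec n), C = chart hφ c}
  chartAt b := (exists_chart b).choose
  mem_chart_source b := (exists_chart b).choose_spec.2
  chart_mem_atlas b := (exists_chart b).choose_spec.1

theorem exists_chartAt_eq (b : LagQuot Λ) : ∃ (φ : OpenPartialHomeomorph M (Vec n))
    (hφ : IsLatticeChart Λ.toCotangentLattice φ) (c : Covec n),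
    chartAt (EuclideanSpace ℝ (Fin (cotDim n))) b = chart hφ c :=
  (exists_chart b).choose_spec.1

/-- A transition lifts through `T*M`: the parametrization is `mk ∘ cotParam`, and the next chart
composed with `mk` is smooth there by `boxParam_symm_mk`. -/
instance (Λ : LagrangianLattice n M) : IsManifold (𝓡 (cotDim n)) ∞ (LagQuot Λ) := by
  apply isManifold_of_contDiffOn
  rintro _ _ ⟨φ, hφ, c, rfl⟩ ⟨φ', hφ', c', rfl⟩ y hy
  apply ContDiffAt.contDiffWithinAt
  have hy' : y ∈ ((chart hφ c).symm ≫ₕ chart hφ' c').source := hy.1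
  rw [OpenPartialHomeomorph.trans_source] at hy'
  have h1 := mem_chart_target hφ c hy'.1
  have h2 : mk Λ (cotParam φ ((cotEquiv n).symm y)) ∈ (param hφ' c').target := hy'.2
  have h3 : ContMDiffAt 𝓘(ℝ, Vec n × Covec n) 𝓘(ℝ, Vec n × Covec n) ∞
      (fun z => (param hφ' c').symm (mk Λ (cotParam φ z))) ((cotEquiv n).symm y) :=
    (CotQuot.contMDiffAt_boxParam_symm_mk _ hφ' c' h2).comp _ (contMDiffAt_cotParam hφ.1 h1.1)
  exact (cotEquiv n).contDiff.contDiffAt.comp y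
    (h3.contDiffAt.comp y (cotEquiv n).symm.contDiff.contDiffAt)

theorem chart_mem_maximalAtlas (hφ : IsLatticeChart Λ.toCotangentLattice φ) (c : Covec n) :
    chart hφ c ∈ IsManifold.maximalAtlas (𝓡 (cotDim n)) ∞ (LagQuot Λ) :=
  IsManifold.subset_maximalAtlas ⟨φ, hφ, c, rfl⟩

/-- The quotient map is a local diffeomorphism. -/
theorem isLocalDiffeomorph_mk (Λ : LagrangianLattice n M) :
    IsLocalDiffeomorph (cotangentModel n) (𝓡 (cotDim n)) ∞ (mk Λ) := by
  intro ξ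
  obtain ⟨φ, hφ, hx⟩ := exists_isLatticeChart Λ ξ.1
  set c := (cotCoord φ ξ).2
  have hC := chart_mem_maximalAtlas hφ c
  refine ⟨{ toFun := mk Λ
            invFun := fun b => cotParam φ ((param hφ c).symm b)
            source := {η | η.1 ∈ φ.source} ∩ cotCoord φ ⁻¹' CotQuot.box φ c
            target := (param hφ c).target
            map_source' := ?_
            map_target' := ?_
            left_inv' := ?_
            right_inv' := ?_
            open_source := ?_
            open_target := (param hφ c).open_target
            contMDiffOn_toFun := ?_
            contMDiffOn_invFun := ?_ }, ⟨hx, CotQuot.mem_box_self hx⟩, fun _ _ => rfl⟩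
  · rintro η ⟨h1, h2⟩
    have h3 := (param hφ c).map_source h2
    rwa [CotQuot.boxParam_apply, cotParam_cotCoord hφ.1 h1] at h3
  · intro b hb
    have h1 : (param hφ c).symm b ∈ CotQuot.box φ c := (param hφ c).map_target hb
    refine ⟨φ.map_target h1.1, ?_⟩
    rwa [mem_preimage, cotCoord_cotParam hφ.1 h1.1]
  · rintro η ⟨h1, h2⟩
    have h3 := (param hφ c).left_inv h2
    rw [CotQuot.boxParam_apply, cotParam_cotCoord hφ.1 h1] at h3
    change cotParam φ ((param hφ c).symm (mk Λ η)) = η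
    rw [h3, cotParam_cotCoord hφ.1 h1]
  · intro b hb
    exact (param hφ c).right_inv hb
  · exact ContinuousOn.isOpen_inter_preimage (fun ξ hξ =>
      (contMDiffAt_cotCoord hφ.1 hξ).continuousAt.continuousWithinAt)
      (φ.open_source.preimage contMDiff_cotProj.continuous) (CotQuot.isOpen_box φ c)
  · rintro η ⟨h1, h2⟩
    have ht : cotEquiv n (cotCoord φ η) ∈ (chart hφ c).target := by
      change (cotEquiv n).symm (cotEquiv n (cotCoord φ η)) ∈ CotQuot.box φ c
      rwa [ContinuousLinearEquiv.symm_apply_apply]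
    have h3 : ContMDiffAt (cotangentModel n) (𝓡 (cotDim n)) ∞
        (fun η => cotEquiv n (cotCoord φ η)) η :=
      (cotEquiv n).contDiff.contDiffAt.contMDiffAt.comp η (contMDiffAt_cotCoord hφ.1 h1)
    have h4 : ContMDiffAt (cotangentModel n) (𝓡 (cotDim n)) ∞
        (fun η => (chart hφ c).symm (cotEquiv n (cotCoord φ η))) η :=
      (chart_symm_contMDiffAt hC ht).comp η h3
    refine (h4.congr_of_eventuallyEq ?_).contMDiffWithinAt
    filter_upwards [(φ.open_source.preimage contMDiff_cotProj.continuous).mem_nhds h1] with ζ hζ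
    rw [chart_symm_apply, ContinuousLinearEquiv.symm_apply_apply, cotParam_cotCoord hφ.1 hζ]
  · intro b hb
    have h1 : (param hφ c).symm b ∈ CotQuot.box φ c := (param hφ c).map_target hb
    have h2 : ContMDiffAt (𝓡 (cotDim n)) 𝓘(ℝ, Vec n × Covec n) ∞
        (fun b => (cotEquiv n).symm (chart hφ c b)) b :=
      (cotEquiv n).symm.contDiff.contDiffAt.contMDiffAt.comp b (chart_contMDiffAt hC hb)
    have h3 : ContMDiffAt (𝓡 (cotDim n)) 𝓘(ℝ, Vec n × Covec n) ∞
        (fun b => (param hφ c).symm b) b := by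
      refine h2.congr_of_eventuallyEq (Eventually.of_forall fun b' => ?_)
      change _ = (cotEquiv n).symm (chart hφ c b')
      rw [chart_apply, ContinuousLinearEquiv.symm_apply_apply]
    exact ((contMDiffAt_cotParam hφ.1 h1.1).comp b h3).contMDiffWithinAt

theorem mdifferentiableAt_mk (ξ : CotangentBundle n M) :
    MDifferentiableAt (cotangentModel n) (𝓡 (cotDim n)) (mk Λ) ξ :=
  (isLocalDiffeomorph_mk Λ).mdifferentiable (by simp) ξ

theorem contMDiff_mk : ContMDiff (cotangentModel n) (𝓡 (cotDim n)) ∞ (mk Λ) :=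
  (isLocalDiffeomorph_mk Λ).contMDiff

/-- The canonical `2`-form of the model of the cotangent bundle. -/
def modelForm (n : ℕ) : (Vec n × Covec n) [⋀^Fin 2]→L[ℝ] ℝ := -extDeriv (modelTautological (Vec n)) 0

theorem modelForm_apply (v w : Vec n × Covec n) :
    modelForm n ![v, w] = w.2 v.1 - v.2 w.1 := by
  change -(extDeriv (modelTautological (Vec n)) 0 ![v, w]) = _
  rw [extDeriv_modelTautological]
  ring

/-- The symplectic form of the quotient. -/
def form (Λ : LagrangianLattice n M) : DiffForm (𝓡 (cotDim n)) (LagQuot Λ) 2 := fun b =>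
  (modelForm n).compContinuousLinearMap (((cotEquiv n).symm : Vec (cotDim n) →L[ℝ] _).comp
    (tderiv (𝓡 (cotDim n)) (𝓡 (cotDim n)) (chartAt (Vec (cotDim n)) b) b))

theorem form_pair (b : LagQuot Λ) (v w : Vec (cotDim n)) : (form Λ).pair b v w = modelForm n
    ![(cotEquiv n).symm (tderiv (𝓡 (cotDim n)) (𝓡 (cotDim n)) (chartAt (Vec (cotDim n)) b) b v),
      (cotEquiv n).symm (tderiv (𝓡 (cotDim n)) (𝓡 (cotDim n)) (chartAt (Vec (cotDim n)) b) b w)] := by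
  change modelForm n (fun i => _) = _
  congr 1
  ext1 i
  fin_cases i <;> rfl

/-- `form` is the constant model form transported by whichever chart is preferred at the point. That
chart differs from cotangent coordinates by a translation, and `ω_can` is the model form in all of
these, so the result does not depend on the choice. -/
theorem form_mk (ξ : CotangentBundle n M) (v w : Vec n × Covec n) :
    (form Λ).pair (mk Λ ξ) (tderiv (cotangentModel n) (𝓡 (cotDim n)) (mk Λ) ξ v)
      (tderiv (cotangentModel n) (𝓡 (cotDim n)) (mk Λ) ξ w) =
    (canonicalForm n M).pair ξ v w := by
  obtain ⟨φ, hφ, c, hc⟩ := exists_chartAt_eq (mk Λ ξ)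
  have hb : mk Λ ξ ∈ (param hφ c).target := by
    have := mem_chart_source (Vec (cotDim n)) (mk Λ ξ)
    rwa [hc] at this
  have hx := (CotQuot.boxParam_symm_mk (exists_isLatticeChart Λ) hφ c hb).1
  have key : ∀ u : Vec n × Covec n, (cotEquiv n).symm (tderiv (𝓡 (cotDim n)) (𝓡 (cotDim n))
      (chartAt (Vec (cotDim n)) (mk Λ ξ)) (mk Λ ξ)
        (tderiv (cotangentModel n) (𝓡 (cotDim n)) (mk Λ) ξ u)) =
      tderiv (cotangentModel n) 𝓘(ℝ, Vec n × Covec n) (cotCoord φ) ξ u := by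
    intro u
    rw [hc, ← tderiv_comp_apply (chart_mdifferentiableAt (chart_mem_maximalAtlas hφ c) hb)
      (mdifferentiableAt_mk ξ)]
    change (cotEquiv n).symm (tderiv (cotangentModel n) 𝓘(ℝ, Vec (cotDim n))
      (fun η => cotEquiv n ((param hφ c).symm (mk Λ η))) ξ u) = _
    rw [tderiv_comp_apply (I' := 𝓘(ℝ, Vec n × Covec n)) (g := cotEquiv n)
      (cotEquiv n).differentiableAt.mdifferentiableAt
      ((CotQuot.contMDiffAt_boxParam_symm_mk _ hφ c hb).mdifferentiableAt (by simp)),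
      tderiv_eq_fderiv, ContinuousLinearEquiv.fderiv, ContinuousLinearEquiv.coe_coe,
      ContinuousLinearEquiv.symm_apply_apply, CotQuot.tderiv_boxParam_symm_mk _ hφ c hb]
  rw [form_pair, key, key, modelForm_apply, canonicalForm_pair hφ.1 hx]

theorem form_chart_symm (hφ : IsLatticeChart Λ.toCotangentLattice φ) (c : Covec n)
    {y : Vec (cotDim n)} (hy : y ∈ (chart hφ c).target) (v w : Vec (cotDim n)) :
    (form Λ).pair ((chart hφ c).symm y)
      (tderiv (𝓡 (cotDim n)) (𝓡 (cotDim n)) (chart hφ c).symm y v)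
      (tderiv (𝓡 (cotDim n)) (𝓡 (cotDim n)) (chart hφ c).symm y w) =
    modelForm n ![(cotEquiv n).symm v, (cotEquiv n).symm w] := by
  have hz := (mem_chart_target hφ c hy).1
  have key : ∀ u, tderiv (𝓡 (cotDim n)) (𝓡 (cotDim n)) (chart hφ c).symm y u =
      tderiv (cotangentModel n) (𝓡 (cotDim n)) (mk Λ) (cotParam φ ((cotEquiv n).symm y))
        (tderiv 𝓘(ℝ, Vec n × Covec n) (cotangentModel n) (cotParam φ) ((cotEquiv n).symm y)
          ((cotEquiv n).symm u)) := by
    intro u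
    change tderiv (𝓡 (cotDim n)) (𝓡 (cotDim n))
      (fun y => mk Λ (cotParam φ ((cotEquiv n).symm y))) y u = _
    have h1 : MDifferentiableAt (𝓡 (cotDim n)) 𝓘(ℝ, Vec n × Covec n) (cotEquiv n).symm y :=
      (cotEquiv n).symm.differentiableAt.mdifferentiableAt
    have h2 := (mdifferentiableAt_cotParam hφ.1 hz)
    have h12 : MDifferentiableAt (𝓡 (cotDim n)) (cotangentModel n)
        (fun y => cotParam φ ((cotEquiv n).symm y)) y := h2.comp y h1
    rw [tderiv_comp_apply (g := mk Λ) (mdifferentiableAt_mk _) h12,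
      tderiv_comp_apply (g := cotParam φ) h2 h1]
    have h3 : tderiv (𝓡 (cotDim n)) 𝓘(ℝ, Vec n × Covec n) (cotEquiv n).symm y u =
        (cotEquiv n).symm u := by
      rw [tderiv_eq_fderiv, ContinuousLinearEquiv.fderiv]; rfl
    rw [h3]
  rw [key, key, chart_symm_apply, form_mk, canonicalForm_pair_cotParam hφ.1 hz, modelForm_apply]

/-- Constancy of the coefficients in the charts is what gives both smoothness and closedness. -/
theorem form_inChart (b : LagQuot Λ) : EqOn ((form Λ).inChart b)
    (fun _ => (modelForm n).compContinuousLinearMap ((cotEquiv n).symm : Vec (cotDim n) →L[ℝ] _))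
    (extChartAt (𝓡 (cotDim n)) b).target := by
  intro y hy
  obtain ⟨φ, hφ, c, hc⟩ := exists_chartAt_eq b
  have hy' : y ∈ (chart hφ c).target := by
    rw [← hc]
    simpa using hy
  apply DiffForm.ext_pair
  intro v w
  have e : ((extChartAt (𝓡 (cotDim n)) b).symm : Vec (cotDim n) → LagQuot Λ) =
      (chart hφ c).symm := by
    rw [← hc]; rfl
  rw [DiffForm.inChart_eq_pull, DiffForm.pull_pair, e, form_chart_symm hφ c hy']
  change _ = modelForm n (fun i => _)
  congr 1
  ext1 i
  fin_cases i <;> rfl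

theorem form_nondegenerate (b : LagQuot Λ) (v : Vec (cotDim n))
    (hv : ∀ w, (form Λ).pair b v w = 0) : v = 0 := by
  have hb := mem_chart_source (Vec (cotDim n)) b
  have hC := IsManifold.chart_mem_maximalAtlas (I := 𝓡 (cotDim n)) (n := ∞) b
  set x := (cotEquiv n).symm
    (tderiv (𝓡 (cotDim n)) (𝓡 (cotDim n)) (chartAt (Vec (cotDim n)) b) b v) with hxdef
  have h1 : ∀ u : Vec n × Covec n, u.2 x.1 - x.2 u.1 = 0 := by
    intro u
    have h2 : (form Λ).pair b v (tderiv (𝓡 (cotDim n)) (𝓡 (cotDim n))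
      (chartAt (Vec (cotDim n)) b).symm ((chartAt (Vec (cotDim n)) b) b) (cotEquiv n u)) = 0 :=
      hv _
    have h3 := tderiv_chart_tderiv_symm hC ((chartAt (Vec (cotDim n)) b).map_source hb)
      (cotEquiv n u)
    rw [(chartAt (Vec (cotDim n)) b).left_inv hb] at h3
    rw [form_pair, h3, ContinuousLinearEquiv.symm_apply_apply, modelForm_apply] at h2
    exact h2
  have h4 : x = 0 := by
    refine Prod.ext ?_ ?_
    · ext i
      have := h1 (0, (EuclideanSpace.proj i : Vec n →L[ℝ] ℝ))
      simpa using this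
    · ext u
      have := h1 (u, 0)
      simpa using this
  have h5 := (cotEquiv n).symm.map_eq_zero_iff.1 h4
  have h6 := tderiv_symm_tderiv_chart hC hb v
  rw [h5, map_zero] at h6
  exact h6.symm

theorem form_isSymplectic (Λ : LagrangianLattice n M) : (form Λ).IsSymplectic where
  smooth b := contDiffOn_const.congr (form_inChart b)
  closed b := by
    have h : (form Λ).inChart b =ᶠ[𝓝 (extChartAt (𝓡 (cotDim n)) b b)] fun _ =>
        (modelForm n).compContinuousLinearMap ((cotEquiv n).symm : Vec (cotDim n) →L[ℝ] _) := by
      filter_upwards [extChartAt_target_mem_nhds (I := 𝓡 (cotDim n)) b] with y hy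
        using form_inChart b hy
    have h0 : extDeriv (fun _ : Vec (cotDim n) => (modelForm n).compContinuousLinearMap
        ((cotEquiv n).symm : Vec (cotDim n) →L[ℝ] _)) (extChartAt (𝓡 (cotDim n)) b b) = 0 := by
      ext v
      simp [extDeriv, ContinuousAlternatingMap.alternatizeUncurryFin_apply]
    rw [DiffForm.d, h.extDeriv_eq, h0]
    rfl
  nondegenerate b v hv := form_nondegenerate b v hv

end LagQuot

end QuotientManifold

end

end PoissonGeom

/-! ### The Lie groupoid structure of `T*M/Λ` -/

namespace PoissonGeom

noncomputable section

open Set Filter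

section QuotientGroupoid

variable {n : ℕ} {M : Type u} [TopologicalSpace M] [ChartedSpace (EuclideanSpace ℝ (Fin n)) M]
  [IsManifold (𝓡 n) ∞ M] {φ : OpenPartialHomeomorph M (Vec n)}

theorem zeroSection_contMDiff : ContMDiff (𝓡 n) (cotangentModel n) ∞
    (fun x : M => (⟨x, 0⟩ : CotangentBundle n M)) := by
  intro x
  have h := (constSection_smooth (IsManifold.chart_mem_maximalAtlas (I := 𝓡 n) (n := ∞) x)
    (0 : Covec n)).contMDiffAt ((chartAt (Vec n) x).open_source.mem_nhds (mem_chart_source _ x))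
  refine h.congr_of_eventuallyEq (Eventually.of_forall fun y => ?_)
  have e : constSection (chartAt (Vec n) x) (0 : Covec n) y = 0 :=
    ContinuousLinearMap.zero_comp _
  exact congrArg (TotalSpace.mk y) e.symm

namespace LagQuot

variable {Λ : LagrangianLattice n M}

/-- The projection to the base. -/
abbrev proj (b : LagQuot Λ) : M := CotQuot.proj b

/-- The parametrization of the part of the quotient over a chart of the base. -/
def cpar (Λ : LagrangianLattice n M) (φ : OpenPartialHomeomorph M (Vec n)) (z : Vec n × Covec n) :
    LagQuot Λ := mk Λ (cotParam φ z)

theorem exists_cpar (b : LagQuot Λ) (hx : proj b ∈ φ.source)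
    (hφ : φ ∈ IsManifold.maximalAtlas (𝓡 n) ∞ M) : ∃ z : Vec n × Covec n,
      z.1 ∈ φ.target ∧ φ (proj b) = z.1 ∧ b = cpar Λ φ z := by
  obtain ⟨ξ, rfl⟩ := CotQuot.mk_surjective b
  exact ⟨cotCoord φ ξ, φ.map_source hx, rfl, by rw [cpar, cotParam_cotCoord hφ hx]⟩

@[simp] theorem proj_cpar (z : Vec n × Covec n) : proj (cpar Λ φ z) = φ.symm z.1 := rfl

/-- A representative of a class. -/
def out (b : LagQuot Λ) : CotangentBundle n M := Function.surjInv CotQuot.mk_surjective b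

theorem mk_out (b : LagQuot Λ) : mk Λ (out b) = b := Function.surjInv_eq _ b

theorem exists_out {x : M} (a : CotangentSpace n M x) : ∃ a' : CotangentSpace n M x,
    out (mk Λ ⟨x, a⟩) = ⟨x, a'⟩ ∧ a' - a ∈ Λ.fiber x := by
  obtain ⟨y, a', b, h1, h2, h3⟩ := CotQuot.mk_eq.1 (mk_out (mk Λ ⟨x, a⟩))
  cases h2
  exact ⟨a', h1, h3⟩

/-- Addition of classes. -/
def mul (b c : LagQuot Λ) : LagQuot Λ :=
  -- Adding the underlying covectors of the model makes the product total. Taking the base point of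
  -- `c` is the correct choice on composable pairs and makes the source of a product right by
  -- definition.
  mk Λ ⟨proj c, (covec (out b).2 + covec (out c).2 : Covec n)⟩

/-- Negation of classes. -/
def inv (b : LagQuot Λ) : LagQuot Λ := mk Λ ⟨proj b, (-covec (out b).2 : Covec n)⟩

theorem mul_mk {x : M} (a b : CotangentSpace n M x) :
    mul (mk Λ ⟨x, a⟩) (mk Λ ⟨x, b⟩) = mk Λ ⟨x, a + b⟩ := by
  obtain ⟨a', ha, ha'⟩ := exists_out (Λ := Λ) a
  obtain ⟨b', hb, hb'⟩ := exists_out (Λ := Λ) b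
  rw [mul, ha, hb, CotQuot.mk_eq]
  refine Λ.rel_mk.2 ?_
  have h : (a' + b' : CotangentSpace n M x) - (a + b) ∈ Λ.fiber x := by
    rw [add_sub_add_comm]; exact add_mem ha' hb'
  exact h

theorem inv_mk {x : M} (a : CotangentSpace n M x) : inv (mk Λ ⟨x, a⟩) = mk Λ ⟨x, -a⟩ := by
  obtain ⟨a', ha, ha'⟩ := exists_out (Λ := Λ) a
  rw [inv, ha, CotQuot.mk_eq]
  refine Λ.rel_mk.2 ?_
  have h : (-a' : CotangentSpace n M x) - -a ∈ Λ.fiber x := by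
    rw [neg_sub_neg, ← neg_sub]; exact neg_mem ha'
  exact h

theorem mul_cpar (u : Vec n) (p p' : Covec n) :
    mul (cpar Λ φ (u, p)) (cpar Λ φ (u, p')) = cpar Λ φ (u, p + p') := mul_mk _ _

theorem inv_cpar (u : Vec n) (p : Covec n) : inv (cpar Λ φ (u, p)) = cpar Λ φ (u, -p) := inv_mk _

theorem contMDiffAt_cpar (hφ : φ ∈ IsManifold.maximalAtlas (𝓡 n) ∞ M) {z : Vec n × Covec n}
    (hz : z.1 ∈ φ.target) :
    ContMDiffAt 𝓘(ℝ, Vec n × Covec n) (𝓡 (cotDim n)) ∞ (cpar Λ φ) z :=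
  (contMDiff_mk (cotParam φ z)).comp z (contMDiffAt_cotParam hφ hz)

theorem mdifferentiableAt_cpar (hφ : φ ∈ IsManifold.maximalAtlas (𝓡 n) ∞ M)
    {z : Vec n × Covec n} (hz : z.1 ∈ φ.target) :
    MDifferentiableAt 𝓘(ℝ, Vec n × Covec n) (𝓡 (cotDim n)) (cpar Λ φ) z :=
  (contMDiffAt_cpar hφ hz).mdifferentiableAt (by simp)

/-- The differential of the parametrization. -/
abbrev dcpar (Λ : LagrangianLattice n M) (φ : OpenPartialHomeomorph M (Vec n))
    (z : Vec n × Covec n) : (Vec n × Covec n) →L[ℝ] Vec (cotDim n) :=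
  tderiv 𝓘(ℝ, Vec n × Covec n) (𝓡 (cotDim n)) (cpar Λ φ) z

theorem dcpar_apply (hφ : φ ∈ IsManifold.maximalAtlas (𝓡 n) ∞ M) {z : Vec n × Covec n}
    (hz : z.1 ∈ φ.target) (v : Vec n × Covec n) : dcpar Λ φ z v =
      tderiv (cotangentModel n) (𝓡 (cotDim n)) (mk Λ) (cotParam φ z)
        (tderiv 𝓘(ℝ, Vec n × Covec n) (cotangentModel n) (cotParam φ) z v) :=
  tderiv_comp_apply (mdifferentiableAt_mk _) (mdifferentiableAt_cotParam hφ hz) v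

theorem form_dcpar (hφ : φ ∈ IsManifold.maximalAtlas (𝓡 n) ∞ M) {z : Vec n × Covec n}
    (hz : z.1 ∈ φ.target) (v w : Vec n × Covec n) :
    (form Λ).pair (cpar Λ φ z) (dcpar Λ φ z v) (dcpar Λ φ z w) = w.2 v.1 - v.2 w.1 := by
  rw [dcpar_apply hφ hz, dcpar_apply hφ hz, cpar, form_mk, canonicalForm_pair_cotParam hφ hz]

theorem dcpar_surjective (hφ : φ ∈ IsManifold.maximalAtlas (𝓡 n) ∞ M) {z : Vec n × Covec n}
    (hz : z.1 ∈ φ.target) : Function.Surjective (dcpar Λ φ z) := by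
  intro u
  obtain ⟨v, hv⟩ := ((isLocalDiffeomorph_mk Λ).mfderivToContinuousLinearEquiv (by simp)
    (cotParam φ z)).surjective u
  have h := tderiv_cotParam_cotCoord hφ (ξ := cotParam φ z) (φ.map_target hz) v
  rw [cotCoord_cotParam hφ hz] at h
  refine ⟨tderiv (cotangentModel n) 𝓘(ℝ, Vec n × Covec n) (cotCoord φ) (cotParam φ z) v, ?_⟩
  rw [dcpar_apply hφ hz, h]
  exact hv

/-- Smoothness of a map on the quotient can be tested on the cotangent bundle. -/
theorem contMDiffAt_of_comp_mk {d : ℕ} {X : Type*} [TopologicalSpace X]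
    [ChartedSpace (EuclideanSpace ℝ (Fin d)) X] {f : LagQuot Λ → X} {ξ : CotangentBundle n M}
    (h : ContMDiffAt (cotangentModel n) (𝓡 d) ∞ (fun η => f (mk Λ η)) ξ) :
    ContMDiffAt (𝓡 (cotDim n)) (𝓡 d) ∞ f (mk Λ ξ) := by
  have hl := isLocalDiffeomorph_mk Λ ξ
  have h1 := hl.localInverse_contMDiffAt
  have h2 : hl.localInverse (mk Λ ξ) = ξ := hl.localInverse_left_inv hl.localInverse_mem_target
  have h3 : ContMDiffAt (𝓡 (cotDim n)) (𝓡 d) ∞ (fun b => f (mk Λ (hl.localInverse b))) (mk Λ ξ) :=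
    ContMDiffAt.comp (g := fun η => f (mk Λ η)) (mk Λ ξ) (by rw [h2]; exact h) h1
  refine h3.congr_of_eventuallyEq ?_
  filter_upwards [hl.localInverse_eventuallyEq_right] with b hb
  exact congrArg f hb.symm

theorem contMDiff_proj : ContMDiff (𝓡 (cotDim n)) (𝓡 n) ∞ (proj : LagQuot Λ → M) := by
  intro b
  obtain ⟨ξ, rfl⟩ := CotQuot.mk_surjective b
  exact contMDiffAt_of_comp_mk (contMDiff_cotProj ξ)

theorem mdifferentiable_proj : MDifferentiable (𝓡 (cotDim n)) (𝓡 n) (proj : LagQuot Λ → M) :=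
  contMDiff_proj.mdifferentiable (by simp)

theorem tderiv_proj_dcpar (hφ : φ ∈ IsManifold.maximalAtlas (𝓡 n) ∞ M) {z : Vec n × Covec n}
    (hz : z.1 ∈ φ.target) (v : Vec n × Covec n) :
    tderiv (𝓡 (cotDim n)) (𝓡 n) (proj : LagQuot Λ → M) (cpar Λ φ z) (dcpar Λ φ z v) =
      tderiv (𝓡 n) (𝓡 n) φ.symm z.1 v.1 := by
  rw [← tderiv_comp_apply (mdifferentiable_proj _) (mdifferentiableAt_cpar hφ hz),
    ← tderiv_proj_cotParam hφ hz, ← tderiv_comp_apply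
      (contMDiff_cotProj.mdifferentiable (by simp) _) (mdifferentiableAt_cotParam hφ hz)]
  rfl

theorem tderiv_proj_dcpar_injective (hφ : φ ∈ IsManifold.maximalAtlas (𝓡 n) ∞ M) {u : Vec n}
    (hu : u ∈ φ.target) {p p' : Covec n} {v w : Vec n × Covec n}
    (h : tderiv (𝓡 (cotDim n)) (𝓡 n) (proj : LagQuot Λ → M) (cpar Λ φ (u, p))
      (dcpar Λ φ (u, p) v) =
      tderiv (𝓡 (cotDim n)) (𝓡 n) (proj : LagQuot Λ → M) (cpar Λ φ (u, p'))
      (dcpar Λ φ (u, p') w)) : v.1 = w.1 := by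
  rw [tderiv_proj_dcpar hφ (z := (u, p)) hu, tderiv_proj_dcpar hφ (z := (u, p')) hu] at h
  rw [← tderiv_chart_tderiv_symm hφ hu v.1, h, tderiv_chart_tderiv_symm hφ hu]

theorem contMDiff_inv : ContMDiff (𝓡 (cotDim n)) (𝓡 (cotDim n)) ∞ (inv : LagQuot Λ → _) := by
  intro b
  obtain ⟨ξ, rfl⟩ := CotQuot.mk_surjective b
  apply contMDiffAt_of_comp_mk
  have hφ := IsManifold.chart_mem_maximalAtlas (I := 𝓡 n) (n := ∞) ξ.1
  have hx := mem_chart_source (Vec n) ξ.1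
  set φ := chartAt (Vec n) ξ.1
  have h1 := contMDiffAt_cotCoord hφ hx
  have h2 : ContMDiffAt (cotangentModel n) 𝓘(ℝ, Vec n × Covec n) ∞
      (fun η => ((cotCoord φ η).1, -(cotCoord φ η).2)) ξ := by
    have h3 : ContDiff ℝ ∞ (fun z : Vec n × Covec n => (z.1, -z.2)) := by fun_prop
    exact h3.contDiffAt.contMDiffAt.comp ξ h1
  have h3 : ContMDiffAt (cotangentModel n) (𝓡 (cotDim n)) ∞
      (fun η => cpar Λ φ ((cotCoord φ η).1, -(cotCoord φ η).2)) ξ :=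
    ContMDiffAt.comp (g := cpar Λ φ) ξ (contMDiffAt_cpar hφ (φ.map_source hx)) h2
  refine h3.congr_of_eventuallyEq ?_
  filter_upwards [(φ.open_source.preimage contMDiff_cotProj.continuous).mem_nhds hx] with η hη
  rw [← inv_cpar, cpar]
  change _ = inv (mk Λ (cotParam φ (cotCoord φ η)))
  rw [cotParam_cotCoord hφ hη]

/-- Local inverses of `mk` lift both factors to `T*M`. There `((q, p), (q', p')) ↦ (q, p + p')` is
smooth on a full neighbourhood, and it induces the product wherever the base points agree. -/
theorem contMDiffOn_mul : ContMDiffOn ((𝓡 (cotDim n)).prod (𝓡 (cotDim n))) (𝓡 (cotDim n)) ∞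
    (fun p : LagQuot Λ × LagQuot Λ => mul p.1 p.2) {p | proj p.1 = proj p.2} := by
  rintro ⟨b, c⟩ hbc
  obtain ⟨ξ, rfl⟩ := CotQuot.mk_surjective b
  obtain ⟨η, rfl⟩ := CotQuot.mk_surjective c
  have hbase : ξ.1 = η.1 := hbc
  have hφ := IsManifold.chart_mem_maximalAtlas (I := 𝓡 n) (n := ∞) ξ.1
  have hx := mem_chart_source (Vec n) ξ.1
  set φ := chartAt (Vec n) ξ.1
  have hy : η.1 ∈ φ.source := hbase ▸ hx
  have hl := isLocalDiffeomorph_mk Λ ξ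
  have hl' := isLocalDiffeomorph_mk Λ η
  have e1 : hl.localInverse (mk Λ ξ) = ξ := hl.localInverse_left_inv hl.localInverse_mem_target
  have e2 : hl'.localInverse (mk Λ η) = η := hl'.localInverse_left_inv hl'.localInverse_mem_target
  have h1 : ContMDiffAt (𝓡 (cotDim n)) 𝓘(ℝ, Vec n × Covec n) ∞
      (fun b => cotCoord φ (hl.localInverse b)) (mk Λ ξ) :=
    ContMDiffAt.comp (g := cotCoord φ) _ (by rw [e1]; exact contMDiffAt_cotCoord hφ hx)
      hl.localInverse_contMDiffAt
  have h2 : ContMDiffAt (𝓡 (cotDim n)) 𝓘(ℝ, Vec n × Covec n) ∞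
      (fun b => cotCoord φ (hl'.localInverse b)) (mk Λ η) :=
    ContMDiffAt.comp (g := cotCoord φ) _ (by rw [e2]; exact contMDiffAt_cotCoord hφ hy)
      hl'.localInverse_contMDiffAt
  have h3 : ContMDiffAt ((𝓡 (cotDim n)).prod (𝓡 (cotDim n)))
      𝓘(ℝ, (Vec n × Covec n) × (Vec n × Covec n)) ∞
      (fun p : LagQuot Λ × LagQuot Λ => (cotCoord φ (hl.localInverse p.1),
        cotCoord φ (hl'.localInverse p.2))) (mk Λ ξ, mk Λ η) :=
    (h1.comp (mk Λ ξ, mk Λ η) contMDiffAt_fst).prodMk_space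
      (h2.comp (mk Λ ξ, mk Λ η) contMDiffAt_snd)
  have h4 : ContDiff ℝ ∞ (fun w : (Vec n × Covec n) × (Vec n × Covec n) =>
      (w.1.1, w.1.2 + w.2.2)) := by fun_prop
  have h5 := h4.contDiffAt.contMDiffAt.comp (mk Λ ξ, mk Λ η) h3
  have h6 : ContMDiffAt ((𝓡 (cotDim n)).prod (𝓡 (cotDim n))) (𝓡 (cotDim n)) ∞
      (fun p : LagQuot Λ × LagQuot Λ => cpar Λ φ ((cotCoord φ (hl.localInverse p.1)).1,
        (cotCoord φ (hl.localInverse p.1)).2 + (cotCoord φ (hl'.localInverse p.2)).2))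
      (mk Λ ξ, mk Λ η) := by
    refine ContMDiffAt.comp (g := cpar Λ φ) _ (contMDiffAt_cpar hφ ?_) h5
    change φ (hl.localInverse (mk Λ ξ)).1 ∈ φ.target
    rw [e1]
    exact φ.map_source hx
  refine h6.contMDiffWithinAt.congr_of_eventuallyEq_of_mem ?_ hbc
  have hs : ∀ᶠ p : LagQuot Λ × LagQuot Λ in 𝓝 (mk Λ ξ, mk Λ η), proj p.1 ∈ φ.source :=
    (CotQuot.continuous_proj.comp continuous_fst).continuousAt.eventually
      (φ.open_source.mem_nhds hx)
  filter_upwards [self_mem_nhdsWithin, mem_nhdsWithin_of_mem_nhds hs,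
    mem_nhdsWithin_of_mem_nhds
      (continuousAt_fst.eventually hl.localInverse_eventuallyEq_right),
    mem_nhdsWithin_of_mem_nhds
      (continuousAt_snd.eventually hl'.localInverse_eventuallyEq_right)] with p hp hps hp1 hp2
  have hp1' : mk Λ (hl.localInverse p.1) = p.1 := hp1
  have hp2' : mk Λ (hl'.localInverse p.2) = p.2 := hp2
  have hb1 : (hl.localInverse p.1).1 = proj p.1 := congrArg CotQuot.proj hp1'
  have hb2 : (hl'.localInverse p.2).1 = proj p.1 := (congrArg CotQuot.proj hp2').trans hp.symm
  rw [← mul_cpar]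
  have e3 : cpar Λ φ ((cotCoord φ (hl.localInverse p.1)).1,
      (cotCoord φ (hl.localInverse p.1)).2) = p.1 := by
    rw [cpar, Prod.mk.eta, cotParam_cotCoord hφ (by rw [hb1]; exact hps), hp1']
  have e4 : cpar Λ φ ((cotCoord φ (hl.localInverse p.1)).1,
      (cotCoord φ (hl'.localInverse p.2)).2) = p.2 := by
    have e5 : (cotCoord φ (hl.localInverse p.1)).1 = (cotCoord φ (hl'.localInverse p.2)).1 :=
      congrArg φ (hb1.trans hb2.symm)
    rw [cpar, e5, Prod.mk.eta, cotParam_cotCoord hφ (by rw [hb2]; exact hps), hp2']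
  rw [e3, e4]

/-- Between the chart of the quotient over `φ` and `φ` itself, the projection is literally `(q, p) ↦
q`, with complement the space of covectors. -/
theorem isSubmersion_proj : Manifold.IsSubmersion (𝓡 (cotDim n)) (𝓡 n) ∞
    (proj : LagQuot Λ → M) := by
  refine ⟨Covec n, inferInstance, inferInstance, fun b => ?_⟩
  obtain ⟨ξ, rfl⟩ := CotQuot.mk_surjective b
  obtain ⟨φ, hφ, hx⟩ := exists_isLatticeChart Λ ξ.1
  refine Manifold.IsSubmersionAtOfComplement.mk_of_continuousAt
    CotQuot.continuous_proj.continuousAt (cotEquiv n).symm (chart hφ (cotCoord φ ξ).2) φ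
    (CotQuot.mk_mem_boxParam_target (exists_isLatticeChart Λ) hφ hx) hx
    (chart_mem_maximalAtlas hφ _) hφ.1 ?_
  intro y hy
  have hy' : y ∈ (chart hφ (cotCoord φ ξ).2).target := by simpa using hy
  exact φ.right_inv (mem_chart_target hφ _ hy').1

variable (Λ) in
/-- The Lie groupoid `T*M/Λ`. -/
def groupoid : LieGroupoid n M where
  Arrow := LagQuot Λ
  dim := cotDim n
  src := proj
  tgt := proj
  unit x := mk Λ ⟨x, 0⟩
  mul := mul
  inv := inv
  src_unit _ := rfl
  tgt_unit _ := rfl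
  src_mul _ _ _ := rfl
  tgt_mul _ _ h := h.symm
  mul_assoc g h k hgh hhk := by
    obtain ⟨⟨x, a⟩, rfl⟩ := CotQuot.mk_surjective g
    obtain ⟨⟨y, b⟩, rfl⟩ := CotQuot.mk_surjective h
    obtain ⟨⟨z, c⟩, rfl⟩ := CotQuot.mk_surjective k
    obtain rfl : x = y := hgh
    obtain rfl : x = z := hhk
    rw [mul_mk, mul_mk, mul_mk, mul_mk, add_assoc]
  unit_mul g := by
    obtain ⟨⟨x, a⟩, rfl⟩ := CotQuot.mk_surjective g
    exact (mul_mk (0 : CotangentSpace n M x) a).trans (by rw [zero_add])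
  mul_unit g := by
    obtain ⟨⟨x, a⟩, rfl⟩ := CotQuot.mk_surjective g
    exact (mul_mk a (0 : CotangentSpace n M x)).trans (by rw [add_zero])
  src_inv _ := rfl
  tgt_inv _ := rfl
  inv_mul g := by
    obtain ⟨⟨x, a⟩, rfl⟩ := CotQuot.mk_surjective g
    rw [inv_mk, mul_mk, neg_add_cancel]
    rfl
  mul_inv g := by
    obtain ⟨⟨x, a⟩, rfl⟩ := CotQuot.mk_surjective g
    rw [inv_mk, mul_mk, add_neg_cancel]
    rfl
  src_submersion := isSubmersion_proj
  tgt_submersion := isSubmersion_proj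
  unit_smooth := contMDiff_mk.comp zeroSection_contMDiff
  inv_smooth := contMDiff_inv
  mul_smooth := contMDiffOn_mul

end LagQuot

end QuotientGroupoid

end

end PoissonGeom

/-! ### `T*M/Λ` as a proper symplectic integration -/

namespace PoissonGeom

noncomputable section

open Set Filter

section QuotientIntegration

variable {n : ℕ} {M : Type u} [TopologicalSpace M] [ChartedSpace (EuclideanSpace ℝ (Fin n)) M]
  [IsManifold (𝓡 n) ∞ M] {φ : OpenPartialHomeomorph M (Vec n)}

namespace LagQuot

variable {Λ : LagrangianLattice n M}

theorem exists_cpar_pair {b c : LagQuot Λ} (h : proj b = proj c) :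
    ∃ (φ : OpenPartialHomeomorph M (Vec n)) (u : Vec n) (p p' : Covec n),
      φ ∈ IsManifold.maximalAtlas (𝓡 n) ∞ M ∧ u ∈ φ.target ∧ b = cpar Λ φ (u, p) ∧
      c = cpar Λ φ (u, p') := by
  have hφ := IsManifold.chart_mem_maximalAtlas (I := 𝓡 n) (n := ∞) (proj b)
  have hx := mem_chart_source (Vec n) (proj b)
  obtain ⟨⟨u, p⟩, hz, hu, hb⟩ := exists_cpar b hx hφ
  obtain ⟨⟨u', p'⟩, hz', hu', hc⟩ := exists_cpar c (by rw [← h]; exact hx) hφ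
  obtain rfl : u = u' := hu.symm.trans ((congrArg _ h).trans hu')
  exact ⟨_, u, p, p', hφ, hz, hb, hc⟩

theorem tderiv_cpar_comp {X : Type*} [NormedAddCommGroup X] [NormedSpace ℝ X]
    (hφ : φ ∈ IsManifold.maximalAtlas (𝓡 n) ∞ M) {l : X → Vec n × Covec n} {w : X}
    {l' : X →L[ℝ] Vec n × Covec n} (hl : HasFDerivAt l l' w) (hz : (l w).1 ∈ φ.target) (v : X) :
    tderiv 𝓘(ℝ, X) (𝓡 (cotDim n)) (fun w => cpar Λ φ (l w)) w v = dcpar Λ φ (l w) (l' v) := by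
  rw [tderiv_comp_apply (g := cpar Λ φ) (f := l) (I' := 𝓘(ℝ, Vec n × Covec n))
    (mdifferentiableAt_cpar hφ hz) hl.differentiableAt.mdifferentiableAt, tderiv_eq_fderiv,
    hl.fderiv]

/-- The map `(u, p, p') ↦ (cpar (u, p), cpar (u, p'))` takes values in composable pairs and its
product is `cpar (u, p + p')`. The chain rule along it determines every derivative `D` of the
product on the vectors in question. -/
theorem mfderiv_mul_cpar (hφ : φ ∈ IsManifold.maximalAtlas (𝓡 n) ∞ M) {u : Vec n}
    (hu : u ∈ φ.target) (p p' : Covec n)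
    {D : Vec (cotDim n) × Vec (cotDim n) →L[ℝ] Vec (cotDim n)}
    (hD : HasMFDerivWithinAt ((𝓡 (cotDim n)).prod (𝓡 (cotDim n))) (𝓡 (cotDim n))
      (fun q : LagQuot Λ × LagQuot Λ => mul q.1 q.2) {q | proj q.1 = proj q.2}
      (cpar Λ φ (u, p), cpar Λ φ (u, p')) D) (v : Vec n) (a a' : Covec n) :
    D (dcpar Λ φ (u, p) (v, a), dcpar Λ φ (u, p') (v, a')) =
      dcpar Λ φ (u, p + p') (v, a + a') := by
  let w₀ : Vec n × Covec n × Covec n := (u, p, p')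
  let pr₀ := ContinuousLinearMap.fst ℝ (Vec n) (Covec n × Covec n)
  let pr₁ := (ContinuousLinearMap.fst ℝ (Covec n) (Covec n)).comp
    (ContinuousLinearMap.snd ℝ (Vec n) (Covec n × Covec n))
  let pr₂ := (ContinuousLinearMap.snd ℝ (Covec n) (Covec n)).comp
    (ContinuousLinearMap.snd ℝ (Vec n) (Covec n × Covec n))
  have l1 : HasFDerivAt (fun w : Vec n × Covec n × Covec n => (w.1, w.2.1)) (pr₀.prod pr₁) w₀ :=
    (pr₀.prod pr₁).hasFDerivAt
  have l2 : HasFDerivAt (fun w : Vec n × Covec n × Covec n => (w.1, w.2.2)) (pr₀.prod pr₂) w₀ :=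
    (pr₀.prod pr₂).hasFDerivAt
  have l3 : HasFDerivAt (fun w : Vec n × Covec n × Covec n => (w.1, w.2.1 + w.2.2))
      (pr₀.prod (pr₁ + pr₂)) w₀ := (pr₀.prod (pr₁ + pr₂)).hasFDerivAt
  have d1 : MDifferentiableAt 𝓘(ℝ, Vec n × Covec n × Covec n) (𝓡 (cotDim n))
      (fun w : Vec n × Covec n × Covec n => cpar Λ φ (w.1, w.2.1)) w₀ :=
    MDifferentiableAt.comp (g := cpar Λ φ) w₀ (mdifferentiableAt_cpar hφ (z := (u, p)) hu)
      l1.differentiableAt.mdifferentiableAt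
  have d2 : MDifferentiableAt 𝓘(ℝ, Vec n × Covec n × Covec n) (𝓡 (cotDim n))
      (fun w : Vec n × Covec n × Covec n => cpar Λ φ (w.1, w.2.2)) w₀ :=
    MDifferentiableAt.comp (g := cpar Λ φ) w₀ (mdifferentiableAt_cpar hφ (z := (u, p')) hu)
      l2.differentiableAt.mdifferentiableAt
  have h1 := d1.hasMFDerivAt.prodMk d2.hasMFDerivAt
  have h2 := HasMFDerivWithinAt.comp (s := univ)
    (u := {q : LagQuot Λ × LagQuot Λ | proj q.1 = proj q.2}) w₀ hD h1.hasMFDerivWithinAt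
    (fun w _ => rfl)
  rw [hasMFDerivWithinAt_univ] at h2
  have h3 := h2.mfderiv
  have h4 : ((fun q : LagQuot Λ × LagQuot Λ => mul q.1 q.2) ∘
      fun w : Vec n × Covec n × Covec n => (cpar Λ φ (w.1, w.2.1), cpar Λ φ (w.1, w.2.2))) =
      fun w => cpar Λ φ (w.1, w.2.1 + w.2.2) := funext fun w => mul_cpar _ _ _
  rw [h4] at h3
  have f1 := tderiv_cpar_comp (Λ := Λ) hφ l1 hu (v, a, a')
  have f2 := tderiv_cpar_comp (Λ := Λ) hφ l2 hu (v, a, a')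
  have f3 := tderiv_cpar_comp (Λ := Λ) hφ l3 hu (v, a, a')
  have h5 : D (tderiv 𝓘(ℝ, Vec n × Covec n × Covec n) (𝓡 (cotDim n))
      (fun w : Vec n × Covec n × Covec n => cpar Λ φ (w.1, w.2.1)) w₀ (v, a, a'),
      tderiv 𝓘(ℝ, Vec n × Covec n × Covec n) (𝓡 (cotDim n))
      (fun w : Vec n × Covec n × Covec n => cpar Λ φ (w.1, w.2.2)) w₀ (v, a, a')) =
      tderiv 𝓘(ℝ, Vec n × Covec n × Covec n) (𝓡 (cotDim n))
      (fun w : Vec n × Covec n × Covec n => cpar Λ φ (w.1, w.2.1 + w.2.2)) w₀ (v, a, a') :=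
    (DFunLike.congr_fun h3 (v, a, a')).symm
  rw [f1, f2, f3] at h5
  exact h5

/-- Composable tangent vectors have the same base component, the product adds their fibre
components, and `b.2 a.1 - a.2 b.1` is additive in the fibre components when the base components are
fixed. -/
theorem form_isMultiplicative (Λ : LagrangianLattice n M) :
    (groupoid Λ).IsMultiplicative (form Λ) := by
  intro b c hbc D hD v₁ v₂ w₁ w₂ h₁ h₂
  obtain ⟨φ, u, p, p', hφ, hu, rfl, rfl⟩ := exists_cpar_pair (Λ := Λ) (b := b) (c := c) hbc
  obtain ⟨⟨x₁, a₁⟩, rfl⟩ := dcpar_surjective (Λ := Λ) hφ (z := (u, p)) hu v₁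
  obtain ⟨⟨x₂, a₂⟩, rfl⟩ := dcpar_surjective (Λ := Λ) hφ (z := (u, p)) hu v₂
  obtain ⟨⟨y₁, b₁⟩, rfl⟩ := dcpar_surjective (Λ := Λ) hφ (z := (u, p')) hu w₁
  obtain ⟨⟨y₂, b₂⟩, rfl⟩ := dcpar_surjective (Λ := Λ) hφ (z := (u, p')) hu w₂
  obtain rfl : x₁ = y₁ := tderiv_proj_dcpar_injective (Λ := Λ) hφ hu h₁
  obtain rfl : x₂ = y₂ := tderiv_proj_dcpar_injective (Λ := Λ) hφ hu h₂
  change (form Λ).pair (mul (cpar Λ φ (u, p)) (cpar Λ φ (u, p')))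
      (D (dcpar Λ φ (u, p) (x₁, a₁), dcpar Λ φ (u, p') (x₁, b₁)))
      (D (dcpar Λ φ (u, p) (x₂, a₂), dcpar Λ φ (u, p') (x₂, b₂))) =
    (form Λ).pair (cpar Λ φ (u, p)) (dcpar Λ φ (u, p) (x₁, a₁)) (dcpar Λ φ (u, p) (x₂, a₂)) +
    (form Λ).pair (cpar Λ φ (u, p')) (dcpar Λ φ (u, p') (x₁, b₁)) (dcpar Λ φ (u, p') (x₂, b₂))
  have e := congrArg₂ ((form Λ).pair (cpar Λ φ (u, p + p')) · ·)
    (mfderiv_mul_cpar hφ hu p p' hD x₁ a₁ b₁) (mfderiv_mul_cpar hφ hu p p' hD x₂ a₂ b₂)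
  rw [mul_cpar]
  refine e.trans ?_
  rw [form_dcpar hφ (z := (u, p)) hu, form_dcpar hφ (z := (u, p')) hu,
    form_dcpar hφ (z := (u, p + p')) hu]
  simp only [add_apply]
  ring

theorem isConnected_proj_preimage (x : M) : IsConnected ((proj : LagQuot Λ → M) ⁻¹' {x}) := by
  have hφ := IsManifold.chart_mem_maximalAtlas (I := 𝓡 n) (n := ∞) x
  have hx := mem_chart_source (Vec n) x
  set φ := chartAt (Vec n) x
  have h : (proj : LagQuot Λ → M) ⁻¹' {x} = range fun p : Covec n => cpar Λ φ (φ x, p) := by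
    ext b
    constructor
    · intro hb
      have hb' : proj b = x := hb
      obtain ⟨⟨u, p⟩, -, hu, rfl⟩ := exists_cpar b (by rw [hb']; exact hx) hφ
      rw [hb'] at hu
      exact ⟨p, by rw [hu]⟩
    · rintro ⟨p, rfl⟩
      exact φ.left_inv hx
  rw [h]
  apply isConnected_range
  rw [continuous_iff_continuousAt]
  intro p
  exact ContinuousAt.comp (g := cpar Λ φ)
    (contMDiffAt_cpar hφ (z := (φ x, p)) (φ.map_source hx)).continuousAt
    (Continuous.prodMk_right (φ x)).continuousAt

/-- A function pulled back from the base has zero derivative along the fibres. Pairing its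
Hamiltonian vector with all vertical vectors therefore gives zero, and these pairings read off the
base component. -/
theorem form_vertical (hφ : φ ∈ IsManifold.maximalAtlas (𝓡 n) ∞ M) {z : Vec n × Covec n}
    (hz : z.1 ∈ φ.target) (f : C^∞⟮𝓡 n, M; ℝ⟯) {v : Vec n × Covec n}
    (h : ∀ w, (form Λ).pair (cpar Λ φ z) (dcpar Λ φ z v) w =
      -tderiv (𝓡 (cotDim n)) 𝓘(ℝ, ℝ) (fun b : LagQuot Λ => f (proj b)) (cpar Λ φ z) w) :
    v.1 = 0 := by
  ext i
  have h1 := h (dcpar Λ φ z (0, (EuclideanSpace.proj i : Vec n →L[ℝ] ℝ)))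
  rw [form_dcpar hφ hz, tderiv_comp_apply (g := f)
    ((f.contMDiff.mdifferentiable (by simp)) _) (mdifferentiable_proj _),
    tderiv_proj_dcpar hφ hz] at h1
  simpa using h1

/-- Both components are the projection, so a limit in `M × M` is on the diagonal. Over a lattice
chart each class has a representative with coefficients in the compact cube `[0, 1]^n`, obtained by
fractional parts; an ultrafilter converges there, and its limit projects to the quotient. -/
theorem isProperMap_proj [T2Space M] : IsProperMap (fun b : LagQuot Λ => (proj b, proj b)) := by
  rw [isProperMap_iff_ultrafilter]
  refine ⟨CotQuot.continuous_proj.prodMk CotQuot.continuous_proj, fun 𝒰 y hy => ?_⟩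
  obtain ⟨x, x'⟩ := y
  have h1 : Tendsto (proj : LagQuot Λ → M) 𝒰 (𝓝 x) := (continuous_fst.tendsto (x, x')).comp hy
  have h2 : Tendsto (proj : LagQuot Λ → M) 𝒰 (𝓝 x') := (continuous_snd.tendsto (x, x')).comp hy
  obtain rfl : x = x' := tendsto_nhds_unique h1 h2
  obtain ⟨φ, hφ, hx⟩ := exists_isLatticeChart Λ x
  let cov : (Fin n → ℝ) → Covec n := fun c =>
    ∑ i, c i • (EuclideanSpace.proj i : Vec n →L[ℝ] ℝ)
  have hcov : ∀ c i, cov c (stdVec i) = c i := by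
    intro c i
    simp [cov, stdVec]
  have hcovc : Continuous cov := by fun_prop
  have hrep : ∀ b : LagQuot Λ, proj b ∈ φ.source → ∃ c ∈ Set.Icc (0 : Fin n → ℝ) 1,
      b = cpar Λ φ (φ (proj b), cov c) := by
    intro b hb
    obtain ⟨⟨u, p⟩, hz, hu, rfl⟩ := exists_cpar b hb hφ.1
    refine ⟨fun i => Int.fract (p (stdVec i)), ⟨fun i => Int.fract_nonneg _,
      fun i => (Int.fract_lt_one _).le⟩, ?_⟩
    rw [hu]
    refine CotQuot.mk_eq.2 ((CotQuot.rel_cotParam hφ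
      (w := (u, cov fun i => Int.fract (p (stdVec i)))) hz hz).2 ⟨rfl, fun i => ⟨⌊p (stdVec i)⌋, ?_⟩⟩)
    change p (stdVec i) - cov _ (stdVec i) = _
    rw [hcov, Int.self_sub_fract]
  classical
  -- The value `0` off the chart domain is immaterial: the ultrafilter eventually lies over the
  -- domain.
  let r : LagQuot Λ → Fin n → ℝ := fun b =>
    if h : proj b ∈ φ.source then (hrep b h).choose else 0
  have hev : ∀ᶠ b in (𝒰 : Filter (LagQuot Λ)), proj b ∈ φ.source :=
    h1.eventually (φ.open_source.mem_nhds hx)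
  have hr : ∀ b, proj b ∈ φ.source → r b ∈ Set.Icc (0 : Fin n → ℝ) 1 ∧
      b = cpar Λ φ (φ (proj b), cov (r b)) := by
    intro b hb
    simp only [r, dif_pos hb]
    exact (hrep b hb).choose_spec
  obtain ⟨c, -, hc⟩ := isCompact_Icc.ultrafilter_le_nhds (𝒰.map r)
    (le_principal_iff.2 (hev.mono fun b hb => (hr b hb).1))
  have hc' : Tendsto r 𝒰 (𝓝 c) := hc
  refine ⟨cpar Λ φ (φ x, cov c), ?_, ?_⟩
  · rw [proj_cpar]
    exact congrArg (fun y => (y, y)) (φ.left_inv hx)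
  · have h3 : Tendsto (fun b => (φ (proj b), cov (r b))) 𝒰 (𝓝 (φ x, cov c)) :=
      ((φ.continuousAt hx).tendsto.comp h1).prodMk_nhds ((hcovc.tendsto c).comp hc')
    have h4 : Tendsto (fun b => cpar Λ φ (φ (proj b), cov (r b))) 𝒰
        (𝓝 (cpar Λ φ (φ x, cov c))) :=
      (contMDiffAt_cpar hφ.1 (z := (φ x, cov c)) (φ.map_source hx)).continuousAt.tendsto.comp h3
    have h5 : Tendsto id (𝒰 : Filter (LagQuot Λ)) (𝓝 (cpar Λ φ (φ x, cov c))) :=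
      h4.congr' (hev.mono fun b hb => (hr b hb).2.symm)
    exact h5

/-- As `mk` is an open quotient map, it suffices that inequivalence is an open relation. Over
different base points this is the Hausdorff property of `M`; over the same one, some coefficient of
the difference is not an integer, which persists because `ℤ` is closed in `ℝ`. -/
theorem t2Space [T2Space M] (Λ : LagrangianLattice n M) : T2Space (LagQuot Λ) := by
  have hq : IsOpenQuotientMap (mk Λ) :=
    ⟨CotQuot.mk_surjective, CotQuot.continuous_mk, CotQuot.isOpenMap_mk (exists_isLatticeChart Λ)⟩
  rw [t2Space_iff_of_isOpenQuotientMap hq, ← isOpen_compl_iff, isOpen_iff_mem_nhds]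
  rintro ⟨ξ, η⟩ hne
  have hcont : Continuous fun η : CotangentBundle n M => η.1 := contMDiff_cotProj.continuous
  by_cases hb : ξ.1 = η.1
  · obtain ⟨φ, hφ, hx⟩ := exists_isLatticeChart Λ ξ.1
    have hy : η.1 ∈ φ.source := hb ▸ hx
    have h1 : ¬ Λ.Rel ξ η := fun h => hne (CotQuot.mk_eq.2 h)
    rw [CotQuot.rel_iff_cotCoord hφ hx hy] at h1
    have h2 : ¬ CotQuot.IsIntegral ((cotCoord φ ξ).2 - (cotCoord φ η).2) :=
      fun h => h1 ⟨congrArg φ hb, h⟩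
    obtain ⟨i, hi⟩ := not_forall.1 h2
    have hc : ContinuousAt (fun p : CotangentBundle n M × CotangentBundle n M =>
        (cotCoord φ p.1).2 (stdVec i) - (cotCoord φ p.2).2 (stdVec i)) (ξ, η) := by
      have e1 : ContinuousAt (fun p : CotangentBundle n M × CotangentBundle n M =>
          (cotCoord φ p.1).2) (ξ, η) :=
        continuousAt_snd.comp (ContinuousAt.comp (g := cotCoord φ) (f := Prod.fst) (x := (ξ, η))
          (contMDiffAt_cotCoord hφ.1 hx).continuousAt continuousAt_fst)
      have e2 : ContinuousAt (fun p : CotangentBundle n M × CotangentBundle n M =>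
          (cotCoord φ p.2).2) (ξ, η) :=
        continuousAt_snd.comp (ContinuousAt.comp (g := cotCoord φ) (f := Prod.snd) (x := (ξ, η))
          (contMDiffAt_cotCoord hφ.1 hy).continuousAt continuousAt_snd)
      exact (e1.clm_apply continuousAt_const).sub (e2.clm_apply continuousAt_const)
    have hcl : IsOpen (range ((↑) : ℤ → ℝ))ᶜ := Int.isClosedEmbedding_coe_real.isClosed_range.isOpen_compl
    have hmem : (cotCoord φ ξ).2 (stdVec i) - (cotCoord φ η).2 (stdVec i) ∈
        (range ((↑) : ℤ → ℝ))ᶜ := by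
      rintro ⟨m, hm⟩
      exact hi ⟨m, hm.symm⟩
    filter_upwards [hc (hcl.mem_nhds hmem),
      (hcont.comp continuous_fst).continuousAt.eventually (φ.open_source.mem_nhds hx),
      (hcont.comp continuous_snd).continuousAt.eventually (φ.open_source.mem_nhds hy)]
      with p hp hp1 hp2 hp3
    obtain ⟨m, hm⟩ := ((CotQuot.rel_iff_cotCoord hφ hp1 hp2).1 (CotQuot.mk_eq.1 hp3)).2 i
    exact hp ⟨m, hm.symm⟩
  · have h1 : IsOpen {p : CotangentBundle n M × CotangentBundle n M | p.1.1 ≠ p.2.1} :=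
      isOpen_ne_fun (hcont.comp continuous_fst) (hcont.comp continuous_snd)
    filter_upwards [h1.mem_nhds (show (ξ, η) ∈ _ from hb)] with p hp hp'
    exact hp (congrArg CotQuot.proj hp')

variable (Λ) in
/-- The proper symplectic integration `T*M/Λ`. -/
def integration [T2Space M] : ProperSymplecticIntegration (PoissonStructure.zero n M) where
  toLieGroupoid := groupoid Λ
  form := form Λ
  hausdorff := t2Space Λ
  src_connected := isConnected_proj_preimage
  symplectic := form_isSymplectic Λ
  multiplicative := form_isMultiplicative Λ
  tgt_poisson f₁ f₂ b X₁ X₂ h₁ h₂ := by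
    obtain ⟨φ, hφ, hx⟩ : ∃ φ ∈ IsManifold.maximalAtlas (𝓡 n) ∞ M, CotQuot.proj b ∈ φ.source :=
      ⟨_, IsManifold.chart_mem_maximalAtlas (I := 𝓡 n) (n := ∞) (CotQuot.proj b),
        mem_chart_source (Vec n) (CotQuot.proj b)⟩
    obtain ⟨z, hz, -, rfl⟩ := exists_cpar (Λ := Λ) b hx hφ
    obtain ⟨v, rfl⟩ := dcpar_surjective (Λ := Λ) hφ hz X₁
    obtain ⟨w, rfl⟩ := dcpar_surjective (Λ := Λ) hφ hz X₂
    have e1 := form_vertical hφ hz f₁ h₁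
    have e2 := form_vertical hφ hz f₂ h₂
    refine (form_dcpar (Λ := Λ) hφ hz v w).trans ?_
    rw [e1, e2, map_zero, map_zero, sub_zero]
    rfl
  proper := isProperMap_proj

theorem isCotangentQuotientMap [T2Space M] (Λ : LagrangianLattice n M) :
    IsCotangentQuotientMap (integration Λ).toSymplecticIntegration Λ.toCotangentLattice (mk Λ) where
  localDiffeo := isLocalDiffeomorph_mk Λ
  surjective := CotQuot.mk_surjective
  src_eq _ := rfl
  tgt_eq _ := rfl
  map_add _ a b := (mul_mk a b).symm
  eq_iff _ _ _ := CotQuot.mk_eq.trans Λ.rel_mk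
  pullback_form ξ v w := form_mk ξ v w

end LagQuot

end QuotientIntegration

end

end PoissonGeom

/-! ### Submersions: adapted charts, local sections, curves in the fibres, constancy along the
fibres -/

namespace PoissonGeom

noncomputable section

open Set Filter

section Submersions

variable {d n : ℕ} {N M : Type*} [TopologicalSpace N] [ChartedSpace (EuclideanSpace ℝ (Fin d)) N]
  [IsManifold (𝓡 d) ∞ N] [TopologicalSpace M] [ChartedSpace (EuclideanSpace ℝ (Fin n)) M]
  [IsManifold (𝓡 n) ∞ M] {s : N → M} {F : Type} [NormedAddCommGroup F] [NormedSpace ℝ F]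

/-- Around each point a submersion has coordinates in which it is the first projection. -/
theorem exists_adapted_chart (hs : Manifold.IsSubmersionOfComplement F (𝓡 d) (𝓡 n) ∞ s) (g : N) :
    ∃ (χ : OpenPartialHomeomorph M (Vec n)) (B : OpenPartialHomeomorph N (Vec n × F)),
      χ ∈ IsManifold.maximalAtlas (𝓡 n) ∞ M ∧ g ∈ B.source ∧
      (∀ g' ∈ B.source, ContMDiffAt (𝓡 d) 𝓘(ℝ, Vec n × F) ∞ B g') ∧
      (∀ w ∈ B.target, ContMDiffAt 𝓘(ℝ, Vec n × F) (𝓡 d) ∞ B.symm w) ∧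
      ∀ g' ∈ B.source, s g' ∈ χ.source ∧ (B g').1 = χ (s g') := by
  have h := hs g
  set Ψ := h.domChart
  have hΨ : Ψ ∈ IsManifold.maximalAtlas (𝓡 d) ∞ N := h.domChart_mem_maximalAtlas
  refine ⟨h.codChart, Ψ.transHomeomorph h.equiv.toHomeomorph, h.codChart_mem_maximalAtlas,
    h.mem_domChart_source, fun g' hg' => ?_, fun w hw => ?_, fun g' hg' => ?_⟩
  · exact h.equiv.contDiff.contDiffAt.contMDiffAt.comp g' (chart_contMDiffAt hΨ hg')
  · exact ContMDiffAt.comp (g := Ψ.symm) (f := h.equiv.symm) w (chart_symm_contMDiffAt hΨ hw)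
      h.equiv.symm.contDiff.contDiffAt.contMDiffAt
  · refine ⟨h.source_subset_preimage_source hg', ?_⟩
    have hg : g' ∈ Ψ.source := hg'
    have hm : Ψ g' ∈ (h.domChart.extend (𝓡 d)).target := by
      simpa using! Ψ.map_source hg
    have h1 := h.writtenInCharts hm
    have h2 : h.codChart (s (Ψ.symm (Ψ g'))) = (h.equiv (Ψ g')).1 := h1
    rw [Ψ.left_inv hg] at h2
    exact h2.symm

theorem adapted_chart_symm {χ : OpenPartialHomeomorph M (Vec n)}
    {B : OpenPartialHomeomorph N (Vec n × F)}
    (h : ∀ g' ∈ B.source, s g' ∈ χ.source ∧ (B g').1 = χ (s g')) {w : Vec n × F}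
    (hw : w ∈ B.target) : s (B.symm w) = χ.symm w.1 ∧ w.1 ∈ χ.target := by
  obtain ⟨h1, h2⟩ := h _ (B.map_target hw)
  rw [B.right_inv hw] at h2
  rw [h2, χ.left_inv h1]
  exact ⟨rfl, χ.map_source h1⟩

theorem submersion_contMDiff (hs : Manifold.IsSubmersionOfComplement F (𝓡 d) (𝓡 n) ∞ s) :
    ContMDiff (𝓡 d) (𝓡 n) ∞ s := by
  intro g
  obtain ⟨χ, B, hχ, hg, hB, -, h⟩ := exists_adapted_chart hs g
  have h1 : ContMDiffAt (𝓡 d) (𝓡 n) ∞ (fun g => (B g).1) g :=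
    contDiffAt_fst.contMDiffAt.comp g (hB g hg)
  have h2 : ContMDiffAt (𝓡 d) (𝓡 n) ∞ (fun g => χ.symm (B g).1) g :=
    ContMDiffAt.comp (g := χ.symm) g (chart_symm_contMDiffAt hχ
      (by rw [(h g hg).2]; exact χ.map_source (h g hg).1)) h1
  refine h2.congr_of_eventuallyEq ?_
  filter_upwards [B.open_source.mem_nhds hg] with g' hg'
  rw [(h g' hg').2, χ.left_inv (h g' hg').1]

/-- Through each point of the total space passes a local section of a submersion. -/
theorem exists_local_section (hs : Manifold.IsSubmersionOfComplement F (𝓡 d) (𝓡 n) ∞ s) (g : N) :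
    ∃ σ : M → N, ContMDiffAt (𝓡 n) (𝓡 d) ∞ σ (s g) ∧ σ (s g) = g ∧
      ∀ᶠ y in 𝓝 (s g), s (σ y) = y := by
  obtain ⟨χ, B, hχ, hg, -, hB, h⟩ := exists_adapted_chart hs g
  have hsg := h g hg
  have e : ((χ (s g), (B g).2) : Vec n × F) = B g := Prod.ext hsg.2.symm rfl
  have ht : ((χ (s g), (B g).2) : Vec n × F) ∈ B.target := by rw [e]; exact B.map_source hg
  have h1 : ContMDiffAt (𝓡 n) 𝓘(ℝ, Vec n × F) ∞ (fun y => (χ y, (B g).2)) (s g) :=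
    (chart_contMDiffAt hχ hsg.1).prodMk_space contMDiffAt_const
  refine ⟨fun y => B.symm (χ y, (B g).2), ContMDiffAt.comp (g := B.symm) (s g) (hB _ ht) h1, ?_, ?_⟩
  · simp only [e, B.left_inv hg]
  · filter_upwards [h1.continuousAt (B.open_target.mem_nhds ht), χ.open_source.mem_nhds hsg.1]
      with y hy hy'
    rw [(adapted_chart_symm h hy).1, χ.left_inv hy']

theorem tderiv_submersion_surjective
    (hs : Manifold.IsSubmersionOfComplement F (𝓡 d) (𝓡 n) ∞ s) (g : N) :
    Function.Surjective (tderiv (𝓡 d) (𝓡 n) s g) := by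
  intro v
  obtain ⟨σ, h1, h2, h3⟩ := exists_local_section hs g
  exact ⟨tderiv (𝓡 n) (𝓡 d) σ (s g) v, tderiv_leftInverse
    ((submersion_contMDiff hs).mdifferentiable (by simp) g) (h1.mdifferentiableAt (by simp)) h2
    h3 v⟩

/-- A vertical vector is the velocity of a curve in the fibre. -/
theorem exists_fibre_curve (hs : Manifold.IsSubmersionOfComplement F (𝓡 d) (𝓡 n) ∞ s) (g : N)
    {v : Vec d} (hv : tderiv (𝓡 d) (𝓡 n) s g v = 0) :
    ∃ σ : ℝ → N, σ 0 = g ∧ MDifferentiableAt 𝓘(ℝ, ℝ) (𝓡 d) σ 0 ∧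
      tderiv 𝓘(ℝ, ℝ) (𝓡 d) σ 0 1 = v ∧ ∀ᶠ τ in 𝓝 (0 : ℝ), s (σ τ) = s g := by
  obtain ⟨χ, B, hχ, hg, hB, hB', h⟩ := exists_adapted_chart hs g
  have hsd := (submersion_contMDiff hs).mdifferentiable (by simp) g
  have hBd := (hB g hg).mdifferentiableAt (by simp)
  set f := tderiv (𝓡 d) 𝓘(ℝ, Vec n × F) B g v with hf
  -- In adapted coordinates a vertical vector has no base component, so the straight line with
  -- velocity `f` stays in the fibre.
  have hf1 : f.1 = 0 := by
    have e1 : tderiv (𝓡 d) (𝓡 n) (fun g => (B g).1) g v = f.1 := by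
      rw [tderiv_comp_apply (g := Prod.fst) (I' := 𝓘(ℝ, Vec n × F))
        differentiableAt_fst.mdifferentiableAt hBd, tderiv_eq_fderiv, fderiv_fst]
      rfl
    have e2 : (fun g => (B g).1) =ᶠ[𝓝 g] fun g => χ (s g) := by
      filter_upwards [B.open_source.mem_nhds hg] with g' hg' using (h g' hg').2
    rw [← e1, tderiv_congr e2, tderiv_comp_apply (chart_mdifferentiableAt hχ (h g hg).1) hsd, hv,
      map_zero]
  have hl : HasFDerivAt (fun τ : ℝ => B g + τ • f)
      ((ContinuousLinearMap.id ℝ ℝ).smulRight f) 0 :=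
    ((ContinuousLinearMap.id ℝ ℝ).smulRight f).hasFDerivAt.const_add _
  have h0 : B g + (0 : ℝ) • f = B g := by simp
  have hBs : MDifferentiableAt 𝓘(ℝ, Vec n × F) (𝓡 d) B.symm (B g + (0 : ℝ) • f) := by
    rw [h0]; exact (hB' _ (B.map_source hg)).mdifferentiableAt (by simp)
  refine ⟨fun τ => B.symm (B g + τ • f), ?_, ?_, ?_, ?_⟩
  · simp only [h0, B.left_inv hg]
  · exact MDifferentiableAt.comp (g := B.symm) (0 : ℝ) hBs hl.differentiableAt.mdifferentiableAt
  · rw [tderiv_comp_apply (g := B.symm) (f := fun τ : ℝ => B g + τ • f) (I' := 𝓘(ℝ, Vec n × F))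
      hBs hl.differentiableAt.mdifferentiableAt, tderiv_eq_fderiv, hl.fderiv, h0]
    have e : ((ContinuousLinearMap.id ℝ ℝ).smulRight f) 1 = f := by simp
    rw [e]
    exact tderiv_leftInverse ((hB' _ (B.map_source hg)).mdifferentiableAt (by simp)) hBd rfl
      (by filter_upwards [B.open_source.mem_nhds hg] with g' hg' using B.left_inv hg') v
  · have hc : B.target ∈ 𝓝 (B g + (0 : ℝ) • f) := by
      rw [h0]; exact B.open_target.mem_nhds (B.map_source hg)
    filter_upwards [hl.continuousAt hc] with τ hτ
    rw [(adapted_chart_symm h hτ).1, Prod.fst_add, Prod.smul_fst, hf1, smul_zero, add_zero,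
      (h g hg).2, χ.left_inv (h g hg).1]

/-- A map from a normed space with vanishing differential is locally constant. -/
theorem eventually_eq_of_tderiv_eq_zero {X : Type*} [NormedAddCommGroup X] [NormedSpace ℝ X]
    {f : X → N} {x : X} (hf : ∀ᶠ y in 𝓝 x, MDifferentiableAt 𝓘(ℝ, X) (𝓡 d) f y ∧
      tderiv 𝓘(ℝ, X) (𝓡 d) f y = 0) : ∀ᶠ y in 𝓝 x, f y = f x := by
  have hχ := IsManifold.chart_mem_maximalAtlas (I := 𝓡 d) (n := ∞) (f x)
  have hx := mem_chart_source (Vec d) (f x)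
  set χ := chartAt (Vec d) (f x)
  have hc := hf.self_of_nhds.1.continuousAt (χ.open_source.mem_nhds hx)
  obtain ⟨r, hr, hb⟩ := Metric.mem_nhds_iff.1 (inter_mem hf hc)
  filter_upwards [Metric.ball_mem_nhds x hr] with y hy
  have hd : ∀ z ∈ Metric.ball x r, HasFDerivAt (fun z => χ (f z)) (0 : X →L[ℝ] Vec d) z := by
    intro z hz
    obtain ⟨⟨h1, h2⟩, h3⟩ := hb hz
    have h4 : MDifferentiableAt 𝓘(ℝ, X) (𝓡 d) (fun z => χ (f z)) z :=
      (chart_mdifferentiableAt hχ h3).comp z h1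
    have h5 := hasFDerivAt_of_tderiv h4
    have h6 : tderiv 𝓘(ℝ, X) 𝓘(ℝ, Vec d) (fun z => χ (f z)) z = 0 := by
      ext1 v
      rw [tderiv_comp_apply (I' := 𝓡 d) (chart_mdifferentiableAt hχ h3) h1, h2]
      simp
    rwa [h6] at h5
  have h7 := (convex_ball x r).is_const_of_fderivWithin_eq_zero (𝕜 := ℝ)
    (fun z hz => (hd z hz).differentiableAt.differentiableWithinAt) (fun z hz =>
      (hd z hz).hasFDerivWithinAt.fderivWithin (Metric.isOpen_ball.uniqueDiffWithinAt hz)) hy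
    (Metric.mem_ball_self hr)
  exact χ.injOn (hb hy).2 hx h7

theorem eq_of_tderiv_eq_zero {X : Type*} [NormedAddCommGroup X] [NormedSpace ℝ X] {S : Set X}
    (hS : IsOpen S) (hS' : IsPreconnected S) {f : X → N}
    (hf : ∀ y ∈ S, MDifferentiableAt 𝓘(ℝ, X) (𝓡 d) f y ∧ tderiv 𝓘(ℝ, X) (𝓡 d) f y = 0) {x y : X}
    (hx : x ∈ S) (hy : y ∈ S) : f x = f y := by
  have : PreconnectedSpace S := isPreconnected_iff_preconnectedSpace.1 hS'
  have hl : IsLocallyConstant (fun z : S => f z) := by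
    rw [IsLocallyConstant.iff_eventually_eq]
    rintro ⟨z, hz⟩
    exact continuousAt_subtype_val.eventually (eventually_eq_of_tderiv_eq_zero
      (by filter_upwards [hS.mem_nhds hz] with w hw using hf w hw))
  exact hl.apply_eq_of_preconnectedSpace ⟨x, hx⟩ ⟨y, hy⟩

/-- A map whose differential vanishes on vertical vectors is constant on connected fibres. -/
theorem eq_of_tderiv_vertical_eq_zero {k : ℕ} {K : Type*} [TopologicalSpace K]
    [ChartedSpace (EuclideanSpace ℝ (Fin k)) K] [IsManifold (𝓡 k) ∞ K]
    (hs : Manifold.IsSubmersionOfComplement F (𝓡 d) (𝓡 n) ∞ s) {f : N → K}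
    (hf : MDifferentiable (𝓡 d) (𝓡 k) f)
    (h0 : ∀ g v, tderiv (𝓡 d) (𝓡 n) s g v = 0 → tderiv (𝓡 d) (𝓡 k) f g v = 0) {x : M}
    (hx : IsPreconnected (s ⁻¹' {x})) {g h : N} (hg : s g = x) (hh : s h = x) : f g = f h := by
  have : PreconnectedSpace (s ⁻¹' {x}) := isPreconnected_iff_preconnectedSpace.1 hx
  have hl : IsLocallyConstant (fun z : s ⁻¹' {x} => f z) := by
    rw [IsLocallyConstant.iff_eventually_eq]
    rintro ⟨g, hg⟩
    obtain ⟨χ, B, hχ, hgB, hB, hB', h⟩ := exists_adapted_chart hs g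
    have hg' : s g = x := hg
    have hcont : Continuous (fun w : F => (((B g).1, w) : Vec n × F)) := by fun_prop
    have htarget : ∀ᶠ w in 𝓝 (B g).2, (((B g).1, w) : Vec n × F) ∈ B.target :=
      hcont.continuousAt.eventually (B.open_target.mem_nhds (B.map_source hgB))
    have hlin : ∀ w : F, HasFDerivAt (fun w : F => (((B g).1, w) : Vec n × F))
        (ContinuousLinearMap.inr ℝ (Vec n) F) w := fun w =>
      (hasFDerivAt_const (B g).1 w).prodMk (hasFDerivAt_id w)
    -- In adapted coordinates the slice with fixed first component parametrizes the fibre near `g`,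
    -- and its tangent vectors are vertical.
    have h1 : ∀ᶠ w in 𝓝 (B g).2, f (B.symm ((B g).1, w)) = f (B.symm ((B g).1, (B g).2)) := by
      apply eventually_eq_of_tderiv_eq_zero (d := k)
      filter_upwards [htarget] with w hw
      have e1 : MDifferentiableAt 𝓘(ℝ, F) (𝓡 d) (fun w => B.symm ((B g).1, w)) w :=
        MDifferentiableAt.comp (g := B.symm) w ((hB' _ hw).mdifferentiableAt (by simp))
          (hlin w).differentiableAt.mdifferentiableAt
      refine ⟨(hf _).comp w e1, ?_⟩
      ext1 v
      rw [tderiv_comp_apply (hf _) e1, zero_apply]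
      apply h0
      rw [← tderiv_comp_apply ((submersion_contMDiff hs).mdifferentiable (by simp) _) e1]
      have e2 : (fun w => s (B.symm ((B g).1, w))) =ᶠ[𝓝 w] fun _ => χ.symm (B g).1 := by
        filter_upwards [hcont.continuousAt.eventually (B.open_target.mem_nhds hw)] with w' hw'
        exact (adapted_chart_symm h hw').1
      rw [tderiv_congr e2, tderiv_const]
      rfl
    have h2 : ∀ᶠ g' in 𝓝 g, f (B.symm ((B g).1, (B g').2)) = f (B.symm ((B g).1, (B g).2)) :=
      (continuousAt_snd.comp (hB g hgB).continuousAt).eventually h1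
    filter_upwards [continuousAt_subtype_val.eventually h2,
      continuousAt_subtype_val.eventually (B.open_source.mem_nhds hgB)] with g' hg1 hg2
    have hs' : s g'.1 = x := g'.2
    have e3 : (B g'.1).1 = (B g).1 := by rw [(h _ hg2).2, (h _ hgB).2, hs', hg']
    rw [← e3, Prod.mk.eta, B.left_inv hg2, e3, Prod.mk.eta, B.left_inv hgB] at hg1
    exact hg1
  exact hl.apply_eq_of_preconnectedSpace ⟨g, hg⟩ ⟨h, hh⟩

end Submersions

end

end PoissonGeom

/-! ### Infinitesimal structure of a symplectic integration: source and target coincide -/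

namespace PoissonGeom

noncomputable section

open Set Filter

variable {n : ℕ} {M : Type u} [TopologicalSpace M] [ChartedSpace (EuclideanSpace ℝ (Fin n)) M]

section SmoothFunctions

variable [T2Space M] [IsManifold (𝓡 n) ∞ M]

/-- A linear function of the coordinates cut off by a bump function. It has to be global because the
Poisson condition on `tgt` speaks of smooth functions on all of `M`. -/
theorem exists_smooth_function_tderiv_eq (x : M) (a : Covec n) :
    ∃ f : C^∞⟮𝓡 n, M; ℝ⟯, tderiv (𝓡 n) 𝓘(ℝ, ℝ) f x = a := by
  have hφ := IsManifold.chart_mem_maximalAtlas (I := 𝓡 n) (n := ∞) x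
  have hx := mem_chart_source (Vec n) x
  set φ := chartAt (Vec n) x with hφ'
  obtain ⟨b⟩ : Nonempty (SmoothBumpFunction (𝓡 n) x) := inferInstance
  set L : Covec n := a.comp (tderiv (𝓡 n) (𝓡 n) φ.symm (φ x)) with hL
  have hs : ContMDiffOn (𝓡 n) 𝓘(ℝ, ℝ) ∞ (fun y => L (φ y)) φ.source := fun y hy =>
    (L.contDiff.contDiffAt.contMDiffAt.comp y (chart_contMDiffAt hφ hy)).contMDiffWithinAt
  refine ⟨⟨fun y => b y • L (φ y), b.contMDiff_smul hs⟩, ?_⟩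
  ext1 v
  have e : (fun y => b y • L (φ y)) =ᶠ[𝓝 x] fun y => L (φ y) := by
    filter_upwards [b.eventuallyEq_one] with y hy
    rw [hy]; simp
  change tderiv (𝓡 n) 𝓘(ℝ, ℝ) (fun y => b y • L (φ y)) x v = a v
  rw [tderiv_congr e, tderiv_comp_apply (g := L) (I' := 𝓡 n)
    L.differentiableAt.mdifferentiableAt (chart_mdifferentiableAt hφ hx)]
  have e2 : tderiv (𝓡 n) 𝓘(ℝ, ℝ) L (φ x) = L := by
    refine (tderiv_eq_fderiv (f := L)).trans L.fderiv
  rw [e2, hL, ContinuousLinearMap.comp_apply, tderiv_symm_tderiv_chart hφ hx]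

end SmoothFunctions

/-- The chain `V ≤ W^⊥ ≤ W` has ends of equal dimension, so it consists of equalities; then `dim W +
dim W^⊥ = dim E` gives the last claim. -/
theorem lagrangian_of_le_orthogonal {E : Type*} [AddCommGroup E] [Module ℝ E]
    [FiniteDimensional ℝ E] {B : LinearMap.BilinForm ℝ E} (hn : B.Nondegenerate)
    {V W : Submodule ℝ E} (h1 : V ≤ B.orthogonal W) (h2 : B.orthogonal W ≤ W)
    (h : Module.finrank ℝ V = Module.finrank ℝ W) :
    V = B.orthogonal W ∧ B.orthogonal W = W ∧ Module.finrank ℝ E = 2 * Module.finrank ℝ W := by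
  have d3 := LinearMap.BilinForm.finrank_orthogonal hn W
  have d4 := Submodule.finrank_mono h1
  have d5 := Submodule.finrank_mono h2
  have d6 := W.finrank_le
  exact ⟨Submodule.eq_of_le_of_finrank_le h1 (by omega),
    Submodule.eq_of_le_of_finrank_le h2 (by omega), by omega⟩

namespace LieGroupoid

variable (G : LieGroupoid n M)

/-- The differential of the source map. -/
def dsrc (g : G.Arrow) : Vec G.dim →L[ℝ] Vec n := tderiv (𝓡 G.dim) (𝓡 n) G.src g

/-- The differential of the target map. -/
def dtgt (g : G.Arrow) : Vec G.dim →L[ℝ] Vec n := tderiv (𝓡 G.dim) (𝓡 n) G.tgt g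

/-- A differential of the multiplication at a composable pair. -/
def tmul (g h : G.Arrow) : Vec G.dim × Vec G.dim →L[ℝ] Vec G.dim :=
  mfderivWithin ((𝓡 G.dim).prod (𝓡 G.dim)) (𝓡 G.dim) (fun p : G.Arrow × G.Arrow => G.mul p.1 p.2)
    {p | G.src p.1 = G.tgt p.2} (g, h)

theorem hasMFDerivWithinAt_mul {g h : G.Arrow} (hgh : G.src g = G.tgt h) :
    HasMFDerivWithinAt ((𝓡 G.dim).prod (𝓡 G.dim)) (𝓡 G.dim)
      (fun p : G.Arrow × G.Arrow => G.mul p.1 p.2) {p | G.src p.1 = G.tgt p.2} (g, h)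
      (G.tmul g h) :=
  ((G.mul_smooth (g, h) hgh).mdifferentiableWithinAt (by simp)).hasMFDerivWithinAt

section Differentials

variable {E' H' N' : Type*} [NormedAddCommGroup E'] [NormedSpace ℝ E'] [TopologicalSpace H']
  {I' : ModelWithCorners ℝ E' H'} [TopologicalSpace N'] [ChartedSpace H' N']
  {a b : N' → G.Arrow} {x : N'}

/-- Composable pairs form a submanifold, so `tmul` carries information only in the directions
tangent to it. The chain rule along maps into composable pairs extracts that information. -/
theorem hasMFDerivAt_mul (ha : MDifferentiableAt I' (𝓡 G.dim) a x)
    (hb : MDifferentiableAt I' (𝓡 G.dim) b x) (hab : ∀ᶠ y in 𝓝 x, G.src (a y) = G.tgt (b y)) :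
    HasMFDerivAt I' (𝓡 G.dim) (fun y => G.mul (a y) (b y)) x ((G.tmul (a x) (b x)).comp
      ((tderiv I' (𝓡 G.dim) a x).prod (tderiv I' (𝓡 G.dim) b x))) := by
  have h1 := ha.hasMFDerivAt.prodMk hb.hasMFDerivAt
  have h2 := HasMFDerivWithinAt.comp (s := {y | G.src (a y) = G.tgt (b y)})
    (u := {p : G.Arrow × G.Arrow | G.src p.1 = G.tgt p.2}) x
    (G.hasMFDerivWithinAt_mul hab.self_of_nhds) h1.hasMFDerivWithinAt (fun y hy => hy)
  exact h2.hasMFDerivAt hab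

theorem mdifferentiableAt_mul (ha : MDifferentiableAt I' (𝓡 G.dim) a x)
    (hb : MDifferentiableAt I' (𝓡 G.dim) b x) (hab : ∀ᶠ y in 𝓝 x, G.src (a y) = G.tgt (b y)) :
    MDifferentiableAt I' (𝓡 G.dim) (fun y => G.mul (a y) (b y)) x :=
  (G.hasMFDerivAt_mul ha hb hab).mdifferentiableAt

theorem tderiv_mul (ha : MDifferentiableAt I' (𝓡 G.dim) a x)
    (hb : MDifferentiableAt I' (𝓡 G.dim) b x) (hab : ∀ᶠ y in 𝓝 x, G.src (a y) = G.tgt (b y))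
    (v : E') : tderiv I' (𝓡 G.dim) (fun y => G.mul (a y) (b y)) x v =
      G.tmul (a x) (b x) (tderiv I' (𝓡 G.dim) a x v, tderiv I' (𝓡 G.dim) b x v) :=
  DFunLike.congr_fun (G.hasMFDerivAt_mul ha hb hab).mfderiv v

theorem contMDiffAt_mul (ha : ContMDiffAt I' (𝓡 G.dim) ∞ a x)
    (hb : ContMDiffAt I' (𝓡 G.dim) ∞ b x) (hab : ∀ᶠ y in 𝓝 x, G.src (a y) = G.tgt (b y)) :
    ContMDiffAt I' (𝓡 G.dim) ∞ (fun y => G.mul (a y) (b y)) x := by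
  have h := ContMDiffWithinAt.comp (s := {y | G.src (a y) = G.tgt (b y)})
    (t := {p : G.Arrow × G.Arrow | G.src p.1 = G.tgt p.2}) x
    (G.mul_smooth (a x, b x) hab.self_of_nhds) (ha.prodMk hb).contMDiffWithinAt (fun y hy => hy)
  exact h.contMDiffAt hab

end Differentials

variable {G} in
theorem IsMultiplicative.pair_tmul {Ω : DiffForm (𝓡 G.dim) G.Arrow 2} (hΩ : G.IsMultiplicative Ω)
    {g h : G.Arrow} (hgh : G.src g = G.tgt h) {v₁ v₂ w₁ w₂ : Vec G.dim}
    (h₁ : G.dsrc g v₁ = G.dtgt h w₁) (h₂ : G.dsrc g v₂ = G.dtgt h w₂) :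
    Ω.pair (G.mul g h) (G.tmul g h (v₁, w₁)) (G.tmul g h (v₂, w₂)) =
      Ω.pair g v₁ v₂ + Ω.pair h w₁ w₂ :=
  hΩ g h hgh (G.tmul g h) (G.hasMFDerivWithinAt_mul hgh) v₁ v₂ w₁ w₂ h₁ h₂

variable [IsManifold (𝓡 n) ∞ M]

theorem contMDiff_src : ContMDiff (𝓡 G.dim) (𝓡 n) ∞ G.src := by
  obtain ⟨F, _, _, h⟩ := G.src_submersion
  exact submersion_contMDiff h

theorem contMDiff_tgt : ContMDiff (𝓡 G.dim) (𝓡 n) ∞ G.tgt := by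
  obtain ⟨F, _, _, h⟩ := G.tgt_submersion
  exact submersion_contMDiff h

theorem mdifferentiable_src : MDifferentiable (𝓡 G.dim) (𝓡 n) G.src :=
  G.contMDiff_src.mdifferentiable (by simp)

theorem mdifferentiable_tgt : MDifferentiable (𝓡 G.dim) (𝓡 n) G.tgt :=
  G.contMDiff_tgt.mdifferentiable (by simp)

theorem mdifferentiable_unit : MDifferentiable (𝓡 n) (𝓡 G.dim) G.unit :=
  G.unit_smooth.mdifferentiable (by simp)

theorem mdifferentiable_inv : MDifferentiable (𝓡 G.dim) (𝓡 G.dim) G.inv :=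
  G.inv_smooth.mdifferentiable (by simp)

theorem dsrc_surjective (g : G.Arrow) : Function.Surjective (G.dsrc g) := by
  obtain ⟨F, _, _, h⟩ := G.src_submersion
  exact tderiv_submersion_surjective h g

theorem dtgt_surjective (g : G.Arrow) : Function.Surjective (G.dtgt g) := by
  obtain ⟨F, _, _, h⟩ := G.tgt_submersion
  exact tderiv_submersion_surjective h g

/-- Differentiate `g · 1_{s(g)} = g`: the unit factor does not move in directions killed by `ds`. -/
theorem tmul_unit_of_dsrc_eq_zero {g : G.Arrow} {v : Vec G.dim} (hv : G.dsrc g v = 0) :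
    G.tmul g (G.unit (G.src g)) (v, 0) = v := by
  have hd : MDifferentiableAt (𝓡 G.dim) (𝓡 G.dim) (fun g => G.unit (G.src g)) g :=
    (G.mdifferentiable_unit _).comp g (G.mdifferentiable_src g)
  have h := G.tderiv_mul (a := fun g => g) (b := fun g => G.unit (G.src g)) (x := g)
    mdifferentiableAt_id hd (.of_forall fun y => (G.tgt_unit _).symm) v
  simp only [G.mul_unit] at h
  rw [tderiv_id, tderiv_comp_apply (G.mdifferentiable_unit _) (G.mdifferentiable_src g)] at h
  change v = G.tmul g _ (v, tderiv _ _ _ _ (G.dsrc g v)) at h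
  rw [hv, map_zero] at h
  exact h.symm

/-- Left translation by `g⁻¹` brings a curve in the target fibre with velocity `w` to the unit at
`s(g)`; `u` is the velocity of the translated curve, and multiplying back by `g` recovers `w`. -/
theorem exists_tmul_unit_of_dtgt_eq_zero {g : G.Arrow} {w : Vec G.dim} (hw : G.dtgt g w = 0) :
    ∃ u, G.dtgt (G.unit (G.src g)) u = 0 ∧ G.tmul g (G.unit (G.src g)) (0, u) = w := by
  obtain ⟨F, _, _, ht⟩ := G.tgt_submersion
  obtain ⟨σ, h0, hσ, hσ', hσt⟩ := exists_fibre_curve ht g hw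
  have hb : MDifferentiableAt 𝓘(ℝ, ℝ) (𝓡 G.dim) (fun τ => G.mul (G.inv g) (σ τ)) 0 :=
    G.mdifferentiableAt_mul (a := fun _ => G.inv g) mdifferentiableAt_const hσ (by
      filter_upwards [hσt] with τ hτ
      rw [hτ, G.src_inv])
  have hbt : ∀ᶠ τ in 𝓝 (0 : ℝ), G.tgt (G.mul (G.inv g) (σ τ)) = G.src g := by
    filter_upwards [hσt] with τ hτ
    rw [G.tgt_mul _ _ (by rw [G.src_inv, hτ]), G.tgt_inv]
  have hb0 : G.mul (G.inv g) (σ 0) = G.unit (G.src g) := by rw [h0, G.inv_mul]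
  refine ⟨tderiv 𝓘(ℝ, ℝ) (𝓡 G.dim) (fun τ => G.mul (G.inv g) (σ τ)) 0 1, ?_, ?_⟩
  · rw [← hb0]
    refine (tderiv_comp_apply (g := G.tgt) (G.mdifferentiable_tgt _) hb 1).symm.trans ?_
    rw [tderiv_congr (g := fun _ => G.src g) hbt, tderiv_const]
    rfl
  · have h := G.tderiv_mul (a := fun _ => g) (b := fun τ => G.mul (G.inv g) (σ τ)) (x := (0 : ℝ))
      (I' := 𝓘(ℝ, ℝ)) mdifferentiableAt_const hb (by filter_upwards [hbt] with τ hτ using hτ.symm) 1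
    rw [tderiv_const, hb0, zero_apply] at h
    rw [← h, ← hσ']
    apply DFunLike.congr_fun (tderiv_congr _)
    filter_upwards [hσt] with τ hτ
    rw [← G.mul_assoc _ _ _ (G.tgt_inv g).symm (by rw [G.src_inv, hτ]), G.mul_inv, ← hτ,
      G.unit_mul]

variable {G} in
-- Write `v` as the product of `(v, 0)` and `w` as the product of `(0, u)` over `g · 1 = g`.
-- Multiplicativity then gives `Ω(v, 0) + Ω(0, u) = 0`.
theorem IsMultiplicative.pair_ker_eq_zero {Ω : DiffForm (𝓡 G.dim) G.Arrow 2}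
    (hΩ : G.IsMultiplicative Ω) {g : G.Arrow} {v w : Vec G.dim} (hv : G.dsrc g v = 0)
    (hw : G.dtgt g w = 0) : Ω.pair g v w = 0 := by
  obtain ⟨u, hu, e⟩ := G.exists_tmul_unit_of_dtgt_eq_zero hw
  have h := hΩ.pair_tmul (g := g) (h := G.unit (G.src g)) (G.tgt_unit _).symm (v₁ := v) (w₁ := 0)
    (v₂ := 0) (w₂ := u) (by rw [hv, map_zero]) (by rw [hu, map_zero])
  rw [G.tmul_unit_of_dsrc_eq_zero hv, e, G.mul_unit] at h
  simpa using h

variable {G} in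
/-- The units of a symplectic groupoid form an isotropic submanifold. -/
theorem IsMultiplicative.pair_unit {Ω : DiffForm (𝓡 G.dim) G.Arrow 2}
    (hΩ : G.IsMultiplicative Ω) (x : M) (v w : Vec n) :
    Ω.pair (G.unit x) (tderiv (𝓡 n) (𝓡 G.dim) G.unit x v)
      (tderiv (𝓡 n) (𝓡 G.dim) G.unit x w) = 0 := by
  have e : ∀ y, G.mul (G.unit y) (G.unit y) = G.unit y := fun y => by
    have := G.mul_unit (G.unit y)
    rwa [G.src_unit] at this
  -- Differentiating `1_y · 1_y = 1_y` exhibits a tangent vector to the units as its own square, so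
  -- multiplicativity makes the pairing equal to twice itself.
  have h1 : ∀ v, tderiv (𝓡 n) (𝓡 G.dim) G.unit x v = G.tmul (G.unit x) (G.unit x)
      (tderiv (𝓡 n) (𝓡 G.dim) G.unit x v, tderiv (𝓡 n) (𝓡 G.dim) G.unit x v) := fun v => by
    have := G.tderiv_mul (a := G.unit) (b := G.unit) (G.mdifferentiable_unit x)
      (G.mdifferentiable_unit x) (.of_forall fun y => by rw [G.src_unit, G.tgt_unit]) v
    rw [← this]
    simp only [e]
  have h2 : ∀ v, G.dsrc (G.unit x) (tderiv (𝓡 n) (𝓡 G.dim) G.unit x v) = v := fun v =>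
    tderiv_leftInverse (G.mdifferentiable_src _) (G.mdifferentiable_unit x) rfl
      (.of_forall G.src_unit) v
  have h3 : ∀ v, G.dtgt (G.unit x) (tderiv (𝓡 n) (𝓡 G.dim) G.unit x v) = v := fun v =>
    tderiv_leftInverse (G.mdifferentiable_tgt _) (G.mdifferentiable_unit x) rfl
      (.of_forall G.tgt_unit) v
  have h := hΩ.pair_tmul (g := G.unit x) (h := G.unit x) (by rw [G.src_unit, G.tgt_unit])
    (v₁ := tderiv (𝓡 n) (𝓡 G.dim) G.unit x v) (w₁ := tderiv (𝓡 n) (𝓡 G.dim) G.unit x v)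
    (v₂ := tderiv (𝓡 n) (𝓡 G.dim) G.unit x w) (w₂ := tderiv (𝓡 n) (𝓡 G.dim) G.unit x w)
    (by rw [h2, h3]) (by rw [h2, h3])
  rw [← h1, ← h1, e] at h
  linarith

end LieGroupoid

namespace SymplecticIntegration

variable [T2Space M] [IsManifold (𝓡 n) ∞ M] (G : SymplecticIntegration (PoissonStructure.zero n M))

theorem pair_nondegenerate (g : G.Arrow) : (G.form.pair g).Nondegenerate := by
  have hl : (G.form.pair g).SeparatingLeft := fun v hv => G.symplectic.nondegenerate g v hv
  refine ⟨hl, fun w hw => hl w fun v => ?_⟩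
  rw [DiffForm.pair_swap, hw, neg_zero]

theorem eq_zero_of_pair {g : G.Arrow} {v : Vec G.dim} (h : ∀ w, G.form.pair g v w = 0) : v = 0 :=
  G.symplectic.nondegenerate g v h

/-- The orthogonal complement of the kernel of the differential of `t` is isotropic. -/
theorem pair_orthogonal_ker_eq_zero {g : G.Arrow} {X₁ X₂ : Vec G.dim}
    (h₁ : ∀ w, G.dtgt g w = 0 → G.form.pair g X₁ w = 0)
    (h₂ : ∀ w, G.dtgt g w = 0 → G.form.pair g X₂ w = 0) : G.form.pair g X₁ X₂ = 0 := by
  obtain ⟨ρ, hρ⟩ := (G.dtgt g).toLinearMap.exists_rightInverse_of_surjective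
    (LinearMap.range_eq_top.2 (G.dtgt_surjective g))
  -- If `X` is orthogonal to `ker dt`, the covector `Ω(X, ·)` factors through `dt`, by means of a
  -- linear right inverse `ρ` of it. So `X` is the Hamiltonian vector of some `f ∘ t`, and the
  -- Poisson condition with zero bracket applies.
  have key : ∀ X : Vec G.dim, (∀ w, G.dtgt g w = 0 → G.form.pair g X w = 0) →
      ∃ f : C^∞⟮𝓡 n, M; ℝ⟯, ∀ Z : Vec G.dim, G.form.pair g X Z =
        -(tderiv (𝓡 G.dim) 𝓘(ℝ, ℝ) (fun a => f (G.tgt a)) g Z) := by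
    intro X hX
    obtain ⟨f, hf⟩ := exists_smooth_function_tderiv_eq (G.tgt g)
      (-(LinearMap.toContinuousLinearMap ((G.form.pair g X).comp ρ)))
    refine ⟨f, fun Z => ?_⟩
    rw [tderiv_comp_apply (I' := 𝓡 n) (f.contMDiff.mdifferentiable (by simp) _)
      (G.mdifferentiable_tgt g), hf]
    change _ = - -(G.form.pair g X (ρ (G.dtgt g Z)))
    have h3 := hX (Z - ρ (G.dtgt g Z)) (by
      have := DFunLike.congr_fun hρ (G.dtgt g Z)
      rw [map_sub]
      exact sub_eq_zero.2 this.symm)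
    rw [map_sub] at h3
    rw [neg_neg]
    exact sub_eq_zero.1 h3
  obtain ⟨f₁, hf₁⟩ := key X₁ h₁
  obtain ⟨f₂, hf₂⟩ := key X₂ h₂
  exact G.tgt_poisson f₁ f₂ g X₁ X₂ hf₁ hf₂

theorem finrank_ker_dsrc (g : G.Arrow) :
    Module.finrank ℝ (LinearMap.ker (G.dsrc g).toLinearMap) + n = G.dim := by
  have h := (G.dsrc g).toLinearMap.finrank_range_add_finrank_ker
  rw [LinearMap.range_eq_top.2 (G.dsrc_surjective g), finrank_top, finrank_euclideanSpace_fin,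
    finrank_euclideanSpace_fin] at h
  omega

theorem finrank_ker_dtgt (g : G.Arrow) :
    Module.finrank ℝ (LinearMap.ker (G.dtgt g).toLinearMap) + n = G.dim := by
  have h := (G.dtgt g).toLinearMap.finrank_range_add_finrank_ker
  rw [LinearMap.range_eq_top.2 (G.dtgt_surjective g), finrank_top, finrank_euclideanSpace_fin,
    finrank_euclideanSpace_fin] at h
  omega

/-- Multiplicativity gives `ker ds ≤ (ker dt)^⊥`, and the Poisson condition gives `(ker dt)^⊥ ≤ ker
dt`. Both kernels have dimension `dim G - n`, so everything coincides. -/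
theorem dim_and_ker (g : G.Arrow) : G.dim = 2 * n ∧
    LinearMap.ker (G.dsrc g).toLinearMap = LinearMap.ker (G.dtgt g).toLinearMap ∧
    (G.form.pair g).orthogonal (LinearMap.ker (G.dsrc g).toLinearMap) =
      LinearMap.ker (G.dsrc g).toLinearMap := by
  have hr : (G.form.pair g).IsRefl := (G.form.pair_isAlt g).isRefl
  have hn := G.pair_nondegenerate g
  set V := LinearMap.ker (G.dsrc g).toLinearMap
  set W := LinearMap.ker (G.dtgt g).toLinearMap
  set W' := (G.form.pair g).orthogonal W
  have h1 : V ≤ W' := fun v hv w hw => by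
    change G.form.pair g w v = 0
    rw [DiffForm.pair_swap, G.multiplicative.pair_ker_eq_zero hv hw, neg_zero]
  -- `W` is the orthogonal of `W'`, and `W'` is isotropic.
  have h2 : W' ≤ W := by
    have e : (G.form.pair g).orthogonal W' = W :=
      LinearMap.BilinForm.orthogonal_orthogonal hn hr W
    rw [← e]
    have h : ∀ v ∈ W', ∀ w, G.dtgt g w = 0 → G.form.pair g v w = 0 := fun v hv w hw => by
      rw [DiffForm.pair_swap, neg_eq_zero]
      exact hv w hw
    exact fun v hv w hw => G.pair_orthogonal_ker_eq_zero (h w hw) (h v hv)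
  have d1 : Module.finrank ℝ V + n = G.dim := G.finrank_ker_dsrc g
  have d2 : Module.finrank ℝ W + n = G.dim := G.finrank_ker_dtgt g
  obtain ⟨e1, e2, e3⟩ := lagrangian_of_le_orthogonal hn h1 h2
    (Nat.add_right_cancel (d1.trans d2.symm))
  have e4 : G.dim = 2 * Module.finrank ℝ W :=
    (finrank_euclideanSpace_fin (𝕜 := ℝ)).symm.trans e3
  refine ⟨by omega, e1.trans e2, ?_⟩
  rw [e1, e2]
  exact e2

theorem dsrc_eq_zero_iff (g : G.Arrow) (v : Vec G.dim) : G.dsrc g v = 0 ↔ G.dtgt g v = 0 :=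
  Submodule.ext_iff.1 (G.dim_and_ker g).2.1 v

/-- Since `dt` vanishes on `ker ds`, the target is constant on each connected source fibre, and that
fibre contains a unit, where source and target agree. -/
theorem tgt_eq_src (g : G.Arrow) : G.tgt g = G.src g := by
  obtain ⟨F, _, _, h⟩ := G.src_submersion
  have := eq_of_tderiv_vertical_eq_zero h G.mdifferentiable_tgt
    (fun g v hv => (G.dsrc_eq_zero_iff g v).1 hv) (G.src_connected (G.src g)).isPreconnected
    (g := g) (h := G.unit (G.src g)) rfl (G.src_unit _)
  rwa [G.tgt_unit] at this

theorem tgt_eq : G.tgt = G.src := funext G.tgt_eq_src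

theorem dtgt_eq (g : G.Arrow) : G.dtgt g = G.dsrc g := by
  unfold LieGroupoid.dtgt LieGroupoid.dsrc
  rw [G.tgt_eq]

theorem pair_vertical {g : G.Arrow} {v w : Vec G.dim} (hv : G.dsrc g v = 0)
    (hw : G.dsrc g w = 0) : G.form.pair g v w = 0 :=
  G.multiplicative.pair_ker_eq_zero hv ((G.dsrc_eq_zero_iff g w).1 hw)

end SymplecticIntegration

end

end PoissonGeom

/-! ### Exponential curves in the fibres and their algebra -/

namespace PoissonGeom

noncomputable section

open Set Filter

variable {n : ℕ} {M : Type u} [TopologicalSpace M] [ChartedSpace (EuclideanSpace ℝ (Fin n)) M]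
  [T2Space M] [IsManifold (𝓡 n) ∞ M]

theorem LieGroupoid.eq_of_mul_inv_eq_unit (G : LieGroupoid n M) {g h : G.Arrow}
    (hs : G.src g = G.src h) (e : G.mul g (G.inv h) = G.unit (G.tgt h)) : g = h := by
  have h1 := G.mul_assoc g (G.inv h) h (by rw [G.tgt_inv, hs]) (G.src_inv h)
  rw [e, G.unit_mul, G.inv_mul, ← hs, G.mul_unit] at h1
  exact h1.symm

namespace SymplecticIntegration

variable (G : SymplecticIntegration (PoissonStructure.zero n M))

theorem composable {g h : G.Arrow} (e : G.src g = G.src h) : G.src g = G.tgt h :=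
  e.trans (G.tgt_eq_src h).symm

/-- Every vector at a product is the product of two vectors with the same projection. -/
theorem exists_tmul_eq {g h : G.Arrow} (e : G.src g = G.src h) (z : Vec G.dim) :
    ∃ z₁ z₂, G.dsrc g z₁ = G.dsrc (G.mul g h) z ∧ G.dsrc h z₂ = G.dsrc (G.mul g h) z ∧
      G.tmul g h (z₁, z₂) = z := by
  have hgh := G.composable e
  have hm := G.src_mul g h hgh
  obtain ⟨F, _, _, hs⟩ := G.src_submersion
  -- With a local section `σ` of the source through `h`, every `k` near `g h` factors smoothly as
  -- `(k σ(s k)⁻¹) · σ(s k)`; differentiating the two factors splits `z`.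
  obtain ⟨σ, hσ, hσh, hσs⟩ := exists_local_section hs h
  have hσd := hσ.mdifferentiableAt (n := ∞) (by simp)
  rw [← hm] at hσd hσs
  rw [← hm] at hσh
  have hsd := G.mdifferentiable_src (G.mul g h)
  have hb : MDifferentiableAt (𝓡 G.dim) (𝓡 G.dim) (fun k => σ (G.src k)) (G.mul g h) :=
    hσd.comp _ hsd
  have hev : ∀ᶠ k in 𝓝 (G.mul g h), G.src (σ (G.src k)) = G.src k :=
    hsd.continuousAt.eventually hσs
  have hib : MDifferentiableAt (𝓡 G.dim) (𝓡 G.dim) (fun k => G.inv (σ (G.src k))) (G.mul g h) :=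
    (G.mdifferentiable_inv _).comp _ hb
  have hk : ∀ᶠ k in 𝓝 (G.mul g h), G.src k = G.tgt (G.inv (σ (G.src k))) := by
    filter_upwards [hev] with k hk
    rw [G.tgt_inv, hk]
  have ha : MDifferentiableAt (𝓡 G.dim) (𝓡 G.dim)
      (fun k => G.mul k (G.inv (σ (G.src k)))) (G.mul g h) :=
    G.mdifferentiableAt_mul (a := fun k => k) mdifferentiableAt_id hib hk
  have hsa : ∀ᶠ k in 𝓝 (G.mul g h), G.src (G.mul k (G.inv (σ (G.src k)))) = G.src k := by
    filter_upwards [hev, hk] with k h1 h2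
    rw [G.src_mul _ _ h2, G.src_inv, G.tgt_eq_src, h1]
  have hsat : ∀ᶠ k in 𝓝 (G.mul g h),
      G.src (G.mul k (G.inv (σ (G.src k)))) = G.tgt (σ (G.src k)) := by
    filter_upwards [hev, hsa] with k h1 h2
    rw [h2, G.tgt_eq_src, h1]
  have a0 : G.mul (G.mul g h) (G.inv (σ (G.src (G.mul g h)))) = g := by
    rw [hσh, G.mul_assoc _ _ _ hgh (G.tgt_inv h).symm, G.mul_inv, ← hgh, G.mul_unit]
  refine ⟨tderiv (𝓡 G.dim) (𝓡 G.dim) (fun k => G.mul k (G.inv (σ (G.src k)))) (G.mul g h) z,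
    tderiv (𝓡 G.dim) (𝓡 G.dim) (fun k => σ (G.src k)) (G.mul g h) z, ?_, ?_, ?_⟩
  · refine (tderiv_comp_apply_of_eq (g := G.src) (G.mdifferentiable_src g) ha a0 z).symm.trans ?_
    exact DFunLike.congr_fun (tderiv_congr hsa) z
  · refine (tderiv_comp_apply_of_eq (g := G.src) (G.mdifferentiable_src h) hb hσh z).symm.trans ?_
    exact DFunLike.congr_fun (tderiv_congr hev) z
  · have h1 := G.tderiv_mul ha hb hsat z
    rw [a0, hσh] at h1
    rw [← h1]
    have h2 : (fun k => G.mul (G.mul k (G.inv (σ (G.src k)))) (σ (G.src k))) =ᶠ[𝓝 (G.mul g h)]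
        fun k => k := by
      filter_upwards [hk, hev] with k h1 h2
      rw [G.mul_assoc _ _ _ h1 (G.src_inv _), G.inv_mul, h2, G.mul_unit]
    rw [tderiv_congr h2, tderiv_id]
    rfl

/-- A curve in the fibre over `x` is exponential for the covector `a` if its velocity is the
Hamiltonian vector of `a`. -/
def IsExpCurve (x : M) (a : Covec n) (γ : ℝ → G.Arrow) (S : Set ℝ) : Prop :=
  ∀ τ ∈ S, G.src (γ τ) = x ∧ MDifferentiableAt 𝓘(ℝ, ℝ) (𝓡 G.dim) γ τ ∧
    ∀ z, G.form.pair (γ τ) (tderiv 𝓘(ℝ, ℝ) (𝓡 G.dim) γ τ 1) z = -a (G.dsrc (γ τ) z)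

variable {G} {x : M} {a b : Covec n} {γ δ : ℝ → G.Arrow} {S T : Set ℝ}

namespace IsExpCurve

theorem mono (h : G.IsExpCurve x a γ S) (hT : T ⊆ S) : G.IsExpCurve x a γ T :=
  fun τ hτ => h τ (hT hτ)

theorem congr (h : G.IsExpCurve x a γ S) (hS : IsOpen S) (e : ∀ τ ∈ S, δ τ = γ τ) :
    G.IsExpCurve x a δ S := by
  intro τ hτ
  have e' : δ =ᶠ[𝓝 τ] γ := by filter_upwards [hS.mem_nhds hτ] with s hs using e s hs
  obtain ⟨h1, h2, h3⟩ := h τ hτ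
  refine ⟨by rw [e τ hτ, h1], h2.congr_of_eventuallyEq e', fun z => ?_⟩
  rw [tderiv_congr e', e τ hτ, h3]

theorem dsrc_velocity (h : G.IsExpCurve x a γ S) (hS : IsOpen S) {τ : ℝ} (hτ : τ ∈ S) :
    G.dsrc (γ τ) (tderiv 𝓘(ℝ, ℝ) (𝓡 G.dim) γ τ 1) = 0 := by
  refine (tderiv_comp_apply (g := G.src) (G.mdifferentiable_src _) (h τ hτ).2.1 1).symm.trans ?_
  rw [tderiv_congr (g := fun _ => x)
    (by filter_upwards [hS.mem_nhds hτ] with s hs using (h s hs).1), tderiv_const]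
  rfl

theorem const (g : G.Arrow) (S : Set ℝ) : G.IsExpCurve (G.src g) 0 (fun _ => g) S := by
  refine fun τ _ => ⟨rfl, mdifferentiableAt_const, fun z => ?_⟩
  rw [tderiv_const]
  simp

/-- Split the test vector `z` into `z₁`, `z₂` with the projection of `z`. Multiplicativity gives
`-a(ds z) - b(ds z)`. -/
theorem mul (h : G.IsExpCurve x a γ S) (h' : G.IsExpCurve x b δ S) (hS : IsOpen S) :
    G.IsExpCurve x (a + b) (fun τ => G.mul (γ τ) (δ τ)) S := by
  intro τ hτ
  have hc : ∀ s ∈ S, G.src (γ s) = G.src (δ s) := fun s hs => by rw [(h s hs).1, (h' s hs).1]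
  have hev : ∀ᶠ s in 𝓝 τ, G.src (γ s) = G.tgt (δ s) := by
    filter_upwards [hS.mem_nhds hτ] with s hs using G.composable (hc s hs)
  refine ⟨by rw [G.src_mul _ _ hev.self_of_nhds, (h' τ hτ).1],
    G.mdifferentiableAt_mul (h τ hτ).2.1 (h' τ hτ).2.1 hev, fun z => ?_⟩
  obtain ⟨z₁, z₂, e₁, e₂, e⟩ := G.exists_tmul_eq (hc τ hτ) z
  rw [G.tderiv_mul (h τ hτ).2.1 (h' τ hτ).2.1 hev, ← e₁]
  nth_rewrite 1 [← e]
  rw [G.multiplicative.pair_tmul hev.self_of_nhds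
    (by rw [G.dtgt_eq, h.dsrc_velocity hS hτ, h'.dsrc_velocity hS hτ])
    (by rw [G.dtgt_eq, e₁, e₂]), (h τ hτ).2.2, (h' τ hτ).2.2, e₂, ← e₁, add_apply]
  ring

/-- The product of the curve with its inverse is constantly a unit, so multiplicativity makes the
two pairings cancel. -/
theorem inv (h : G.IsExpCurve x a γ S) (hS : IsOpen S) :
    G.IsExpCurve x (-a) (fun τ => G.inv (γ τ)) S := by
  have hd : ∀ τ ∈ S, MDifferentiableAt 𝓘(ℝ, ℝ) (𝓡 G.dim) (fun τ => G.inv (γ τ)) τ := fun τ hτ =>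
    (G.mdifferentiable_inv _).comp τ (h τ hτ).2.1
  have hs : ∀ τ ∈ S, G.src (G.inv (γ τ)) = x := fun τ hτ => by
    rw [G.src_inv, G.tgt_eq_src, (h τ hτ).1]
  intro τ hτ
  refine ⟨hs τ hτ, hd τ hτ, fun z => ?_⟩
  have hv : G.dsrc (G.inv (γ τ)) (tderiv 𝓘(ℝ, ℝ) (𝓡 G.dim) (fun τ => G.inv (γ τ)) τ 1) = 0 := by
    refine (tderiv_comp_apply (g := G.src) (G.mdifferentiable_src _) (hd τ hτ) 1).symm.trans ?_
    rw [tderiv_congr (g := fun _ => x)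
      (by filter_upwards [hS.mem_nhds hτ] with s hs' using hs s hs'), tderiv_const]
    rfl
  obtain ⟨z₁, hz₁⟩ := G.dsrc_surjective (γ τ) (G.dsrc (G.inv (γ τ)) z)
  have hm := G.multiplicative.pair_tmul (g := γ τ) (h := G.inv (γ τ)) (G.tgt_inv _).symm
    (v₁ := tderiv 𝓘(ℝ, ℝ) (𝓡 G.dim) γ τ 1)
    (w₁ := tderiv 𝓘(ℝ, ℝ) (𝓡 G.dim) (fun τ => G.inv (γ τ)) τ 1)
    (v₂ := z₁) (w₂ := z) (by rw [G.dtgt_eq, hv, h.dsrc_velocity hS hτ]) (by rw [G.dtgt_eq, hz₁])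
  have h0 := G.tderiv_mul (h τ hτ).2.1 (hd τ hτ) (.of_forall fun s => (G.tgt_inv _).symm) 1
  have h1 : (fun s => G.mul (γ s) (G.inv (γ s))) =ᶠ[𝓝 τ] fun _ => G.unit x := by
    filter_upwards [hS.mem_nhds hτ] with s hs'
    rw [G.mul_inv, G.tgt_eq_src, (h s hs').1]
  rw [tderiv_congr h1, tderiv_const, zero_apply] at h0
  rw [← h0, (h τ hτ).2.2, hz₁] at hm
  simp only [map_zero, LinearMap.zero_apply] at hm
  rw [neg_apply]
  linarith

theorem scale (h : G.IsExpCurve x a γ S) (c : ℝ) :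
    G.IsExpCurve x (c • a) (fun τ => γ (c * τ)) {τ | c * τ ∈ S} := by
  intro τ hτ
  have hl : HasFDerivAt (fun τ : ℝ => c * τ) (c • ContinuousLinearMap.id ℝ ℝ) τ :=
    (c • ContinuousLinearMap.id ℝ ℝ).hasFDerivAt
  obtain ⟨h1, h2, h3⟩ := h _ hτ
  refine ⟨h1, MDifferentiableAt.comp (g := γ) τ h2 hl.differentiableAt.mdifferentiableAt,
    fun z => ?_⟩
  rw [tderiv_comp_apply (g := γ) (f := fun τ : ℝ => c * τ) (I' := 𝓘(ℝ, ℝ)) h2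
    hl.differentiableAt.mdifferentiableAt, tderiv_eq_fderiv, hl.fderiv]
  have e : (c • ContinuousLinearMap.id ℝ ℝ) 1 = c • (1 : ℝ) := rfl
  rw [e, map_smul, map_smul, LinearMap.smul_apply, h3, smul_apply, smul_neg]

theorem eq_of_zero (h : G.IsExpCurve x 0 γ S) (hS : IsOpen S) (hS' : IsPreconnected S) {τ s : ℝ}
    (hτ : τ ∈ S) (hs : s ∈ S) : γ τ = γ s := by
  refine eq_of_tderiv_eq_zero hS hS' (fun t ht => ⟨(h t ht).2.1, ?_⟩) hτ hs
  ext1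
  exact G.eq_zero_of_pair fun w => by rw [(h t ht).2.2]; simp

/-- The curve `γ δ⁻¹` is exponential for the covector `a - a = 0`, so by nondegeneracy its velocity
vanishes and it is constant. This takes the place of uniqueness for ordinary differential equations.
-/
theorem eq_of_eq (h : G.IsExpCurve x a γ S) (h' : G.IsExpCurve x a δ S) (hS : IsOpen S)
    (hS' : IsPreconnected S) {τ s : ℝ} (hτ : τ ∈ S) (hs : s ∈ S) (e : γ τ = δ τ) :
    γ s = δ s := by
  have h0 := h.mul (h'.inv hS) hS
  rw [add_neg_cancel] at h0
  have h1 := h0.eq_of_zero hS hS' hs hτ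
  simp only [e, G.mul_inv] at h1
  refine G.eq_of_mul_inv_eq_unit ((h s hs).1.trans (h' s hs).1.symm) ?_
  rw [h1, G.tgt_eq_src, G.tgt_eq_src, (h' s hs).1, (h' τ hτ).1]

end IsExpCurve

variable (G) in
/-- `g` is the exponential of the covector `a` at `x`. -/
def IsExp (x : M) (a : Covec n) (g : G.Arrow) : Prop :=
  ∃ (γ : ℝ → G.Arrow) (S : Set ℝ), IsOpen S ∧ Convex ℝ S ∧ 0 ∈ S ∧ 1 ∈ S ∧
    G.IsExpCurve x a γ S ∧ γ 0 = G.unit x ∧ γ 1 = g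

namespace IsExp

variable {g h : G.Arrow}

/-- Both curves start at the unit and are compared on the intersection of their domains, which is
connected because both domains are convex. -/
theorem unique (hg : G.IsExp x a g) (hh : G.IsExp x a h) : g = h := by
  obtain ⟨γ, S, hS, hSc, h0, h1, hγ, e0, rfl⟩ := hg
  obtain ⟨δ, T, hT, hTc, h0', h1', hδ, e0', rfl⟩ := hh
  exact (hγ.mono inter_subset_left).eq_of_eq (hδ.mono inter_subset_right) (hS.inter hT)
    (hSc.inter hTc).isPreconnected ⟨h0, h0'⟩ ⟨h1, h1'⟩ (e0.trans e0'.symm)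

theorem src_eq (hg : G.IsExp x a g) : G.src g = x := by
  obtain ⟨γ, S, hS, hSc, h0, h1, hγ, e0, rfl⟩ := hg
  exact (hγ 1 h1).1

theorem mul (hg : G.IsExp x a g) (hh : G.IsExp x b h) : G.IsExp x (a + b) (G.mul g h) := by
  obtain ⟨γ, S, hS, hSc, h0, h1, hγ, e0, rfl⟩ := hg
  obtain ⟨δ, T, hT, hTc, h0', h1', hδ, e0', rfl⟩ := hh
  refine ⟨fun τ => G.mul (γ τ) (δ τ), S ∩ T, hS.inter hT, hSc.inter hTc, ⟨h0, h0'⟩, ⟨h1, h1'⟩,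
    (hγ.mono inter_subset_left).mul (hδ.mono inter_subset_right) (hS.inter hT), ?_, rfl⟩
  have := G.mul_unit (G.unit x)
  rw [G.src_unit] at this
  simp only [e0, e0', this]

theorem zero (x : M) : G.IsExp x 0 (G.unit x) := by
  refine ⟨fun _ => G.unit x, univ, isOpen_univ, convex_univ, trivial, trivial, ?_, rfl, rfl⟩
  have := IsExpCurve.const (G.unit x) univ
  rwa [G.src_unit] at this

end IsExp

theorem IsExpCurve.isExp (h : G.IsExpCurve x a γ S) (hS : IsOpen S) (hS' : Convex ℝ S)
    (h0 : 0 ∈ S) (e : γ 0 = G.unit x) {c : ℝ} (hc : c ∈ S) : G.IsExp x (c • a) (γ c) := by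
  refine ⟨fun τ => γ (c * τ), {τ | c * τ ∈ S}, hS.preimage (by fun_prop),
    hS'.linear_preimage (LinearMap.mulLeft ℝ c), by simpa, by simpa, h.scale c, by simpa, by simp⟩

end SymplecticIntegration

end

end PoissonGeom

/-! ### Fibred coordinates along the units -/

namespace PoissonGeom

noncomputable section

open Set Filter

variable {n : ℕ} {M : Type u} [TopologicalSpace M] [ChartedSpace (EuclideanSpace ℝ (Fin n)) M]
  [T2Space M] [IsManifold (𝓡 n) ∞ M]

namespace SymplecticIntegration

variable (G : SymplecticIntegration (PoissonStructure.zero n M))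

/-- Coordinates around the unit at a point, adapted to the source fibration and to the units. -/
structure IsFibreParam {F : Type} [NormedAddCommGroup F] [NormedSpace ℝ F]
    (χ : OpenPartialHomeomorph M (Vec n)) (U : Set (Vec n)) (r : ℝ) (Q : Vec n × F → G.Arrow) :
    Prop where
  chart_mem : χ ∈ IsManifold.maximalAtlas (𝓡 n) ∞ M
  isOpen : IsOpen U
  subset : U ⊆ χ.target
  pos : 0 < r
  smooth : ContMDiffOn 𝓘(ℝ, Vec n × F) (𝓡 G.dim) ∞ Q (U ×ˢ Metric.ball 0 r)
  src_eq : ∀ w ∈ U ×ˢ Metric.ball 0 r, G.src (Q w) = χ.symm w.1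
  unit_eq : ∀ y ∈ U, Q (y, 0) = G.unit (χ.symm y)
  surjective : ∀ w ∈ U ×ˢ Metric.ball 0 r,
    Function.Surjective (tderiv 𝓘(ℝ, Vec n × F) (𝓡 G.dim) Q w)
  finrank_eq : Module.finrank ℝ (Vec n × F) = 2 * n

/-- A chart adapted to the source map is sheared along the fibres so that the units become the zero
section. -/
theorem exists_isFibreParam (x : M) : ∃ (F : Type) (_ : NormedAddCommGroup F) (_ : NormedSpace ℝ F)
    (_ : FiniteDimensional ℝ F) (χ : OpenPartialHomeomorph M (Vec n)) (U : Set (Vec n)) (r : ℝ)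
    (Q : Vec n × F → G.Arrow), x ∈ χ.source ∧ χ x ∈ U ∧ G.IsFibreParam χ U r Q := by
  obtain ⟨F, _, _, hs⟩ := G.src_submersion
  obtain ⟨χ, B, hχ, hg, hB, hB', h⟩ := exists_adapted_chart hs (G.unit x)
  have hx : x ∈ χ.source := by
    have := (h _ hg).1
    rwa [G.src_unit] at this
  have i1 : ∀ w ∈ B.target, ∀ v, tderiv (𝓡 G.dim) 𝓘(ℝ, Vec n × F) B (B.symm w)
      (tderiv 𝓘(ℝ, Vec n × F) (𝓡 G.dim) B.symm w v) = v := fun w hw v =>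
    tderiv_leftInverse ((hB _ (B.map_target hw)).mdifferentiableAt (by simp))
      ((hB' w hw).mdifferentiableAt (by simp)) rfl
      (by filter_upwards [B.open_target.mem_nhds hw] with z hz using B.right_inv hz) v
  have i2 : ∀ g ∈ B.source, ∀ v, tderiv 𝓘(ℝ, Vec n × F) (𝓡 G.dim) B.symm (B g)
      (tderiv (𝓡 G.dim) 𝓘(ℝ, Vec n × F) B g v) = v := fun g hg v =>
    tderiv_leftInverse ((hB' _ (B.map_source hg)).mdifferentiableAt (by simp))
      ((hB g hg).mdifferentiableAt (by simp)) rfl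
      (by filter_upwards [B.open_source.mem_nhds hg] with z hz using B.left_inv hz) v
  have i3 : ∀ w ∈ B.target, Function.Surjective (tderiv 𝓘(ℝ, Vec n × F) (𝓡 G.dim) B.symm w) := by
    intro w hw v
    have := i2 _ (B.map_target hw) v
    rw [B.right_inv hw] at this
    exact ⟨_, this⟩
  have hw0 := B.map_source hg
  let e₀ : (Vec n × F) ≃ₗ[ℝ] Vec G.dim := LinearEquiv.ofBijective
    (tderiv 𝓘(ℝ, Vec n × F) (𝓡 G.dim) B.symm (B (G.unit x))).toLinearMap
    ⟨Function.LeftInverse.injective (fun v : Vec n × F => i1 _ hw0 v), i3 _ hw0⟩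
  have hfin : FiniteDimensional ℝ (Vec n × F) := e₀.symm.finiteDimensional
  have hfinF : FiniteDimensional ℝ F :=
    Module.Finite.of_surjective (LinearMap.snd ℝ (Vec n) F) LinearMap.snd_surjective
  have hrank : Module.finrank ℝ (Vec n × F) = 2 * n := by
    rw [e₀.finrank_eq, finrank_euclideanSpace_fin]
    exact (G.dim_and_ker (G.unit x)).1
  let D₁ : Set (Vec n) := χ.target ∩ (fun y => G.unit (χ.symm y)) ⁻¹' B.source
  have hu : ∀ y ∈ χ.target, ContMDiffAt (𝓡 n) (𝓡 G.dim) ∞ (fun y => G.unit (χ.symm y)) y :=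
    fun y hy => (G.unit_smooth _).comp y (chart_symm_contMDiffAt hχ hy)
  have hD₁ : IsOpen D₁ := ContinuousOn.isOpen_inter_preimage
    (fun y hy => (hu y hy).continuousAt.continuousWithinAt) χ.open_target B.open_source
  -- The fibre coordinate of the unit over `y`; the shear `l` below adds it, so that `l (y, 0)` is
  -- the coordinate of the unit.
  let c : Vec n → F := fun y => (B (G.unit (χ.symm y))).2
  have hc : ContDiffOn ℝ ∞ c D₁ := fun y hy => ContDiffAt.contDiffWithinAt (contMDiffAt_iff_contDiffAt.1
    (contDiffAt_snd.contMDiffAt.comp y ((hB _ hy.2).comp y (hu y hy.1))))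
  have hBc : ∀ y ∈ D₁, B (G.unit (χ.symm y)) = (y, c y) := fun y hy => by
    refine Prod.ext ?_ rfl
    rw [(h _ hy.2).2, G.src_unit, χ.right_inv hy.1]
  let l : Vec n × F → Vec n × F := fun w => (w.1, c w.1 + w.2)
  have hl : ContDiffOn ℝ ∞ l (D₁ ×ˢ univ) := contDiffOn_fst.prodMk
    ((hc.comp contDiffOn_fst (fun w hw => hw.1)).add contDiffOn_snd)
  let D : Set (Vec n × F) := D₁ ×ˢ univ ∩ l ⁻¹' B.target
  have hD : IsOpen D := hl.continuousOn.isOpen_inter_preimage (hD₁.prod isOpen_univ) B.open_target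
  have hxD₁ : χ x ∈ D₁ := ⟨χ.map_source hx, by
    rw [mem_preimage, χ.left_inv hx]; exact hg⟩
  have hl0 : ∀ y ∈ D₁, l (y, 0) = B (G.unit (χ.symm y)) := fun y hy => by
    rw [hBc y hy]; simp [l]
  have hxD : ((χ x, 0) : Vec n × F) ∈ D := ⟨⟨hxD₁, trivial⟩, by
    rw [mem_preimage, hl0 _ hxD₁, χ.left_inv hx]; exact hw0⟩
  obtain ⟨U, V, hU, hxU, hV, h0V, hUV⟩ := mem_nhds_prod_iff'.1 (hD.mem_nhds hxD)
  obtain ⟨r, hr, hrV⟩ := Metric.mem_nhds_iff.1 (hV.mem_nhds h0V)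
  have hsub : U ×ˢ Metric.ball 0 r ⊆ D := (prod_mono subset_rfl hrV).trans hUV
  have hUD : U ⊆ D₁ := fun y hy => (hUV (mk_mem_prod hy h0V)).1.1
  have hlAt : ∀ w ∈ D, ContDiffAt ℝ ∞ l w := fun w hw =>
    hl.contDiffAt ((hD₁.prod isOpen_univ).mem_nhds hw.1)
  refine ⟨F, _, _, hfinF, χ, U, r, fun w => B.symm (l w), hx, hxU,
    ⟨hχ, hU, fun y hy => (hUD hy).1, hr, fun w hw => ?_, fun w hw => ?_, fun y hy => ?_,
      fun w hw => ?_, hrank⟩⟩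
  · exact (ContMDiffAt.comp (g := B.symm) w (hB' _ (hsub hw).2)
      (hlAt w (hsub hw)).contMDiffAt).contMDiffWithinAt
  · exact (adapted_chart_symm h (hsub hw).2).1
  · have hy' := hUD hy
    change B.symm (l (y, 0)) = _
    rw [hl0 y hy', B.left_inv hy'.2]
  · have hwD := hsub hw
    have hcd : HasFDerivAt c (fderiv ℝ c w.1) w.1 :=
      ((hc.contDiffAt (hD₁.mem_nhds hwD.1.1)).differentiableAt (by simp)).hasFDerivAt
    have hld : HasFDerivAt l ((ContinuousLinearMap.fst ℝ (Vec n) F).prod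
        ((fderiv ℝ c w.1).comp (ContinuousLinearMap.fst ℝ (Vec n) F) +
          ContinuousLinearMap.snd ℝ (Vec n) F)) w :=
      hasFDerivAt_fst.prodMk ((hcd.comp w hasFDerivAt_fst).add hasFDerivAt_snd)
    intro v
    obtain ⟨u, hu'⟩ := i3 _ hwD.2 v
    refine ⟨(u.1, u.2 - fderiv ℝ c w.1 u.1), ?_⟩
    rw [tderiv_comp_apply (g := B.symm) (f := l) (I' := 𝓘(ℝ, Vec n × F))
      ((hB' _ hwD.2).mdifferentiableAt (by simp)) hld.differentiableAt.mdifferentiableAt,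
      tderiv_eq_fderiv, hld.fderiv, ← hu']
    congr 1
    exact Prod.ext rfl (by simp)

end SymplecticIntegration

end

end PoissonGeom

/-! ### The fibrewise logarithm and local exponentials -/

namespace PoissonGeom

noncomputable section

open Set Filter

theorem finrank_covec (n : ℕ) : Module.finrank ℝ (Covec n) = n := by
  have e : (Vec n →ₗ[ℝ] ℝ) ≃ₗ[ℝ] Covec n := LinearMap.toContinuousLinearMap
  rw [← e.finrank_eq]
  exact Subspace.dual_finrank_eq.trans finrank_euclideanSpace_fin

/-- The mixed part of a `2`-form on a product. -/
def mixedPart {n : ℕ} {F : Type*} [NormedAddCommGroup F] [NormedSpace ℝ F] [FiniteDimensional ℝ F]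
    (β : (Vec n × F) [⋀^Fin 2]→L[ℝ] ℝ) : F →L[ℝ] Covec n :=
  LinearMap.toContinuousLinearMap ((LinearMap.toContinuousLinearMap :
    (Vec n →ₗ[ℝ] ℝ) ≃ₗ[ℝ] (Vec n →L[ℝ] ℝ)).toLinearMap.comp
      (-((DiffForm.altBilin β).compl₁₂ (LinearMap.inr ℝ (Vec n) F) (LinearMap.inl ℝ (Vec n) F))))

theorem mixedPart_apply {n : ℕ} {F : Type*} [NormedAddCommGroup F] [NormedSpace ℝ F]
    [FiniteDimensional ℝ F] (β : (Vec n × F) [⋀^Fin 2]→L[ℝ] ℝ) (ζ : F) (e : Vec n) :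
    mixedPart β ζ e = -β ![(0, ζ), (e, 0)] := rfl

theorem contDiffOn_alternating_apply {E X : Type*} [NormedAddCommGroup E] [NormedSpace ℝ E]
    [NormedAddCommGroup X] [NormedSpace ℝ X] {k : ℕ} {β : X → E [⋀^Fin k]→L[ℝ] ℝ} {S : Set X}
    (hβ : ContDiffOn ℝ ∞ β S) (v : Fin k → E) : ContDiffOn ℝ ∞ (fun x => β x v) S :=
  (ContinuousAlternatingMap.apply ℝ E ℝ v).contDiff.comp_contDiffOn hβ

variable {n : ℕ} {M : Type u} [TopologicalSpace M] [ChartedSpace (EuclideanSpace ℝ (Fin n)) M]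
  [T2Space M] [IsManifold (𝓡 n) ∞ M]

namespace SymplecticIntegration

variable (G : SymplecticIntegration (PoissonStructure.zero n M))

/-- A smooth family of exponential curves starting at the units. -/
structure IsLocalExp (χ : OpenPartialHomeomorph M (Vec n)) (U : Set (Vec n)) (r : ℝ)
    (ε : Vec n × Covec n → G.Arrow) : Prop where
  smooth : ContMDiffOn 𝓘(ℝ, Vec n × Covec n) (𝓡 G.dim) ∞ ε (U ×ˢ Metric.ball 0 r)
  unit_eq : ∀ y ∈ U, ε (y, 0) = G.unit (χ.symm y)
  isExpCurve : ∀ y ∈ U, ∀ p : Covec n,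
    G.IsExpCurve (χ.symm y) (p.comp (tderiv (𝓡 n) (𝓡 n) χ (χ.symm y))) (fun τ => ε (y, τ • p))
      {τ | τ • p ∈ Metric.ball 0 r}

variable {G} {χ : OpenPartialHomeomorph M (Vec n)} {U : Set (Vec n)} {r : ℝ} {F : Type}
  [NormedAddCommGroup F] [NormedSpace ℝ F] {Q : Vec n × F → G.Arrow}

namespace IsFibreParam

theorem mdifferentiableAt (h : G.IsFibreParam χ U r Q) {w : Vec n × F}
    (hw : w ∈ U ×ˢ Metric.ball 0 r) : MDifferentiableAt 𝓘(ℝ, Vec n × F) (𝓡 G.dim) Q w :=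
  (h.smooth.contMDiffAt ((h.isOpen.prod Metric.isOpen_ball).mem_nhds hw)).mdifferentiableAt
    (by simp)

theorem dsrc_tderiv (h : G.IsFibreParam χ U r Q) {w : Vec n × F}
    (hw : w ∈ U ×ˢ Metric.ball 0 r) (v : Vec n × F) :
    G.dsrc (Q w) (tderiv 𝓘(ℝ, Vec n × F) (𝓡 G.dim) Q w v) =
      tderiv (𝓡 n) (𝓡 n) χ.symm w.1 v.1 := by
  have hd := chart_symm_mdifferentiableAt h.chart_mem (h.subset hw.1)
  refine (tderiv_comp_apply (g := G.src) (G.mdifferentiable_src _) (h.mdifferentiableAt hw)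
    v).symm.trans ?_
  have e : (fun w => G.src (Q w)) =ᶠ[𝓝 w] fun w => χ.symm w.1 := by
    filter_upwards [(h.isOpen.prod Metric.isOpen_ball).mem_nhds hw] with w' hw'
      using h.src_eq w' hw'
  rw [tderiv_congr e, tderiv_comp_apply (g := χ.symm) (f := Prod.fst) (I' := 𝓘(ℝ, Vec n)) hd
    differentiableAt_fst.mdifferentiableAt, tderiv_eq_fderiv, fderiv_fst]
  rfl

theorem injective [FiniteDimensional ℝ F] (h : G.IsFibreParam χ U r Q) {w : Vec n × F}
    (hw : w ∈ U ×ˢ Metric.ball 0 r) :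
    Function.Injective (tderiv 𝓘(ℝ, Vec n × F) (𝓡 G.dim) Q w) := by
  refine (LinearMap.injective_iff_surjective_of_finrank_eq_finrank
    (f := (tderiv 𝓘(ℝ, Vec n × F) (𝓡 G.dim) Q w).toLinearMap) ?_).2 (h.surjective w hw)
  rw [h.finrank_eq, finrank_euclideanSpace_fin, (G.dim_and_ker (Q w)).1]

variable [FiniteDimensional ℝ F]

/-- Evaluate `dΩ = 0` on two vertical vectors and one horizontal vector. The vertical-vertical
coefficients vanish identically because the fibres are isotropic, and the two remaining terms are
the asserted symmetry. -/
theorem mixedPart_symm (h : G.IsFibreParam χ U r Q) {w : Vec n × F}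
    (hw : w ∈ U ×ˢ Metric.ball 0 r) (hA : DifferentiableAt ℝ (fun w => mixedPart (G.form.pull Q w)) w)
    (ζ η : F) : fderiv ℝ (fun w => mixedPart (G.form.pull Q w)) w (0, ζ) η =
      fderiv ℝ (fun w => mixedPart (G.form.pull Q w)) w (0, η) ζ := by
  have hO := h.isOpen.prod (Metric.isOpen_ball (x := (0 : F)) (ε := r))
  have hβ := DiffForm.pull_contDiffOn G.symplectic.smooth hO h.smooth
  have hβd : DifferentiableAt ℝ (G.form.pull Q) w :=
    (hβ.contDiffAt (hO.mem_nhds hw)).differentiableAt (by simp)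
  have hclosed : extDeriv (G.form.pull Q) w = 0 := by
    rw [DiffForm.extDeriv_pull G.symplectic.smooth.differentiableOn hO hw h.smooth]
    ext v
    exact DFunLike.congr_fun (G.symplectic.closed (Q w)) _
  have key : ∀ (v : Vec n × F) (η : F) (e : Vec n),
      fderiv ℝ (fun w => mixedPart (G.form.pull Q w)) w v η e =
        -fderiv ℝ (fun w => G.form.pull Q w ![(0, η), (e, 0)]) w v := by
    intro v η e
    have h1 := (hA.hasFDerivAt.clm_apply (hasFDerivAt_const η w)).clm_apply (hasFDerivAt_const e w)
    have h2 : (fun w => mixedPart (G.form.pull Q w) η e) =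
        fun w => -G.form.pull Q w ![(0, η), (e, 0)] := rfl
    rw [h2] at h1
    have h3 := h1.fderiv
    rw [fderiv_fun_neg] at h3
    have h4 := DFunLike.congr_fun h3 v
    rw [neg_apply] at h4
    rw [h4]
    simp
  have hvert : ∀ ζ η : F, (fun w => G.form.pull Q w ![(0, ζ), (0, η)]) =ᶠ[𝓝 w] fun _ => 0 := by
    intro ζ η
    filter_upwards [hO.mem_nhds hw] with w' hw'
    rw [DiffForm.pull_pair]
    apply G.pair_vertical <;> rw [h.dsrc_tderiv hw', map_zero]
  ext e
  have h5 := extDeriv_two_apply hβd (0, ζ) (0, η) (e, 0)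
  rw [hclosed, (hvert ζ η).fderiv_eq, fderiv_fun_const] at h5
  simp only [Pi.zero_apply, zero_apply, add_zero] at h5
  have h5' : (0 : ℝ) = _ := h5
  rw [key, key]
  linarith

/-- The fibres are isotropic, so pairing with a vertical vector depends only on the projection of
the other argument: it is a covector-valued `1`-form along the fibres, closed by `mixedPart_symm`.
Its primitive `L` vanishing on units is the logarithm: vertical curves along which `L` is `τ p` are
exponential. -/
theorem exists_log (h : G.IsFibreParam χ U r Q) :
    ∃ L : Vec n × F → Covec n, ContDiffOn ℝ ∞ L (U ×ˢ Metric.ball 0 r) ∧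
      (∀ y, L (y, 0) = 0) ∧ ∀ w ∈ U ×ˢ Metric.ball 0 r, ∀ ζ z,
        G.form.pair (Q w) (tderiv 𝓘(ℝ, Vec n × F) (𝓡 G.dim) Q w (0, ζ)) z =
          -fderiv ℝ L w (0, ζ) (tderiv (𝓡 n) (𝓡 n) χ (χ.symm w.1) (G.dsrc (Q w) z)) := by
  have hO := h.isOpen.prod (Metric.isOpen_ball (x := (0 : F)) (ε := r))
  have hβ := DiffForm.pull_contDiffOn G.symplectic.smooth hO h.smooth
  have hA : ContDiffOn ℝ ∞ (fun w => mixedPart (G.form.pull Q w)) (U ×ˢ Metric.ball 0 r) := by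
    refine contDiffOn_clm_apply.2 fun ζ => contDiffOn_clm_apply.2 fun e => ?_
    exact (contDiffOn_alternating_apply hβ ![(0, ζ), (e, 0)]).neg
  obtain ⟨L, hL, hL0, hLd⟩ := exists_primitive_with_parameter h.isOpen h.pos hA
    fun w hw ζ η => h.mixedPart_symm hw
      ((hA.contDiffAt (hO.mem_nhds hw)).differentiableAt (by simp)) ζ η
  refine ⟨L, hL, hL0, fun w hw ζ z => ?_⟩
  obtain ⟨⟨e, η⟩, rfl⟩ := h.surjective w hw z
  rw [hLd w hw, mixedPart_apply, h.dsrc_tderiv hw, neg_neg,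
    tderiv_chart_tderiv_symm h.chart_mem (h.subset hw.1), DiffForm.pull_pair]
  have e1 : ((e, η) : Vec n × F) = (e, 0) + (0, η) := by simp
  rw [e1, map_add, map_add]
  rw [G.pair_vertical (v := tderiv 𝓘(ℝ, Vec n × F) (𝓡 G.dim) Q w (0, ζ))
    (w := tderiv 𝓘(ℝ, Vec n × F) (𝓡 G.dim) Q w (0, η)), add_zero]
  · simp
  all_goals rw [h.dsrc_tderiv hw, map_zero]

end IsFibreParam

/-- The map `(y, ζ) ↦ (y, L (y, ζ))` is invertible near the unit, and its inverse followed by `Q` is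
the exponential: along `τ ↦ (y, τ p)` the logarithm is `τ p`, so the velocity is the Hamiltonian
vector of `p`. -/
theorem IsFibreParam.exists_isLocalExp [FiniteDimensional ℝ F] (h : G.IsFibreParam χ U r Q)
    {y₀ : Vec n} (hy₀ : y₀ ∈ U) : ∃ (V : Set (Vec n)) (ρ : ℝ) (ε : Vec n × Covec n → G.Arrow),
      IsOpen V ∧ V ⊆ χ.target ∧ y₀ ∈ V ∧ 0 < ρ ∧ G.IsLocalExp χ V ρ ε := by
  have hO := h.isOpen.prod (Metric.isOpen_ball (x := (0 : F)) (ε := r))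
  obtain ⟨L, hL, hL0, hLd⟩ := h.exists_log
  have hw₀ : ((y₀, 0) : Vec n × F) ∈ U ×ˢ Metric.ball (0 : F) r :=
    ⟨hy₀, Metric.mem_ball_self h.pos⟩
  have hLdiff : ∀ w ∈ U ×ˢ Metric.ball (0 : F) r, HasFDerivAt L (fderiv ℝ L w) w := fun w hw =>
    ((hL.contDiffAt (hO.mem_nhds hw)).differentiableAt (by simp)).hasFDerivAt
  let f : Vec n × F → Vec n × Covec n := fun w => (w.1, L w)
  have hf : ContDiffOn ℝ ∞ f (U ×ˢ Metric.ball 0 r) := contDiffOn_fst.prodMk hL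
  have hfd : ∀ w ∈ U ×ˢ Metric.ball (0 : F) r, HasFDerivAt f
      ((ContinuousLinearMap.fst ℝ (Vec n) F).prod (fderiv ℝ L w)) w := fun w hw =>
    hasFDerivAt_fst.prodMk (hLdiff w hw)
  let f' := (ContinuousLinearMap.fst ℝ (Vec n) F).prod (fderiv ℝ L (y₀, 0))
  -- A vector in the kernel is vertical and `dL` kills it, so it pairs to zero with everything and
  -- nondegeneracy applies. The dimensions agree because both are `2n`.
  have hinj : Function.Injective f'.toLinearMap := by
    refine (injective_iff_map_eq_zero f'.toLinearMap).2 fun v hv => ?_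
    obtain ⟨e, ζ⟩ := v
    have h1 : e = 0 := congrArg Prod.fst hv
    subst h1
    have h2 : fderiv ℝ L (y₀, 0) (0, ζ) = 0 := congrArg Prod.snd hv
    apply h.injective hw₀
    rw [map_zero]
    refine G.eq_zero_of_pair (g := Q (y₀, 0)) fun z => ?_
    rw [hLd _ hw₀, h2]
    simp
  have hrank : Module.finrank ℝ (Vec n × F) = Module.finrank ℝ (Vec n × Covec n) := by
    rw [h.finrank_eq, Module.finrank_prod, finrank_covec, finrank_euclideanSpace_fin, two_mul]
  let e := (LinearMap.linearEquivOfInjective f'.toLinearMap hinj hrank).toContinuousLinearEquiv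
  have he : (e : (Vec n × F) →L[ℝ] Vec n × Covec n) = f' := rfl
  obtain ⟨g, hg0, hgU, hgf, hgs⟩ := exists_smooth_local_inverse hO hw₀ hf e
    (by rw [he]; exact hfd _ hw₀)
  have hf0 : ∀ y, f (y, 0) = (y, 0) := fun y => Prod.ext rfl (hL0 y)
  have hgt : ((y₀, 0) : Vec n × Covec n) ∈ g.target := by
    have := g.map_source hg0
    rwa [hgf, hf0] at this
  -- Needed besides `(y, 0) ∈ g.target`: only if `(y, 0)` lies in the source as well does the
  -- inverse fix it, so that the exponential of zero is the unit.
  have hN : {y : Vec n | ((y, 0) : Vec n × F) ∈ g.source} ∈ 𝓝 y₀ :=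
    (by fun_prop : Continuous fun y : Vec n => ((y, 0) : Vec n × F)).continuousAt
      (g.open_source.mem_nhds hg0)
  obtain ⟨V₁, W, hV₁, hyV₁, hW, h0W, hVW⟩ := mem_nhds_prod_iff'.1 (g.open_target.mem_nhds hgt)
  obtain ⟨ρ, hρ, hρW⟩ := Metric.mem_nhds_iff.1 (hW.mem_nhds h0W)
  obtain ⟨V₂, hV₂N, hV₂, hyV₂⟩ := mem_nhds_iff.1 hN
  have hsub : (V₁ ∩ V₂) ×ˢ Metric.ball 0 ρ ⊆ g.target :=
    (prod_mono inter_subset_left hρW).trans hVW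
  have hVO : IsOpen ((V₁ ∩ V₂) ×ˢ Metric.ball (0 : Covec n) ρ) :=
    (hV₁.inter hV₂).prod Metric.isOpen_ball
  have hgU' : ∀ z ∈ g.target, g.symm z ∈ U ×ˢ Metric.ball (0 : F) r := fun z hz =>
    hgU (g.map_target hz)
  have hgi : ∀ z ∈ g.target, f (g.symm z) = z := fun z hz => by
    rw [← hgf, g.right_inv hz]
  have hgi1 : ∀ z ∈ g.target, (g.symm z).1 = z.1 := fun z hz => congrArg Prod.fst (hgi z hz)
  refine ⟨V₁ ∩ V₂, ρ, fun z => Q (g.symm z), hV₁.inter hV₂, fun y hy => ?_, ⟨hyV₁, hyV₂⟩, hρ,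
    fun z hz => ?_, fun y hy => ?_, fun y hy p τ hτ => ?_⟩
  · exact h.subset (hgU (hV₂N hy.2)).1
  · have hz' := hsub hz
    refine (ContMDiffAt.comp (g := Q) z (h.smooth.contMDiffAt (hO.mem_nhds (hgU' z hz'))) ?_
      ).contMDiffWithinAt
    exact (hgs.contDiffAt (g.open_target.mem_nhds hz')).contMDiffAt
  · have h1 : g.symm (y, 0) = (y, 0) := by
      rw [← hf0, ← hgf, g.left_inv (hV₂N hy.2)]
    change Q (g.symm (y, 0)) = _
    rw [h1]
    exact h.unit_eq y (hgU (hV₂N hy.2)).1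
  · have hz : (y, τ • p) ∈ g.target := hsub ⟨hy, hτ⟩
    have hw := hgU' _ hz
    have hl : HasFDerivAt (fun τ : ℝ => ((y, τ • p) : Vec n × Covec n))
        ((0 : ℝ →L[ℝ] Vec n).prod ((ContinuousLinearMap.id ℝ ℝ).smulRight p)) τ :=
      (hasFDerivAt_const y τ).prodMk ((ContinuousLinearMap.id ℝ ℝ).smulRight p).hasFDerivAt
    have hgd : DifferentiableAt ℝ (fun τ : ℝ => g.symm (y, τ • p)) τ :=
      ((hgs.contDiffAt (g.open_target.mem_nhds hz)).differentiableAt (by simp)).comp τ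
        hl.differentiableAt
    set w' := fderiv ℝ (fun τ : ℝ => g.symm (y, τ • p)) τ 1 with hw'
    have hcomp := (hfd _ hw).comp τ hgd.hasFDerivAt
    have hev : (f ∘ fun τ : ℝ => g.symm (y, τ • p)) =ᶠ[𝓝 τ] fun τ => (y, τ • p) := by
      filter_upwards [hl.continuousAt (g.open_target.mem_nhds hz)] with s hs
      exact hgi _ hs
    have huniq := DFunLike.congr_fun ((hcomp.congr_of_eventuallyEq hev.symm).unique hl) 1
    have h1 : w'.1 = 0 := congrArg Prod.fst huniq
    have h2 : fderiv ℝ L (g.symm (y, τ • p)) w' = p :=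
      (congrArg Prod.snd huniq).trans (one_smul ℝ p)
    have h3 : w' = (0, w'.2) := Prod.ext h1 rfl
    refine ⟨?_, MDifferentiableAt.comp (g := Q) τ (h.mdifferentiableAt hw)
      hgd.mdifferentiableAt, fun v => ?_⟩
    · exact (h.src_eq _ hw).trans (by rw [hgi1 _ hz])
    · have hvel : tderiv 𝓘(ℝ, ℝ) (𝓡 G.dim) (fun τ : ℝ => Q (g.symm (y, τ • p))) τ 1 =
          tderiv 𝓘(ℝ, Vec n × F) (𝓡 G.dim) Q (g.symm (y, τ • p)) (0, w'.2) := by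
        rw [tderiv_comp_apply (g := Q) (f := fun τ : ℝ => g.symm (y, τ • p))
          (I' := 𝓘(ℝ, Vec n × F)) (h.mdifferentiableAt hw) hgd.mdifferentiableAt,
          tderiv_eq_fderiv, ← hw', ← h3]
      refine (congrArg (fun u => G.form.pair (Q (g.symm (y, τ • p))) u v) hvel).trans ?_
      rw [hLd _ hw, ← h3, h2, hgi1 _ hz]
      rfl

end SymplecticIntegration

end

end PoissonGeom

/-! ### The global exponential map and the pullback of the symplectic form -/

namespace PoissonGeom

noncomputable section

open Set Filter

variable {n : ℕ} {M : Type u} [TopologicalSpace M] [ChartedSpace (EuclideanSpace ℝ (Fin n)) M]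
  [T2Space M] [IsManifold (𝓡 n) ∞ M]

namespace SymplecticIntegration

variable {G : SymplecticIntegration (PoissonStructure.zero n M)}

namespace IsLocalExp

variable {χ : OpenPartialHomeomorph M (Vec n)} {U : Set (Vec n)} {r : ℝ}
  {ε : Vec n × Covec n → G.Arrow}

theorem isExp (h : G.IsLocalExp χ U r ε) {z : Vec n × Covec n} (hz : z ∈ U ×ˢ Metric.ball 0 r) :
    G.IsExp (cotParam χ z).1 (covec (cotParam χ z).2) (ε z) := by
  have h1 := (h.isExpCurve z.1 hz.1 z.2).isExp (Metric.isOpen_ball.preimage (by fun_prop))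
    ((convex_ball 0 r).linear_preimage ((LinearMap.id : ℝ →ₗ[ℝ] ℝ).smulRight z.2))
    (by simpa using dist_nonneg.trans_lt hz.2) (by simpa using h.unit_eq z.1 hz.1)
    (c := 1) (by simpa using hz.2)
  simp only [one_smul] at h1
  exact h1

/-- The exponential of `p` is the square of that of `p / 2`. The radius doubles while `U` stays the
same, so iteration reaches every covector over a fixed neighbourhood. -/
theorem double (h : G.IsLocalExp χ U r ε) (hU : IsOpen U) : G.IsLocalExp χ U (2 * r)
    fun z => G.mul (ε (z.1, (2⁻¹ : ℝ) • z.2)) (ε (z.1, (2⁻¹ : ℝ) • z.2)) := by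
  have hball : ∀ p : Covec n, p ∈ Metric.ball 0 (2 * r) → (2⁻¹ : ℝ) • p ∈ Metric.ball 0 r := by
    intro p hp
    rw [mem_ball_zero_iff] at hp ⊢
    rw [norm_smul]
    norm_num
    linarith
  refine ⟨fun z hz => ?_, fun y hy => ?_, fun y hy p => ?_⟩
  · have h1 : ContMDiffAt 𝓘(ℝ, Vec n × Covec n) (𝓡 G.dim) ∞
        (fun z : Vec n × Covec n => ε (z.1, (2⁻¹ : ℝ) • z.2)) z := by
      refine ContMDiffAt.comp (g := ε) z (h.smooth.contMDiffAt
        ((hU.prod Metric.isOpen_ball).mem_nhds ⟨hz.1, hball _ hz.2⟩)) ?_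
      exact (contDiff_fst.prodMk (contDiff_snd.const_smul _)).contDiffAt.contMDiffAt
    exact (G.contMDiffAt_mul h1 h1 (.of_forall fun z => G.composable rfl)).contMDiffWithinAt
  · have := G.mul_unit (G.unit (χ.symm y))
    rw [G.src_unit] at this
    simp only [smul_zero, h.unit_eq y hy, this]
  · have h1 := h.isExpCurve y hy ((2⁻¹ : ℝ) • p)
    have h2 := h1.mul h1 (Metric.isOpen_ball.preimage (by fun_prop))
    have e : ((2⁻¹ : ℝ) • p).comp (tderiv (𝓡 n) (𝓡 n) χ (χ.symm y)) +
        ((2⁻¹ : ℝ) • p).comp (tderiv (𝓡 n) (𝓡 n) χ (χ.symm y)) =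
        p.comp (tderiv (𝓡 n) (𝓡 n) χ (χ.symm y)) := by
      rw [← ContinuousLinearMap.add_comp, ← add_smul]
      norm_num
    rw [e] at h2
    simp only [smul_comm _ (2⁻¹ : ℝ)] at h2
    exact h2.mono fun τ hτ => hball _ hτ

end IsLocalExp

variable (G)

/-- Near each point there are local exponentials on arbitrarily large balls of covectors. -/
theorem exists_isLocalExp (x : M) : ∃ (χ : OpenPartialHomeomorph M (Vec n)) (U : Set (Vec n)),
    χ ∈ IsManifold.maximalAtlas (𝓡 n) ∞ M ∧ x ∈ χ.source ∧ IsOpen U ∧ U ⊆ χ.target ∧ χ x ∈ U ∧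
      ∀ R : ℝ, ∃ r, R < r ∧ ∃ ε, G.IsLocalExp χ U r ε := by
  obtain ⟨F, _, _, _, χ, U', r', Q, hx, hxU, h⟩ := G.exists_isFibreParam x
  obtain ⟨U, r, ε, hU, hUt, hxU', hr, hε⟩ := h.exists_isLocalExp hxU
  refine ⟨χ, U, h.chart_mem, hx, hU, hUt, hxU', fun R => ?_⟩
  have key : ∀ k : ℕ, ∃ ε, G.IsLocalExp χ U (2 ^ k * r) ε := by
    intro k
    induction k with
    | zero => exact ⟨ε, by simpa using hε⟩
    | succ k ih =>
      obtain ⟨ε', hε'⟩ := ih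
      have h1 := hε'.double hU
      rw [← mul_assoc, ← pow_succ'] at h1
      exact ⟨_, h1⟩
  obtain ⟨k, hk⟩ := pow_unbounded_of_one_lt (R / r) (one_lt_two)
  exact ⟨2 ^ k * r, (div_lt_iff₀ hr).1 hk, key k⟩

theorem exists_isExp (ξ : CotangentBundle n M) : ∃ g, G.IsExp ξ.1 (covec ξ.2) g := by
  obtain ⟨χ, U, hχ, hx, hU, hUt, hxU, h⟩ := G.exists_isLocalExp ξ.1
  obtain ⟨r, hr, ε, hε⟩ := h ‖(cotCoord χ ξ).2‖
  have := hε.isExp (z := cotCoord χ ξ) ⟨hxU, mem_ball_zero_iff.2 hr⟩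
  rw [cotParam_cotCoord hχ hx] at this
  exact ⟨_, this⟩

/-- The exponential map from the cotangent bundle to a symplectic integration of the zero Poisson
structure. -/
def exp (ξ : CotangentBundle n M) : G.Arrow := (G.exists_isExp ξ).choose

theorem isExp_exp (ξ : CotangentBundle n M) : G.IsExp ξ.1 (covec ξ.2) (G.exp ξ) :=
  (G.exists_isExp ξ).choose_spec

variable {G} in
theorem IsExp.eq_exp {ξ : CotangentBundle n M} {g : G.Arrow} (h : G.IsExp ξ.1 (covec ξ.2) g) :
    G.exp ξ = g := (G.isExp_exp ξ).unique h

theorem src_exp (ξ : CotangentBundle n M) : G.src (G.exp ξ) = ξ.1 := (G.isExp_exp ξ).src_eq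

theorem exp_add (x : M) (a b : CotangentSpace n M x) :
    G.exp ⟨x, a + b⟩ = G.mul (G.exp ⟨x, a⟩) (G.exp ⟨x, b⟩) :=
  IsExp.eq_exp ((G.isExp_exp ⟨x, a⟩).mul (G.isExp_exp ⟨x, b⟩))

theorem exp_zero (x : M) : G.exp ⟨x, 0⟩ = G.unit x := IsExp.eq_exp (IsExp.zero x)

/-- By uniqueness `exp` agrees near `ξ` with a local exponential of large enough radius, which is
smooth. -/
theorem contMDiff_exp : ContMDiff (cotangentModel n) (𝓡 G.dim) ∞ G.exp := by
  intro ξ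
  obtain ⟨χ, U, hχ, hx, hU, hUt, hxU, h⟩ := G.exists_isLocalExp ξ.1
  obtain ⟨r, hr, ε, hε⟩ := h ‖(cotCoord χ ξ).2‖
  have hO : U ×ˢ Metric.ball (0 : Covec n) r ∈ 𝓝 (cotCoord χ ξ) :=
    (hU.prod Metric.isOpen_ball).mem_nhds ⟨hxU, mem_ball_zero_iff.2 hr⟩
  have hc := contMDiffAt_cotCoord hχ hx
  refine (ContMDiffAt.comp (g := ε) ξ (hε.smooth.contMDiffAt hO) hc).congr_of_eventuallyEq ?_
  filter_upwards [hc.continuousAt hO,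
    (χ.open_source.preimage contMDiff_cotProj.continuous).mem_nhds hx] with η hη hη'
  have := hε.isExp hη
  rw [cotParam_cotCoord hχ hη'] at this
  exact IsExp.eq_exp this

theorem mdifferentiable_exp : MDifferentiable (cotangentModel n) (𝓡 G.dim) G.exp :=
  G.contMDiff_exp.mdifferentiable (by simp)

theorem isExpCurve_exp (ξ : CotangentBundle n M) :
    G.IsExpCurve ξ.1 (covec ξ.2) (fun τ => G.exp ⟨ξ.1, τ • ξ.2⟩) univ := by
  intro τ _
  obtain ⟨χ, U, hχ, hx, hU, hUt, hxU, h⟩ := G.exists_isLocalExp ξ.1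
  obtain ⟨r, hr, ε, hε⟩ := h ‖τ • (cotCoord χ ξ).2‖
  obtain ⟨z, hz⟩ : ∃ z, z = cotCoord χ ξ := ⟨_, rfl⟩
  have hzξ : cotParam χ z = ξ := by rw [hz, cotParam_cotCoord hχ hx]
  have hzU : z.1 ∈ U := by rw [hz]; exact hxU
  rw [← hz] at hr
  subst hzξ
  have hS : IsOpen {τ : ℝ | τ • z.2 ∈ Metric.ball 0 r} := Metric.isOpen_ball.preimage (by fun_prop)
  refine ((hε.isExpCurve z.1 hzU z.2).congr
    (δ := fun τ => G.exp ⟨(cotParam χ z).1, τ • (cotParam χ z).2⟩) hS fun s hs => ?_) τ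
    (mem_ball_zero_iff.2 hr)
  exact IsExp.eq_exp (hε.isExp (z := (z.1, s • z.2)) ⟨hzU, hs⟩)

section Pullback

variable {G} {χ : OpenPartialHomeomorph M (Vec n)}

theorem mdifferentiableAt_exp_cotParam (hχ : χ ∈ IsManifold.maximalAtlas (𝓡 n) ∞ M)
    {z : Vec n × Covec n} (hz : z.1 ∈ χ.target) :
    MDifferentiableAt 𝓘(ℝ, Vec n × Covec n) (𝓡 G.dim) (fun z => G.exp (cotParam χ z)) z :=
  MDifferentiableAt.comp (g := G.exp) z (G.mdifferentiable_exp _) (mdifferentiableAt_cotParam hχ hz)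

/-- The curve `τ ↦ exp (p + τ q)` is the constant `exp p` times the exponential curve of `q`, hence
is itself exponential for `0 + q`. -/
theorem pair_exp_vertical (hχ : χ ∈ IsManifold.maximalAtlas (𝓡 n) ∞ M)
    {z : Vec n × Covec n} (hz : z.1 ∈ χ.target) (q : Covec n) (v : Vec G.dim) :
    G.form.pair (G.exp (cotParam χ z)) (tderiv 𝓘(ℝ, Vec n × Covec n) (𝓡 G.dim)
      (fun z => G.exp (cotParam χ z)) z (0, q)) v =
      -q (tderiv (𝓡 n) (𝓡 n) χ (χ.symm z.1) (G.dsrc (G.exp (cotParam χ z)) v)) := by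
  have h1 := G.isExpCurve_exp (cotParam χ (z.1, q))
  have h2 := IsExpCurve.const (G.exp (cotParam χ z)) univ
  rw [G.src_exp] at h2
  have h3 := (h2.mul h1 isOpen_univ) 0 trivial
  have hl : HasFDerivAt (fun τ : ℝ => ((z.1, z.2 + τ • q) : Vec n × Covec n))
      ((0 : ℝ →L[ℝ] Vec n).prod ((ContinuousLinearMap.id ℝ ℝ).smulRight q)) 0 :=
    (hasFDerivAt_const z.1 0).prodMk
      (((ContinuousLinearMap.id ℝ ℝ).smulRight q).hasFDerivAt.const_add z.2)
  have e0 : ((z.1, z.2 + (0 : ℝ) • q) : Vec n × Covec n) = z := by simp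
  have e1 : (fun τ : ℝ => G.mul (G.exp (cotParam χ z))
      (G.exp ⟨(cotParam χ (z.1, q)).1, τ • (cotParam χ (z.1, q)).2⟩)) =
      fun τ => G.exp (cotParam χ (z.1, z.2 + τ • q)) := by
    funext τ
    exact (G.exp_add (χ.symm z.1) (cotParam χ z).2 (τ • (cotParam χ (z.1, q)).2)).symm
  have h4 := h3.2.2 v
  rw [e1] at h4
  rw [tderiv_comp_apply_of_eq (g := fun z => G.exp (cotParam χ z))
    (f := fun τ : ℝ => ((z.1, z.2 + τ • q) : Vec n × Covec n)) (I' := 𝓘(ℝ, Vec n × Covec n))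
    (mdifferentiableAt_exp_cotParam hχ hz) hl.differentiableAt.mdifferentiableAt e0,
    tderiv_eq_fderiv, hl.fderiv, zero_add] at h4
  simp only [e0] at h4
  have e4 : (((0 : ℝ →L[ℝ] Vec n).prod ((ContinuousLinearMap.id ℝ ℝ).smulRight q)) 1) =
      ((0, q) : Vec n × Covec n) := Prod.ext rfl (one_smul ℝ q)
  rw [e4] at h4
  exact h4

theorem dsrc_exp_cotParam (hχ : χ ∈ IsManifold.maximalAtlas (𝓡 n) ∞ M)
    {z : Vec n × Covec n} (hz : z.1 ∈ χ.target) (v : Vec n × Covec n) :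
    G.dsrc (G.exp (cotParam χ z)) (tderiv 𝓘(ℝ, Vec n × Covec n) (𝓡 G.dim)
      (fun z => G.exp (cotParam χ z)) z v) = tderiv (𝓡 n) (𝓡 n) χ.symm z.1 v.1 := by
  have hd := chart_symm_mdifferentiableAt hχ hz
  refine (tderiv_comp_apply (g := G.src) (G.mdifferentiable_src _)
    (mdifferentiableAt_exp_cotParam hχ hz) v).symm.trans ?_
  have e : (fun z => G.src (G.exp (cotParam χ z))) = fun z => χ.symm z.1 :=
    funext fun z => G.src_exp _
  rw [e, tderiv_comp_apply (g := χ.symm) (f := Prod.fst) (I' := 𝓘(ℝ, Vec n)) hd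
    differentiableAt_fst.mdifferentiableAt, tderiv_eq_fderiv, fderiv_fst]
  rfl

theorem pull_exp_vertical (hχ : χ ∈ IsManifold.maximalAtlas (𝓡 n) ∞ M)
    {z : Vec n × Covec n} (hz : z.1 ∈ χ.target) (q : Covec n) (w : Vec n × Covec n) :
    G.form.pull (fun z => G.exp (cotParam χ z)) z ![(0, q), w] = -q w.1 := by
  rw [DiffForm.pull_pair, pair_exp_vertical hχ hz, dsrc_exp_cotParam hχ hz,
    tderiv_chart_tderiv_symm hχ hz]

/-- The mixed coefficients of `exp^*Ω` are constant by `pull_exp_vertical`, so closedness makes the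
horizontal ones independent of `p`. At `p = 0` the map is the unit section, whose image is
isotropic. -/
theorem pull_exp_horizontal (hχ : χ ∈ IsManifold.maximalAtlas (𝓡 n) ∞ M)
    {z : Vec n × Covec n} (hz : z.1 ∈ χ.target) (e e' : Vec n) :
    G.form.pull (fun z => G.exp (cotParam χ z)) z ![(e, 0), (e', 0)] = 0 := by
  set E : Vec n × Covec n → G.Arrow := fun z => G.exp (cotParam χ z)
  have hO := isOpen_cotTarget χ
  have hE : ContMDiffOn 𝓘(ℝ, Vec n × Covec n) (𝓡 G.dim) ∞ E {z | z.1 ∈ χ.target} := fun z hz =>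
    (ContMDiffAt.comp (g := G.exp) z (G.contMDiff_exp _)
      (contMDiffAt_cotParam hχ hz)).contMDiffWithinAt
  have hβ := DiffForm.pull_contDiffOn G.symplectic.smooth hO hE
  have hβd : ∀ z : Vec n × Covec n, z.1 ∈ χ.target → DifferentiableAt ℝ (G.form.pull E) z :=
    fun z hz => (hβ.contDiffAt (hO.mem_nhds hz)).differentiableAt (by simp)
  have hb := contDiffOn_alternating_apply hβ ![(e, 0), (e', 0)]
  have hzero : ∀ p q : Covec n,
      fderiv ℝ (fun w => G.form.pull E w ![(e, 0), (e', 0)]) (z.1, p) (0, q) = 0 := by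
    intro p q
    have hz' : ((z.1, p) : Vec n × Covec n) ∈ {z : Vec n × Covec n | z.1 ∈ χ.target} := hz
    have hclosed : extDeriv (G.form.pull E) (z.1, p) = 0 := by
      rw [DiffForm.extDeriv_pull G.symplectic.smooth.differentiableOn hO hz' hE]
      ext v
      exact DFunLike.congr_fun (G.symplectic.closed (E (z.1, p))) _
    have h1 := extDeriv_two_apply (hβd _ hz') (0, q) (e, 0) (e', 0)
    have hv : ∀ e : Vec n, (fun w => G.form.pull E w ![(0, q), (e, 0)]) =ᶠ[𝓝 (z.1, p)]
        fun _ => -q e := by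
      intro e
      filter_upwards [hO.mem_nhds hz'] with w hw
      exact pull_exp_vertical hχ hw q (e, 0)
    rw [hclosed, (hv e).fderiv_eq, (hv e').fderiv_eq, fderiv_fun_const, fderiv_fun_const] at h1
    simp only [Pi.zero_apply, zero_apply, add_zero, sub_zero] at h1
    exact h1.symm
  have hd : ∀ p : Covec n, HasFDerivAt (fun p => G.form.pull E (z.1, p) ![(e, 0), (e', 0)])
      (0 : Covec n →L[ℝ] ℝ) p := by
    intro p
    have hz' : ((z.1, p) : Vec n × Covec n) ∈ {z : Vec n × Covec n | z.1 ∈ χ.target} := hz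
    have h1 := ((hb.contDiffAt (hO.mem_nhds hz')).differentiableAt (by simp)).hasFDerivAt.comp p
      ((hasFDerivAt_const z.1 p).prodMk (hasFDerivAt_id p))
    refine h1.congr_fderiv ?_
    ext q
    exact hzero p q
  have hconst := is_const_of_fderiv_eq_zero (𝕜 := ℝ)
    (fun p => (hd p).differentiableAt) (fun p => (hd p).fderiv) z.2 0
  have hz0 : ((z.1, (0 : Covec n))).1 ∈ χ.target := hz
  have hu : ∀ e : Vec n, tderiv 𝓘(ℝ, Vec n × Covec n) (𝓡 G.dim) E (z.1, 0) (e, 0) =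
      tderiv (𝓡 n) (𝓡 G.dim) G.unit (χ.symm z.1) (tderiv (𝓡 n) (𝓡 n) χ.symm z.1 e) := by
    intro e
    have hl : HasFDerivAt (fun y : Vec n => ((y, 0) : Vec n × Covec n))
        (ContinuousLinearMap.inl ℝ (Vec n) (Covec n)) z.1 :=
      (ContinuousLinearMap.inl ℝ (Vec n) (Covec n)).hasFDerivAt
    have h1 := tderiv_comp_apply (g := E) (f := fun y : Vec n => ((y, 0) : Vec n × Covec n))
      (I := 𝓘(ℝ, Vec n)) (I' := 𝓘(ℝ, Vec n × Covec n)) (x := z.1)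
      (mdifferentiableAt_exp_cotParam hχ hz0) hl.differentiableAt.mdifferentiableAt e
    rw [tderiv_eq_fderiv (f := fun y : Vec n => ((y, 0) : Vec n × Covec n)), hl.fderiv] at h1
    have h2 : (fun y : Vec n => E (y, 0)) = fun y => G.unit (χ.symm y) := by
      funext y
      rw [← G.exp_zero]
      exact congrArg G.exp (cotangent_ext rfl fun _ => rfl)
    rw [h2, tderiv_comp_apply (I' := 𝓡 n) (G.mdifferentiable_unit _)
      (chart_symm_mdifferentiableAt hχ hz)] at h1
    exact h1.symm
  refine hconst.trans ?_
  rw [DiffForm.pull_pair, hu, hu]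
  have e5 : E (z.1, 0) = G.unit (χ.symm z.1) := by
    rw [← G.exp_zero]
    exact congrArg G.exp (cotangent_ext rfl fun _ => rfl)
  rw [e5]
  exact G.multiplicative.pair_unit _ _ _

theorem pull_exp (hχ : χ ∈ IsManifold.maximalAtlas (𝓡 n) ∞ M)
    {z : Vec n × Covec n} (hz : z.1 ∈ χ.target) (v w : Vec n × Covec n) :
    G.form.pair (G.exp (cotParam χ z))
      (tderiv 𝓘(ℝ, Vec n × Covec n) (𝓡 G.dim) (fun z => G.exp (cotParam χ z)) z v)
      (tderiv 𝓘(ℝ, Vec n × Covec n) (𝓡 G.dim) (fun z => G.exp (cotParam χ z)) z w) =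
    w.2 v.1 - v.2 w.1 := by
  have hv : v = (v.1, 0) + (0, v.2) := by simp
  have hw : w = (w.1, 0) + (0, w.2) := by simp
  have h1 := pull_exp_vertical (G := G) hχ hz v.2 w
  have h2 := pull_exp_vertical (G := G) hχ hz w.2 (v.1, 0)
  have h3 := pull_exp_horizontal (G := G) hχ hz v.1 w.1
  rw [DiffForm.pull_pair] at h1 h2 h3
  rw [DiffForm.pair_swap] at h2
  rw [hv, map_add, map_add, LinearMap.add_apply, h1, hw, map_add, map_add, h3]
  simp only [Prod.fst_add, Prod.snd_add]
  simp only [add_zero, zero_add]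
  linarith

end Pullback

theorem pair_exp (ξ : CotangentBundle n M) (v w : Vec n × Covec n) :
    G.form.pair (G.exp ξ) (tderiv (cotangentModel n) (𝓡 G.dim) G.exp ξ v)
      (tderiv (cotangentModel n) (𝓡 G.dim) G.exp ξ w) = (canonicalForm n M).pair ξ v w := by
  have hχ := IsManifold.chart_mem_maximalAtlas (I := 𝓡 n) (n := ∞) ξ.1
  have hx := mem_chart_source (Vec n) ξ.1
  set χ := chartAt (Vec n) ξ.1
  have hz : (cotCoord χ ξ).1 ∈ χ.target := χ.map_source hx
  have key : ∀ v : Vec n × Covec n, tderiv (cotangentModel n) (𝓡 G.dim) G.exp ξ v =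
      tderiv 𝓘(ℝ, Vec n × Covec n) (𝓡 G.dim) (fun z => G.exp (cotParam χ z)) (cotCoord χ ξ)
        (tderiv (cotangentModel n) 𝓘(ℝ, Vec n × Covec n) (cotCoord χ) ξ v) := by
    intro v
    rw [tderiv_comp_apply (g := G.exp) (f := cotParam χ) (I' := cotangentModel n)
      (G.mdifferentiable_exp _) (mdifferentiableAt_cotParam hχ hz),
      tderiv_cotParam_cotCoord hχ hx, cotParam_cotCoord hχ hx]
  rw [canonicalForm_pair hχ hx, key, key, ← pull_exp (G := G) hχ hz, cotParam_cotCoord hχ hx]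

end SymplecticIntegration

end

end PoissonGeom

/-! ### The exponential is a surjective local diffeomorphism; its kernel is discrete and of full
rank -/

namespace PoissonGeom

noncomputable section

open Set Filter

variable {n : ℕ} {M : Type u} [TopologicalSpace M] [ChartedSpace (EuclideanSpace ℝ (Fin n)) M]
  [T2Space M] [IsManifold (𝓡 n) ∞ M]

theorem continuous_cotangent_mk (x : M) :
    Continuous fun a : Covec n => (⟨x, a⟩ : CotangentBundle n M) :=
  FiberBundle.continuous_totalSpaceMk (Covec n) (CotangentSpace n M) x

namespace SymplecticIntegration

variable (G : SymplecticIntegration (PoissonStructure.zero n M))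

/-- The pulled back form is the nondegenerate canonical one. -/
theorem tderiv_exp_cotParam_injective {χ : OpenPartialHomeomorph M (Vec n)}
    (hχ : χ ∈ IsManifold.maximalAtlas (𝓡 n) ∞ M) {z : Vec n × Covec n} (hz : z.1 ∈ χ.target) :
    Function.Injective (tderiv 𝓘(ℝ, Vec n × Covec n) (𝓡 G.dim)
      (fun z => G.exp (cotParam χ z)) z) := by
  refine (injective_iff_map_eq_zero (tderiv 𝓘(ℝ, Vec n × Covec n) (𝓡 G.dim)
    (fun z => G.exp (cotParam χ z)) z)).2 fun v hv => ?_
  have h : ∀ w : Vec n × Covec n, w.2 v.1 - v.2 w.1 = 0 := fun w => by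
    rw [← pull_exp (G := G) hχ hz v w, hv, map_zero, LinearMap.zero_apply]
  have h2 : v.2 = 0 := by
    ext e
    simpa using h (e, 0)
  refine Prod.ext ?_ h2
  ext i
  have := h (0, (EuclideanSpace.proj i : Vec n →L[ℝ] ℝ))
  simpa using this

theorem isLocalDiffeomorph_exp : IsLocalDiffeomorph (cotangentModel n) (𝓡 G.dim) ∞ G.exp := by
  intro ξ
  have hχ := IsManifold.chart_mem_maximalAtlas (I := 𝓡 n) (n := ∞) ξ.1
  have hx := mem_chart_source (Vec n) ξ.1
  set χ := chartAt (Vec n) ξ.1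
  have hC := IsManifold.chart_mem_maximalAtlas (I := 𝓡 G.dim) (n := ∞) (G.exp ξ)
  have hg := mem_chart_source (Vec G.dim) (G.exp ξ)
  set C := chartAt (Vec G.dim) (G.exp ξ)
  set E : Vec n × Covec n → G.Arrow := fun z => G.exp (cotParam χ z)
  have hE : ∀ z : Vec n × Covec n, z.1 ∈ χ.target →
      ContMDiffAt 𝓘(ℝ, Vec n × Covec n) (𝓡 G.dim) ∞ E z := fun z hz =>
    ContMDiffAt.comp (g := G.exp) z (G.contMDiff_exp _) (contMDiffAt_cotParam hχ hz)
  set z₀ := cotCoord χ ξ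
  have hz₀ : z₀.1 ∈ χ.target := χ.map_source hx
  have hEz₀ : E z₀ = G.exp ξ := congrArg G.exp (cotParam_cotCoord hχ hx)
  let O : Set (Vec n × Covec n) := {z | z.1 ∈ χ.target} ∩ E ⁻¹' C.source
  have hO : IsOpen O := ContinuousOn.isOpen_inter_preimage
    (fun z hz => (hE z hz).continuousAt.continuousWithinAt) (isOpen_cotTarget χ) C.open_source
  have hz₀O : z₀ ∈ O := ⟨hz₀, by rw [mem_preimage, hEz₀]; exact hg⟩
  have hf : ContDiffOn ℝ ∞ (fun z => C (E z)) O := fun z hz => ContDiffAt.contDiffWithinAt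
    (contMDiffAt_iff_contDiffAt.1 ((chart_contMDiffAt hC hz.2).comp z (hE z hz.1)))
  have hfd : HasFDerivAt (fun z => C (E z)) ((tderiv (𝓡 G.dim) (𝓡 G.dim) C (E z₀)).comp
      (tderiv 𝓘(ℝ, Vec n × Covec n) (𝓡 G.dim) E z₀)) z₀ := by
    have h1 := chart_mdifferentiableAt hC hz₀O.2
    have h2 := (hE z₀ hz₀).mdifferentiableAt (by simp)
    have h3 := hasFDerivAt_of_tderiv (f := fun z => C (E z)) (x := z₀) (h1.comp z₀ h2)
    have h4 := tderiv_comp h1 h2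
    rw [← h4]
    exact h3
  set f' := (tderiv (𝓡 G.dim) (𝓡 G.dim) C (E z₀)).comp
      (tderiv 𝓘(ℝ, Vec n × Covec n) (𝓡 G.dim) E z₀)
  have hinj : Function.Injective f'.toLinearMap :=
    (Function.LeftInverse.injective (fun v => tderiv_symm_tderiv_chart hC hz₀O.2 v)).comp
      (G.tderiv_exp_cotParam_injective hχ hz₀)
  have hrank : Module.finrank ℝ (Vec n × Covec n) = Module.finrank ℝ (Vec G.dim) := by
    rw [Module.finrank_prod, finrank_covec, finrank_euclideanSpace_fin, finrank_euclideanSpace_fin,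
      (G.dim_and_ker (G.exp ξ)).1, two_mul]
  let e := (LinearMap.linearEquivOfInjective f'.toLinearMap hinj hrank).toContinuousLinearEquiv
  have he : (e : (Vec n × Covec n) →L[ℝ] Vec G.dim) = f' := rfl
  obtain ⟨g, hg0, hgO, hgf, hgs⟩ := exists_smooth_local_inverse hO hz₀O hf e (by rwa [he])
  have hcoordO : IsOpen ({η : CotangentBundle n M | η.1 ∈ χ.source} ∩ cotCoord χ ⁻¹' g.source) :=
    ContinuousOn.isOpen_inter_preimage (fun ξ hξ =>
      (contMDiffAt_cotCoord hχ hξ).continuousAt.continuousWithinAt)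
      (χ.open_source.preimage contMDiff_cotProj.continuous) g.open_source
  have hEc : ∀ η : CotangentBundle n M, η.1 ∈ χ.source → E (cotCoord χ η) = G.exp η :=
    fun η hη => congrArg G.exp (cotParam_cotCoord hχ hη)
  refine ⟨{ toFun := G.exp
            invFun := fun b => cotParam χ (g.symm (C b))
            source := {η | η.1 ∈ χ.source} ∩ cotCoord χ ⁻¹' g.source
            target := C.source ∩ C ⁻¹' g.target
            map_source' := ?_
            map_target' := ?_
            left_inv' := ?_
            right_inv' := ?_
            open_source := hcoordO
            open_target := C.isOpen_inter_preimage g.open_target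
            contMDiffOn_toFun := G.contMDiff_exp.contMDiffOn
            contMDiffOn_invFun := ?_ }, ⟨hx, hg0⟩, fun _ _ => rfl⟩
  · rintro η ⟨h1, h2⟩
    refine ⟨?_, ?_⟩
    · rw [← hEc η h1]; exact (hgO h2).2
    · rw [mem_preimage, ← hEc η h1, ← hgf]; exact g.map_source h2
  · rintro b ⟨h1, h2⟩
    have h3 := (hgO (g.map_target h2)).1
    refine ⟨χ.map_target h3, ?_⟩
    rw [mem_preimage, cotCoord_cotParam hχ h3]
    exact g.map_target h2
  · rintro η ⟨h1, h2⟩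
    rw [← hEc η h1, ← hgf, g.left_inv h2, cotParam_cotCoord hχ h1]
  · rintro b ⟨h1, h2⟩
    have h3 := hgf (g.symm (C b))
    rw [g.right_inv h2] at h3
    exact C.injOn (hgO (g.map_target h2)).2 h1 h3.symm
  · rintro b ⟨h1, h2⟩
    have h3 := (hgO (g.map_target h2)).1
    have h4 : ContMDiffAt (𝓡 G.dim) 𝓘(ℝ, Vec n × Covec n) ∞ (fun b => g.symm (C b)) b :=
      (hgs.contDiffAt (g.open_target.mem_nhds h2)).contMDiffAt.comp b (chart_contMDiffAt hC h1)
    exact ((contMDiffAt_cotParam hχ h3).comp b h4).contMDiffWithinAt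

theorem exists_injOn_exp (ξ : CotangentBundle n M) : ∃ N ∈ 𝓝 ξ, InjOn G.exp N := by
  obtain ⟨Φ, h1, h2⟩ := G.isLocalDiffeomorph_exp ξ
  exact ⟨Φ.source, Φ.open_source.mem_nhds h1, h2.symm.injOn_iff.1 Φ.toPartialEquiv.injOn⟩

theorem exp_neg_mul (x : M) (a : CotangentSpace n M x) :
    G.mul (G.exp ⟨x, a⟩) (G.exp ⟨x, -a⟩) = G.unit x := by
  rw [← G.exp_add, add_neg_cancel, G.exp_zero]

/-- The image in a source fibre is an open subgroup of the fibre; its cosets are open too, so it is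
also closed, and a connected fibre is all of it. -/
theorem surjective_exp : Function.Surjective G.exp := by
  intro g
  set x := G.src g with hx
  have hO : IsOpen (range G.exp) := G.isLocalDiffeomorph_exp.isOpen_range
  have : PreconnectedSpace (G.src ⁻¹' {x}) :=
    isPreconnected_iff_preconnectedSpace.1 (G.src_connected x).isPreconnected
  have hmem : ∀ h : G.src ⁻¹' {x}, h.1 ∈ range G.exp →
      ∃ a : CotangentSpace n M x, h.1 = G.exp ⟨x, a⟩ := by
    rintro ⟨h, hh⟩ ⟨⟨y, a⟩, rfl⟩
    obtain rfl : y = x := (G.src_exp ⟨y, a⟩).symm.trans hh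
    exact ⟨a, rfl⟩
  have hl : IsLocallyConstant (fun h : G.src ⁻¹' {x} => h.1 ∈ range G.exp) := by
    rw [IsLocallyConstant.iff_eventually_eq]
    rintro ⟨k, hk⟩
    have hk' : G.src k = x := hk
    have hcomp : ∀ h : G.src ⁻¹' {x}, G.src (G.inv k) = G.tgt h.1 := fun h => by
      have hh : G.src h.1 = x := h.2
      rw [G.src_inv, G.tgt_eq_src, G.tgt_eq_src, hh, hk']
    have hcont : Continuous (fun h : G.src ⁻¹' {x} => G.mul (G.inv k) h.1) :=
      G.mul_smooth.continuousOn.comp_continuous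
        (f := fun h : G.src ⁻¹' {x} => (G.inv k, h.1)) (by fun_prop) hcomp
    -- For `h` near `k` the element `k⁻¹ h` is near a unit, hence of the form `exp b`; then `h = k
    -- exp b` and `k = h exp (-b)` lie in the image together.
    have hu : G.mul (G.inv k) k ∈ range G.exp := by
      rw [G.inv_mul]
      exact ⟨⟨_, 0⟩, G.exp_zero _⟩
    filter_upwards [hcont.continuousAt (x := ⟨k, hk⟩) (hO.mem_nhds hu)] with h hh
    have hh' : G.src h.1 = x := h.2
    obtain ⟨b, hb⟩ := hmem ⟨G.mul (G.inv k) h.1, (G.src_mul _ _ (hcomp h)).trans hh'⟩ hh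
    have hu' : G.mul (G.unit x) h.1 = h.1 := by
      have := G.unit_mul h.1
      rwa [G.tgt_eq_src, hh'] at this
    have e1 : h.1 = G.mul k (G.exp ⟨x, b⟩) := by
      rw [← hb, ← G.mul_assoc _ _ _ (G.tgt_inv k).symm (hcomp h), G.mul_inv, G.tgt_eq_src, hk',
        hu']
    have hsb : ∀ b : CotangentSpace n M x, G.tgt (G.exp ⟨x, b⟩) = x := fun b => by
      rw [G.tgt_eq_src, G.src_exp]
    have e2 : k = G.mul h.1 (G.exp ⟨x, -b⟩) := by
      rw [e1, G.mul_assoc _ _ _ (by rw [hsb, hk']) (by rw [hsb, G.src_exp]), G.exp_neg_mul, ← hk',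
        G.mul_unit]
    refine propext ⟨fun h1 => ?_, fun h1 => ?_⟩
    · obtain ⟨a, ha⟩ := hmem h h1
      rw [e2, ha, ← G.exp_add]
      exact ⟨_, rfl⟩
    · obtain ⟨a, ha⟩ := hmem ⟨k, hk⟩ h1
      have ha' : k = _ := ha
      rw [e1, ha', ← G.exp_add]
      exact ⟨_, rfl⟩
  have h := hl.apply_eq_of_preconnectedSpace ⟨g, hx.symm⟩ ⟨G.unit x, G.src_unit x⟩
  exact h.symm.mp ⟨⟨x, 0⟩, G.exp_zero x⟩

/-- The kernel of the exponential map at `x`. -/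
def kernel (x : M) : AddSubgroup (CotangentSpace n M x) where
  carrier := {a | G.exp ⟨x, a⟩ = G.unit x}
  zero_mem' := G.exp_zero x
  add_mem' {a b} ha hb := by
    have ha' : G.exp ⟨x, a⟩ = G.unit x := ha
    have hb' : G.exp ⟨x, b⟩ = G.unit x := hb
    have := G.mul_unit (G.unit x)
    rw [G.src_unit] at this
    change G.exp ⟨x, a + b⟩ = _
    rw [G.exp_add, ha', hb', this]
  neg_mem' {a} ha := by
    have ha' : G.exp ⟨x, a⟩ = G.unit x := ha
    have h1 := G.exp_neg_mul x a
    have h2 := G.unit_mul (G.exp ⟨x, -a⟩)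
    rw [G.tgt_eq_src, G.src_exp] at h2
    rw [ha', h2] at h1
    exact h1

variable {G}

theorem mem_kernel {x : M} {a : CotangentSpace n M x} :
    a ∈ G.kernel x ↔ G.exp ⟨x, a⟩ = G.unit x := Iff.rfl

theorem exp_eq_exp_iff {x : M} {a b : CotangentSpace n M x} :
    G.exp ⟨x, a⟩ = G.exp ⟨x, b⟩ ↔ a - b ∈ G.kernel x := by
  rw [mem_kernel]
  refine ⟨fun h => ?_, fun h => ?_⟩
  · rw [sub_eq_add_neg, G.exp_add, h, G.exp_neg_mul]
  · have h1 := G.exp_add x (a - b) b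
    have h2 := G.unit_mul (G.exp ⟨x, b⟩)
    rw [G.tgt_eq_src, G.src_exp] at h2
    rwa [sub_add_cancel, h, h2] at h1

/-- `exp` is injective near the zero covector at `x`, so no other kernel element is close to it. -/
theorem kernel_discrete (x : M) : DiscreteTopology (G.kernel x) := by
  apply discreteTopology_of_isOpen_singleton_zero
  obtain ⟨N, hN, hinj⟩ := G.exists_injOn_exp ⟨x, 0⟩
  obtain ⟨S, hSN, hS, h0⟩ := mem_nhds_iff.1
    ((continuous_cotangent_mk (n := n) x).continuousAt (x := 0) hN)
  have hS' : IsOpen (S : Set (CotangentSpace n M x)) := hS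
  have h : ({0} : Set (G.kernel x)) = Subtype.val ⁻¹' (S : Set (CotangentSpace n M x)) := by
    ext a
    constructor
    · rintro rfl
      exact h0
    · intro ha
      have h1 : G.exp ⟨x, a.1⟩ = G.exp ⟨x, 0⟩ := (mem_kernel.1 a.2).trans (G.exp_zero x).symm
      have h2 := hinj (hSN ha) (hSN h0) h1
      have h3 : a.1 = 0 := eq_of_heq (TotalSpace.mk.inj h2).2
      exact Subtype.ext h3
  rw [h]
  exact hS'.preimage continuous_subtype_val

end SymplecticIntegration

namespace ProperSymplecticIntegration

variable (G : ProperSymplecticIntegration (PoissonStructure.zero n M))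

theorem isCompact_fibre (x : M) : IsCompact (G.src ⁻¹' {x}) := by
  have h := G.proper.isCompact_preimage (isCompact_singleton (x := (x, x)))
  have e : G.src ⁻¹' {x} = (fun g => (G.src g, G.tgt g)) ⁻¹' {(x, x)} := by
    ext g
    simp [G.toSymplecticIntegration.tgt_eq_src g]
  rwa [e]

/-- The kernel of the exponential map is cocompact. -/
theorem exists_bounded_representative (x : M) : ∃ (T : Covec n →L[ℝ] Covec n) (R : ℝ),
    ∀ a : CotangentSpace n M x, ∃ p : Covec n, ‖p‖ < R ∧
      ∃ b : CotangentSpace n M x, covec b = T p ∧ a - b ∈ G.kernel x := by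
  have hχ := IsManifold.chart_mem_maximalAtlas (I := 𝓡 n) (n := ∞) x
  have hx := mem_chart_source (Vec n) x
  set χ := chartAt (Vec n) x
  -- The open images of these sets, increasing in `R`, cover the compact fibre over `x`, so a single
  -- radius suffices.
  let W : ℕ → Set (CotangentBundle n M) := fun R =>
    {η | η.1 ∈ χ.source} ∩ cotCoord χ ⁻¹' (univ ×ˢ Metric.ball 0 R)
  have hW : ∀ R, IsOpen (W R) := fun R => ContinuousOn.isOpen_inter_preimage
    (fun ξ hξ => (contMDiffAt_cotCoord hχ hξ).continuousAt.continuousWithinAt)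
    (χ.open_source.preimage contMDiff_cotProj.continuous) (isOpen_univ.prod Metric.isOpen_ball)
  have hWmono : Monotone W := fun R R' h => inter_subset_inter_right _ (preimage_mono
    (prod_mono subset_rfl (Metric.ball_subset_ball (by exact_mod_cast h))))
  have hdir : Directed (· ⊆ ·) fun R => G.exp '' W R :=
    (monotone_image.comp hWmono).directed_le
  obtain ⟨R, hR⟩ := (G.isCompact_fibre x).elim_directed_cover (fun R => G.exp '' W R)
    (fun R => G.isLocalDiffeomorph_exp.isOpenMap _ (hW R)) (by
      intro g hg
      obtain ⟨ξ, rfl⟩ := G.surjective_exp g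
      have hξ : ξ.1 = x := (G.src_exp ξ).symm.trans hg
      obtain ⟨R, hR⟩ := exists_nat_gt ‖(cotCoord χ ξ).2‖
      refine mem_iUnion.2 ⟨R, ξ, ⟨?_, trivial, mem_ball_zero_iff.2 hR⟩, rfl⟩
      change ξ.1 ∈ χ.source
      rw [hξ]; exact hx) hdir
  -- `T` is composition with `dχ`, which turns the bounded `p`-coordinates of a representative back
  -- into a covector at `x`.
  refine ⟨(ContinuousLinearMap.compL ℝ (Vec n) (Vec n) ℝ).flip (tderiv (𝓡 n) (𝓡 n) χ x), R,
    fun a => ?_⟩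
  obtain ⟨⟨y, b⟩, ⟨hb1, hb2⟩, hb3⟩ := hR (G.src_exp ⟨x, a⟩)
  obtain rfl : y = x := (G.src_exp ⟨y, b⟩).symm.trans
    ((congrArg G.src hb3).trans (G.src_exp ⟨x, a⟩))
  refine ⟨(cotCoord χ ⟨y, b⟩).2, mem_ball_zero_iff.1 hb2.2, b, ?_,
    SymplecticIntegration.exp_eq_exp_iff.1 hb3.symm⟩
  ext v
  change covec b v = covec b (tderiv (𝓡 n) (𝓡 n) χ.symm (χ y) (tderiv (𝓡 n) (𝓡 n) χ y v))
  rw [tderiv_symm_tderiv_chart hχ hx]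

/-- Otherwise some nonzero linear functional vanishes on the kernel. It takes on every covector the
value at a bounded representative, so it is bounded above, which is impossible. -/
theorem kernel_span (x : M) :
    Submodule.span ℝ (G.kernel x : Set (CotangentSpace n M x)) = ⊤ := by
  by_contra hne
  obtain ⟨f, hf, hker⟩ := Submodule.exists_le_ker_of_lt_top _ (lt_top_iff_ne_top.2 hne)
  obtain ⟨T, R, hT⟩ := G.exists_bounded_representative x
  let f' : Covec n →L[ℝ] ℝ := LinearMap.toContinuousLinearMap f
  have hbound : ∀ a : CotangentSpace n M x, f a ≤ ‖f'.comp T‖ * R := by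
    intro a
    obtain ⟨p, hp, b, hb, hab⟩ := hT a
    have h1 : f (a - b) = 0 := hker (Submodule.subset_span hab)
    have h2 : f a = f' (T p) := by
      rw [map_sub, sub_eq_zero] at h1
      rw [← hb]
      exact h1
    rw [h2]
    calc f' (T p) ≤ ‖(f'.comp T) p‖ := le_abs_self _
      _ ≤ ‖f'.comp T‖ * ‖p‖ := (f'.comp T).le_opNorm p
      _ ≤ ‖f'.comp T‖ * R := by gcongr
  apply hf
  ext a
  by_contra ha
  have ha' : f a ≠ 0 := ha
  have h := hbound (((‖f'.comp T‖ * R + 1) / f a) • a)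
  rw [f.map_smul, smul_eq_mul, div_mul_cancel₀ _ ha'] at h
  linarith

end ProperSymplecticIntegration

end

end PoissonGeom

/-! ### Smoothness of the kernel, and the Lagrangian lattice of a proper integration -/

namespace PoissonGeom

noncomputable section

open Set Filter

/-- A discrete subgroup of full rank has an integral basis. -/
theorem exists_integral_basis {E : Type*} [NormedAddCommGroup E] [NormedSpace ℝ E]
    [FiniteDimensional ℝ E] {n : ℕ} (hn : Module.finrank ℝ E = n) (Λ : AddSubgroup E)
    (hd : DiscreteTopology Λ) (hs : Submodule.span ℝ (Λ : Set E) = ⊤) :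
    ∃ b : Fin n → E, LinearIndependent ℝ b ∧ (∀ i, b i ∈ Λ) ∧
      ∀ t : Fin n → ℝ, ∑ i, t i • b i ∈ Λ → ∃ m : Fin n → ℤ, ∀ i, t i = m i := by
  let L : Submodule ℤ E := AddSubgroup.toIntSubmodule Λ
  have hdL : DiscreteTopology L := hd
  have hzL : IsZLattice ℝ L := ⟨hs⟩
  have hf : Module.Finite ℤ L := ZLattice.module_finite ℝ L
  have hfr : Module.Free ℤ L := ZLattice.module_free ℝ L
  let b := Module.finBasisOfFinrankEq ℤ L ((ZLattice.rank ℝ L).trans hn)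
  let B := b.ofZLatticeBasis ℝ L
  have hB : ∀ i, B i = b i := fun i => b.ofZLatticeBasis_apply ℝ L i
  refine ⟨B, B.linearIndependent, fun i => by rw [hB]; exact (b i).2, fun t ht => ?_⟩
  refine ⟨fun i => b.repr ⟨_, ht⟩ i, fun i => ?_⟩
  have h1 := b.ofZLatticeBasis_repr_apply ℝ L ⟨∑ i, t i • B i, ht⟩ i
  change B.repr (∑ i, t i • B i) i = _ at h1
  rw [B.repr_sum_self] at h1
  exact h1

variable {n : ℕ} {M : Type u} [TopologicalSpace M] [ChartedSpace (EuclideanSpace ℝ (Fin n)) M]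
  [T2Space M] [IsManifold (𝓡 n) ∞ M]

theorem constSection_secCoord {χ : OpenPartialHomeomorph M (Vec n)}
    (hχ : χ ∈ IsManifold.maximalAtlas (𝓡 n) ∞ M) (α : ∀ y : M, CotangentSpace n M y) {q : Vec n}
    (hq : q ∈ χ.target) : constSection χ (secCoord χ α q) (χ.symm q) = α (χ.symm q) := by
  apply covec_injective
  ext v
  have h := secCoord_tderiv hχ α (χ.map_target hq) v
  rwa [χ.right_inv hq] at h

theorem constSection_sum {χ : OpenPartialHomeomorph M (Vec n)} (t : Fin n → ℝ)
    (p : Fin n → Covec n) (y : M) :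
    constSection χ (∑ i, t i • p i) y = ∑ i, t i • constSection χ (p i) y := by
  let T : Covec n →ₗ[ℝ] CotangentSpace n M y :=
    ((ContinuousLinearMap.compL ℝ (Vec n) (Vec n) ℝ).flip (tderiv (𝓡 n) (𝓡 n) χ y)).toLinearMap
  have h : T (∑ i, t i • p i) = ∑ i, t i • T (p i) := by
    rw [map_sum]
    simp only [map_smul]
  exact h

theorem int_smul_mem {x : M} (S : AddSubgroup (CotangentSpace n M x)) {a : CotangentSpace n M x}
    (ha : a ∈ S) {m : ℤ} : (m : ℝ) • a ∈ S := by
  have e : (m : ℝ) • a = m • a := Int.cast_smul_eq_zsmul ℝ m (covec a)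
  rw [e]
  exact zsmul_mem ha m

namespace SymplecticIntegration

variable {G : SymplecticIntegration (PoissonStructure.zero n M)}

/-- An element of the kernel of the exponential map extends to a smooth section of the kernel. -/
theorem exists_kernel_section {x : M} {b : CotangentSpace n M x} (hb : b ∈ G.kernel x) :
    ∃ (U : Set M) (α : ∀ y : M, CotangentSpace n M y), IsOpen U ∧ x ∈ U ∧
      IsSmoothSectionOn n M α U ∧ α x = b ∧ ∀ y ∈ U, α y ∈ G.kernel y := by
  obtain ⟨Φ, hΦ, hΦe⟩ := G.isLocalDiffeomorph_exp ⟨x, b⟩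
  let A : M → CotangentBundle n M := fun y => Φ.invFun (G.unit y)
  let U : Set M := G.unit ⁻¹' Φ.target
  have hU : IsOpen U := Φ.open_target.preimage G.unit_smooth.continuous
  have hexp : ∀ y ∈ U, G.exp (A y) = G.unit y := fun y hy =>
    (hΦe (Φ.map_target' hy)).trans (Φ.right_inv' hy)
  have hbase : ∀ y ∈ U, (A y).1 = y := fun y hy => by
    rw [← G.src_exp, hexp y hy, G.src_unit]
  let α : ∀ y : M, CotangentSpace n M y := fun y => (covec (A y).2 : Covec n)
  have hαA : ∀ y ∈ U, (⟨y, α y⟩ : CotangentBundle n M) = A y := fun y hy =>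
    (cotangent_ext (hbase y hy) fun v => rfl).symm
  have hb' : Φ.toFun ⟨x, b⟩ = G.unit x := (hΦe hΦ).symm.trans hb
  have hA0 : A x = ⟨x, b⟩ := by
    change Φ.invFun (G.unit x) = _
    rw [← hb']
    exact Φ.left_inv' hΦ
  have hxU : x ∈ U := by
    change G.unit x ∈ Φ.target
    rw [← hb']
    exact Φ.map_source' hΦ
  refine ⟨U, α, hU, hxU, ?_, ?_, fun y hy => ?_⟩
  · have hA : ContMDiffOn (𝓡 n) (cotangentModel n) ∞ A U :=
      Φ.contMDiffOn_invFun.comp G.unit_smooth.contMDiffOn fun y hy => hy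
    exact hA.congr hαA
  · have h := (hαA x hxU).trans hA0
    exact eq_of_heq (TotalSpace.mk.inj h).2
  · exact (congrArg G.exp (hαA y hy)).trans (hexp y hy)

/-- By compactness of the cube it is enough to work near each `(q₀, t₀)`. If `t₀` gives a kernel
element it is integral by hypothesis, and injectivity of `exp` near that element forces nearby
solutions to equal `t₀`. If not, the exponential stays away from the units because the arrows form a
Hausdorff space. -/
theorem eventually_integral {χ : OpenPartialHomeomorph M (Vec n)}
    (hχ : χ ∈ IsManifold.maximalAtlas (𝓡 n) ∞ M) {q₀ : Vec n} (hq₀ : q₀ ∈ χ.target)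
    {p : Fin n → Vec n → Covec n} (hp : ∀ i, ContinuousAt (p i) q₀)
    (hli : LinearIndependent ℝ fun i => p i q₀)
    (hmem : ∀ m : Fin n → ℤ, ∀ᶠ q in 𝓝 q₀,
      G.exp (cotParam χ (q, ∑ i, (m i : ℝ) • p i q)) = G.unit (χ.symm q))
    (hint : ∀ t : Fin n → ℝ, G.exp (cotParam χ (q₀, ∑ i, t i • p i q₀)) = G.unit (χ.symm q₀) →
      ∃ m : Fin n → ℤ, ∀ i, t i = m i) :
    ∀ᶠ q in 𝓝 q₀, ∀ t ∈ Icc (0 : Fin n → ℝ) 1,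
      G.exp (cotParam χ (q, ∑ i, t i • p i q)) = G.unit (χ.symm q) →
        ∃ m : Fin n → ℤ, ∀ i, t i = m i := by
  have := G.hausdorff
  have hli' : ∀ᶠ q in 𝓝 q₀, LinearIndependent ℝ fun i => p i q := by
    have hc : ContinuousAt (fun q => fun i => p i q) q₀ := continuousAt_pi.2 hp
    exact hc.eventually (isOpen_setOfPred_linearIndependent.mem_nhds hli)
  refine IsCompact.eventually_forall_of_forall_eventually isCompact_Icc fun t₀ _ => ?_
  have hp' : ∀ i, ContinuousAt (fun z : Vec n × (Fin n → ℝ) => p i z.1) (q₀, t₀) := fun i =>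
    ContinuousAt.comp (f := Prod.fst) (g := p i) (hp i) continuousAt_fst
  have hS : ContinuousAt (fun z : Vec n × (Fin n → ℝ) => cotParam χ (z.1, ∑ i, z.2 i • p i z.1))
      (q₀, t₀) := by
    have h1 : ContinuousAt (fun z : Vec n × (Fin n → ℝ) => (z.1, ∑ i, z.2 i • p i z.1))
        (q₀, t₀) := continuousAt_fst.prodMk (tendsto_finsetSum _ fun i _ =>
      ((continuous_apply i).continuousAt.comp continuousAt_snd).smul (hp' i))
    exact ContinuousAt.comp (g := cotParam χ)
      (contMDiffAt_cotParam hχ (z := (q₀, ∑ i, t₀ i • p i q₀)) hq₀).continuousAt h1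
  have hS₀ : ContinuousAt (fun z : Vec n × (Fin n → ℝ) => cotParam χ (z.1, ∑ i, t₀ i • p i z.1))
      (q₀, t₀) := by
    have h1 : ContinuousAt (fun z : Vec n × (Fin n → ℝ) => (z.1, ∑ i, t₀ i • p i z.1))
        (q₀, t₀) := continuousAt_fst.prodMk (tendsto_finsetSum _ fun i _ =>
      (hp' i).const_smul (t₀ i))
    exact ContinuousAt.comp (g := cotParam χ)
      (contMDiffAt_cotParam hχ (z := (q₀, ∑ i, t₀ i • p i q₀)) hq₀).continuousAt h1
  by_cases h0 : G.exp (cotParam χ (q₀, ∑ i, t₀ i • p i q₀)) = G.unit (χ.symm q₀)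
  · obtain ⟨m, hm⟩ := hint t₀ h0
    obtain ⟨N, hN, hinj⟩ := G.exists_injOn_exp (cotParam χ (q₀, ∑ i, t₀ i • p i q₀))
    have hm' := hmem m
    simp only [← hm] at hm'
    filter_upwards [hS hN, hS₀ hN, continuousAt_fst.eventually hm', continuousAt_fst.eventually hli',
      continuousAt_fst.eventually (χ.open_target.eventually_mem hq₀)] with z h1 h2 h3 h4 h5 h6
    have h7 := congrArg (cotCoord χ) (hinj h1 h2 (h6.trans h3.symm))
    rw [cotCoord_cotParam hχ h5, cotCoord_cotParam hχ h5] at h7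
    have h8 : ∑ i, z.2 i • p i z.1 = ∑ i, t₀ i • p i z.1 := congrArg Prod.snd h7
    refine ⟨m, fun i => ?_⟩
    have h9 := Fintype.linearIndependent_iff.1 h4 (fun i => z.2 i - t₀ i) (by
      simp only [sub_smul, Finset.sum_sub_distrib, h8, sub_self]) i
    rw [← hm, sub_eq_zero.1 h9]
  · have h1 : ContinuousAt (fun z : Vec n × (Fin n → ℝ) => G.unit (χ.symm z.1)) (q₀, t₀) :=
      ContinuousAt.comp (f := Prod.fst) (g := fun q => G.unit (χ.symm q))
        (G.unit_smooth.continuous.continuousAt.comp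
          (chart_symm_contMDiffAt hχ hq₀).continuousAt) continuousAt_fst
    have h2 := G.contMDiff_exp.continuous.continuousAt.comp hS
    filter_upwards [(h2.ne_iff_eventually_ne h1).1 h0] with z hz h3
    exact absurd h3 hz

/-- An integral basis at `x` extends to sections of the kernel. At nearby points these remain a real
basis, and they still generate: subtracting integral parts brings the coefficients of a kernel
element into the unit cube, where `eventually_integral` makes them integers. -/
theorem kernel_smooth (hspan : ∀ x, Submodule.span ℝ (G.kernel x : Set (CotangentSpace n M x)) = ⊤)
    (x : M) : ∃ (U : Set M) (α : Fin n → ∀ y : M, CotangentSpace n M y),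
      IsOpen U ∧ x ∈ U ∧ (∀ i, IsSmoothSectionOn n M (α i) U) ∧
        ∀ y ∈ U, G.kernel y = AddSubgroup.closure (Set.range fun i => α i y) := by
  have hχ := IsManifold.chart_mem_maximalAtlas (I := 𝓡 n) (n := ∞) x
  have hx := mem_chart_source (Vec n) x
  set χ := chartAt (Vec n) x
  obtain ⟨b, hb, hbΛ, hbint⟩ := exists_integral_basis (E := Covec n) (finrank_covec n) (G.kernel x)
    (kernel_discrete x) (hspan x)
  choose U α hU hxU hα hαx hαΛ using fun i => exists_kernel_section (hbΛ i)
  let p : Fin n → Vec n → Covec n := fun i => secCoord χ (α i)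
  have hq₀ : χ x ∈ χ.target := χ.map_source hx
  have hcomb : ∀ q ∈ χ.target, ∀ t : Fin n → ℝ, cotParam χ (q, ∑ i, t i • p i q) =
      ⟨χ.symm q, ∑ i, t i • α i (χ.symm q)⟩ := by
    intro q hq t
    have h1 : constSection χ (∑ i, t i • p i q) (χ.symm q) = ∑ i, t i • α i (χ.symm q) := by
      rw [constSection_sum]
      exact Finset.sum_congr rfl fun i _ => by rw [constSection_secCoord hχ _ hq]
    rw [← h1]
    rfl
  have hmemint : ∀ q ∈ χ.target, (∀ i, χ.symm q ∈ U i) → ∀ m : Fin n → ℤ,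
      ∑ i, (m i : ℝ) • α i (χ.symm q) ∈ G.kernel (χ.symm q) := by
    intro q hq hqU m
    refine sum_mem fun i _ => ?_
    exact int_smul_mem _ (hαΛ i _ (hqU i))
  have hev : ∀ᶠ q in 𝓝 (χ x), q ∈ χ.target ∧ ∀ i, χ.symm q ∈ U i := by
    refine (χ.open_target.eventually_mem hq₀).and (eventually_all.2 fun i => ?_)
    refine (χ.continuousAt_symm hq₀).eventually ((hU i).eventually_mem ?_)
    rw [χ.left_inv hx]
    exact hxU i
  have hp : ∀ i, ContinuousAt (p i) (χ x) := fun i =>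
    (secCoord_contDiffAt hχ (hU i) (hα i) hq₀ (by rw [χ.left_inv hx]; exact hxU i)).continuousAt
  have hli : LinearIndependent ℝ fun i => p i (χ x) := by
    refine LinearIndependent.of_comp ((ContinuousLinearMap.compL ℝ (Vec n) (Vec n) ℝ).flip
      (tderiv (𝓡 n) (𝓡 n) χ x)).toLinearMap ?_
    convert! hb using 1
    funext i
    ext v
    refine (secCoord_tderiv hχ (α i) hx v).trans ?_
    rw [hαx]
    rfl
  have hmain := eventually_integral (G := G) hχ hq₀ hp hli (fun m => by
      filter_upwards [hev] with q hq
      rw [hcomb q hq.1]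
      exact hmemint q hq.1 hq.2 m) (fun t ht => hbint t (by
      rw [hcomb _ hq₀] at ht
      have h1 : (⟨χ.symm (χ x), ∑ i, t i • α i (χ.symm (χ x))⟩ : CotangentBundle n M) =
          ⟨x, ∑ i, t i • α i x⟩ := by rw [χ.left_inv hx]
      rw [h1, χ.left_inv hx] at ht
      have h2 : ∑ i, t i • α i x ∈ G.kernel x := ht
      simp only [hαx] at h2
      exact h2))
  have hli' : ∀ᶠ q in 𝓝 (χ x), LinearIndependent ℝ fun i => p i q :=
    (continuousAt_pi.2 hp).eventually (isOpen_setOfPred_linearIndependent.mem_nhds hli)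
  have hall := (χ.continuousAt hx).eventually (hev.and (hmain.and hli'))
  obtain ⟨W, hW, hWo, hxW⟩ := mem_nhds_iff.1 (hall.and (χ.open_source.eventually_mem hx))
  refine ⟨W, α, hWo, hxW, fun i => (hα i).mono fun y hy => ?_, fun y hy => ?_⟩
  · obtain ⟨⟨⟨-, h2⟩, -⟩, h3⟩ := hW hy
    have := h2 i
    rwa [χ.left_inv h3] at this
  · obtain ⟨⟨⟨h1, h2⟩, h3, h4⟩, h5⟩ := hW hy
    have h5' : χ.symm (χ y) = y := χ.left_inv h5
    apply le_antisymm
    · intro a ha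
      obtain ⟨s, hs⟩ : ∃ s : Fin n → ℝ, a = ∑ i, s i • α i y := by
        have hsp := h4.span_eq_top_of_card_eq_finrank' (by rw [finrank_covec, Fintype.card_fin])
        have hmem : secCoord χ (fun y => (covec a : Covec n)) (χ y) ∈
            Submodule.span ℝ (range fun i => p i (χ y)) := by rw [hsp]; trivial
        obtain ⟨s, hs⟩ := (Submodule.mem_span_range_iff_exists_fun ℝ).1 hmem
        refine ⟨s, ?_⟩
        have e1 := constSection_secCoord hχ (fun y => (covec a : Covec n)) h1
        rw [← hs, constSection_sum, h5'] at e1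
        refine e1.symm.trans (Finset.sum_congr rfl fun i _ => ?_)
        have e2 := constSection_secCoord hχ (α i) h1
        rw [h5'] at e2
        rw [← e2]
      -- Removing the floor parts changes `a` by an integral combination of kernel sections, so it
      -- remains in the kernel.
      have hfr : ∑ i, Int.fract (s i) • α i y ∈ G.kernel y := by
        have e : ∑ i, Int.fract (s i) • α i y = a - ∑ i, (⌊s i⌋ : ℝ) • α i y := by
          rw [hs, ← Finset.sum_sub_distrib]
          refine Finset.sum_congr rfl fun i _ => ?_
          exact sub_smul (s i) (⌊s i⌋ : ℝ) (covec (α i y))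
        rw [e]
        refine sub_mem ha ?_
        have := hmemint _ h1 h2 fun i => ⌊s i⌋
        rwa [h5'] at this
      obtain ⟨m, hm⟩ := h3 (fun i => Int.fract (s i))
        ⟨fun i => Int.fract_nonneg _, fun i => (Int.fract_lt_one _).le⟩ (by
          rw [hcomb _ h1]
          have e : (⟨χ.symm (χ y), ∑ i, Int.fract (s i) • α i (χ.symm (χ y))⟩ :
              CotangentBundle n M) = ⟨y, ∑ i, Int.fract (s i) • α i y⟩ := by rw [h5']
          rw [e, h5']
          exact hfr)
      rw [hs]
      refine sum_mem fun i _ => ?_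
      have e : s i = ((⌊s i⌋ + m i : ℤ) : ℝ) := by
        rw [Int.cast_add, ← hm, Int.floor_add_fract]
      rw [e]
      exact int_smul_mem _ (AddSubgroup.subset_closure (k := range fun i => α i y)
        (mem_range_self i))
    · rw [AddSubgroup.closure_le]
      rintro _ ⟨i, rfl⟩
      have := h2 i
      rw [h5'] at this
      exact hαΛ i y this

/-- Sections of the kernel of the exponential map are closed. -/
theorem canonicalForm_kernel_section {U : Set M} {α : ∀ y : M, CotangentSpace n M y}
    (hU : IsOpen U) (hα : IsSmoothSectionOn n M α U) (hαΛ : ∀ y ∈ U, α y ∈ G.kernel y) {y : M}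
    (hy : y ∈ U) (v w : Vec n) : (canonicalForm n M).pair ⟨y, α y⟩
      (tderiv (𝓡 n) (cotangentModel n) (fun x => (⟨x, α x⟩ : CotangentBundle n M)) y v)
      (tderiv (𝓡 n) (cotangentModel n) (fun x => (⟨x, α x⟩ : CotangentBundle n M)) y w) = 0 := by
  have hd : MDifferentiableAt (𝓡 n) (cotangentModel n)
      (fun x => (⟨x, α x⟩ : CotangentBundle n M)) y :=
    (hα.contMDiffAt (hU.mem_nhds hy)).mdifferentiableAt (by simp)
  -- Since `exp ∘ α` is the unit section, `α^*ω_can = α^*exp^*Ω` is the pullback of `Ω` to the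
  -- units, which vanishes.
  have hev : (fun y => G.exp ⟨y, α y⟩) =ᶠ[𝓝 y] G.unit := by
    filter_upwards [hU.mem_nhds hy] with z hz using hαΛ z hz
  have key : ∀ v : Vec n, tderiv (cotangentModel n) (𝓡 G.dim) G.exp ⟨y, α y⟩
      (tderiv (𝓡 n) (cotangentModel n) (fun x => (⟨x, α x⟩ : CotangentBundle n M)) y v) =
      tderiv (𝓡 n) (𝓡 G.dim) G.unit y v := by
    intro v
    rw [← tderiv_congr hev]
    exact (tderiv_comp_apply (g := G.exp) (f := fun x => (⟨x, α x⟩ : CotangentBundle n M))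
      (G.mdifferentiable_exp _) hd v).symm
  have h3 : G.exp ⟨y, α y⟩ = G.unit y := hev.eq_of_nhds
  rw [← G.pair_exp, key, key, h3, G.multiplicative.pair_unit]

end SymplecticIntegration

/-- The Lagrangian lattice of a proper symplectic integration of the zero Poisson structure: the
kernel of the exponential map. -/
def ProperSymplecticIntegration.lattice
    (G : ProperSymplecticIntegration (PoissonStructure.zero n M)) : LagrangianLattice n M where
  fiber := G.kernel
  discrete := SymplecticIntegration.kernel_discrete
  full_rank := G.kernel_span
  smooth := SymplecticIntegration.kernel_smooth G.kernel_span
  lagrangian _ _ hU hα hαΛ _ hy v w :=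
    SymplecticIntegration.canonicalForm_kernel_section hU hα hαΛ hy v w

end

end PoissonGeom

/-! ### Quotient maps are exponentials; classification by lattices -/

namespace PoissonGeom

noncomputable section

open Set Filter

variable {n : ℕ} {M : Type u} [TopologicalSpace M] [ChartedSpace (EuclideanSpace ℝ (Fin n)) M]
  [T2Space M] [IsManifold (𝓡 n) ∞ M]

theorem tderiv_surjective_of_isLocalDiffeomorph {d : ℕ} {N : Type*} [TopologicalSpace N]
    [ChartedSpace (EuclideanSpace ℝ (Fin d)) N] {p : CotangentBundle n M → N}
    (hp : IsLocalDiffeomorph (cotangentModel n) (𝓡 d) ∞ p) (ξ : CotangentBundle n M) :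
    Function.Surjective (tderiv (cotangentModel n) (𝓡 d) p ξ) :=
  (hp.mfderivToContinuousLinearEquiv (by simp) ξ).surjective

namespace IsCotangentQuotientMap

variable {G : SymplecticIntegration (PoissonStructure.zero n M)} {Λ : CotangentLattice n M}
  {p : CotangentBundle n M → G.Arrow} (h : IsCotangentQuotientMap G Λ p)

include h

/-- From `0 + 0 = 0` the image is an idempotent arrow at `x`, and multiplying by its inverse makes
it a unit. -/
theorem map_zero (x : M) : p ⟨x, 0⟩ = G.unit x := by
  have h1 := h.map_add x 0 0
  rw [add_zero] at h1
  set g := p ⟨x, 0⟩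
  have hs : G.src g = x := h.src_eq _
  have ht : G.tgt g = x := h.tgt_eq _
  have h2 := G.mul_assoc (G.inv g) g g (G.src_inv g) (hs.trans ht.symm)
  rw [← h1, G.inv_mul, hs] at h2
  have h3 := G.unit_mul g
  rw [ht] at h3
  exact h3.symm.trans h2

/-- In `T*M` the vertical vector `(0, q)` pairs with `w` to `-q(w.1)`. As `p` preserves the forms
and the projections and has surjective differential, the image of a ray satisfies the equation of an
exponential curve. -/
theorem isExpCurve (ξ : CotangentBundle n M) :
    G.IsExpCurve ξ.1 (covec ξ.2) (fun τ => p ⟨ξ.1, τ • ξ.2⟩) univ := by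
  intro τ _
  have hχ := IsManifold.chart_mem_maximalAtlas (I := 𝓡 n) (n := ∞) ξ.1
  have hx := mem_chart_source (Vec n) ξ.1
  set χ := chartAt (Vec n) ξ.1
  obtain ⟨z, hz⟩ : ∃ z, z = cotCoord χ ξ := ⟨_, rfl⟩
  have hzt : z.1 ∈ χ.target := by rw [hz]; exact χ.map_source hx
  have hzξ : cotParam χ z = ξ := by rw [hz, cotParam_cotCoord hχ hx]
  -- The chart was chosen at the base point of `ξ`; forgetting this allows `ξ` to be replaced by
  -- `cotParam χ z`.
  clear_value χ
  subst hzξ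
  have hpd : ∀ ξ, MDifferentiableAt (cotangentModel n) (𝓡 G.dim) p ξ := fun ξ =>
    h.localDiffeo.mdifferentiable (by simp) ξ
  have hP : ∀ p' : Covec n, MDifferentiableAt 𝓘(ℝ, Vec n × Covec n) (𝓡 G.dim)
      (fun z => p (cotParam χ z)) (z.1, p') := fun p' =>
    MDifferentiableAt.comp (g := p) (z.1, p') (hpd _) (mdifferentiableAt_cotParam hχ hzt)
  have hl : HasFDerivAt (fun τ : ℝ => ((z.1, τ • z.2) : Vec n × Covec n))
      ((0 : ℝ →L[ℝ] Vec n).prod ((ContinuousLinearMap.id ℝ ℝ).smulRight z.2)) τ :=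
    (hasFDerivAt_const z.1 τ).prodMk ((ContinuousLinearMap.id ℝ ℝ).smulRight z.2).hasFDerivAt
  have hvel : tderiv 𝓘(ℝ, ℝ) (𝓡 G.dim) (fun τ : ℝ => p (cotParam χ (z.1, τ • z.2))) τ 1 =
      tderiv (cotangentModel n) (𝓡 G.dim) p (cotParam χ (z.1, τ • z.2))
        (tderiv 𝓘(ℝ, Vec n × Covec n) (cotangentModel n) (cotParam χ) (z.1, τ • z.2)
          (0, z.2)) := by
    rw [tderiv_comp_apply (g := fun z => p (cotParam χ z))
      (f := fun τ : ℝ => ((z.1, τ • z.2) : Vec n × Covec n)) (I' := 𝓘(ℝ, Vec n × Covec n)) (hP _)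
      hl.differentiableAt.mdifferentiableAt, tderiv_eq_fderiv, hl.fderiv,
      tderiv_comp_apply (g := p) (f := cotParam χ) (I' := cotangentModel n)
        (x := (z.1, τ • z.2)) (hpd _) (mdifferentiableAt_cotParam hχ hzt)]
    congr 2
    exact Prod.ext rfl (one_smul ℝ z.2)
  refine ⟨h.src_eq _, ?_, fun Z => ?_⟩
  · exact MDifferentiableAt.comp (g := fun z => p (cotParam χ z)) τ (hP _)
      hl.differentiableAt.mdifferentiableAt
  · obtain ⟨w, hw⟩ := tderiv_surjective_of_isLocalDiffeomorph h.localDiffeo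
      (cotParam χ (z.1, τ • z.2)) Z
    set w' := tderiv (cotangentModel n) 𝓘(ℝ, Vec n × Covec n) (cotCoord χ)
      (cotParam χ (z.1, τ • z.2)) w with hw'
    have hww' : tderiv 𝓘(ℝ, Vec n × Covec n) (cotangentModel n) (cotParam χ) (z.1, τ • z.2) w' =
        w := by
      have := tderiv_cotParam_cotCoord hχ (ξ := cotParam χ (z.1, τ • z.2)) (χ.map_target hzt) w
      rwa [cotCoord_cotParam hχ (z := (z.1, τ • z.2)) hzt] at this
    have hsrc : G.dsrc (p (cotParam χ (z.1, τ • z.2))) Z =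
        tderiv (𝓡 n) (𝓡 n) χ.symm z.1 w'.1 := by
      rw [← tderiv_proj_cotParam hχ (z := (z.1, τ • z.2)) hzt, hww', ← hw]
      refine (tderiv_comp_apply (g := G.src) (G.mdifferentiable_src _) (hpd _) w).symm.trans ?_
      have e : (fun ξ => G.src (p ξ)) = fun ξ => ξ.1 := funext h.src_eq
      rw [e]
    have hform := h.pullback_form (cotParam χ (z.1, τ • z.2))
      (tderiv 𝓘(ℝ, Vec n × Covec n) (cotangentModel n) (cotParam χ) (z.1, τ • z.2) (0, z.2)) w
    change G.form.pair (p (cotParam χ (z.1, τ • z.2)))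
      (tderiv 𝓘(ℝ, ℝ) (𝓡 G.dim) (fun τ : ℝ => p (cotParam χ (z.1, τ • z.2))) τ 1) Z =
      -(z.2 (tderiv (𝓡 n) (𝓡 n) χ (χ.symm z.1) (G.dsrc (p (cotParam χ (z.1, τ • z.2))) Z)))
    rw [hvel, hsrc, tderiv_chart_tderiv_symm hχ hzt, ← hw]
    refine hform.trans ?_
    change (canonicalForm n M).pair _ _ w = _
    rw [← hww', canonicalForm_pair_cotParam hχ (z := (z.1, τ • z.2)) hzt]
    simp

/-- A quotient map `T*M → T*M/Λ ≅ G` is the exponential map of `G`. -/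
theorem eq_exp : p = G.exp := by
  funext ξ
  have h1 := (h.isExpCurve ξ).isExp isOpen_univ convex_univ trivial
    (by simpa using h.map_zero ξ.1) (c := 1) trivial
  simp only [one_smul] at h1
  exact (SymplecticIntegration.IsExp.eq_exp h1).symm

theorem fiber_eq_kernel (x : M) : Λ.fiber x = G.kernel x := by
  ext a
  have h1 := h.eq_iff x a 0
  rw [sub_zero, h.eq_exp, G.exp_zero] at h1
  exact h1.symm

end IsCotangentQuotientMap

namespace ProperSymplecticIntegration

variable (G G' : ProperSymplecticIntegration (PoissonStructure.zero n M))

theorem isCotangentQuotientMap_exp :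
    IsCotangentQuotientMap G.toSymplecticIntegration G.lattice.toCotangentLattice G.exp where
  localDiffeo := G.isLocalDiffeomorph_exp
  surjective := G.surjective_exp
  src_eq := G.src_exp
  tgt_eq ξ := (G.tgt_eq_src _).trans (G.src_exp ξ)
  map_add := G.exp_add
  eq_iff _ _ _ := SymplecticIntegration.exp_eq_exp_iff
  pullback_form := G.pair_exp

variable {G G'}

theorem isCotangentQuotient_iff (Λ : LagrangianLattice n M) :
    G.lattice = Λ ↔ IsCotangentQuotient G.toSymplecticIntegration Λ.toCotangentLattice := by
  refine ⟨?_, ?_⟩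
  · rintro rfl
    exact ⟨G.exp, G.isCotangentQuotientMap_exp⟩
  · rintro ⟨p, hp⟩
    exact LagrangianLattice.ext_fiber fun x => (hp.fiber_eq_kernel x).symm

/-- Composing `G.exp` with the isomorphism gives a quotient map onto `G'` with the lattice of `G`,
and a quotient map determines its lattice. -/
theorem lattice_eq_of_isIsomorphic
    (h : G.toSymplecticIntegration.IsIsomorphic G'.toSymplecticIntegration) :
    G.lattice = G'.lattice := by
  obtain ⟨F, hs, ht, hm, hΩ⟩ := h
  have hp := G.isCotangentQuotientMap_exp
  refine ((isCotangentQuotient_iff (G := G') G.lattice).2 ⟨fun ξ => F (G.exp ξ), ?_⟩).symm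
  refine ⟨fun ξ => (hp.localDiffeo ξ).comp (𝓡 G'.dim) G'.Arrow
    (F.isLocalDiffeomorph _), F.surjective.comp hp.surjective,
    fun ξ => (hs _).trans (hp.src_eq ξ), fun ξ => (ht _).trans (hp.tgt_eq ξ), fun x ξ η => ?_,
    fun x ξ η => ?_, fun ξ v w => ?_⟩
  · refine (congrArg F (hp.map_add x ξ η)).trans (hm _ _ ?_)
    rw [hp.src_eq, hp.tgt_eq]
  · exact F.injective.eq_iff.trans (hp.eq_iff x ξ η)
  · have hd : ∀ v : Vec n × Covec n, tderiv (cotangentModel n) (𝓡 G'.dim) (fun ξ => F (G.exp ξ)) ξ v =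
        tderiv (𝓡 G.dim) (𝓡 G'.dim) F (G.exp ξ)
          (tderiv (cotangentModel n) (𝓡 G.dim) G.exp ξ v) := fun v =>
      tderiv_comp_apply (g := F) (f := G.exp) (F.mdifferentiable (by simp) _)
        (G.mdifferentiable_exp ξ) v
    have key : ∀ v w : Vec n × Covec n, G'.form.pair (F (G.exp ξ))
        (tderiv (cotangentModel n) (𝓡 G'.dim) (fun ξ => F (G.exp ξ)) ξ v)
        (tderiv (cotangentModel n) (𝓡 G'.dim) (fun ξ => F (G.exp ξ)) ξ w) =
        (canonicalForm n M).pair ξ v w := fun v w => by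
      rw [hd, hd]
      exact (hΩ _ _ _).trans (hp.pullback_form ξ v w)
    exact key v w

/-- The exponential map of `G'` factors through that of `G` if the lattices agree. -/
theorem exists_factorization (h : G.lattice = G'.lattice) :
    ∃ F : G.Arrow → G'.Arrow, ContMDiff (𝓡 G.dim) (𝓡 G'.dim) ∞ F ∧
      ∀ ξ, F (G.exp ξ) = G'.exp ξ := by
  have hker : ∀ x, G.kernel x = G'.kernel x := fun x =>
    congrArg (fun Λ : LagrangianLattice n M => Λ.fiber x) h
  have hwd : ∀ ξ η, G.exp ξ = G.exp η → G'.exp ξ = G'.exp η := by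
    rintro ⟨x, a⟩ ⟨y, b⟩ e
    obtain rfl : x = y := (G.src_exp ⟨x, a⟩).symm.trans ((congrArg G.src e).trans (G.src_exp _))
    rw [SymplecticIntegration.exp_eq_exp_iff] at e ⊢
    rwa [← hker]
  choose ρ hρ using G.surjective_exp
  have hF : ∀ ξ, G'.exp (ρ (G.exp ξ)) = G'.exp ξ := fun ξ => hwd _ _ (hρ _)
  refine ⟨fun g => G'.exp (ρ g), fun g => ?_, hF⟩
  obtain ⟨ξ, rfl⟩ := G.surjective_exp g
  have hl := G.isLocalDiffeomorph_exp ξ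
  have h1 : ContMDiffAt (𝓡 G.dim) (𝓡 G'.dim) ∞ (fun g => G'.exp (hl.localInverse g)) (G.exp ξ) :=
    (G'.contMDiff_exp _).comp _ hl.localInverse_contMDiffAt
  refine h1.congr_of_eventuallyEq ?_
  filter_upwards [hl.localInverse_eventuallyEq_right] with g hg
  have hg' : G.exp (hl.localInverse g) = g := hg
  rw [← hF (hl.localInverse g), hg']

/-- The two exponentials have the same fibres, so each factors smoothly through the other, giving
inverse diffeomorphisms. Products and forms correspond because both exponentials are additive and
pull the forms back to `ω_can`. -/
theorem isIsomorphic_of_lattice_eq (h : G.lattice = G'.lattice) :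
    G.toSymplecticIntegration.IsIsomorphic G'.toSymplecticIntegration := by
  obtain ⟨F, hF, hFe⟩ := exists_factorization h
  obtain ⟨F', hF', hFe'⟩ := exists_factorization h.symm
  have hp := G.isCotangentQuotientMap_exp
  have hp' := G'.isCotangentQuotientMap_exp
  refine ⟨⟨⟨F, F', fun g => ?_, fun g => ?_⟩, hF, hF'⟩, fun g => ?_, fun g => ?_, fun g k hgk => ?_,
    fun g v w => ?_⟩
  · obtain ⟨ξ, rfl⟩ := G.surjective_exp g
    rw [hFe, hFe']
  · obtain ⟨ξ, rfl⟩ := G'.surjective_exp g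
    rw [hFe', hFe]
  · obtain ⟨ξ, rfl⟩ := G.surjective_exp g
    exact (congrArg G'.src (hFe ξ)).trans ((hp'.src_eq ξ).trans (hp.src_eq ξ).symm)
  · obtain ⟨ξ, rfl⟩ := G.surjective_exp g
    exact (congrArg G'.tgt (hFe ξ)).trans ((hp'.tgt_eq ξ).trans (hp.tgt_eq ξ).symm)
  · obtain ⟨⟨x, a⟩, rfl⟩ := G.surjective_exp g
    obtain ⟨⟨y, b⟩, rfl⟩ := G.surjective_exp k
    obtain rfl : x = y := (hp.src_eq ⟨x, a⟩).symm.trans (hgk.trans (hp.tgt_eq _))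
    change F _ = G'.mul (F _) (F _)
    rw [← G.exp_add, hFe, hFe, hFe, G'.exp_add]
  · obtain ⟨ξ, rfl⟩ := G.surjective_exp g
    obtain ⟨v', hv'⟩ := tderiv_surjective_of_isLocalDiffeomorph hp.localDiffeo ξ v
    obtain ⟨w', hw'⟩ := tderiv_surjective_of_isLocalDiffeomorph hp.localDiffeo ξ w
    have hd : ∀ v : Vec n × Covec n, tderiv (𝓡 G.dim) (𝓡 G'.dim) F (G.exp ξ)
        (tderiv (cotangentModel n) (𝓡 G.dim) G.exp ξ v) =
        tderiv (cotangentModel n) (𝓡 G'.dim) G'.exp ξ v := fun v => by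
      rw [← tderiv_comp_apply (g := F) (f := G.exp) (hF.mdifferentiable (by simp) _)
        (G.mdifferentiable_exp ξ) v, funext hFe]
    change G'.form.pair (F (G.exp ξ)) (tderiv (𝓡 G.dim) (𝓡 G'.dim) F (G.exp ξ) v)
      (tderiv (𝓡 G.dim) (𝓡 G'.dim) F (G.exp ξ) w) = G.form.pair (G.exp ξ) v w
    rw [← hv', ← hw', hd, hd, hFe, G'.pair_exp, G.pair_exp]

variable (n M) in
/-- Isomorphism classes of proper symplectic integrations of the zero Poisson structure correspond
to Lagrangian lattices. -/
def latticeEquiv :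
    Quotient (isomorphismSetoid (PoissonStructure.zero n M)) ≃ LagrangianLattice n M where
  toFun := Quotient.lift lattice fun _ _ h => lattice_eq_of_isIsomorphic h
  invFun Λ := Quotient.mk _ (LagQuot.integration Λ)
  left_inv := by
    rintro ⟨G⟩
    exact Quotient.sound (isIsomorphic_of_lattice_eq ((isCotangentQuotient_iff _).2
      ⟨_, LagQuot.isCotangentQuotientMap G.lattice⟩))
  right_inv Λ := (isCotangentQuotient_iff Λ).2 ⟨_, LagQuot.isCotangentQuotientMap Λ⟩

end ProperSymplecticIntegration

end

end PoissonGeom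

open PoissonGeom in
theorem mainTheorem11 (n : ℕ) (M : Type u) [TopologicalSpace M] [T2Space M]
    [SecondCountableTopology M] [ChartedSpace (EuclideanSpace ℝ (Fin n)) M]
    [IsManifold (𝓡 n) ∞ M] :
    ∃ (Φ : Quotient (ProperSymplecticIntegration.isomorphismSetoid (PoissonStructure.zero n M)) ≃
          IntegralAffineStructure n M)
      (Ψ : IntegralAffineStructure n M ≃ LagrangianLattice n M),
      (∀ (𝒜 : IntegralAffineStructure n M),
        ∀ φ ∈ IsManifold.maximalAtlas (𝓡 n) ∞ M, φ ∈ 𝒜.charts ↔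
          ∀ x ∈ φ.source, (Ψ 𝒜).fiber x =
            AddSubgroup.closure (Set.range fun i => coordDifferential φ i x)) ∧
      (∀ (G : ProperSymplecticIntegration (PoissonStructure.zero n M)) (Λ : LagrangianLattice n M),
        Ψ (Φ ⟦G⟧) = Λ ↔ IsCotangentQuotient G.toSymplecticIntegration Λ.toCotangentLattice) := by
  -- With this choice `Ψ ∘ Φ` is `latticeEquiv`, which sends the class of `G` to the kernel of its
  -- exponential map.
  refine ⟨(ProperSymplecticIntegration.latticeEquiv n M).trans (affineEquivLattice n M).symm,
    affineEquivLattice n M, fun 𝒜 φ hφ => 𝒜.mem_charts_iff hφ, fun G Λ => ?_⟩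
  rw [Equiv.trans_apply, Equiv.apply_symm_apply]
  exact ProperSymplecticIntegration.isCotangentQuotient_iff Λ
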